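/- Let $p, l$ be primes and $F/\mathbb{Q}_p$ a finite extension with residue field $k_F$ of order $q$, absolute Galois group $G_F$, inertia subgroup $I_F$ and wild inertia subgroup $P_F$. Let $\tilde P_F\subset I_F$ be the kernel of the maximal pro-$l$ quotient of $I_F$. Fix a lift $\phi\in G_F$ of the arithmetic Frobenius and $\sigma\in I_F$ whose image topologically generates $I_F/P_F$. Let $E/\mathbb{Q}_l$ be a finite extension with ring of integers $\mathcal{O}$ and residue field $\mathbb{F}$, containing all $(q^{n!}-1)$th roots of unity. Suppose that $l$ is quasi-banal: $l>n$ and $l\mid q-1$. Put $a=v_l(q-1)$. Types. A partition is a weakly decreasing, eventually zero sequence of non-negative integers $P=(P(1),P(2),\dots)$, and $\deg P=\sum_i P(i)$. Let $\mathcal{I}_0$ be the set of isomorphism classes of representations of $I_F$ over $\bar E$ that extend to a continuous irreducible finite-dimensional representation of $G_F$, and $\mathcal{I}$ the set of finitely supported functions from $\mathcal{I}_0$ to partitions. For $\mathcal{P}\in\mathcal{I}$ let $\tau_{\mathcal{P}}$ be the restriction to $I_F$ of the $l$-adic representation of the Weil group attached to the Weil–Deligne representation $\bigoplus_{\tau_0}\bigoplus_i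 \mathrm{Sp}(\rho_{\tau_0},\mathcal{P}(\tau_0)(i))$, where $\rho_{\tau_0}$ is an irreducible extension of $\tau_0$ to the Weil group; here $\mathrm{Sp}(\rho,k)=V\oplus V(1)\oplus\dots\oplus V(k-1)$, $V$ being the space of $\rho$, with $N$ identifying $V(i)$ with $V(i+1)$ for $i<k-1$ and $N=0$ on $V(k-1)$. Regard the characters $k_F^\times\to\mu_{l^a}$ as elements of $\mathcal{I}_0$ via the canonical surjection $I_F\to k_F^\times$, enumerate them as $\chi_1,\dots,\chi_{l^a}$, and let $\mathcal{I}_1\subset\mathcal{I}$ be the set of functions supported on them. An element $\mathcal{P}\in\mathcal{I}_1$ corresponds to the sequence of partitions $(P_i)_i=(\mathcal{P}(\chi_i))_i$. Lifting rings. Let $\bar\rho:G_F\to GL_n(\mathbb{F})$ be a continuous homomorphism that is trivial on $\tilde P_F$ and distinguished: every standard basis vector of $\mathbb{F}^n$ lies in a generalised eigenspace of $\bar\rho(\phi)$ (with eigenvalue in $\mathbb{F}$), and each generalised eigenspace is stable under $\bar\rho(\sigma)$, which acts on it with minimal polynomial $(X-1)^d$, where $d$ is its dimension. Let $Q$ be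 the partition of $n$ whose parts are the dimensions of the generalised eigenspaces of $\bar\rho(\phi)$. Let $R^\square(\bar\rho)$ be the universal lifting ring: the complete noetherian local $\mathcal{O}$-algebra with residue field $\mathbb{F}$ that pro-represents the functor of continuous lifts of $\bar\rho$ to $GL_n(A)$, for $A$ an artinian local $\mathcal{O}$-algebra with residue field $\mathbb{F}$. Let $R^\square(\bar\rho,\tau_{\mathcal{P}})$ be its reduced quotient whose spectrum is the Zariski closure of the set of $\bar E$-points $x$ over $\mathcal{O}$ with $\rho_x|_{I_F}\cong\tau_{\mathcal{P}}$. Cycles. For a noetherian local ring $A$ of dimension $d$ and a finitely generated $A$-module $M$, let $Z(M)=\sum_{\mathfrak a}\mathrm{length}_{A_{\mathfrak a}}(M_{\mathfrak a})\,[\mathfrak a]$, the sum being over the primes $\mathfrak a$ with $\dim A/\mathfrak a=d$. The cycle below is taken on $A=R^\square(\bar\rho)\otimes_{\mathcal{O}}\mathbb{F}$. Bipartitions. For a sequence of partitions $(P_i)_i$, almost all of them zero, let $\mathrm{Bip}((P_i)_i,Q)$ be the number of matrices $(a(i,j))_{i,j\ge1}$ of non-negative integers, almost all zero, whose $i$th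 row is a rearrangement of the sequence $P_i$ for each $i$ (so that its sum is $\deg P_i$) and whose $j$th column has sum $Q(j)$ for each $j$. Then the universal lifting ring $R^\square(\bar\rho)$ exists, and: 1. If $\mathcal{P}\in\mathcal{I}\setminus\mathcal{I}_1$, then $R^\square(\bar\rho,\tau_{\mathcal{P}})=0$. 2. The ring $R^\square(\bar\rho)\otimes_{\mathcal{O}}\mathbb{F}$ has a unique minimal prime $\mathfrak{p}$. 3. If $\mathcal{P}\in\mathcal{I}_1$ corresponds to the sequence $(P_i)_i$, then $$Z\bigl(R^\square(\bar\rho,\tau_{\mathcal{P}})\otimes_{\mathcal{O}}\mathbb{F}\bigr)=\mathrm{Bip}\bigl((P_i)_i,Q\bigr)\cdot[\mathfrak{p}].$$ -/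

import Mathlib

noncomputable section

namespace LiftingRing

/-! ### Local fields

A finite extension of `ℚ_p` is given as a finite subextension of the algebraic closure
`PadicAlgCl p` of `ℚ_p`, on which `‖·‖` is the unique extension of the `p`-adic absolute value. -/

section LocalField

variable {p : ℕ} [Fact p.Prime]

/-- The ring of integers `{x ∈ K : ‖x‖ ≤ 1}` of `K`. -/
def integers (K : IntermediateField ℚ_[p] (PadicAlgCl p)) : ValuationSubring K :=
  (NormedField.valuation (K := PadicAlgCl p)).valuationSubring.comap
    (algebraMap K (PadicAlgCl p))

theorem mem_integers {K : IntermediateField ℚ_[p] (PadicAlgCl p)} {x : K} :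
    x ∈ integers K ↔ ‖(x : PadicAlgCl p)‖ ≤ 1 := Iff.rfl

/-- The residue field of `K`. -/
abbrev ResidueField (K : IntermediateField ℚ_[p] (PadicAlgCl p)) : Type :=
  IsLocalRing.ResidueField (integers K)

/-- The order `q` of the residue field. -/
def residueCard (K : IntermediateField ℚ_[p] (PadicAlgCl p)) : ℕ := Nat.card (ResidueField K)

/-- The absolute Galois group of `F`, with its Krull topology. -/
abbrev GaloisGroup (F : IntermediateField ℚ_[p] (PadicAlgCl p)) : Type :=
  PadicAlgCl p ≃ₐ[F] PadicAlgCl p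

variable (F : IntermediateField ℚ_[p] (PadicAlgCl p))

theorem norm_galois (g : GaloisGroup F) (x : PadicAlgCl p) : ‖g x‖ = ‖x‖ :=
  (spectralNorm_eq_of_equiv (K := ℚ_[p]) (g.restrictScalars ℚ_[p]) x).symm

/-- The inertia subgroup `I_F`: the elements acting trivially on the residue field of the
algebraic closure. -/
def inertia : Subgroup (GaloisGroup F) where
  carrier := {g | ∀ x : PadicAlgCl p, ‖x‖ ≤ 1 → ‖g x - x‖ < 1}
  one_mem' := by
    intro x _
    simp
  mul_mem' := by
    intro g h hg hh x hx
    have e : (g * h) x - x = g (h x - x) + (g x - x) := by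
      simp [AlgEquiv.mul_apply]
    rw [e]
    refine lt_of_le_of_lt (PadicAlgCl.isNonarchimedean p _ _) (max_lt ?_ (hg x hx))
    rw [norm_galois]
    exact hh x hx
  inv_mem' := by
    intro g hg x hx
    have e : g⁻¹ x - x = -(g⁻¹ (g x - x)) := by
      rw [map_sub, ← AlgEquiv.mul_apply g⁻¹ g, inv_mul_cancel]
      simp
    change ‖g⁻¹ x - x‖ < 1
    rw [e, norm_neg, norm_galois]
    exact hg x hx

/-- The wild inertia subgroup `P_F`: the elements `g` with `g x / x ≡ 1` modulo the maximal ideal,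
for all nonzero `x` in the algebraic closure. -/
def wildInertia : Subgroup (GaloisGroup F) where
  carrier := {g | ∀ x : PadicAlgCl p, x ≠ 0 → ‖g x - x‖ < ‖x‖}
  one_mem' := by
    intro x hx
    simpa using hx
  mul_mem' := by
    intro g h hg hh x hx
    have e : (g * h) x - x = g (h x - x) + (g x - x) := by
      simp [AlgEquiv.mul_apply]
    rw [e]
    refine lt_of_le_of_lt (PadicAlgCl.isNonarchimedean p _ _) (max_lt ?_ (hg x hx))
    rw [norm_galois]
    exact hh x hx
  inv_mem' := by
    intro g hg x hx
    have e : g⁻¹ x - x = -(g⁻¹ (g x - x)) := by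
      rw [map_sub, ← AlgEquiv.mul_apply g⁻¹ g, inv_mul_cancel]
      simp
    change ‖g⁻¹ x - x‖ < ‖x‖
    rw [e, norm_neg, norm_galois]
    exact hg x hx

/-- `φ` is a lift to `G_F` of the arithmetic Frobenius. -/
def IsFrobenius (φ : GaloisGroup F) : Prop :=
  ∀ x : PadicAlgCl p, ‖x‖ ≤ 1 → ‖φ x - x ^ residueCard F‖ < 1

/-- `σ ∈ I_F` maps to a topological generator of `I_F / P_F`. -/
def IsTameGenerator (σ : inertia F) : Prop :=
  closure (Subgroup.closure (insert (σ : GaloisGroup F) (wildInertia F : Set (GaloisGroup F))) :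
    Set (GaloisGroup F)) = inertia F

/-- The kernel `P̃_F` of the maximal pro-`l` quotient of `I_F`. -/
def proKernel (l : ℕ) : Subgroup (inertia F) :=
  ⨅ (U : Subgroup (inertia F)) (_ : U.Normal ∧ IsOpen (U : Set (inertia F)) ∧
    ∃ k : ℕ, U.index = l ^ k), U

end LocalField

/-! ### Partitions and bipartitions -/

/-- Partitions: weakly decreasing, eventually zero sequences of natural numbers
(the `i`-th part, `i ≥ 1`, is the value at `i - 1`). -/
def Part : Type := {P : ℕ →₀ ℕ // Antitone P}

instance : Zero Part := ⟨⟨0, fun _ _ _ => le_rfl⟩⟩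

/-- The number partitioned by `P`. -/
def Part.deg (P : Part) : ℕ := P.1.sum fun _ m => m

/-- A bipartition for sequences `P`, `Q`: a finitely supported matrix of natural numbers whose
`i`-th row has sum `P i` and whose `j`-th column has sum `Q j`. -/
def IsBipartition (P Q : ℕ → ℕ) (A : ℕ × ℕ →₀ ℕ) : Prop :=
  (∀ i, ∑ᶠ j, A (i, j) = P i) ∧ ∀ j, ∑ᶠ i, A (i, j) = Q j

/-- The entries of the `i`-th row of `A` form, up to order, the partition `P i`. -/
def HasWeight (P : ℕ → Part) (A : ℕ × ℕ →₀ ℕ) : Prop :=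
  ∀ i, ∃ e : Equiv.Perm ℕ, ∀ j, A (i, j) = (P i).1 (e j)

/-- `Bip ((P_i)_i, Q)`: the number of bipartitions, for the sequence `(deg P_i)_i` and `Q`, of
weight `(P_i)_i`. -/
def Bip (P : ℕ → Part) (Q : Part) : ℕ :=
  Nat.card {A : ℕ × ℕ →₀ ℕ // IsBipartition (fun i => (P i).deg) Q.1 A ∧ HasWeight P A}

/-! ### Cycles -/

/-- The points of `Spec A` whose closure has the same dimension as `Spec A`. -/
abbrev TopPoint (A : Type*) [CommRing A] : Type _ :=
  {a : PrimeSpectrum A // ringKrullDim (A ⧸ a.asIdeal) = ringKrullDim A}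

/-- The top-dimensional cycle `Z(M)` of an `A`-module `M`, given by its coefficients: the
coefficient at `a` is the length of `M_a` over `A_a`. -/
def cycle (A : Type*) [CommRing A] (M : Type*) [AddCommGroup M] [Module A M] :
    TopPoint A → ℕ∞ :=
  fun a => Module.length (Localization.AtPrime a.1.asIdeal)
    (LocalizedModule a.1.asIdeal.primeCompl M)

/-- The cycle `[a]` of a top-dimensional point `a`. -/
def pointCycle {A : Type*} [CommRing A] (a : TopPoint A) : TopPoint A → ℕ∞ :=
  open Classical in Pi.single a 1

/-! ### Inertial types -/

section Types

variable {p : ℕ} [Fact p.Prime] (F : IntermediateField ℚ_[p] (PadicAlgCl p))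
variable (l : ℕ) [Fact l.Prime]

/-- A homomorphism to `GL_d` is irreducible if `d > 0` and there is no proper nonzero
invariant subspace. -/
def IsIrreducible {G K : Type*} [Group G] [Field K] {d : ℕ} (ρ : G →* GL (Fin d) K) : Prop :=
  0 < d ∧ ∀ W : Submodule K (Fin d → K),
    (∀ g, ∀ v ∈ W, (ρ g : Matrix (Fin d) (Fin d) K).mulVec v ∈ W) → W = ⊥ ∨ W = ⊤

/-- The representation `τ` of `I_F` extends to a continuous (for the `l`-adic topology)
irreducible representation of `G_F`. -/
def IsBasic {d : ℕ} (τ : inertia F →* GL (Fin d) (PadicAlgCl l)) : Prop :=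
  ∃ ρ : GaloisGroup F →* GL (Fin d) (PadicAlgCl l),
    Continuous ρ ∧ IsIrreducible ρ ∧ ∀ g : inertia F, ρ g = τ g

/-- Representations of `I_F` over the algebraic closure of `ℚ_l` that extend to a continuous
irreducible representation of `G_F`. -/
structure BasicRep where
  dim : ℕ
  rep : inertia F →* GL (Fin dim) (PadicAlgCl l)
  isBasic : IsBasic F l rep

/-- Isomorphism of representations. -/
instance basicRepSetoid : Setoid (BasicRep F l) where
  r τ τ' := ∃ T : (Fin τ.dim → PadicAlgCl l) ≃ₗ[PadicAlgCl l] (Fin τ'.dim → PadicAlgCl l),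
    ∀ g v, T ((τ.rep g).1.mulVec v) = (τ'.rep g).1.mulVec (T v)
  iseqv :=
    { refl := fun τ => ⟨LinearEquiv.refl _ _, fun _ _ => rfl⟩
      symm := by
        rintro τ τ' ⟨T, hT⟩
        refine ⟨T.symm, fun g v => ?_⟩
        rw [LinearEquiv.symm_apply_eq, hT, LinearEquiv.apply_symm_apply]
      trans := by
        rintro τ τ' τ'' ⟨T, hT⟩ ⟨T', hT'⟩
        refine ⟨T.trans T', fun g v => ?_⟩
        rw [LinearEquiv.trans_apply, LinearEquiv.trans_apply, hT, hT'] }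

/-- The set `𝓘₀` of basic inertial types. -/
def BasicType : Type := Quotient (basicRepSetoid F l)

/-- A representative of a basic inertial type. -/
def BasicType.out {F : IntermediateField ℚ_[p] (PadicAlgCl p)} {l : ℕ} [Fact l.Prime]
    (τ : BasicType F l) : BasicRep F l :=
  Quotient.out (s := basicRepSetoid F l) τ

/-- The set `𝓘` of finitely supported functions from basic inertial types to partitions. -/
abbrev TypeDatum : Type := BasicType F l →₀ Part

variable {F}

/-- The homomorphism `t_l : I_F → ℤ_l` determined by the generator `σ`: the continuous
homomorphism with `t_l(σ) = 1`. -/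
def tameLog (σ : inertia F) : inertia F →* Multiplicative ℤ_[l] :=
  open Classical in
  if h : ∃ t : inertia F →* Multiplicative ℤ_[l], Continuous t ∧ t σ = Multiplicative.ofAdd 1
  then h.choose else 1

variable {l}

/-- The pairs `(τ₀, i)` for which the `i`-th part of `𝒫(τ₀)` is nonzero. -/
abbrev BlockIndex (P : TypeDatum F l) : Type := Σ τ : P.support, (P τ).1.support

/-- A basis of `⨁_{(τ₀, i)} Sp(ρ_{τ₀}, 𝒫(τ₀)(i))`, where `ρ_{τ₀}` extends `τ₀` and
`Sp(ρ, k) = V ⊕ V(1) ⊕ ⋯ ⊕ V(k-1)`, `V` being the space of `ρ`: the vector `(τ₀, i, a, b)`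
is the `a`-th basis vector of `V(b)`. -/
abbrev SpIndex (P : TypeDatum F l) : Type :=
  Σ s : BlockIndex P, Fin (BasicType.out s.1.1).dim × Fin ((P s.1).1 s.2)

/-- The restriction to `I_F` of `r`, where `(r, N)` is the Weil-Deligne representation
`⨁ Sp(ρ_{τ₀}, 𝒫(τ₀)(i))`: the twists are trivial on `I_F`, and `ρ_{τ₀}` restricts to `τ₀`. -/
def spInertia (P : TypeDatum F l) (g : inertia F) :
    Matrix (SpIndex P) (SpIndex P) (PadicAlgCl l) :=
  open Classical in
  Matrix.blockDiagonal' fun s =>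
    Matrix.kronecker (((BasicType.out s.1.1).rep g).1) (1 : Matrix _ _ (PadicAlgCl l))

/-- The monodromy operator `N` of `⨁ Sp(ρ_{τ₀}, 𝒫(τ₀)(i))`: on each summand it is the
identification of `V(b)` with `V(b+1)`, and zero on the last `V(b)`. -/
def spMonodromy (P : TypeDatum F l) : Matrix (SpIndex P) (SpIndex P) (PadicAlgCl l) :=
  open Classical in
  Matrix.blockDiagonal' fun s =>
    Matrix.kronecker (1 : Matrix _ _ (PadicAlgCl l))
      (Matrix.of fun b b' : Fin ((P s.1).1 s.2) => if b.1 = b'.1 + 1 then 1 else 0)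

/-- The inertial type `τ_𝒫`: the restriction `g ↦ r(g) exp(t_l(g) N)` to `I_F` of the
representation of the Weil group attached to `(r, N) = ⨁ Sp(ρ_{τ₀}, 𝒫(τ₀)(i))`. -/
def inertialType (σ : inertia F) (P : TypeDatum F l) (g : inertia F) :
    Matrix (SpIndex P) (SpIndex P) (PadicAlgCl l) :=
  open Classical in
  spInertia P g * IsNilpotent.exp
    (algebraMap ℚ_[l] (PadicAlgCl l) ((tameLog l σ g).toAdd : ℚ_[l]) • spMonodromy P)

/-- The representation `ρ` of `G_F` is of type `τ_𝒫`: its restriction to `I_F` is isomorphic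
to `τ_𝒫`. -/
def HasType (σ : inertia F) {n : ℕ} (ρ : GaloisGroup F →* GL (Fin n) (PadicAlgCl l))
    (P : TypeDatum F l) : Prop :=
  ∃ T : (Fin n → PadicAlgCl l) ≃ₗ[PadicAlgCl l] (SpIndex P → PadicAlgCl l),
    ∀ (g : inertia F) (v : Fin n → PadicAlgCl l),
      T ((ρ g : Matrix (Fin n) (Fin n) (PadicAlgCl l)).mulVec v) =
        (inertialType σ P g).mulVec (T v)

/-- The exponent `a` of `l` in `q - 1`. -/
def tameExponent (F : IntermediateField ℚ_[p] (PadicAlgCl p)) (l : ℕ) : ℕ :=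
  padicValNat l (residueCard F - 1)

/-- The basic inertial type `τ₀` is a character of `k_F^×` with values in the `l^a`-th roots of
unity, inflated along the canonical surjection `I_F → k_F^×`.  The latter takes `g` to the
reduction of `g y / y ∈ μ_{q-1}(F)`, where `y ^ (q - 1)` is a uniformiser of `F`. -/
def BasicType.IsTameChar (τ : BasicType F l) : Prop :=
  ∃ χ : (ResidueField F)ˣ →* (PadicAlgCl l)ˣ,
    (∀ c, χ c ^ l ^ tameExponent F l = 1) ∧ τ.out.dim = 1 ∧
    ∀ (g : inertia F) (ϖ : integers F) (y : PadicAlgCl p) (u : (integers F)ˣ),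
      Irreducible ϖ → y ^ (residueCard F - 1) = algebraMap F (PadicAlgCl p) ϖ →
      (g : GaloisGroup F) y = algebraMap F (PadicAlgCl p) (u : integers F) * y →
      (τ.out.rep g).1 = Matrix.scalar _
        (χ (Units.map (IsLocalRing.residue (integers F)).toMonoidHom u) : PadicAlgCl l)

/-- The subset `𝓘₁` of `𝓘`: the functions supported on the characters of `k_F^×` with values in
the `l^a`-th roots of unity. -/
def TypeDatum.IsTame (P : TypeDatum F l) : Prop := ∀ τ ∈ P.support, BasicType.IsTameChar τ

/-- The sequence `(P_i)_i = (𝒫(χ_i))_i` of partitions given by an element `𝒫` of `𝓘₁`, for an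
enumeration of the characters `k_F^× → μ_{l^a}`. -/
def TypeDatum.seq (P : TypeDatum F l)
    (χ : Fin (l ^ tameExponent F l) ≃ {τ : BasicType F l // τ.IsTameChar}) : ℕ → Part :=
  fun i => if h : i < l ^ tameExponent F l then P (χ ⟨i, h⟩) else 0

end Types

/-! ### Lifting rings -/

section Lifts

variable {p : ℕ} [Fact p.Prime] {F : IntermediateField ℚ_[p] (PadicAlgCl p)}
variable {l : ℕ} [Fact l.Prime] {E : IntermediateField ℚ_[l] (PadicAlgCl l)} {n : ℕ}

/-- A local `𝒪`-algebra `A` whose structure map is local and identifies the residue fields. -/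
class IsCoefficientRing (E : IntermediateField ℚ_[l] (PadicAlgCl l)) (A : Type) [CommRing A]
    [IsLocalRing A] [Algebra (integers E) A] : Prop
    extends IsLocalHom (algebraMap (integers E) A) where
  surjective : Function.Surjective
    (IsLocalRing.ResidueField.map (algebraMap (integers E) A))

/-- `ρ : G_F → GL_n(A)` reduces to `ρ̄` modulo the maximal ideal of `A`. -/
def IsLift (ρbar : GaloisGroup F →* GL (Fin n) (ResidueField E)) {A : Type} [CommRing A]
    [IsLocalRing A] [Algebra (integers E) A] [IsCoefficientRing E A]
    (ρ : GaloisGroup F →* GL (Fin n) A) : Prop :=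
  (Matrix.GeneralLinearGroup.map (IsLocalRing.residue A)).comp ρ =
    (Matrix.GeneralLinearGroup.map
      (IsLocalRing.ResidueField.map (algebraMap (integers E) A))).comp ρbar

/-- `R`, with `ρ : G_F → GL_n(R)`, is the universal lifting ring `R^□(ρ̄)` with its universal lift:
`R` is a complete noetherian local `𝒪`-algebra with residue field `𝔽`, `ρ` is continuous for
the `𝔪_R`-adic topology and lifts `ρ̄`, and every continuous lift of `ρ̄` to an artinian local
`𝒪`-algebra `A` with residue field `𝔽` comes from `ρ` by a unique homomorphism `R → A`
(such an `A` is finite and discrete, so continuity means that the kernel is open). -/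
structure IsUniversalLift (ρbar : GaloisGroup F →* GL (Fin n) (ResidueField E)) {R : Type}
    [CommRing R] [IsLocalRing R] [Algebra (integers E) R] [IsCoefficientRing E R]
    (ρ : GaloisGroup F →* GL (Fin n) R) : Prop where
  noetherian : IsNoetherianRing R
  complete : IsAdicComplete (IsLocalRing.maximalIdeal R) R
  continuous : ∀ k : ℕ, IsOpen (((Matrix.GeneralLinearGroup.map
    (Ideal.Quotient.mk (IsLocalRing.maximalIdeal R ^ k))).comp ρ).ker : Set (GaloisGroup F))
  isLift : IsLift ρbar ρ
  universal : ∀ (A : Type) [CommRing A] [IsLocalRing A] [IsArtinianRing A]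
    [Algebra (integers E) A] [IsCoefficientRing E A] (ρA : GaloisGroup F →* GL (Fin n) A),
    IsOpen (ρA.ker : Set (GaloisGroup F)) → IsLift ρbar ρA →
    ∃! f : R →ₐ[integers E] A, (Matrix.GeneralLinearGroup.map (f : R →+* A)).comp ρ = ρA

/-- The generalised eigenspace of `ρ̄(φ)` for the eigenvalue `α`. -/
abbrev frobeniusSpace (ρbar : GaloisGroup F →* GL (Fin n) (ResidueField E)) (φ : GaloisGroup F)
    (α : ResidueField E) : Submodule (ResidueField E) (Fin n → ResidueField E) :=
  Module.End.maxGenEigenspace (Matrix.toLin' (ρbar φ).1) α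

/-- `ρ̄` (with the standard basis) is distinguished: `P̃_F` acts trivially, each basis vector lies
in a generalised eigenspace of `ρ̄(φ)`, and each generalised eigenspace is stable under `ρ̄(σ)`, which
acts on it with minimal polynomial `(X - 1)^d`, `d` being its dimension. -/
structure IsDistinguished (φ : GaloisGroup F) (σ : inertia F)
    (ρbar : GaloisGroup F →* GL (Fin n) (ResidueField E)) : Prop where
  trivial : ∀ g ∈ proKernel F l, ρbar (g : inertia F) = 1
  standard : ∀ i : Fin n, ∃ α, (Pi.single i 1 : Fin n → ResidueField E) ∈ frobeniusSpace ρbar φ α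
  unipotent : ∀ α, Module.End.HasEigenvalue (Matrix.toLin' (ρbar φ).1) α →
    ∃ h : ∀ v ∈ frobeniusSpace ρbar φ α,
      Matrix.toLin' (ρbar σ).1 v ∈ frobeniusSpace ρbar φ α,
      minpoly (ResidueField E) ((Matrix.toLin' (ρbar σ).1).restrict h) =
        (Polynomial.X - 1) ^ Module.finrank (ResidueField E) (frobeniusSpace ρbar φ α)

/-- The parts of `Q` are the dimensions of the generalised eigenspaces of `ρ̄(φ)`. -/
def IsFrobeniusPartition (φ : GaloisGroup F)
    (ρbar : GaloisGroup F →* GL (Fin n) (ResidueField E)) (Q : Part) : Prop :=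
  ∃ (r : ℕ) (α : Fin r → ResidueField E), Function.Injective α ∧
    (∀ a, Module.End.HasEigenvalue (Matrix.toLin' (ρbar φ).1) a ↔ a ∈ Set.range α) ∧
    ∀ i : ℕ, Q.1 i =
      if h : i < r then Module.finrank (ResidueField E) (frobeniusSpace ρbar φ (α ⟨i, h⟩)) else 0

/-- `R ⊗_𝒪 𝔽`. -/
abbrev SpecialFibre (E : IntermediateField ℚ_[l] (PadicAlgCl l)) (R : Type) [CommRing R]
    [Algebra (integers E) R] : Type :=
  R ⧸ (IsLocalRing.maximalIdeal (integers E)).map (algebraMap (integers E) R)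

/-- The ideal cutting out the Zariski closure, with its reduced structure, of the
`PadicAlgCl l`-points `x` of `Spec R` over `𝒪` whose Galois representation `ρ_x` is of type `τ_𝒫`:
the intersection of the kernels of these points. -/
def typeIdeal (E : IntermediateField ℚ_[l] (PadicAlgCl l)) {R : Type} [CommRing R]
    [Algebra (integers E) R] (σ : inertia F) (ρ : GaloisGroup F →* GL (Fin n) R)
    (P : TypeDatum F l) : Ideal R :=
  ⨅ (x : R →ₐ[integers E] PadicAlgCl l)
    (_ : HasType σ ((Matrix.GeneralLinearGroup.map (x : R →+* PadicAlgCl l)).comp ρ) P),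
    RingHom.ker (x : R →+* PadicAlgCl l)

/-- The fixed type lifting ring `R^□(ρ̄, τ_𝒫)`, where `R` is `R^□(ρ̄)` and `ρ` the universal lift. -/
abbrev TypeRing (E : IntermediateField ℚ_[l] (PadicAlgCl l)) {R : Type} [CommRing R]
    [Algebra (integers E) R] (σ : inertia F) (ρ : GaloisGroup F →* GL (Fin n) R)
    (P : TypeDatum F l) : Type :=
  R ⧸ typeIdeal E σ ρ P

/-- `R^□(ρ̄, τ_𝒫) ⊗_𝒪 𝔽`, as a quotient of `R^□(ρ̄) ⊗_𝒪 𝔽`. -/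
abbrev TypeSpecialFibre (E : IntermediateField ℚ_[l] (PadicAlgCl l)) {R : Type} [CommRing R]
    [Algebra (integers E) R] (σ : inertia F) (ρ : GaloisGroup F →* GL (Fin n) R)
    (P : TypeDatum F l) : Type :=
  SpecialFibre E R ⧸ (typeIdeal E σ ρ P).map (Ideal.Quotient.mk
    ((IsLocalRing.maximalIdeal (integers E)).map (algebraMap (integers E) R)))

end Lifts

end LiftingRing

end

/-!
The proof rests on the structure of the tame lifts. Every lift `ρ` of `ρbar` is trivial on wild
inertia, and is therefore given by a pair of matrices `Φ = ρ φ`, `T = ρ σ` with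
`Φ * T = T ^ q * Φ`. As `ρbar` is distinguished, such a pair has a unique normal form: after
conjugation by a matrix `B` with a prescribed pattern of entries, `Φ` and `T` become block diagonal,
each block of `T` being the companion matrix of a monic polynomial `f j` that lifts `(X - 1) ^ d j`,
and the block of `Φ` being determined by `f j` and by the image of a cyclic vector. The relation
amounts to `f j ∣ f j (X ^ q)`; since `l` is quasi-banal, it forces `f j` to divide a power of
`X ^ (l ^ a) - 1`. So the universal lifting ring exists (`exists_universalLift`) and is a power
series ring over the finite local `𝒪`-algebra `PolyRing` that classifies the families `(f j)`.

Let `x` be a point of the lifting ring over `ℚ̄_l`. The restriction to inertia of its representation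
factors through tame inertia and is determined by `T`, whose characteristic polynomial is the
product of the `f j`. The eigenvalues of `T` are `l ^ a`-th roots of unity, and the Jordan type of `T` at
the root of unity belonging to `χ i` is read off from its multiplicities as a root of `f 1, f 2, …`:
each companion block contributes one Jordan block. Hence `x` has type `P` if
and only if each row of the matrix of these multiplicities is a rearrangement of `P i`
(`hasType_iff_hasWeight`), and types that do not come from characters of `k_F^×` have no points
(`isTame_of_hasType_point`). The columns sum to `d j = Q j`, so the points of `PolyRing` of type `P`
are counted by bipartitions (`card_typePoints`), and all of them are defined over `𝒪`.

The type ideal is consequently generated by the intersection `J` of the kernels of these finitely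
many points `PolyRing → 𝒪` (`typeIdeal_eq_map`). The special fibre of a power series ring over a
finite local `𝒪`-algebra has a unique minimal prime, extended from the maximal ideal of
`PolyRing` (`minimalPrimes_fibre`). The image of `PolyRing` in a power of `𝒪`
under these points is free of rank their number `m`, so its reduction has order `|𝔽| ^ m`; splitting
off colon ideals one at a time shows the length at the minimal prime to be `m` (`lengthAt_fibre`).
-/

noncomputable section

namespace LiftingRing

open Matrix.GeneralLinearGroup renaming map → glMap

/-! ### Rings of integers of local fields -/

section LocalFieldBasics

variable {p : ℕ} [Fact p.Prime] (K : IntermediateField ℚ_[p] (PadicAlgCl p))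

theorem norm_natCast_prime : ‖(p : PadicAlgCl p)‖ < 1 := by
  have h := PadicAlgCl.norm_extends p (p : ℚ_[p])
  have e : ((p : ℚ_[p]) : PadicAlgCl p) = (p : PadicAlgCl p) := by simp
  rw [← e, h]
  exact Padic.norm_p_lt_one

theorem norm_natCast_eq_one {m : ℕ} (h : ¬ p ∣ m) : ‖(m : PadicAlgCl p)‖ = 1 := by
  have e : ((m : ℚ_[p]) : PadicAlgCl p) = (m : PadicAlgCl p) := by simp
  rw [← e, PadicAlgCl.norm_extends]
  rw [Padic.norm_natCast_eq_one_iff]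
  exact ((Nat.Prime.coprime_iff_not_dvd Fact.out).mpr h)

variable {K} in
theorem integers_isUnit_iff {x : integers K} : IsUnit x ↔ ‖((x : K) : PadicAlgCl p)‖ = 1 := by
  constructor
  · rintro ⟨u, rfl⟩
    have h1 : ‖(((u : integers K) : K) : PadicAlgCl p)‖ ≤ 1 := (u : integers K).2
    have h2 : ‖(((u⁻¹ : (integers K)ˣ) : integers K) : K).1‖ ≤ 1 := (u⁻¹ : (integers K)ˣ).1.2
    have h3 : (((u : integers K) : K) : PadicAlgCl p) * (((u⁻¹ : (integers K)ˣ) : integers K) : K).1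
        = 1 := by
      exact congrArg (fun y : integers K => ((y : K) : PadicAlgCl p)) u.mul_inv
    have h4 := congrArg norm h3
    rw [norm_mul, norm_one] at h4
    nlinarith [norm_nonneg (((u : integers K) : K) : PadicAlgCl p)]
  · intro h
    have h0 : (x : K) ≠ 0 := by
      intro h0; rw [h0] at h; simp at h
    have hi : (x : K)⁻¹ ∈ integers K := by
      rw [mem_integers]; push_cast; rw [norm_inv, h]; simp
    exact IsUnit.of_mul_eq_one ⟨_, hi⟩ (Subtype.ext (mul_inv_cancel₀ h0))

variable {K} in
theorem mem_maximalIdeal_integers {x : integers K} :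
    x ∈ IsLocalRing.maximalIdeal (integers K) ↔ ‖((x : K) : PadicAlgCl p)‖ < 1 := by
  rw [IsLocalRing.mem_maximalIdeal, mem_nonunits_iff, integers_isUnit_iff]
  have : ‖((x : K) : PadicAlgCl p)‖ ≤ 1 := x.2
  exact ⟨fun h => lt_of_le_of_ne this h, fun h => h.ne⟩

variable [FiniteDimensional ℚ_[p] K]

theorem integers_dvr_finite_compact : IsDiscreteValuationRing (integers K) ∧
    Finite (ResidueField K) ∧ CompactSpace (integers K) := by
  let _ : NontriviallyNormedField K :=
    { (inferInstance : NormedField K) with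
      non_trivial := by
        obtain ⟨x, hx⟩ := NontriviallyNormedField.non_trivial (α := ℚ_[p])
        exact ⟨algebraMap ℚ_[p] K x, by rwa [norm_algebraMap']⟩ }
  let _ : Valued K NNReal := NormedField.toValued
  have hp : ProperSpace K := FiniteDimensional.proper ℚ_[p] K
  have hmem (x : K) : x ∈ Valued.integer K ↔ x ∈ integers K := by
    rw [mem_integers, Valued.integer.mem_iff]; rfl
  have hcl : (Metric.closedBall (0 : K) 1) = {x | x ∈ integers K} := by
    ext x
    simp only [Metric.mem_closedBall, dist_zero_right, Set.mem_ofPred_eq, mem_integers]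
    rfl
  have hc1 : IsCompact {x : K | x ∈ integers K} := hcl ▸ isCompact_closedBall (0 : K) 1
  have hc : CompactSpace (Valued.integer K) := by
    have h : (Valued.integer K : Set K) = {x : K | x ∈ integers K} := Set.ext hmem
    exact isCompact_iff_compactSpace.mp (h ▸ hc1)
  have hn : (Valued.v : Valuation K NNReal).IsNontrivial := by
    obtain ⟨x, h0, h1⟩ := NormedField.exists_norm_lt_one K
    refine ⟨x, ?_, ?_⟩
    · simpa using h0
    · intro h
      have : ‖x‖ = 1 := congrArg NNReal.toReal h
      linarith
  have hd : IsDiscreteValuationRing (Valued.integer K) :=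
    Valued.integer.isDiscreteValuationRing_of_compactSpace
  let e : Valued.integer K ≃+* integers K :=
    { toFun := fun x => ⟨x.1, (hmem _).1 x.2⟩
      invFun := fun x => ⟨x.1, (hmem _).2 x.2⟩
      left_inv := fun _ => rfl
      right_inv := fun _ => rfl
      map_mul' := fun _ _ => rfl
      map_add' := fun _ _ => rfl }
  have hd' : IsDiscreteValuationRing (integers K) :=
    IsDiscreteValuationRing.RingEquivClass.isDiscreteValuationRing e
  refine ⟨hd', ?_, isCompact_iff_compactSpace.mp hc1⟩
  have hcc : CompactSpace (integers K) := isCompact_iff_compactSpace.mp hc1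
  have ho : IsOpen ((IsLocalRing.maximalIdeal (integers K)).toAddSubgroup : Set (integers K)) := by
    have : ((IsLocalRing.maximalIdeal (integers K)).toAddSubgroup : Set (integers K)) =
        (fun x : integers K => ‖(x : K)‖) ⁻¹' Set.Iio 1 := by
      ext x
      exact mem_maximalIdeal_integers
    rw [this]
    exact isOpen_Iio.preimage (continuous_norm.comp continuous_subtype_val)
  have := AddSubgroup.quotient_finite_of_isOpen (IsLocalRing.maximalIdeal (integers K)).toAddSubgroup ho
  exact this

instance : IsDiscreteValuationRing (integers K) := (integers_dvr_finite_compact K).1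
instance : Finite (ResidueField K) := (integers_dvr_finite_compact K).2.1

instance : CharP (ResidueField K) p := by
  have h : ((p : ℕ) : ResidueField K) = 0 := by
    have : IsLocalRing.residue (integers K) (p : integers K) = 0 := by
      rw [IsLocalRing.residue_eq_zero_iff, mem_maximalIdeal_integers]
      simpa using norm_natCast_prime
    simpa using this
  exact (CharP.charP_iff_prime_eq_zero Fact.out).2 h

theorem residueCard_eq_pow : ∃ f : ℕ, 0 < f ∧ residueCard K = p ^ f := by
  have := Fintype.ofFinite (ResidueField K)
  obtain ⟨n, _, h⟩ := FiniteField.card (ResidueField K) p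
  exact ⟨n, n.2, by rw [residueCard, Nat.card_eq_fintype_card, h]⟩

theorem one_lt_residueCard : 1 < residueCard K := by
  obtain ⟨f, hf, h⟩ := residueCard_eq_pow K
  rw [h]; exact Nat.one_lt_pow hf.ne' (Fact.out : p.Prime).one_lt

theorem dvd_residueCard : p ∣ residueCard K := by
  obtain ⟨f, hf, h⟩ := residueCard_eq_pow K
  rw [h]; exact dvd_pow_self _ hf.ne'

theorem norm_eq_uniformizer_zpow {ϖ : integers K} (hϖ : Irreducible ϖ) {x : K} (hx : x ≠ 0) :
    ∃ k : ℤ, ‖(x : PadicAlgCl p)‖ = ‖((ϖ : K) : PadicAlgCl p)‖ ^ k := by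
  have key (y : integers K) (hy : y ≠ 0) :
      ∃ k : ℤ, ‖((y : K) : PadicAlgCl p)‖ = ‖((ϖ : K) : PadicAlgCl p)‖ ^ k := by
    obtain ⟨n, u, h⟩ := IsDiscreteValuationRing.eq_unit_mul_pow_irreducible hy hϖ
    refine ⟨n, ?_⟩
    have hu := integers_isUnit_iff.1 u.isUnit
    rw [h]; push_cast
    rw [norm_mul, hu, norm_pow, one_mul, zpow_natCast]
  rcases (integers K).mem_or_inv_mem x with h | h
  · exact key ⟨x, h⟩ (fun h0 => hx (congrArg Subtype.val h0))
  · obtain ⟨k, hk⟩ := key ⟨x⁻¹, h⟩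
      (fun h0 => inv_ne_zero hx (congrArg Subtype.val h0))
    refine ⟨-k, ?_⟩
    rw [zpow_neg, ← hk]; push_cast; rw [norm_inv, inv_inv]

theorem norm_irreducible {ϖ : integers K} (hϖ : Irreducible ϖ) :
    0 < ‖((ϖ : K) : PadicAlgCl p)‖ ∧ ‖((ϖ : K) : PadicAlgCl p)‖ < 1 := by
  refine ⟨norm_pos_iff.2 ?_, mem_maximalIdeal_integers.1 ?_⟩
  · intro h0
    exact hϖ.ne_zero (Subtype.ext (Subtype.ext h0))
  · exact hϖ.not_isUnit

theorem ne_zero_of_pow_eq_irreducible {ϖ : integers K} (hϖ : Irreducible ϖ) {N : ℕ} (hN : 0 < N)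
    {y : PadicAlgCl p} (hy : y ^ N = algebraMap K (PadicAlgCl p) ϖ) : y ≠ 0 := by
  rintro rfl
  rw [zero_pow hN.ne'] at hy
  exact norm_pos_iff.1 (norm_irreducible K hϖ).1 hy.symm

theorem mem_maximalIdeal_pow_integers {ϖ : integers K} (hϖ : Irreducible ϖ) {x : integers K}
    (n : ℕ) : x ∈ IsLocalRing.maximalIdeal (integers K) ^ n ↔
      ‖((x : K) : PadicAlgCl p)‖ ≤ ‖((ϖ : K) : PadicAlgCl p)‖ ^ n := by
  obtain ⟨h0, h1⟩ := norm_irreducible K hϖ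
  rw [hϖ.maximalIdeal_eq, Ideal.span_singleton_pow, Ideal.mem_span_singleton]
  constructor
  · rintro ⟨y, rfl⟩
    have : ‖((y : K) : PadicAlgCl p)‖ ≤ 1 := y.2
    push_cast
    rw [norm_mul, norm_pow]
    exact mul_le_of_le_one_right (by positivity) this
  · intro h
    have hne : ((ϖ : K) : PadicAlgCl p) ≠ 0 := norm_pos_iff.1 h0
    have hne' : (ϖ : K) ≠ 0 := by simpa using hne
    refine ⟨⟨(x : K) / (ϖ : K) ^ n, ?_⟩, ?_⟩
    · rw [mem_integers]; push_cast
      rw [norm_div, norm_pow]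
      exact div_le_one_of_le₀ h (by positivity)
    · apply Subtype.ext
      push_cast
      field_simp

instance : IsAdicComplete (IsLocalRing.maximalIdeal (integers K)) (integers K) where
  haus' := (inferInstance : IsHausdorff (IsLocalRing.maximalIdeal (integers K)) (integers K)).haus'
  prec' := by
    intro f hf
    obtain ⟨ϖ, hϖ⟩ := IsDiscreteValuationRing.exists_irreducible (integers K)
    obtain ⟨h0, h1⟩ := norm_irreducible K hϖ
    have hd {m n : ℕ} (h : m ≤ n) : ‖(((f m : K) - (f n : K) : K) : PadicAlgCl p)‖ ≤
        ‖((ϖ : K) : PadicAlgCl p)‖ ^ m := by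
      have := hf h
      rw [SModEq.sub_mem, smul_eq_mul, Ideal.mul_top, mem_maximalIdeal_pow_integers K hϖ] at this
      simpa using this
    have : CompactSpace (integers K) := (integers_dvr_finite_compact K).2.2
    -- a cluster point of the sequence is its limit
    obtain ⟨x, -, φ, hφ, hx⟩ := (isCompact_univ (X := integers K)).tendsto_subseq
      (fun n => Set.mem_univ (f n))
    refine ⟨x, fun n => ?_⟩
    rw [SModEq.sub_mem, smul_eq_mul, Ideal.mul_top, mem_maximalIdeal_pow_integers K hϖ]
    have hcont : Continuous fun y : integers K => ‖(((f n : K) - (y : K) : K) : PadicAlgCl p)‖ := by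
      have : Continuous fun y : integers K => ((y : K) : PadicAlgCl p) :=
        continuous_subtype_val.comp continuous_subtype_val
      push_cast
      exact (continuous_const.sub this).norm
    have := (hcont.tendsto x).comp hx
    refine (le_of_tendsto this ?_)
    filter_upwards [Filter.eventually_ge_atTop n] with m hm
    exact hd (hm.trans hφ.le_apply)

end LocalFieldBasics

/-! ### Ramification in the absolute Galois group -/

section Ramification

variable {p : ℕ} [Fact p.Prime]

theorem norm_eq_one_of_pow_eq_one {x : PadicAlgCl p} {N : ℕ} (hN : N ≠ 0) (h : x ^ N = 1) :
    ‖x‖ = 1 := by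
  have := congrArg norm h
  rw [norm_pow, norm_one] at this
  exact (pow_eq_one_iff_of_nonneg (norm_nonneg _) hN).1 this

theorem norm_sub_lt_trans {x y z : PadicAlgCl p} {c : ℝ} (h : ‖x - y‖ < c) (h' : ‖y - z‖ < c) :
    ‖x - z‖ < c := by
  rw [← sub_add_sub_cancel x y z]
  exact lt_of_le_of_lt (PadicAlgCl.isNonarchimedean p _ _) (max_lt h h')

theorem norm_eq_of_norm_sub_lt {x y : PadicAlgCl p} (h : ‖x - y‖ < ‖y‖) : ‖x‖ = ‖y‖ := by
  have := IsUltrametricDist.norm_add_eq_max_of_norm_ne_norm (x := x - y) (y := y) h.ne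
  rw [sub_add_cancel, max_eq_right h.le] at this
  exact this

theorem norm_sum_lt {ι : Type*} (s : Finset ι) (f : ι → PadicAlgCl p) {c : ℝ} (hc : 0 < c)
    (h : ∀ i ∈ s, ‖f i‖ < c) : ‖∑ i ∈ s, f i‖ < c := by
  classical
  induction s using Finset.induction with
  | empty => simpa using hc
  | insert a s ha ih =>
    rw [Finset.sum_insert ha]
    exact lt_of_le_of_lt (PadicAlgCl.isNonarchimedean p _ _)
      (max_lt (h a (by simp)) (ih fun i hi => h i (by simp [hi])))

theorem norm_pow_sub_one_le {z : PadicAlgCl p} (hz : ‖z‖ ≤ 1) (i : ℕ) :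
    ‖z ^ i - 1‖ ≤ ‖z - 1‖ := by
  induction i with
  | zero => simp
  | succ i ih =>
    have e : z ^ (i + 1) - 1 = z * (z ^ i - 1) + (z - 1) := by ring
    rw [e]
    refine (PadicAlgCl.isNonarchimedean p _ _).trans (max_le ?_ le_rfl)
    rw [norm_mul]
    exact (mul_le_of_le_one_left (norm_nonneg _) hz).trans ih

/-- Distinct roots of unity of order prime to `p` are not congruent. -/
theorem eq_of_pow_eq_one_of_norm_sub_lt {x y : PadicAlgCl p} {N : ℕ} (hN : ¬ p ∣ N)
    (hx : x ^ N = 1) (hy : y ^ N = 1) (h : ‖x - y‖ < 1) : x = y := by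
  have hN0 : N ≠ 0 := fun h0 => hN (h0 ▸ dvd_zero p)
  have hny := norm_eq_one_of_pow_eq_one hN0 hy
  have hy0 : y ≠ 0 := norm_pos_iff.1 (hny ▸ one_pos)
  set z := x / y with hz
  have hzN : z ^ N = 1 := by rw [hz, div_pow, hx, hy, div_one]
  have hnz := norm_eq_one_of_pow_eq_one hN0 hzN
  have hz1 : ‖z - 1‖ < 1 := by
    have : z - 1 = (x - y) / y := by rw [hz]; field_simp
    rw [this, norm_div, hny, div_one]; exact h
  by_contra hne
  have hz_ne : z - 1 ≠ 0 := by
    rw [sub_ne_zero]; intro h1; exact hne ((div_eq_one_iff_eq hy0).1 h1)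
  have hg : ∑ i ∈ Finset.range N, z ^ i = 0 := by
    have := geom_sum_mul z N
    rw [hzN, sub_self] at this
    exact (mul_eq_zero.1 this).resolve_right hz_ne
  have hs : ‖(0 : PadicAlgCl p) - (N : PadicAlgCl p)‖ < 1 := by
    have : (0 : PadicAlgCl p) - N = ∑ i ∈ Finset.range N, (z ^ i - 1) := by
      rw [Finset.sum_sub_distrib, hg]; simp
    rw [this]
    exact norm_sum_lt _ _ one_pos fun i _ => (norm_pow_sub_one_le hnz.le i).trans_lt hz1
  rw [zero_sub, norm_neg, norm_natCast_eq_one hN] at hs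
  exact lt_irrefl _ hs

variable {F : IntermediateField ℚ_[p] (PadicAlgCl p)}

theorem wildInertia_le_inertia : wildInertia F ≤ inertia F := by
  intro g hg x hx
  by_cases h0 : x = 0
  · simp [h0]
  · exact (hg x h0).trans_le hx

theorem inertia_apply_rootOfUnity {g : GaloisGroup F} (hg : g ∈ inertia F) {x : PadicAlgCl p}
    {N : ℕ} (hN : ¬ p ∣ N) (hx : x ^ N = 1) : g x = x := by
  have hN0 : N ≠ 0 := fun h0 => hN (h0 ▸ dvd_zero p)
  refine eq_of_pow_eq_one_of_norm_sub_lt hN (by rw [← map_pow, hx, map_one]) hx ?_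
  exact hg x (norm_eq_one_of_pow_eq_one hN0 hx).le

theorem frobenius_apply_rootOfUnity {φ : GaloisGroup F} (hφ : IsFrobenius F φ)
    {x : PadicAlgCl p} {N : ℕ} (hN : ¬ p ∣ N) (hx : x ^ N = 1) : φ x = x ^ residueCard F := by
  have hN0 : N ≠ 0 := fun h0 => hN (h0 ▸ dvd_zero p)
  refine eq_of_pow_eq_one_of_norm_sub_lt hN (by rw [← map_pow, hx, map_one]) ?_ ?_
  · rw [← pow_mul, mul_comm, pow_mul, hx, one_pow]
  · exact hφ x (norm_eq_one_of_pow_eq_one hN0 hx).le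

/-- An element `y` with `y ^ N ∈ F`, `N` prime to `p`, is fixed by wild inertia. -/
theorem wildInertia_apply_of_pow_mem {g : GaloisGroup F} (hg : g ∈ wildInertia F)
    {y : PadicAlgCl p} {N : ℕ} (hN : ¬ p ∣ N) {c : F} (hy : y ^ N = algebraMap F _ c) :
    g y = y := by
  have hN0 : N ≠ 0 := fun h0 => hN (h0 ▸ dvd_zero p)
  by_cases h0 : y = 0
  · simp [h0]
  have h1 : (g y / y) ^ N = 1 := by
    rw [div_pow, ← map_pow, hy, AlgEquiv.commutes, div_self]
    rw [← hy]; exact pow_ne_zero _ h0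
  have h2 : ‖g y / y - 1‖ < 1 := by
    have : g y / y - 1 = (g y - y) / y := by field_simp
    rw [this, norm_div]
    exact (div_lt_one (norm_pos_iff.2 h0)).2 (hg y h0)
  exact (div_eq_one_iff_eq h0).1 (eq_of_pow_eq_one_of_norm_sub_lt hN h1 (one_pow N) h2)

/-- On inertia, the ratio `g x / x` depends modulo the maximal ideal only on `‖x‖`. -/
theorem inertia_ratio {g : GaloisGroup F} (hg : g ∈ inertia F) {x y : PadicAlgCl p}
    (hx : x ≠ 0) (hy : y ≠ 0) (h : ‖x‖ = ‖y‖) : ‖g x / x - g y / y‖ < 1 := by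
  have hgx : g x ≠ 0 := by simpa using hx
  have hgy : g y ≠ 0 := by simpa using hy
  have hu : ‖x / y‖ ≤ 1 := by rw [norm_div, h, div_self (norm_ne_zero_iff.2 hy)]
  have e : g x / x - g y / y = (g (x / y) - x / y) * (g y / x) := by
    rw [map_div₀]; field_simp
  rw [e, norm_mul, norm_div, norm_galois, h, div_self (norm_ne_zero_iff.2 hy), mul_one]
  exact hg _ hu

theorem inertia_ratio_pow {g : GaloisGroup F} (hg : g ∈ inertia F) {x : PadicAlgCl p}
    (hx : x ≠ 0) (k : ℕ) : ‖(g ^ k) x / x - (g x / x) ^ k‖ < 1 := by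
  induction k with
  | zero => simp [hx]
  | succ k ih =>
    have hgx : g x ≠ 0 := by simpa using hx
    have h1 := inertia_ratio ((inertia F).pow_mem hg k) hgx hx (norm_galois F g x)
    have hn : ‖g x / x‖ = 1 := by
      rw [norm_div, norm_galois, div_self (norm_ne_zero_iff.2 hx)]
    have h2 := norm_sub_lt_trans h1 ih
    have e : (g ^ (k + 1)) x / x - (g x / x) ^ (k + 1) =
        ((g ^ k) (g x) / (g x) - (g x / x) ^ k) * (g x / x) := by
      rw [pow_succ g, AlgEquiv.mul_apply, pow_succ, sub_mul]; field_simp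
    rw [e, norm_mul, hn, mul_one]
    exact h2

/-- The tame relation `φ g φ⁻¹ ≡ g ^ q` modulo wild inertia, for `g ∈ I_F`. -/
theorem tame_relation {φ : GaloisGroup F} (hφ : IsFrobenius F φ) {g : GaloisGroup F}
    (hg : g ∈ inertia F) : (g ^ residueCard F)⁻¹ * (φ * g * φ⁻¹) ∈ wildInertia F := by
  intro x hx
  have hφx : φ⁻¹ x ≠ 0 := by simpa using hx
  set q := residueCard F
  have h1 : ‖(φ * g * φ⁻¹) x / x - (g (φ⁻¹ x) / φ⁻¹ x) ^ q‖ < 1 := by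
    have e : (φ * g * φ⁻¹) x / x = φ (g (φ⁻¹ x) / φ⁻¹ x) := by
      rw [map_div₀, ← AlgEquiv.mul_apply φ φ⁻¹, mul_inv_cancel]; simp [AlgEquiv.mul_apply]
    rw [e]
    apply hφ
    rw [norm_div, norm_galois, div_self (norm_ne_zero_iff.2 hφx)]
  have h2 : ‖(g (φ⁻¹ x) / φ⁻¹ x) ^ q - (g x / x) ^ q‖ < 1 := by
    have h3 := inertia_ratio hg hφx hx (norm_galois F φ⁻¹ x)
    have hn : ‖g x / x‖ = 1 := by
      rw [norm_div, norm_galois, div_self (norm_ne_zero_iff.2 hx)]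
    set a := g (φ⁻¹ x) / φ⁻¹ x
    set b := g x / x
    have hb : b ≠ 0 := norm_pos_iff.1 (hn ▸ one_pos)
    have hab : ‖a / b - 1‖ < 1 := by
      have : a / b - 1 = (a - b) / b := by field_simp
      rw [this, norm_div, hn, div_one]; exact h3
    have hab1 : ‖a / b‖ ≤ 1 := by
      have := norm_eq_of_norm_sub_lt (x := a / b) (y := 1) (by simpa using hab)
      rw [this]; simp
    have e : a ^ q - b ^ q = ((a / b) ^ q - 1) * b ^ q := by
      rw [sub_mul, ← mul_pow, div_mul_cancel₀ _ hb, one_mul]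
    rw [e, norm_mul, norm_pow b, hn, one_pow, mul_one]
    exact (norm_pow_sub_one_le hab1 q).trans_lt hab
  have h4 := inertia_ratio_pow hg hx q
  have h5 : ‖(φ * g * φ⁻¹) x / x - (g ^ q) x / x‖ < 1 :=
    norm_sub_lt_trans (norm_sub_lt_trans h1 h2) (by rwa [norm_sub_rev])
  rw [← sub_div, norm_div, div_lt_one (norm_pos_iff.2 hx)] at h5
  have e : ((g ^ q)⁻¹ * (φ * g * φ⁻¹)) x - x = (g ^ q)⁻¹ ((φ * g * φ⁻¹) x - (g ^ q) x) := by
    rw [map_sub, ← AlgEquiv.mul_apply (g ^ q)⁻¹ (g ^ q), inv_mul_cancel]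
    simp [AlgEquiv.mul_apply]
  rw [e, norm_galois]
  exact h5

/-- Wild inertia is pro-`p`: the trace `∑ hⁱ z` of a nonzero `z` has the norm of `m z`, so it
does not vanish, while it vanishes for `z = h x - x`. -/
theorem wildInertia_mem_of_pow_mem {U : Subgroup (GaloisGroup F)}
    (hU : IsClosed (U : Set (GaloisGroup F))) {h : GaloisGroup F} (hh : h ∈ wildInertia F)
    {m : ℕ} (hm : ¬ p ∣ m) (hmU : h ^ m ∈ U) : h ∈ U := by
  have e := InfiniteGalois.fixingSubgroup_fixedField (⟨U, hU⟩ : ClosedSubgroup (GaloisGroup F))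
  change (IntermediateField.fixedField U).fixingSubgroup = U at e
  rw [← e, IntermediateField.mem_fixingSubgroup_iff]
  intro x hx
  have hx' : (h ^ m) x = x := hx ⟨_, hmU⟩
  by_contra hne
  set z := h x - x with hz
  have hz0 : z ≠ 0 := sub_ne_zero.2 hne
  have htr : ∑ i ∈ Finset.range m, (h ^ i) z = 0 := by
    have : ∀ i, (h ^ i) z = (h ^ (i + 1)) x - (h ^ i) x := fun i => by
      rw [hz, map_sub, pow_succ h, AlgEquiv.mul_apply]
    simp_rw [this]
    rw [Finset.sum_range_sub (fun i => (h ^ i) x), hx']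
    simp
  have hs : ‖∑ i ∈ Finset.range m, ((h ^ i) z - z)‖ < ‖z‖ :=
    norm_sum_lt _ _ (norm_pos_iff.2 hz0) fun i _ => (wildInertia F).pow_mem hh i z hz0
  rw [Finset.sum_sub_distrib, htr, zero_sub, norm_neg] at hs
  simp only [Finset.sum_const, Finset.card_range, nsmul_eq_mul] at hs
  rw [norm_mul, norm_natCast_eq_one hm, one_mul] at hs
  exact lt_irrefl _ hs

end Ramification

section Generation

open Polynomial

variable {p : ℕ} [Fact p.Prime] {F : IntermediateField ℚ_[p] (PadicAlgCl p)}

theorem exists_norm_lt_one_of_norm_prod_lt {ι : Type*} {s : Finset ι} {f : ι → PadicAlgCl p}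
    (h : ‖∏ i ∈ s, f i‖ < 1) : ∃ i ∈ s, ‖f i‖ < 1 := by
  by_contra! hn
  rw [norm_prod] at h
  exact absurd h (not_lt.2 (Finset.prod_induction _ (fun x => 1 ≤ x)
    (fun a b ha hb => one_le_mul_of_one_le_of_one_le ha hb) le_rfl hn))

theorem norm_eval_le_one {Q : (PadicAlgCl p)[X]} (hQ : ∀ i, ‖Q.coeff i‖ < 1) {c : PadicAlgCl p}
    (hc : ‖c‖ ≤ 1) : ‖Q.eval c‖ < 1 := by
  rw [eval_eq_sum_range]
  refine norm_sum_lt _ _ one_pos fun i _ => ?_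
  rw [norm_mul, norm_pow]
  exact (mul_le_of_le_one_right (norm_nonneg _) (pow_le_one₀ (norm_nonneg _) hc)).trans_lt (hQ i)

theorem not_dvd_residueCard_pow_sub_one [FiniteDimensional ℚ_[p] F] {M : ℕ} (hM : M ≠ 0) :
    ¬ p ∣ residueCard F ^ M - 1 := by
  intro h
  have h1 : p ∣ residueCard F ^ M := dvd_pow (dvd_residueCard F) hM
  have h2 : 1 ≤ residueCard F ^ M := Nat.one_le_pow _ _ (one_lt_residueCard F).le
  have := (Nat.dvd_sub h1 h)
  rw [Nat.sub_sub_self h2] at this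
  exact (Fact.out : p.Prime).one_lt.ne' (Nat.dvd_one.1 this)

/-- An element which is congruent to its `q`-th power is congruent to an element of `F`. -/
theorem exists_approx_of_norm_pow_sub_lt [FiniteDimensional ℚ_[p] F] {c : PadicAlgCl p}
    (hc : ‖c‖ ≤ 1) (h : ‖c ^ residueCard F - c‖ < 1) :
    ∃ a : F, ‖(a : PadicAlgCl p)‖ ≤ 1 ∧ ‖c - a‖ < 1 := by
  classical
  have := Fintype.ofFinite (ResidueField F)
  have hq : residueCard F = Fintype.card (ResidueField F) := Nat.card_eq_fintype_card
  have hq1 : 1 < Fintype.card (ResidueField F) := hq ▸ one_lt_residueCard F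
  set s : ResidueField F → integers F := fun a => Quotient.out a
  have hs (a) : IsLocalRing.residue (integers F) (s a) = a := Quotient.out_eq a
  set P : (integers F)[X] := ∏ a, (X - C (s a)) with hP
  have hP' : P.map (IsLocalRing.residue (integers F)) =
      X ^ Fintype.card (ResidueField F) - X := by
    rw [hP, Polynomial.map_prod]
    simp only [Polynomial.map_sub, map_X, map_C, hs]
    have hmonic : (X ^ Fintype.card (ResidueField F) - X : (ResidueField F)[X]).Monic :=
      monic_X_pow_sub (by rw [degree_X]; exact_mod_cast hq1)
    have hroots := FiniteField.roots_X_pow_card_sub_X (ResidueField F)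
    have h3 := prod_multiset_X_sub_C_of_monic_of_roots_card_eq hmonic (by
      rw [hroots, FiniteField.X_pow_card_sub_X_natDegree_eq _ hq1]; rfl)
    rw [hroots] at h3
    exact h3
  set D : (integers F)[X] := P - (X ^ Fintype.card (ResidueField F) - X) with hD
  have hD0 : D.map (IsLocalRing.residue (integers F)) = 0 := by
    rw [hD, Polynomial.map_sub, hP']; simp
  set j : integers F →+* PadicAlgCl p := (algebraMap F (PadicAlgCl p)).comp (integers F).subtype
  have hDc : ∀ i, ‖(D.map j).coeff i‖ < 1 := by
    intro i
    have := congrArg (fun Q => coeff Q i) hD0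
    simp only [coeff_map, coeff_zero] at this
    rw [IsLocalRing.residue_eq_zero_iff, mem_maximalIdeal_integers] at this
    rw [coeff_map]; exact this
  have h1 := norm_eval_le_one hDc hc
  have h2 : ‖(P.map j).eval c‖ < 1 := by
    have e : (P.map j).eval c = (D.map j).eval c + (c ^ residueCard F - c) := by
      rw [hD, hq]; simp
    rw [e]
    exact lt_of_le_of_lt (PadicAlgCl.isNonarchimedean p _ _) (max_lt h1 h)
  rw [hP, Polynomial.map_prod, eval_prod] at h2
  obtain ⟨a, -, ha⟩ := exists_norm_lt_one_of_norm_prod_lt h2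
  have h4 : ‖c - j (s a)‖ < 1 := by simpa using ha
  exact ⟨s a, (s a).2, h4⟩

/-- The conjugates over `F` of a root of unity `ζ` of order prime to `p` are the `ζ ^ (q ^ m)`. -/
theorem exists_apply_eq_pow_pow [FiniteDimensional ℚ_[p] F] {φ : GaloisGroup F}
    (hφ : IsFrobenius F φ) {M : ℕ} (hM : M ≠ 0) {ζ : PadicAlgCl p}
    (hζ : ζ ^ (residueCard F ^ M - 1) = 1) (g : GaloisGroup F) :
    ∃ m, g ζ = ζ ^ residueCard F ^ m := by
  set q := residueCard F with hq
  have hN := not_dvd_residueCard_pow_sub_one (F := F) hM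
  have hN0 : q ^ M - 1 ≠ 0 := fun h0 => hN (by rw [← hq, h0]; exact dvd_zero p)
  have hnζ := norm_eq_one_of_pow_eq_one hN0 hζ
  have hζM : ζ ^ q ^ M = ζ := by
    have h2 : 1 ≤ q ^ M := Nat.one_le_pow _ _ (one_lt_residueCard F).le
    calc ζ ^ q ^ M = ζ ^ (q ^ M - 1 + 1) := by rw [Nat.sub_add_cancel h2]
      _ = ζ := by rw [pow_succ, hζ, one_mul]
  have hpow (m) : (ζ ^ q ^ m) ^ (q ^ M - 1) = 1 := by
    rw [← pow_mul, mul_comm, pow_mul, hζ, one_pow]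
  set P : (PadicAlgCl p)[X] := ∏ m ∈ Finset.range M, (X - C (ζ ^ q ^ m)) with hP
  have hPdeg : P.natDegree < M + 1 := by
    rw [hP, natDegree_prod_of_monic _ _ fun i _ => monic_X_sub_C _]; simp only [natDegree_X_sub_C]; simp
  have hPφ : P.map (φ : PadicAlgCl p →+* PadicAlgCl p) = P := by
    have e1 : P.map (φ : PadicAlgCl p →+* PadicAlgCl p) =
        ∏ m ∈ Finset.range M, (X - C (ζ ^ q ^ (m + 1))) := by
      rw [hP, Polynomial.map_prod]
      refine Finset.prod_congr rfl fun m _ => ?_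
      have : φ (ζ ^ q ^ m) = ζ ^ q ^ (m + 1) := by
        rw [frobenius_apply_rootOfUnity hφ hN (hpow m), ← pow_mul, pow_succ]
      simp only [Polynomial.map_sub, map_X, map_C]
      rw [← this]; rfl
    have e2 := Finset.prod_range_succ (fun m => (X - C (ζ ^ q ^ m))) M
    rw [Finset.prod_range_succ' (fun m => (X - C (ζ ^ q ^ m))) M, hζM, pow_zero, pow_one] at e2
    rw [e1, hP]
    exact mul_right_cancel₀ (X_sub_C_ne_zero ζ) e2
  have hPc : ∀ i, ‖P.coeff i‖ ≤ 1 := by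
    set A := (NormedField.valuation (K := PadicAlgCl p)).valuationSubring
    have hA (m) : ζ ^ q ^ m ∈ A := (norm_eq_one_of_pow_eq_one hN0 (hpow m)).le
    have : P = (∏ m ∈ Finset.range M, (X - C (⟨_, hA m⟩ : A))).map A.subtype := by
      rw [hP, Polynomial.map_prod]; simp
    intro i
    rw [this, coeff_map]
    exact (coeff _ i : A).2
  have hex (i) : ∃ a : F, ‖(a : PadicAlgCl p)‖ ≤ 1 ∧ ‖P.coeff i - a‖ < 1 := by
    refine exists_approx_of_norm_pow_sub_lt (hPc i) ?_
    have := hφ _ (hPc i)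
    have e : φ (P.coeff i) = P.coeff i := by
      have := congrArg (fun Q => coeff Q i) hPφ
      simpa using this
    rw [e] at this
    rwa [norm_sub_rev]
  choose a ha1 ha using hex
  have happ : ∀ c : PadicAlgCl p, ‖c‖ ≤ 1 →
      ‖P.eval c - ∑ i ∈ Finset.range (M + 1), (a i : PadicAlgCl p) * c ^ i‖ < 1 := fun c hc => by
    rw [eval_eq_sum_range' hPdeg, ← Finset.sum_sub_distrib]
    refine norm_sum_lt _ _ one_pos fun i _ => ?_
    rw [← sub_mul, norm_mul, norm_pow]
    exact (mul_le_of_le_one_right (norm_nonneg _) (pow_le_one₀ (norm_nonneg _) hc)).trans_lt (ha i)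
  have h0 : P.eval ζ = 0 := by
    rw [hP, eval_prod]
    exact Finset.prod_eq_zero (Finset.mem_range.2 (Nat.pos_of_ne_zero hM)) (by simp)
  have h1 := happ ζ hnζ.le
  rw [h0, zero_sub, norm_neg, ← norm_galois F g] at h1
  have h2 := happ (g ζ) (by rw [norm_galois, hnζ])
  have e : g (∑ i ∈ Finset.range (M + 1), (a i : PadicAlgCl p) * ζ ^ i) =
      ∑ i ∈ Finset.range (M + 1), (a i : PadicAlgCl p) * (g ζ) ^ i := by
    rw [map_sum]
    refine Finset.sum_congr rfl fun i _ => ?_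
    rw [map_mul, map_pow]
    congr 1
    exact g.commutes (a i)
  rw [e] at h1
  have h3 : ‖P.eval (g ζ)‖ < 1 := by
    have := norm_sub_lt_trans (z := 0) h2 (by rwa [sub_zero])
    rwa [sub_zero] at this
  rw [hP, eval_prod] at h3
  obtain ⟨m, -, hm⟩ := exists_norm_lt_one_of_norm_prod_lt h3
  refine ⟨m, eq_of_pow_eq_one_of_norm_sub_lt hN (by rw [← map_pow, hζ, map_one]) (hpow m) ?_⟩
  simpa using hm

/-- Every unit of the integral closure is congruent to a root of unity of order prime to `p`. -/
theorem exists_rootOfUnity_near (F : IntermediateField ℚ_[p] (PadicAlgCl p))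
    [FiniteDimensional ℚ_[p] F] {x : PadicAlgCl p} (hx : ‖x‖ = 1) :
    ∃ M, M ≠ 0 ∧ ∃ ζ : PadicAlgCl p, ζ ^ (residueCard F ^ M - 1) = 1 ∧ ‖x - ζ‖ < 1 := by
  classical
  set K : IntermediateField ℚ_[p] (PadicAlgCl p) := IntermediateField.adjoin ℚ_[p] {x}
  have : FiniteDimensional ℚ_[p] K :=
    IntermediateField.adjoin.finiteDimensional (Algebra.IsIntegral.isIntegral x)
  obtain ⟨f', hf', hK⟩ := residueCard_eq_pow K
  obtain ⟨f, hf, hF⟩ := residueCard_eq_pow F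
  have := Fintype.ofFinite (ResidueField K)
  have hc : residueCard K = Fintype.card (ResidueField K) := Nat.card_eq_fintype_card
  set y : integers K := ⟨⟨x, IntermediateField.mem_adjoin_simple_self _ x⟩, hx.le⟩
  have h1 := FiniteField.pow_card_pow (K := ResidueField K) f (IsLocalRing.residue _ y)
  rw [← hc, hK, ← pow_mul, mul_comm f' f, pow_mul, ← hF, ← map_pow, ← sub_eq_zero, ← map_sub,
    IsLocalRing.residue_eq_zero_iff, mem_maximalIdeal_integers] at h1
  have h2 : ‖x ^ residueCard F ^ f' - x‖ < 1 := by simpa using h1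
  refine ⟨f', hf'.ne', ?_⟩
  have hle : 1 ≤ residueCard F ^ f' := Nat.one_le_pow _ _ (one_lt_residueCard F).le
  set N := residueCard F ^ f' - 1 with hNdef
  have hN : N ≠ 0 := by
    have := Nat.one_lt_pow hf'.ne' (one_lt_residueCard F)
    omega
  have h3 : ‖x ^ N - 1‖ < 1 := by
    have e : x ^ residueCard F ^ f' - x = x * (x ^ N - 1) := by
      rw [mul_sub, mul_one, ← pow_succ', hNdef, Nat.sub_add_cancel hle]
    rwa [e, norm_mul, hx, one_mul] at h2
  have : NeZero N := ⟨hN⟩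
  obtain ⟨ζ, hζ⟩ := HasEnoughRootsOfUnity.exists_primitiveRoot (PadicAlgCl p) N
  have h4 := congrArg (Polynomial.eval x) (Polynomial.X_pow_sub_one_eq_prod
    (Nat.pos_of_ne_zero hN) hζ)
  rw [eval_prod] at h4
  simp only [eval_sub, eval_pow, eval_X, eval_one, eval_C] at h4
  rw [h4] at h3
  obtain ⟨z, hz, hz'⟩ := exists_norm_lt_one_of_norm_prod_lt h3
  exact ⟨z, (Polynomial.mem_nthRootsFinset (Nat.pos_of_ne_zero hN) 1).1 hz, hz'⟩

theorem isClosed_apply_eq (g : GaloisGroup F) (x : PadicAlgCl p) :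
    IsClosed {h : GaloisGroup F | h x = g x} := by
  have h1 := (stabilizer_isOpen_of_isIntegral (K := F) x)
  have h2 := Subgroup.isClosed_of_isOpen _ h1
  have : {h : GaloisGroup F | h x = g x} = (fun h => g⁻¹ * h) ⁻¹'
      (MulAction.stabilizer (GaloisGroup F) x : Set (GaloisGroup F)) := by
    ext h
    simp only [Set.mem_ofPred_eq, Set.mem_preimage, SetLike.mem_coe, MulAction.mem_stabilizer_iff,
      AlgEquiv.smul_def, AlgEquiv.mul_apply]
    rw [← AlgEquiv.symm_apply_eq (e := g)] 
    exact Iff.rfl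
  rw [this]
  exact h2.preimage (continuous_const.mul continuous_id)

/-- The absolute Galois group is topologically generated by a Frobenius and inertia. -/
theorem eq_top_of_frobenius_mem [FiniteDimensional ℚ_[p] F] {φ : GaloisGroup F}
    (hφ : IsFrobenius F φ) {U : Subgroup (GaloisGroup F)}
    (hU : IsClosed (U : Set (GaloisGroup F))) (hφU : φ ∈ U) (hI : inertia F ≤ U) : U = ⊤ := by
  rw [eq_top_iff]
  rintro g -
  set q := residueCard F with hq
  have hq1 : 1 < q := one_lt_residueCard F
  let t : ℕ → Set (GaloisGroup F) := fun n =>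
    {h | h ∈ U ∧ ∀ x : PadicAlgCl p, x ^ (q ^ n.factorial - 1) = 1 → h x = g x}
  have hdvd : ∀ {a b : ℕ}, a ∣ b → q ^ a - 1 ∣ q ^ b - 1 := fun {a b} h => by
    obtain ⟨c, rfl⟩ := h
    rw [pow_mul]
    simpa using Nat.sub_dvd_pow_sub_pow (q ^ a) 1 c
  have hclosed (n) : IsClosed (t n) := by
    have : t n = (U : Set (GaloisGroup F)) ∩
        ⋂ (x : PadicAlgCl p) (_ : x ^ (q ^ n.factorial - 1) = 1), {h | h x = g x} := by
      ext h; simp [t]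
    rw [this]
    exact hU.inter (isClosed_iInter fun x => isClosed_iInter fun _ => isClosed_apply_eq g x)
  obtain ⟨h, hh⟩ := IsCompact.nonempty_iInter_of_sequence_nonempty_isCompact_isClosed t
    (by
      rintro n h ⟨h1, h2⟩
      refine ⟨h1, fun x hx => h2 x ?_⟩
      obtain ⟨c, hc⟩ := hdvd (Nat.factorial_dvd_factorial n.le_succ)
      rw [hc, pow_mul, hx, one_pow])
    (by
      intro n
      have hN : q ^ n.factorial - 1 ≠ 0 := by
        have := Nat.one_lt_pow n.factorial_ne_zero hq1
        omega
      have : NeZero (q ^ n.factorial - 1) := ⟨hN⟩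
      obtain ⟨ζ, hζ⟩ := HasEnoughRootsOfUnity.exists_primitiveRoot (PadicAlgCl p)
        (q ^ n.factorial - 1)
      obtain ⟨m, hm⟩ := exists_apply_eq_pow_pow hφ n.factorial_ne_zero hζ.pow_eq_one g
      have hφm (k) : (φ ^ k) ζ = ζ ^ q ^ k := by
        induction k with
        | zero => simp
        | succ k ih =>
          rw [pow_succ, AlgEquiv.mul_apply, frobenius_apply_rootOfUnity hφ
            (not_dvd_residueCard_pow_sub_one n.factorial_ne_zero) hζ.pow_eq_one, map_pow, ih,
            ← pow_mul, pow_succ]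
      refine ⟨φ ^ m, U.pow_mem hφU m, fun x hx => ?_⟩
      obtain ⟨i, -, rfl⟩ := hζ.eq_pow_of_pow_eq_one hx
      rw [map_pow, map_pow, hφm, hm])
    (hclosed 0).isCompact hclosed
  simp only [Set.mem_iInter] at hh
  have hinert : h⁻¹ * g ∈ inertia F := by
    intro x hx
    rcases hx.lt_or_eq with hx | hx
    · have := norm_galois F (h⁻¹ * g) x
      rw [sub_eq_add_neg]
      refine lt_of_le_of_lt (PadicAlgCl.isNonarchimedean p _ _) (max_lt ?_ (by rwa [norm_neg]))
      rwa [this]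
    · obtain ⟨M, hM, ζ, hζ, hxζ⟩ := exists_rootOfUnity_near F hx
      have h1 : (h⁻¹ * g) ζ = ζ := by
        obtain ⟨c, hc⟩ := hdvd (Nat.dvd_factorial (Nat.pos_of_ne_zero hM) le_rfl)
        have := (hh M).2 ζ (by rw [hc, pow_mul, hζ, one_pow])
        rw [AlgEquiv.mul_apply, ← this, ← AlgEquiv.mul_apply, inv_mul_cancel]; rfl
      have h2 : ‖(h⁻¹ * g) x - ζ‖ < 1 := by
        rw [← h1, ← map_sub, norm_galois]; exact hxζ
      exact norm_sub_lt_trans h2 (by rwa [norm_sub_rev])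
  have := U.mul_mem (hh 0).1 (hI hinert)
  rwa [mul_inv_cancel_left] at this

theorem IsTameGenerator.isClosed_inertia {σ : inertia F} (hσ : IsTameGenerator F σ) :
    IsClosed (inertia F : Set (GaloisGroup F)) := by
  rw [← hσ]; exact isClosed_closure

theorem IsTameGenerator.inertia_le {σ : inertia F} (hσ : IsTameGenerator F σ)
    {U : Subgroup (GaloisGroup F)} (hU : IsClosed (U : Set (GaloisGroup F)))
    (hσU : (σ : GaloisGroup F) ∈ U) (hP : wildInertia F ≤ U) : inertia F ≤ U := by
  intro g hg
  have : g ∈ (inertia F : Set (GaloisGroup F)) := hg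
  rw [← hσ] at this
  refine closure_minimal ?_ hU this
  exact (Subgroup.closure_le U).2 (Set.insert_subset hσU hP)

end Generation

/-! ### Tame inertia -/

section TameInertia

variable {p : ℕ} [Fact p.Prime] {F : IntermediateField ℚ_[p] (PadicAlgCl p)}

theorem IsTameGenerator.eq_top {σ : inertia F} (hσ : IsTameGenerator F σ)
    {V : Subgroup (inertia F)} (hV : IsClosed (V : Set (inertia F))) (hσV : σ ∈ V)
    (hP : ∀ g : inertia F, (g : GaloisGroup F) ∈ wildInertia F → g ∈ V) : V = ⊤ := by
  have hc : IsClosed ((V.map (inertia F).subtype : Subgroup (GaloisGroup F)) :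
      Set (GaloisGroup F)) := by
    rw [Subgroup.coe_map]
    exact hσ.isClosed_inertia.isClosedMap_subtype_val _ hV
  have h := hσ.inertia_le hc ⟨σ, hσV, rfl⟩
    (fun g hg => ⟨⟨g, wildInertia_le_inertia hg⟩, hP _ hg, rfl⟩)
  rw [eq_top_iff]
  rintro g -
  obtain ⟨g', hg', e⟩ := h g.2
  rwa [← Subtype.ext e]

theorem IsTameGenerator.wild_mem {σ : inertia F} (hσ : IsTameGenerator F σ)
    {V : Subgroup (inertia F)} (hV : IsClosed (V : Set (inertia F))) {g : inertia F}
    (hg : (g : GaloisGroup F) ∈ wildInertia F) {m : ℕ} (hm : ¬ p ∣ m) (h : g ^ m ∈ V) :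
    g ∈ V := by
  have hc : IsClosed ((V.map (inertia F).subtype : Subgroup (GaloisGroup F)) :
      Set (GaloisGroup F)) := by
    rw [Subgroup.coe_map]
    exact hσ.isClosed_inertia.isClosedMap_subtype_val _ hV
  obtain ⟨g', hg', e⟩ := wildInertia_mem_of_pow_mem hc hg hm ⟨g ^ m, h, rfl⟩
  rwa [← Subtype.ext e]

theorem wildInertia_le_proKernel {σ : inertia F} (hσ : IsTameGenerator F σ) {l : ℕ}
    [Fact l.Prime] (hlp : l ≠ p) {g : inertia F}
    (hg : (g : GaloisGroup F) ∈ wildInertia F) : g ∈ proKernel F l := by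
  simp only [proKernel, Subgroup.mem_iInf]
  rintro U ⟨hU, hUo, k, hk⟩
  refine hσ.wild_mem (Subgroup.isClosed_of_isOpen _ hUo) hg (m := l ^ k) ?_ ?_
  · intro h
    have := (Fact.out : p.Prime).dvd_of_dvd_pow h
    exact hlp ((Nat.prime_dvd_prime_iff_eq Fact.out Fact.out).1 this).symm
  · rw [← hk]; exact U.pow_index_mem g

/-- A homomorphism on inertia with open kernel containing wild inertia has cyclic image,
generated by the image of a tame generator. -/
theorem IsTameGenerator.exists_zpow {σ : inertia F} (hσ : IsTameGenerator F σ) {H : Type*}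
    [Group H] (τ : inertia F →* H) (hτ : IsOpen (τ.ker : Set (inertia F)))
    (hP : ∀ g : inertia F, (g : GaloisGroup F) ∈ wildInertia F → τ g = 1) (g : inertia F) :
    ∃ k : ℤ, τ g = τ σ ^ k := by
  have hle : τ.ker ≤ (Subgroup.zpowers (τ σ)).comap τ := fun x hx => by
    rw [Subgroup.mem_comap, MonoidHom.mem_ker.1 hx]; exact one_mem _
  have ho := Subgroup.isOpen_mono hle hτ
  have := hσ.eq_top (Subgroup.isClosed_of_isOpen _ ho) (Subgroup.mem_zpowers (τ σ))
    (fun g hg => hle (hP g hg))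
  have hg : g ∈ (Subgroup.zpowers (τ σ)).comap τ := this ▸ Subgroup.mem_top g
  obtain ⟨k, hk⟩ := hg
  exact ⟨k, hk.symm⟩

/-- The Kummer character `g ↦ g y / y` of inertia, for `y ^ N ∈ F` with `N` prime to `p`. -/
def kummer (y : PadicAlgCl p) (hy : y ≠ 0) (N : ℕ) (hN : ¬ p ∣ N) (c : F)
    (hc : y ^ N = algebraMap F (PadicAlgCl p) c) : inertia F →* (PadicAlgCl p)ˣ where
  toFun g := Units.mk0 ((g : GaloisGroup F) y / y)
    (div_ne_zero (by simpa using hy) hy)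
  map_one' := by ext; simp [hy]
  map_mul' g h := by
    ext
    have hu : ((h : GaloisGroup F) y / y) ^ N = 1 := by
      rw [div_pow, ← map_pow, hc, AlgEquiv.commutes, div_self]
      rw [← hc]; exact pow_ne_zero _ hy
    have h1 := inertia_apply_rootOfUnity g.2 hN hu
    rw [map_div₀, div_eq_iff (by simpa using hy)] at h1
    simp only [Subgroup.coe_mul, Units.val_mk0, Units.val_mul, AlgEquiv.mul_apply]
    rw [h1]; field_simp

section
variable (y : PadicAlgCl p) (hy : y ≠ 0) (N : ℕ) (hN : ¬ p ∣ N) (c : F)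
    (hc : y ^ N = algebraMap F (PadicAlgCl p) c)

theorem kummer_mul (g : inertia F) :
    ((kummer y hy N hN c hc g : (PadicAlgCl p)ˣ) : PadicAlgCl p) * y = (g : GaloisGroup F) y := by
  simp [kummer, hy]

theorem kummer_pow_eq_one (g : inertia F) : kummer y hy N hN c hc g ^ N = 1 := by
  ext
  simp only [kummer, MonoidHom.coe_mk, OneHom.coe_mk, Units.val_pow_eq_pow_val, Units.val_mk0,
    Units.val_one]
  rw [div_pow, ← map_pow, hc, AlgEquiv.commutes, div_self]
  rw [← hc]; exact pow_ne_zero _ hy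

theorem kummer_eq_one_iff (g : inertia F) :
    kummer y hy N hN c hc g = 1 ↔ (g : GaloisGroup F) y = y := by
  rw [← kummer_mul y hy N hN c hc g]
  constructor
  · intro h; rw [h]; simp
  · intro h; ext; simpa [hy] using h

theorem kummer_wild {g : inertia F} (hg : (g : GaloisGroup F) ∈ wildInertia F) :
    kummer y hy N hN c hc g = 1 :=
  (kummer_eq_one_iff y hy N hN c hc g).2 (wildInertia_apply_of_pow_mem hg hN hc)

theorem isOpen_ker_kummer : IsOpen ((kummer y hy N hN c hc).ker : Set (inertia F)) := by
  have : ((kummer y hy N hN c hc).ker : Set (inertia F)) = Subtype.val ⁻¹'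
      (MulAction.stabilizer (GaloisGroup F) y : Set (GaloisGroup F)) := by
    ext g
    simp only [SetLike.mem_coe, MonoidHom.mem_ker, kummer_eq_one_iff, Set.mem_preimage,
      MulAction.mem_stabilizer_iff, AlgEquiv.smul_def]
  rw [this]
  exact (stabilizer_isOpen_of_isIntegral (K := F) y).preimage continuous_subtype_val

end

variable [FiniteDimensional ℚ_[p] F]

theorem not_dvd_of_dvd_residueCard_sub_one {r : ℕ} (hr : r ∣ residueCard F - 1) : ¬ p ∣ r := by
  intro h
  refine not_dvd_residueCard_pow_sub_one (F := F) one_ne_zero ?_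
  rw [pow_one]
  exact h.trans hr

/-- A root of order `r ∣ q - 1` of a uniformiser is not fixed by the tame generator: otherwise its
product with a suitable root of unity would lie in `F`, against the discreteness of the norm. -/
theorem tameGenerator_apply_ne {φ : GaloisGroup F} (hφ : IsFrobenius F φ) {σ : inertia F}
    (hσ : IsTameGenerator F σ) {r : ℕ} (hr1 : r ≠ 1) (hr : r ∣ residueCard F - 1)
    {ϖ : integers F} (hϖ : Irreducible ϖ) {y : PadicAlgCl p}
    (hy : y ^ r = algebraMap F (PadicAlgCl p) ϖ) : (σ : GaloisGroup F) y ≠ y := by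
  intro hσy
  have hpr := not_dvd_of_dvd_residueCard_sub_one hr
  have hr0 : r ≠ 0 := fun h => hpr (h ▸ dvd_zero p)
  obtain ⟨hϖ0, hϖ1⟩ := norm_irreducible F hϖ
  have hny : ‖y‖ ^ r = ‖((ϖ : F) : PadicAlgCl p)‖ := by rw [← norm_pow, hy]; rfl
  have hy0 : y ≠ 0 := by
    rintro rfl
    rw [norm_zero, zero_pow hr0] at hny
    exact hϖ0.ne hny
  have hI : inertia F ≤ MulAction.stabilizer (GaloisGroup F) y :=
    hσ.inertia_le (Subgroup.isClosed_of_isOpen _ (stabilizer_isOpen_of_isIntegral (K := F) y))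
      hσy (fun g hg => wildInertia_apply_of_pow_mem hg hpr hy)
  set q := residueCard F with hq
  have hq1 : 1 < q := one_lt_residueCard F
  set η := φ y / y with hη
  have hηr : η ^ r = 1 := by
    rw [hη, div_pow, ← map_pow, hy, AlgEquiv.commutes, div_self]
    rw [← hy]; exact pow_ne_zero _ hy0
  have hη0 : η ≠ 0 := fun h => by rw [h, zero_pow hr0] at hηr; exact zero_ne_one hηr
  obtain ⟨ω, hω⟩ := IsAlgClosed.exists_pow_nat_eq η⁻¹ (n := q - 1) (by omega)
  have hωN : ω ^ ((q - 1) * r) = 1 := by rw [pow_mul, hω, inv_pow, hηr, inv_one]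
  have hN : ¬ p ∣ (q - 1) * r := by
    intro h
    rcases (Fact.out : p.Prime).dvd_mul.1 h with h | h
    · exact not_dvd_of_dvd_residueCard_sub_one (F := F) dvd_rfl h
    · exact hpr h
  have hN0 : (q - 1) * r ≠ 0 := fun h => hN (h ▸ dvd_zero p)
  have hnω := norm_eq_one_of_pow_eq_one hN0 hωN
  have hfix : MulAction.stabilizer (GaloisGroup F) (ω * y) = ⊤ := by
    refine eq_top_of_frobenius_mem hφ (Subgroup.isClosed_of_isOpen _
      (stabilizer_isOpen_of_isIntegral (K := F) _)) ?_ ?_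
    · change φ (ω * y) = ω * y
      have h1 : φ y = η * y := by rw [hη]; field_simp
      rw [map_mul, frobenius_apply_rootOfUnity hφ hN hωN, h1, ← hq]
      have : ω ^ q = ω * ω ^ (q - 1) := by rw [← pow_succ', Nat.sub_add_cancel hq1.le]
      rw [this, hω]; field_simp
    · intro g hg
      change g (ω * y) = ω * y
      rw [map_mul, inertia_apply_rootOfUnity hg hN hωN]
      congr 1
      exact hI hg
  obtain ⟨x, hx⟩ := (InfiniteGalois.mem_range_algebraMap_iff_fixed (k := F) (ω * y)).2
    (fun f => by
      have : f ∈ MulAction.stabilizer (GaloisGroup F) (ω * y) := hfix ▸ Subgroup.mem_top f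
      exact this)
  have hx0 : x ≠ 0 := by
    rintro rfl
    rw [map_zero] at hx
    have : ω ≠ 0 := norm_pos_iff.1 (hnω ▸ one_pos)
    exact (mul_ne_zero this hy0) hx.symm
  obtain ⟨k, hk⟩ := norm_eq_uniformizer_zpow F hϖ hx0
  have h1 : ‖(x : PadicAlgCl p)‖ = ‖y‖ := by
    have : (x : PadicAlgCl p) = ω * y := hx
    rw [this, norm_mul, hnω, one_mul]
  rw [← h1, hk, ← zpow_natCast, ← zpow_mul] at hny
  have h2 := zpow_right_injective₀ hϖ0 hϖ1.ne (hny.trans (zpow_one _).symm)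
  have h3 : (r : ℤ) ∣ 1 := ⟨k, by linarith⟩
  have h4 : r ∣ 1 := by exact_mod_cast h3
  exact hr1 (Nat.dvd_one.1 h4)

/-- The Kummer character of an `N`-th root of a uniformiser takes a tame generator to a primitive
`N`-th root of unity. -/
theorem orderOf_kummer {φ : GaloisGroup F} (hφ : IsFrobenius F φ) {σ : inertia F}
    (hσ : IsTameGenerator F σ) {N : ℕ} (hN0 : 0 < N)
    (hr : ∀ r : ℕ, r.Prime → r ∣ N → r ∣ residueCard F - 1)
    {ϖ : integers F} (hϖ : Irreducible ϖ) {y : PadicAlgCl p} (hy0 : y ≠ 0) (hN : ¬ p ∣ N)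
    (hy : y ^ N = algebraMap F (PadicAlgCl p) ϖ) : orderOf (kummer y hy0 N hN ϖ hy σ) = N := by
  refine orderOf_eq_of_pow_and_pow_div_prime hN0 (kummer_pow_eq_one _ _ _ _ _ _ _) ?_
  intro r hrp hrN h
  have hd : (y ^ (N / r)) ^ r = algebraMap F (PadicAlgCl p) ϖ := by
    rw [← pow_mul, Nat.div_mul_cancel hrN, hy]
  refine tameGenerator_apply_ne hφ hσ hrp.ne_one (hr r hrp hrN) hϖ hd ?_
  rw [map_pow, ← kummer_mul y hy0 N hN ϖ hy, mul_pow, ← Units.val_pow_eq_pow_val, h]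
  simp

theorem not_dvd_prime_pow {l : ℕ} [Fact l.Prime] (hl : l ∣ residueCard F - 1) (m : ℕ) :
    ¬ p ∣ l ^ m := fun h =>
  not_dvd_of_dvd_residueCard_sub_one hl ((Fact.out : p.Prime).dvd_of_dvd_pow h)

/-- The restriction of a homomorphism on inertia to `l`-power quotients is a quotient of `ℤ_l`: there
is a continuous homomorphism `I_F → ℤ_l` taking the tame generator to `1`. -/
theorem exists_tameLog {φ : GaloisGroup F} (hφ : IsFrobenius F φ) {σ : inertia F}
    (hσ : IsTameGenerator F σ) {l : ℕ} [Fact l.Prime] (hl : l ∣ residueCard F - 1) :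
    ∃ t : inertia F →* Multiplicative ℤ_[l], Continuous t ∧ t σ = Multiplicative.ofAdd 1 := by
  obtain ⟨ϖ, hϖ⟩ := IsDiscreteValuationRing.exists_irreducible (integers F)
  have hl0 (m) : 0 < l ^ m := pow_pos (Fact.out : l.Prime).pos m
  have hex (m) : ∃ y : PadicAlgCl p, y ^ l ^ m = algebraMap F (PadicAlgCl p) ϖ :=
    IsAlgClosed.exists_pow_nat_eq _ (hl0 m)
  choose y hy using hex
  have hy0 (m) := ne_zero_of_pow_eq_irreducible F hϖ (hl0 m) (hy m)
  set θ : ∀ m, inertia F →* (PadicAlgCl p)ˣ := fun m =>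
    kummer (y m) (hy0 m) (l ^ m) (not_dvd_prime_pow hl m) ϖ (hy m) with hθ
  have hord (m) : orderOf (θ m σ) = l ^ m :=
    orderOf_kummer hφ hσ (hl0 m) (fun r hr h =>
      ((Nat.prime_dvd_prime_iff_eq hr Fact.out).1 (hr.dvd_of_dvd_pow h)) ▸ hl) hϖ (hy0 m)
      (not_dvd_prime_pow hl m) (hy m)
  have hpair : ∀ m n (g : inertia F), ∃ k : ℤ, θ m g = θ m σ ^ k ∧ θ n g = θ n σ ^ k := by
    intro m n g
    obtain ⟨k, hk⟩ := hσ.exists_zpow ((θ m).prod (θ n)) (by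
        have : (((θ m).prod (θ n)).ker : Set (inertia F)) =
            ((θ m).ker : Set (inertia F)) ∩ ((θ n).ker : Set (inertia F)) := by
          ext x; simp [MonoidHom.mem_ker, Prod.ext_iff]
        rw [this]
        exact (isOpen_ker_kummer _ _ _ _ _ _).inter (isOpen_ker_kummer _ _ _ _ _ _))
      (fun g hg => Prod.ext (kummer_wild _ _ _ _ _ _ hg) (kummer_wild _ _ _ _ _ _ hg)) g
    exact ⟨k, congrArg Prod.fst hk, congrArg Prod.snd hk⟩
  have hz : ∀ m (k k' : ℤ), θ m σ ^ k = θ m σ ^ k' ↔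
      (k : ZMod (l ^ m)) = (k' : ZMod (l ^ m)) := fun m k k' => by
    rw [zpow_eq_zpow_iff_modEq, hord, ZMod.intCast_eq_intCast_iff]
  have hlim : ∀ g : inertia F, ∃ z : ℤ_[l], ∀ m, ∃ k : ℤ, θ m g = θ m σ ^ k ∧
      PadicInt.toZModPow m z = k := by
    intro g
    choose k hk using fun m => hpair m m g
    obtain ⟨z, hz'⟩ := IsPrecomplete.prec (I := IsLocalRing.maximalIdeal ℤ_[l]) (M := ℤ_[l])
      (f := fun m => (k m : ℤ_[l])) inferInstance (by
        intro m n hmn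
        obtain ⟨j, hj1, hj2⟩ := hpair m n g
        have e1 := (hz m (k m) j).1 ((hk m).1.symm.trans hj1)
        have e2 := (hz n (k n) j).1 ((hk n).1.symm.trans hj2)
        rw [SModEq.sub_mem, smul_eq_mul, Ideal.mul_top, PadicInt.maximalIdeal_eq_span_p,
          Ideal.span_singleton_pow, ← PadicInt.ker_toZModPow, RingHom.mem_ker, map_sub,
          map_intCast, map_intCast, e1, sub_eq_zero]
        have e3 := congrArg (ZMod.castHom (pow_dvd_pow l hmn) (ZMod (l ^ m))) e2
        rw [map_intCast, map_intCast] at e3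
        exact e3.symm)
    refine ⟨z, fun m => ⟨k m, (hk m).1, ?_⟩⟩
    have := hz' m
    rw [SModEq.sub_mem, smul_eq_mul, Ideal.mul_top, PadicInt.maximalIdeal_eq_span_p,
      Ideal.span_singleton_pow, ← PadicInt.ker_toZModPow, RingHom.mem_ker, map_sub,
      map_intCast, sub_eq_zero] at this
    exact this.symm
  choose t ht using hlim
  have huniq : ∀ g z, (∀ m, ∃ k : ℤ, θ m g = θ m σ ^ k ∧ PadicInt.toZModPow m z = k) →
      t g = z := fun g z h => by
    refine PadicInt.ext_of_toZModPow.1 fun m => ?_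
    obtain ⟨k, h1, h2⟩ := h m
    obtain ⟨k', h1', h2'⟩ := ht g m
    rw [h2, h2', ← hz, ← h1, ← h1']
  let T : inertia F →* Multiplicative ℤ_[l] :=
    { toFun := fun g => Multiplicative.ofAdd (t g)
      map_one' := by
        rw [huniq 1 0 fun m => ⟨0, by simp, by simp⟩]; rfl
      map_mul' := fun g h => by
        rw [huniq (g * h) (t g + t h) fun m => ?_]; · rfl
        obtain ⟨k, h1, h2⟩ := ht g m
        obtain ⟨k', h1', h2'⟩ := ht h m
        exact ⟨k + k', by rw [map_mul, h1, h1', zpow_add], by rw [map_add, h2, h2']; simp⟩ }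
  refine ⟨T, ?_, ?_⟩
  · refine continuous_of_continuousAt_one T ?_
    rw [ContinuousAt, map_one]
    change Filter.Tendsto t _ (nhds (0 : ℤ_[l]))
    rw [Metric.tendsto_nhds]
    intro ε hε
    obtain ⟨m, hm⟩ := PadicInt.exists_pow_neg_lt l hε
    filter_upwards [(isOpen_ker_kummer (y m) (hy0 m) (l ^ m) (not_dvd_prime_pow hl m) ϖ
      (hy m)).mem_nhds (one_mem _)] with g hg
    obtain ⟨k, h1, h2⟩ := ht g m
    have h3 : θ m σ ^ k = θ m σ ^ (0 : ℤ) := by rw [← h1, zpow_zero]; exact hg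
    rw [hz] at h3
    rw [h3, Int.cast_zero, ← RingHom.mem_ker, PadicInt.ker_toZModPow,
      ← PadicInt.norm_le_pow_iff_mem_span_pow] at h2
    rw [dist_zero_right]
    exact h2.trans_lt hm
  · change Multiplicative.ofAdd (t σ) = _
    rw [huniq σ 1 fun m => ⟨1, by simp, by simp⟩]

theorem tameLog_spec {φ : GaloisGroup F} (hφ : IsFrobenius F φ) {σ : inertia F}
    (hσ : IsTameGenerator F σ) {l : ℕ} [Fact l.Prime] (hl : l ∣ residueCard F - 1) :
    Continuous (tameLog l σ) ∧ tameLog l σ σ = Multiplicative.ofAdd 1 := by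
  have h := exists_tameLog hφ hσ hl
  rw [tameLog, dif_pos h]
  exact h.choose_spec

theorem tameLog_wild {φ : GaloisGroup F} (hφ : IsFrobenius F φ) {σ : inertia F}
    (hσ : IsTameGenerator F σ) {l : ℕ} [Fact l.Prime] (hl : l ∣ residueCard F - 1)
    {g : inertia F} (hg : (g : GaloisGroup F) ∈ wildInertia F) : tameLog l σ g = 1 := by
  have hc := (tameLog_spec hφ hσ hl).1
  have key : ∀ m : ℕ, (l : ℤ_[l]) ^ m ∣ (tameLog l σ g).toAdd := by
    intro m
    let V : Subgroup (inertia F) :=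
      (AddSubgroup.toSubgroup (Ideal.span {(l : ℤ_[l]) ^ m}).toAddSubgroup).comap (tameLog l σ)
    have hV : IsClosed (V : Set (inertia F)) := by
      have h1 : IsClosed {z : ℤ_[l] | z ∈ Ideal.span {(l : ℤ_[l]) ^ m}} := by
        simp_rw [← PadicInt.norm_le_pow_iff_mem_span_pow]
        exact isClosed_le continuous_norm continuous_const
      exact h1.preimage hc
    have := hσ.wild_mem hV hg (not_dvd_prime_pow hl m) (by
      change (tameLog l σ (g ^ l ^ m)).toAdd ∈ Ideal.span {(l : ℤ_[l]) ^ m}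
      rw [map_pow, toAdd_pow, Ideal.mem_span_singleton]
      exact ⟨(tameLog l σ g).toAdd, by simp⟩)
    exact Ideal.mem_span_singleton.1 this
  have h0 : (tameLog l σ g).toAdd = 0 := by
    refine PadicInt.ext_of_toZModPow.1 fun m => ?_
    rw [map_zero, ← RingHom.mem_ker, PadicInt.ker_toZModPow, Ideal.mem_span_singleton]
    exact key m
  exact h0

end TameInertia

section TameRepresentations

variable {p : ℕ} [Fact p.Prime] {F : IntermediateField ℚ_[p] (PadicAlgCl p)}
  [FiniteDimensional ℚ_[p] F]

/-- A homomorphism on `G_F` with open kernel is determined by its values on a Frobenius, a tame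
generator, and wild inertia. -/
theorem hom_ext_of_tame {φ : GaloisGroup F} (hφ : IsFrobenius F φ) {σ : inertia F}
    (hσ : IsTameGenerator F σ) {H : Type*} [Group H] {ρ ρ' : GaloisGroup F →* H}
    (h : IsOpen (ρ.ker : Set (GaloisGroup F))) (h' : IsOpen (ρ'.ker : Set (GaloisGroup F)))
    (e1 : ρ φ = ρ' φ) (e2 : ρ σ = ρ' σ) (e3 : ∀ g ∈ wildInertia F, ρ g = ρ' g) : ρ = ρ' := by
  have hle : ρ.ker ⊓ ρ'.ker ≤ ρ.eqLocus ρ' := fun g hg => by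
    change ρ g = ρ' g
    rw [MonoidHom.mem_ker.1 hg.1, MonoidHom.mem_ker.1 hg.2]
  have ho : IsOpen (ρ.eqLocus ρ' : Set (GaloisGroup F)) :=
    Subgroup.isOpen_mono hle (h.inter h')
  have hc := Subgroup.isClosed_of_isOpen _ ho
  have ht := eq_top_of_frobenius_mem hφ hc e1 (hσ.inertia_le hc e2 e3)
  ext g
  have : g ∈ ρ.eqLocus ρ' := ht ▸ Subgroup.mem_top g
  exact this

theorem semiconj_pow_pow {H : Type*} [Group H] {Φ T : H} {q : ℕ} (h : Φ * T = T ^ q * Φ)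
    (j b : ℕ) : Φ ^ j * T ^ b = T ^ (q ^ j * b) * Φ ^ j := by
  have h1 (b) : Φ * T ^ b = T ^ (q * b) * Φ := by
    have : SemiconjBy Φ T (T ^ q) := h
    rw [pow_mul]; exact this.pow_right b
  induction j generalizing b with
  | zero => simp
  | succ j ih => rw [pow_succ, mul_assoc, h1, ← mul_assoc, ih, mul_assoc, pow_succ q, mul_assoc]

theorem modEq_of_pow_modEq {q M i j : ℕ} (hq : 2 < q) (hM : 0 < M)
    (h : q ^ i ≡ q ^ j [MOD q ^ M - 1]) : i ≡ j [MOD M] := by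
  have hM1 : 1 ≤ q ^ M := Nat.one_le_pow _ _ (by omega)
  have h1 : q ^ M ≡ 1 [MOD q ^ M - 1] := by
    have := (Nat.modEq_iff_dvd' (n := q ^ M - 1) hM1).2 dvd_rfl
    exact this.symm
  have hred (k) : q ^ k ≡ q ^ (k % M) [MOD q ^ M - 1] := by
    conv_lhs => rw [← Nat.div_add_mod k M, pow_add, pow_mul]
    simpa using (h1.pow (k / M)).mul_right (q ^ (k % M))
  have hlt (k) : q ^ (k % M) < q ^ M - 1 := by
    have h2 : q ^ (k % M) ≤ q ^ (M - 1) :=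
      Nat.pow_le_pow_right (by omega) (Nat.le_sub_one_of_lt (Nat.mod_lt _ hM))
    have h3 : q ^ M = q ^ (M - 1) * q := by rw [← pow_succ, Nat.sub_add_cancel hM]
    have h4 : 1 ≤ q ^ (M - 1) := Nat.one_le_pow _ _ (by omega)
    have : q ^ (M - 1) * 3 ≤ q ^ M := by rw [h3]; exact Nat.mul_le_mul_left _ hq
    omega
  have h5 := ((hred i).symm.trans h).trans (hred j)
  have h6 := Nat.ModEq.eq_of_lt_of_lt h5 (hlt i) (hlt j)
  exact Nat.pow_right_injective (by omega : 2 ≤ q) h6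

/-- Tame representations exist: elements `Φ`, `T` of a finite group, with `Φ T Φ⁻¹ = T ^ q` and `T`
of `l`-power order, are the images of a Frobenius and of a tame generator under a continuous
homomorphism that is trivial on wild inertia. It is `g ↦ T ^ b(g) Φ' ^ j(g)`, with `b` the Kummer
cocycle of an `l`-power root of a uniformiser and `j` the unramified coordinate. -/
theorem exists_tame_hom {φ : GaloisGroup F} (hφ : IsFrobenius F φ) {σ : inertia F}
    (hσ : IsTameGenerator F σ) {l : ℕ} [Fact l.Prime] (hl : l ∣ residueCard F - 1)
    {H : Type*} [Group H] [Finite H] (Φ T : H) {m : ℕ} (hT : T ^ l ^ m = 1)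
    (hrel : Φ * T = T ^ residueCard F * Φ) :
    ∃ ρ : GaloisGroup F →* H, IsOpen (ρ.ker : Set (GaloisGroup F)) ∧ ρ φ = Φ ∧ ρ σ = T ∧
      ∀ g ∈ wildInertia F, ρ g = 1 := by
  obtain ⟨ϖ, hϖ⟩ := IsDiscreteValuationRing.exists_irreducible (integers F)
  set N := l ^ m with hNdef
  have hl1 : 1 < l := (Fact.out : l.Prime).one_lt
  have hN0 : 0 < N := pow_pos (by omega) m
  have hpN : ¬ p ∣ N := not_dvd_prime_pow hl m
  have hq1 : 1 < residueCard F := one_lt_residueCard F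
  have hq2 : 2 < residueCard F := by
    have := Nat.le_of_dvd (by omega) hl
    rcases this.lt_or_eq with h | h
    · omega
    · by_contra hlt
      have : residueCard F - 1 = 1 := by omega
      omega
  obtain ⟨y, hy⟩ := IsAlgClosed.exists_pow_nat_eq (algebraMap F (PadicAlgCl p) ϖ) hN0
  have hy0 := ne_zero_of_pow_eq_irreducible F hϖ hN0 hy
  have hord := orderOf_kummer hφ hσ hN0 (fun r hr h =>
      ((Nat.prime_dvd_prime_iff_eq hr Fact.out).1 (hr.dvd_of_dvd_pow h)) ▸ hl) hϖ hy0 hpN hy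
  set ξ : (PadicAlgCl p)ˣ := kummer y hy0 N hpN ϖ hy σ with hξ
  have hξp : IsPrimitiveRoot (ξ : PadicAlgCl p) N := by
    rw [IsPrimitiveRoot.coe_units_iff, ← hord]; exact IsPrimitiveRoot.orderOf ξ
  have : NeZero N := ⟨hN0.ne'⟩
  -- the Kummer cocycle
  have hb (g : GaloisGroup F) : ∃ b : ℕ, g y = (ξ : PadicAlgCl p) ^ b * y := by
    have h1 : (g y / y) ^ N = 1 := by
      rw [div_pow, ← map_pow, hy, AlgEquiv.commutes, div_self]
      rw [← hy]; exact pow_ne_zero _ hy0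
    obtain ⟨i, -, hi⟩ := hξp.eq_pow_of_pow_eq_one h1
    exact ⟨i, by rw [hi]; field_simp⟩
  choose b hb using hb
  have hbmod : ∀ i j : ℕ, (ξ : PadicAlgCl p) ^ i * y = (ξ : PadicAlgCl p) ^ j * y →
      i ≡ j [MOD N] := fun i j h => by
    have := mul_right_cancel₀ hy0 h
    rw [← hord, ← pow_eq_pow_iff_modEq]
    ext; push_cast; exact this
  have hσy : (σ : GaloisGroup F) y = (ξ : PadicAlgCl p) ^ 1 * y := by
    rw [pow_one, hξ, kummer_mul]
  have hTmod : ∀ {i j : ℕ}, i ≡ j [MOD N] → T ^ i = T ^ j := fun {i j} h =>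
    pow_eq_pow_iff_modEq.2 (h.of_dvd (orderOf_dvd_of_pow_eq_one hT))
  -- the twisted Frobenius
  set Φ' : H := (T ^ b φ)⁻¹ * Φ with hΦ'
  have hrel' : Φ' * T = T ^ residueCard F * Φ' := by
    rw [hΦ', mul_assoc, hrel, ← mul_assoc, ← mul_assoc]
    congr 1
    exact (Commute.pow_pow (Commute.refl T) (b φ) (residueCard F)).inv_left
  -- the unramified coordinate
  have hcop : Nat.Coprime (residueCard F) N := by
    refine Nat.Coprime.pow_right m ?_
    obtain ⟨f, hf, h⟩ := residueCard_eq_pow F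
    rw [h]
    refine Nat.Coprime.pow_left f ?_
    exact (Nat.coprime_primes Fact.out Fact.out).2 fun h =>
      not_dvd_of_dvd_residueCard_sub_one hl (h ▸ dvd_rfl)
  set M := orderOf Φ' * N.totient with hM
  have hM0 : 0 < M := Nat.mul_pos (orderOf_pos Φ') (Nat.totient_pos.2 hN0)
  have hNM : N ∣ residueCard F ^ M - 1 := by
    have h1 : residueCard F ^ M ≡ 1 [MOD N] := by
      rw [hM, mul_comm, pow_mul]
      simpa using (Nat.ModEq.pow_totient hcop).pow (orderOf Φ')
    exact (Nat.modEq_iff_dvd' (Nat.one_le_pow _ _ (by omega))).1 h1.symm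
  have hΦM : Φ' ^ M = 1 := by rw [hM, pow_mul, pow_orderOf_eq_one, one_pow]
  have hQ0 : residueCard F ^ M - 1 ≠ 0 := by
    have := Nat.one_lt_pow hM0.ne' hq1
    omega
  have : NeZero (residueCard F ^ M - 1) := ⟨hQ0⟩
  have hpQ := not_dvd_residueCard_pow_sub_one (F := F) hM0.ne'
  obtain ⟨ζ, hζ⟩ := HasEnoughRootsOfUnity.exists_primitiveRoot (PadicAlgCl p)
    (residueCard F ^ M - 1)
  choose j hj using fun g : GaloisGroup F =>
    exists_apply_eq_pow_pow hφ hM0.ne' hζ.pow_eq_one g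
  have hjmod : ∀ i k : ℕ, ζ ^ residueCard F ^ i = ζ ^ residueCard F ^ k → i ≡ k [MOD M] :=
    fun i k h => modEq_of_pow_modEq hq2 hM0 (by
      rw [hζ.eq_orderOf, ← IsOfFinOrder.pow_eq_pow_iff_modEq (isOfFinOrder_iff_pow_eq_one.2
        ⟨_, Nat.pos_of_ne_zero hQ0, hζ.pow_eq_one⟩)]
      exact h)
  have hΦmod : ∀ {i k : ℕ}, i ≡ k [MOD M] → Φ' ^ i = Φ' ^ k := fun {i k} h =>
    pow_eq_pow_iff_modEq.2 (h.of_dvd (orderOf_dvd_of_pow_eq_one hΦM))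
  have hξg (g : GaloisGroup F) : g (ξ : PadicAlgCl p) = (ξ : PadicAlgCl p) ^
      residueCard F ^ j g := by
    obtain ⟨c, hc⟩ := hNM
    obtain ⟨i, -, hi⟩ := hζ.eq_pow_of_pow_eq_one (ξ := (ξ : PadicAlgCl p)) (by
      rw [hc, pow_mul, hξp.pow_eq_one, one_pow])
    rw [← hi, map_pow, hj, ← pow_mul, ← pow_mul, mul_comm]
  have hone : ∀ g : GaloisGroup F, g y = y → g ζ = ζ → T ^ b g * Φ' ^ j g = 1 := by
    intro g h1 h2
    have e1 := hbmod (b g) 0 (by rw [← hb, h1]; simp)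
    have e2 := hjmod (j g) 0 (by rw [← hj, h2]; simp)
    rw [hTmod e1, hΦmod e2]; simp
  let ρ : GaloisGroup F →* H :=
    { toFun := fun g => T ^ b g * Φ' ^ j g
      map_one' := hone 1 rfl rfl
      map_mul' := fun g h => by
        have e1 : b (g * h) ≡ b g + residueCard F ^ j g * b h [MOD N] := by
          refine hbmod _ _ ?_
          rw [← hb, AlgEquiv.mul_apply, hb h, map_mul, map_pow, hξg, hb g, pow_add, pow_mul]
          ring
        have e2 : j (g * h) ≡ j g + j h [MOD M] := by
          refine hjmod _ _ ?_
          rw [← hj, AlgEquiv.mul_apply, hj h, map_pow, hj g, pow_add, pow_mul]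
        rw [hTmod e1, hΦmod e2, mul_assoc, ← mul_assoc (Φ' ^ j g), semiconj_pow_pow hrel',
          pow_add, pow_add]
        simp only [mul_assoc] }
  refine ⟨ρ, ?_, ?_, ?_, ?_⟩
  · have ho : IsOpen ((MulAction.stabilizer (GaloisGroup F) y ⊓
        MulAction.stabilizer (GaloisGroup F) ζ : Subgroup (GaloisGroup F)) :
        Set (GaloisGroup F)) :=
      (stabilizer_isOpen_of_isIntegral (K := F) y).inter
        (stabilizer_isOpen_of_isIntegral (K := F) ζ)
    refine Subgroup.isOpen_mono ?_ ho
    intro g hg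
    exact hone g hg.1 hg.2
  · change T ^ b φ * Φ' ^ j φ = Φ
    have e2 := hjmod (j φ) 1 (by
      rw [← hj, frobenius_apply_rootOfUnity hφ hpQ hζ.pow_eq_one, pow_one])
    rw [hΦmod e2, pow_one, hΦ', mul_inv_cancel_left]
  · change T ^ b σ * Φ' ^ j σ = T
    have e1 := hbmod (b σ) 1 (by rw [← hb, hσy])
    have e2 := hjmod (j σ) 0 (by
      rw [← hj, inertia_apply_rootOfUnity σ.2 hpQ hζ.pow_eq_one]; simp)
    rw [hTmod e1, hΦmod e2]; simp
  · intro g hg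
    exact hone g (wildInertia_apply_of_pow_mem hg hpN hy)
      (inertia_apply_rootOfUnity (wildInertia_le_inertia hg) hpQ hζ.pow_eq_one)

end TameRepresentations

/-! ### Power series over a complete local ring -/

section PowerSeries

open MvPowerSeries IsLocalRing

variable {ι : Type} {S : Type} [CommRing S]

/-- A power series without terms of degree less than `k` is in the `k`-th power of the ideal
generated by the variables. -/
theorem mem_span_X_pow [Finite ι] (k : ℕ) {f : MvPowerSeries ι S}
    (hf : ∀ e, e.degree < k → coeff e f = 0) :
    f ∈ Ideal.span (Set.range (X : ι → MvPowerSeries ι S)) ^ k := by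
  classical
  have := Fintype.ofFinite ι
  induction k generalizing f with
  | zero => simp
  | succ k ih =>
    have h0 : coeff 0 f = 0 := hf 0 (by simp)
    -- distribute each monomial to one of its variables
    have hi : ∀ e : ι →₀ ℕ, e ≠ 0 → ∃ i, e i ≠ 0 := fun e he => by
      by_contra! h
      exact he (Finsupp.ext h)
    let v : ∀ e : ι →₀ ℕ, ι → Prop := fun e i => ∃ h : e ≠ 0, (hi e h).choose = i
    let g : ι → MvPowerSeries ι S := fun i e =>
      if v (e + Finsupp.single i 1) i then coeff (e + Finsupp.single i 1) f else 0
    have hg : ∀ i e, coeff e (g i) =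
      if v (e + Finsupp.single i 1) i then coeff (e + Finsupp.single i 1) f else 0 :=
      fun _ _ => rfl
    have hfg : f = ∑ i, X i * g i := by
      ext e
      rw [map_sum]
      have hterm (i) : coeff e (X i * g i) = if v e i then coeff e f else 0 := by
        rw [X, coeff_monomial_mul, one_mul]
        by_cases hle : Finsupp.single i 1 ≤ e
        · rw [if_pos hle, hg, tsub_add_cancel_of_le hle]
        · rw [if_neg hle, if_neg]
          rintro ⟨h, hc⟩
          have h1 := (hi e h).choose_spec
          rw [hc] at h1
          exact hle (Finsupp.single_le_iff.2 (Nat.one_le_iff_ne_zero.2 h1))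
      simp_rw [hterm]
      by_cases he : e = 0
      · subst he
        rw [h0]; simp
      · rw [Finset.sum_eq_single (hi e he).choose]
        · rw [if_pos ⟨he, rfl⟩]
        · rintro i - hne
          rw [if_neg]
          rintro ⟨_, h⟩
          exact hne h.symm
        · simp
    rw [hfg, pow_succ']
    refine Ideal.sum_mem _ fun i _ => Ideal.mul_mem_mul (Ideal.subset_span ⟨i, rfl⟩) (ih ?_)
    intro e he
    rw [hg]
    split_ifs
    · exact hf _ (by rw [map_add, Finsupp.degree_single]; omega)
    · rfl

theorem finite_degree_lt [Finite ι] (k : ℕ) : {e : ι →₀ ℕ | e.degree < k}.Finite := by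
  have := Fintype.ofFinite ι
  classical
  refine (Set.finite_Icc 0 (Finsupp.equivFunOnFinite.symm fun _ : ι => k)).subset ?_
  refine fun e he => ⟨zero_le, fun i => ?_⟩
  exact (Finsupp.le_degree i e).trans (le_of_lt he)

theorem monomial_eq_C_mul (e : ι →₀ ℕ) (s : S) :
    (monomial e s : MvPowerSeries ι S) = C s * e.prod fun i n => X i ^ n := by
  have h := congrArg (fun f : MvPolynomial ι S => (f : MvPowerSeries ι S))
    (MvPolynomial.monomial_eq (s := e) (a := s))
  simp only [MvPolynomial.coe_monomial, MvPolynomial.coe_mul, MvPolynomial.coe_C] at h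
  rw [h]
  congr 1
  rw [Finsupp.prod, Finsupp.prod, ← MvPolynomial.coeToMvPowerSeries.ringHom_apply, map_prod]
  simp

/-- A power series is the sum of its terms of degree less than `k` modulo the `k`-th power of the
ideal generated by the variables. -/
theorem sub_sum_mem_span_X_pow [Finite ι] (k : ℕ) (f : MvPowerSeries ι S) :
    f - ∑ e ∈ (finite_degree_lt k).toFinset, monomial e (coeff e f) ∈
      Ideal.span (Set.range (X : ι → MvPowerSeries ι S)) ^ k := by
  classical
  refine mem_span_X_pow k fun e he => ?_
  rw [map_sub, map_sum]
  simp_rw [coeff_monomial]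
  rw [Finset.sum_ite_eq, if_pos (by simpa using he), sub_self]

theorem mem_map_C_iff [IsNoetherianRing S] (J : Ideal S) {f : MvPowerSeries ι S} :
    f ∈ J.map (C : S →+* MvPowerSeries ι S) ↔ ∀ e, coeff e f ∈ J := by
  classical
  constructor
  · intro hf e
    induction hf using Submodule.span_induction generalizing e with
    | mem x hx =>
      obtain ⟨a, ha, rfl⟩ := hx
      rw [coeff_C]; split_ifs
      · exact ha
      · exact J.zero_mem
    | zero => simp
    | add x y _ _ hx hy => rw [map_add]; exact J.add_mem (hx e) (hy e)
    | smul a x _ hx =>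
      rw [smul_eq_mul, coeff_mul]
      exact J.sum_mem fun p _ => J.mul_mem_left _ (hx _)
  · intro hf
    obtain ⟨s, hs⟩ := (inferInstance : IsNoetherianRing S).noetherian J
    have h1 (e) : ∃ c : S → S, ∑ a ∈ s, c a • a = coeff e f := by
      have := hf e
      rw [← hs, Submodule.mem_span_finset] at this
      obtain ⟨c, -, hc⟩ := this
      exact ⟨c, hc⟩
    choose c hc using h1
    let g : S → MvPowerSeries ι S := fun a e => c e a
    have : f = ∑ a ∈ s, (C a : MvPowerSeries ι S) * g a := by
      ext e
      rw [map_sum, ← hc e]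
      refine Finset.sum_congr rfl fun a _ => ?_
      rw [coeff_C_mul, smul_eq_mul, mul_comm]; rfl
    rw [this]
    refine Ideal.sum_mem _ fun a ha => Ideal.mul_mem_right _ _ (Ideal.mem_map_of_mem _ ?_)
    rw [← hs]; exact Submodule.subset_span ha

/-- Colon ideals commute with the extension of ideals to power series. -/
theorem mem_map_C_colon [IsNoetherianRing S] (J : Ideal S) (s : S) {f : MvPowerSeries ι S}
    (h : C s * f ∈ J.map (C : S →+* MvPowerSeries ι S)) :
    f ∈ (J.colon {s}).map (C : S →+* MvPowerSeries ι S) := by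
  rw [mem_map_C_iff] at h ⊢
  intro e
  have := h e
  rw [coeff_C_mul] at this
  rw [Submodule.mem_colon_singleton, smul_eq_mul, mul_comm]
  exact this

theorem isPrime_map_C [IsNoetherianRing S] (J : Ideal S) [J.IsPrime] :
    (J.map (C : S →+* MvPowerSeries ι S)).IsPrime := by
  have : J.map (C : S →+* MvPowerSeries ι S) =
      RingHom.ker (MvPowerSeries.map (σ := ι) (Ideal.Quotient.mk J)) := by
    ext f
    rw [mem_map_C_iff, RingHom.mem_ker, MvPowerSeries.ext_iff]
    simp [Ideal.Quotient.eq_zero_iff_mem]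
  rw [this]
  have : IsDomain (MvPowerSeries ι (S ⧸ J)) := NoZeroDivisors.to_isDomain _
  exact RingHom.ker_isPrime _

section Hom

variable {A : Type} [CommRing A]

theorem powerSeries_hom_ext [Finite ι] {I : Ideal A} {k : ℕ} (hI : I ^ k = ⊥)
    {f g : MvPowerSeries ι S →+* A} (hC : ∀ s, f (C s) = g (C s)) (hX : ∀ i, f (X i) = g (X i))
    (hfX : ∀ i, f (X i) ∈ I) : f = g := by
  classical
  have := Fintype.ofFinite ι
  have hmon (e) (s) : f (monomial e s) = g (monomial e s) := by
    rw [monomial_eq_C_mul, map_mul, map_mul, hC]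
    congr 1
    simp only [Finsupp.prod, map_prod, map_pow, hX]
  have hker : ∀ h : MvPowerSeries ι S →+* A, (∀ i, h (X i) ∈ I) →
      ∀ x ∈ Ideal.span (Set.range (X : ι → MvPowerSeries ι S)) ^ k, h x = 0 := by
    intro h hh x hx
    have h1 : Ideal.span (Set.range (X : ι → MvPowerSeries ι S)) ≤ I.comap h := by
      rw [Ideal.span_le]; rintro _ ⟨i, rfl⟩; exact hh i
    have h2 : h x ∈ I ^ k := by
      have := Ideal.mem_map_of_mem h (Ideal.pow_right_mono h1 k hx)
      rw [Ideal.map_pow] at this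
      exact Ideal.pow_right_mono Ideal.map_comap_le k this
    rwa [hI, Ideal.mem_bot] at h2
  ext x
  have hx := sub_sum_mem_span_X_pow k x
  have e1 := hker f hfX _ hx
  have e2 := hker g (fun i => hX i ▸ hfX i) _ hx
  rw [map_sub, map_sum, sub_eq_zero] at e1 e2
  rw [e1, e2]
  exact Finset.sum_congr rfl fun e _ => hmon _ _

theorem exists_powerSeries_hom_of_nilpotent [Finite ι] (ψ : S →+* A) {a : ι → A}
    (ha : ∀ i, IsNilpotent (a i)) : ∃ f : MvPowerSeries ι S →+* A,
      (∀ s, f (C s) = ψ s) ∧ ∀ i, f (X i) = a i := by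
  let _ : UniformSpace S := ⊥
  let _ : UniformSpace A := ⊥
  have : DiscreteUniformity S := ⟨rfl⟩
  have : DiscreteUniformity A := ⟨rfl⟩
  have hcont : Continuous ψ := continuous_of_discreteTopology
  have heval : HasEval a :=
    { hpow := fun i => by
        obtain ⟨n, hn⟩ := ha i
        refine tendsto_atTop_of_eventually_const (i₀ := n) fun m hm => ?_
        rw [← Nat.sub_add_cancel hm, pow_add, hn, mul_zero]
      tendsto_zero := by simp }
  refine ⟨eval₂Hom hcont heval, fun s => ?_, fun i => ?_⟩
  · rw [coe_eval₂Hom, eval₂_C]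
  · rw [coe_eval₂Hom, eval₂_X]

theorem exists_powerSeries_hom [Finite ι] (I : Ideal A) [IsAdicComplete I A] (ψ : S →+* A)
    {a : ι → A}
    (ha : ∀ i, a i ∈ I) : ∃ f : MvPowerSeries ι S →+* A,
      (∀ s, f (C s) = ψ s) ∧ ∀ i, f (X i) = a i := by
  have hnil (k) (i) : IsNilpotent (Ideal.Quotient.mk (I ^ k) (a i)) := by
    refine ⟨k, ?_⟩
    rw [← map_pow, Ideal.Quotient.eq_zero_iff_mem]
    exact Ideal.pow_mem_pow (ha i) k
  choose f hfC hfX using fun k => exists_powerSeries_hom_of_nilpotent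
    ((Ideal.Quotient.mk (I ^ k)).comp ψ) (hnil k)
  have hcompat : ∀ {m n : ℕ} (hle : m ≤ n),
      (Ideal.Quotient.factorPow I hle).comp (f n) = f m := by
    intro m n hle
    refine powerSeries_hom_ext (I := I.map (Ideal.Quotient.mk (I ^ m))) (k := m) ?_ ?_ ?_ ?_
    · rw [← Ideal.map_pow, Ideal.map_quotient_self]
    · intro s
      rw [RingHom.comp_apply, hfC, hfC]; rfl
    · intro i
      rw [RingHom.comp_apply, hfX, hfX]; rfl
    · intro i
      rw [RingHom.comp_apply, hfX]
      exact Ideal.mem_map_of_mem _ (ha i)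
  refine ⟨IsAdicComplete.liftRingHom I f hcompat, fun s => ?_, fun i => ?_⟩
  · refine (IsHausdorff.eq_iff_smodEq (I := I)).2 fun n => ?_
    rw [SModEq.sub_mem, smul_eq_mul, Ideal.mul_top, ← Ideal.Quotient.eq,
      IsAdicComplete.mk_liftRingHom, hfC]; rfl
  · refine (IsHausdorff.eq_iff_smodEq (I := I)).2 fun n => ?_
    rw [SModEq.sub_mem, smul_eq_mul, Ideal.mul_top, ← Ideal.Quotient.eq,
      IsAdicComplete.mk_liftRingHom, hfX]

end Hom

section Local

variable [IsLocalRing S]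

theorem mem_maximalIdeal_powerSeries {f : MvPowerSeries ι S} :
    f ∈ maximalIdeal (MvPowerSeries ι S) ↔ constantCoeff f ∈ maximalIdeal S := by
  rw [mem_maximalIdeal, mem_maximalIdeal, mem_nonunits_iff, mem_nonunits_iff,
    isUnit_iff_constantCoeff]

theorem mem_maximalIdeal_pow_powerSeries [Finite ι] [IsNoetherianRing S] (k : ℕ)
    {f : MvPowerSeries ι S} : f ∈ maximalIdeal (MvPowerSeries ι S) ^ k ↔
      ∀ e, coeff e f ∈ maximalIdeal S ^ (k - e.degree) := by
  classical
  have := Fintype.ofFinite ι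
  constructor
  · intro hf
    induction k generalizing f with
    | zero => simp
    | succ k ih =>
      rw [pow_succ'] at hf
      induction hf using Submodule.mul_induction_on' with
      | mem_mul_mem a ha b hb =>
        intro e
        rw [coeff_mul]
        refine Ideal.sum_mem _ fun p hp => ?_
        have hp' := Finset.HasAntidiagonal.mem_antidiagonal.1 hp
        have hb' := ih hb p.2
        have hdeg : e.degree = p.1.degree + p.2.degree := by rw [← hp', map_add]
        by_cases h0 : p.1 = 0
        · rw [h0]
          have ha' := mem_maximalIdeal_powerSeries.1 ha
          rw [← coeff_zero_eq_constantCoeff_apply] at ha'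
          have := Ideal.mul_mem_mul ha' hb'
          rw [← pow_succ'] at this
          refine Ideal.pow_le_pow_right ?_ this
          rw [h0] at hdeg; simp at hdeg; omega
        · refine Ideal.mul_mem_left _ _ (Ideal.pow_le_pow_right ?_ hb')
          have : p.1.degree ≠ 0 := by rwa [Ne, Finsupp.degree_eq_zero_iff]
          omega
      | add x _ y _ hx hy => intro e; rw [map_add]; exact Ideal.add_mem _ (hx e) (hy e)
  · intro hf
    have h1 := sub_sum_mem_span_X_pow k f
    have hX : Ideal.span (Set.range (X : ι → MvPowerSeries ι S)) ≤
        maximalIdeal (MvPowerSeries ι S) := by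
      rw [Ideal.span_le]; rintro _ ⟨i, rfl⟩
      rw [SetLike.mem_coe, mem_maximalIdeal_powerSeries]; simp
    have h2 := Ideal.pow_right_mono hX k h1
    have hC : (maximalIdeal S).map (C : S →+* MvPowerSeries ι S) ≤
        maximalIdeal (MvPowerSeries ι S) := by
      rw [Ideal.map_le_iff_le_comap]
      intro s hs
      rw [Ideal.mem_comap, mem_maximalIdeal_powerSeries]; simpa using hs
    rw [← sub_add_cancel f (∑ e ∈ (finite_degree_lt k).toFinset, monomial e (coeff e f))]
    refine Ideal.add_mem _ h2 (Ideal.sum_mem _ fun e he => ?_)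
    have he' : e.degree < k := by simpa using he
    rw [monomial_eq_C_mul]
    have h3 : (C (coeff e f) : MvPowerSeries ι S) ∈
        maximalIdeal (MvPowerSeries ι S) ^ (k - e.degree) := by
      have := Ideal.mem_map_of_mem (C : S →+* MvPowerSeries ι S) (hf e)
      rw [Ideal.map_pow] at this
      exact Ideal.pow_right_mono hC _ this
    have h4 : (e.prod fun i n => (X i : MvPowerSeries ι S) ^ n) ∈
        maximalIdeal (MvPowerSeries ι S) ^ e.degree := by
      rw [Finsupp.prod, Finsupp.degree_apply, ← Finset.prod_pow_eq_pow_sum]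
      exact Ideal.prod_mem_prod fun i _ => Ideal.pow_mem_pow
        (hX (Ideal.subset_span ⟨i, rfl⟩)) _
    have := Ideal.mul_mem_mul h3 h4
    rwa [← pow_add, Nat.sub_add_cancel he'.le] at this

theorem isAdicComplete_powerSeries [Finite ι] [IsNoetherianRing S]
    [IsAdicComplete (maximalIdeal S) S] :
    IsAdicComplete (maximalIdeal (MvPowerSeries ι S)) (MvPowerSeries ι S) where
  haus' := (inferInstance : IsHausdorff (maximalIdeal (MvPowerSeries ι S))
    (MvPowerSeries ι S)).haus'
  prec' := by
    intro f hf
    have hf' : ∀ e {m n : ℕ}, m ≤ n → coeff e (f m) - coeff e (f n) ∈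
        maximalIdeal S ^ (m - e.degree) := fun e m n h => by
      have := hf h
      rw [SModEq.sub_mem, smul_eq_mul, Ideal.mul_top, mem_maximalIdeal_pow_powerSeries] at this
      simpa using this e
    have hlim (e : ι →₀ ℕ) : ∃ c : S, ∀ n,
        coeff e (f (n + e.degree)) - c ∈ maximalIdeal S ^ n := by
      obtain ⟨c, hc⟩ := IsPrecomplete.prec (I := maximalIdeal S) (M := S)
        (f := fun n => coeff e (f (n + e.degree))) inferInstance (by
          intro m n h
          rw [SModEq.sub_mem, smul_eq_mul, Ideal.mul_top]
          have := hf' e (Nat.add_le_add_right h e.degree)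
          rwa [Nat.add_sub_cancel] at this)
      refine ⟨c, fun n => ?_⟩
      have := hc n
      rwa [SModEq.sub_mem, smul_eq_mul, Ideal.mul_top] at this
    choose c hc using hlim
    let g : MvPowerSeries ι S := c
    refine ⟨g, fun n => ?_⟩
    rw [SModEq.sub_mem, smul_eq_mul, Ideal.mul_top, mem_maximalIdeal_pow_powerSeries]
    intro e
    rw [map_sub]
    change coeff e (f n) - c e ∈ _
    rcases le_total n e.degree with h | h
    · rw [Nat.sub_eq_zero_of_le h]; simp
    · have := hc e (n - e.degree)
      rwa [Nat.sub_add_cancel h] at this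

end Local

/-- A nonzero power series over a complete discrete valuation ring does not vanish at some point with
coordinates in the maximal ideal: if its part of lowest degree `d` does not vanish at `u`, the value
at `ϖ ^ m u` is not divisible by `ϖ ^ (m (d + 1))` for large `m`. -/
theorem exists_powerSeries_hom_ne_zero [Finite ι] {O : Type} [CommRing O] [IsDomain O]
    [IsDiscreteValuationRing O] [IsAdicComplete (maximalIdeal O) O] (ψ : S →+* O)
    {f : MvPowerSeries ι S} (hf : MvPowerSeries.map ψ f ≠ 0) :
    ∃ x : MvPowerSeries ι S →+* O, (∀ s, x (C s) = ψ s) ∧ x f ≠ 0 := by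
  classical
  have := Fintype.ofFinite ι
  obtain ⟨ϖ, hϖ⟩ := IsDiscreteValuationRing.exists_irreducible O
  have hϖm : ϖ ∈ maximalIdeal O := hϖ.not_isUnit
  have hex : ∃ d, ∃ e : ι →₀ ℕ, e.degree = d ∧ ψ (coeff e f) ≠ 0 := by
    by_contra! h
    refine hf (MvPowerSeries.ext fun e => ?_)
    rw [coeff_map, map_zero]
    exact h _ e rfl
  set d := Nat.find hex with hd
  have hlow : ∀ e : ι →₀ ℕ, e.degree < d → ψ (coeff e f) = 0 := fun e he => by
    by_contra h
    exact Nat.find_min hex he ⟨e, rfl, h⟩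
  obtain ⟨e0, he0, hne⟩ := Nat.find_spec hex
  let T := (finite_degree_lt (ι := ι) (d + 1)).toFinset
  let P : MvPolynomial ι O := ∑ e ∈ T, MvPolynomial.monomial e (ψ (coeff e f))
  have hP : P ≠ 0 := by
    intro h
    have := congrArg (MvPolynomial.coeff e0) h
    rw [MvPolynomial.coeff_sum] at this
    simp_rw [MvPolynomial.coeff_monomial] at this
    have hT : e0 ∈ T := (Set.Finite.mem_toFinset _).2 (Nat.lt_succ_of_le he0.le)
    rw [Finset.sum_ite_eq', if_pos hT] at this
    exact hne this
  have : Infinite O := by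
    refine Infinite.of_injective (fun n : ℕ => ϖ ^ n) ?_
    intro a b h
    rcases lt_trichotomy a b with h1 | h1 | h1
    · exact absurd h (fun h : ϖ ^ a = ϖ ^ b => by
        have := (pow_dvd_pow_iff hϖ.ne_zero hϖ.not_isUnit).1 (h ▸ dvd_rfl : ϖ ^ b ∣ ϖ ^ a); omega)
    · exact h1
    · exact absurd h (fun h : ϖ ^ a = ϖ ^ b => by
        have := (pow_dvd_pow_iff hϖ.ne_zero hϖ.not_isUnit).1 (h ▸ dvd_rfl : ϖ ^ a ∣ ϖ ^ b); omega)
  obtain ⟨u, hu⟩ : ∃ u : ι → O, MvPolynomial.eval u P ≠ 0 := by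
    by_contra! h
    exact hP (MvPolynomial.funext (by simpa using h))
  obtain ⟨v, w, hw⟩ := IsDiscreteValuationRing.eq_unit_mul_pow_irreducible hu hϖ
  set m := v + 1 with hm
  obtain ⟨x, hxC, hxX⟩ := exists_powerSeries_hom (maximalIdeal O) ψ (a := fun i => ϖ ^ m * u i)
    (fun i => Ideal.mul_mem_right _ _ (Ideal.pow_mem_of_mem _ hϖm m (by omega)))
  refine ⟨x, hxC, fun h0 => ?_⟩
  have h1 := sub_sum_mem_span_X_pow (d + 1) f
  have h2 : x (f - ∑ e ∈ T, monomial e (coeff e f)) ∈ Ideal.span {ϖ ^ m} ^ (d + 1) := by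
    have hle : Ideal.span (Set.range (X : ι → MvPowerSeries ι S)) ≤
        (Ideal.span {ϖ ^ m}).comap x := by
      rw [Ideal.span_le]; rintro _ ⟨i, rfl⟩
      rw [SetLike.mem_coe, Ideal.mem_comap, hxX]
      exact Ideal.mul_mem_right _ _ (Ideal.mem_span_singleton_self _)
    have := Ideal.mem_map_of_mem x (Ideal.pow_right_mono hle _ h1)
    rw [Ideal.map_pow] at this
    exact Ideal.pow_right_mono Ideal.map_comap_le _ this
  have h3 : x (∑ e ∈ T, monomial e (coeff e f)) = ϖ ^ (m * d) * MvPolynomial.eval u P := by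
    rw [map_sum, map_sum, Finset.mul_sum]
    refine Finset.sum_congr rfl fun e he => ?_
    have he' : e.degree < d + 1 := by simpa [T] using he
    rw [monomial_eq_C_mul, map_mul, hxC, MvPolynomial.eval_monomial]
    rcases Nat.lt_succ_iff_lt_or_eq.1 he' with h | h
    · rw [hlow e h]; simp
    · have : x (e.prod fun i n => (X i : MvPowerSeries ι S) ^ n) =
          ϖ ^ (m * d) * e.prod fun i n => u i ^ n := by
        simp only [Finsupp.prod, map_prod, map_pow, hxX, mul_pow, Finset.prod_mul_distrib]
        congr 1
        rw [← h, Finsupp.degree_apply, Finset.mul_sum, ← Finset.prod_pow_eq_pow_sum]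
        exact Finset.prod_congr rfl fun i _ => by rw [pow_mul]
      rw [this]; ring
  rw [map_sub, h0, zero_sub, neg_mem_iff, h3, Ideal.span_singleton_pow, Ideal.mem_span_singleton,
    hw, ← pow_mul, mul_left_comm, ← pow_add] at h2
  have h4 : ϖ ^ (m * (d + 1)) ∣ ϖ ^ (m * d + v) := by
    rcases h2 with ⟨z, hz⟩
    refine ⟨↑w⁻¹ * z, ?_⟩
    rw [mul_left_comm, ← hz, Units.inv_mul_cancel_left]
  have h5 := (pow_dvd_pow_iff hϖ.ne_zero hϖ.not_isUnit).1 h4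
  rw [mul_add, mul_one, hm] at h5
  omega

end PowerSeries

/-! ### Lengths at a prime -/

section Length

open IsLocalRing

variable {A : Type} [CommRing A] (𝔭 : Ideal A) [𝔭.IsPrime]

/-- The length at the prime `𝔭` of a module. -/
def lengthAt (M : Type) [AddCommGroup M] [Module A M] : ℕ∞ :=
  Module.length (Localization.AtPrime 𝔭) (LocalizedModule 𝔭.primeCompl M)

theorem lengthAt_eq_add {M N P : Type} [AddCommGroup M] [Module A M] [AddCommGroup N] [Module A N]
    [AddCommGroup P] [Module A P] (f : N →ₗ[A] M) (g : M →ₗ[A] P) (hf : Function.Injective f)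
    (hg : Function.Surjective g) (hfg : Function.Exact f g) :
    lengthAt 𝔭 M = lengthAt 𝔭 N + lengthAt 𝔭 P :=
  Module.length_eq_add_of_exact (LocalizedModule.map 𝔭.primeCompl f)
    (LocalizedModule.map 𝔭.primeCompl g)
    (IsLocalizedModule.map_injective 𝔭.primeCompl (LocalizedModule.mkLinearMap _ _)
      (LocalizedModule.mkLinearMap _ _) f hf)
    (IsLocalizedModule.map_surjective 𝔭.primeCompl (LocalizedModule.mkLinearMap _ _)
      (LocalizedModule.mkLinearMap _ _) g hg)
    (LocalizedModule.map_exact 𝔭.primeCompl f g hfg)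

theorem lengthAt_of_subsingleton (M : Type) [AddCommGroup M] [Module A M] [Subsingleton M] :
    lengthAt 𝔭 M = 0 := by
  have : Subsingleton (LocalizedModule 𝔭.primeCompl M) :=
    LocalizedModule.subsingleton_iff.2 fun m => ⟨1, Submonoid.one_mem _, Subsingleton.elim _ _⟩
  exact Module.length_eq_zero

theorem lengthAt_self : lengthAt 𝔭 (A ⧸ 𝔭) = 1 := by
  rw [lengthAt, Module.length_eq_one_iff, isSimpleModule_iff_toSpanSingleton_surjective]
  have hz : ∀ (a : A) (s : 𝔭.primeCompl),
      LocalizedModule.mk (Ideal.Quotient.mk 𝔭 a) s = 0 ↔ a ∈ 𝔭 := fun a s => by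
    rw [← LocalizedModule.zero_mk 1, LocalizedModule.mk_eq]
    constructor
    · rintro ⟨c, hc⟩
      rw [smul_zero, smul_zero, one_smul, Submonoid.smul_def, ← Ideal.Quotient.mk_eq_mk,
        ← Submodule.Quotient.mk_smul, Submodule.Quotient.mk_eq_zero] at hc
      exact (‹𝔭.IsPrime›.mem_or_mem hc).resolve_left c.2
    · intro h
      exact ⟨1, by rw [Ideal.Quotient.eq_zero_iff_mem.2 h]; simp⟩
  refine ⟨⟨LocalizedModule.mk (Ideal.Quotient.mk 𝔭 1) 1, 0, ?_⟩, ?_⟩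
  · rw [Ne, hz]
    exact (Ideal.ne_top_iff_one _).1 ‹𝔭.IsPrime›.ne_top
  · intro x hx y
    induction x using LocalizedModule.induction_on with | _ x s
    induction y using LocalizedModule.induction_on with | _ y t
    obtain ⟨a, rfl⟩ := Ideal.Quotient.mk_surjective x
    obtain ⟨b, rfl⟩ := Ideal.Quotient.mk_surjective y
    rw [Ne, hz] at hx
    refine ⟨Localization.mk (b * s) (⟨a, hx⟩ * t), ?_⟩
    rw [LinearMap.toSpanSingleton_apply, LocalizedModule.mk_smul_mk, LocalizedModule.mk_eq]
    refine ⟨1, ?_⟩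
    simp only [one_smul, Submonoid.smul_def, Submonoid.coe_mul, ← Ideal.Quotient.mk_eq_mk,
      ← Submodule.Quotient.mk_smul]
    congr 1
    simp only [smul_eq_mul]; ring

end Length

section Colon

variable {A : Type} [CommRing A] (I : Ideal A) (s : A)

/-- Multiplication by `s`, from `A / (I : s)` to `A / I`. -/
def colonMul : (A ⧸ I.colon {s}) →ₗ[A] A ⧸ I :=
  Submodule.mapQ _ _ (LinearMap.mulLeft A s) fun x hx => by
    rw [Submodule.mem_colon_singleton, smul_eq_mul, mul_comm] at hx
    exact hx

theorem colonMul_mk (x : A) :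
    colonMul I s (Ideal.Quotient.mk _ x) = Ideal.Quotient.mk I (s * x) := rfl

theorem colonMul_injective : Function.Injective (colonMul I s) := by
  rw [injective_iff_map_eq_zero]
  intro x hx
  obtain ⟨x, rfl⟩ := Ideal.Quotient.mk_surjective x
  rw [colonMul_mk, Ideal.Quotient.eq_zero_iff_mem] at hx
  rw [Ideal.Quotient.eq_zero_iff_mem, Submodule.mem_colon_singleton, smul_eq_mul, mul_comm]
  exact hx

theorem colonMul_exact : Function.Exact (colonMul I s)
    (Submodule.factor (le_sup_left : I ≤ I ⊔ Ideal.span {s})) := by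
  intro y
  obtain ⟨y, rfl⟩ := Ideal.Quotient.mk_surjective y
  rw [← Ideal.Quotient.mk_eq_mk,
    show ∀ x, Submodule.factor (le_sup_left : I ≤ I ⊔ Ideal.span {s}) (Submodule.Quotient.mk x) =
      Submodule.Quotient.mk x from fun _ => rfl,
    Submodule.Quotient.mk_eq_zero, Submodule.mem_sup]
  constructor
  · rintro ⟨a, ha, b, hb, rfl⟩
    obtain ⟨c, rfl⟩ := Ideal.mem_span_singleton'.1 hb
    refine ⟨Ideal.Quotient.mk _ c, ?_⟩
    rw [colonMul_mk, Ideal.Quotient.mk_eq_mk, Ideal.Quotient.eq]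
    have : s * c - (a + c * s) = -a := by ring
    rw [this]; exact I.neg_mem ha
  · rintro ⟨c, hc⟩
    obtain ⟨c, rfl⟩ := Ideal.Quotient.mk_surjective c
    rw [colonMul_mk, Ideal.Quotient.mk_eq_mk, Ideal.Quotient.eq] at hc
    refine ⟨y - s * c, ?_, s * c, Ideal.mem_span_singleton'.2 ⟨c, mul_comm _ _⟩, by ring⟩
    rw [← neg_mem_iff]; convert hc using 1; ring

theorem lengthAt_quotient_eq_add (𝔭 : Ideal A) [𝔭.IsPrime] : lengthAt 𝔭 (A ⧸ I) =
    lengthAt 𝔭 (A ⧸ I.colon {s}) + lengthAt 𝔭 (A ⧸ I ⊔ Ideal.span {s}) :=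
  lengthAt_eq_add 𝔭 _ _ (colonMul_injective I s) (Submodule.factor_surjective _)
    (colonMul_exact I s)

theorem card_quotient_eq_mul : Nat.card (A ⧸ I) =
    Nat.card (A ⧸ I.colon {s}) * Nat.card (A ⧸ I ⊔ Ideal.span {s}) := by
  rw [Submodule.card_eq_card_quotient_mul_card (LinearMap.range (colonMul I s))]
  congr 1
  · exact Nat.card_congr (LinearEquiv.ofInjective _ (colonMul_injective I s)).toEquiv.symm
  · have h := (colonMul_exact I s).linearMap_ker_eq
    rw [← h]
    exact Nat.card_congr (LinearMap.quotKerEquivOfSurjective _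
      (Submodule.factor_surjective _)).toEquiv

end Colon

section Descent

open IsLocalRing

variable {A : Type} [CommRing A] (𝔭 : Ideal A) [𝔭.IsPrime]
variable {S : Type} [CommRing S] [IsLocalRing S]

/-- A proper ideal of finite index in a local ring contains a power of the maximal ideal. -/
theorem exists_maximalIdeal_pow_le (K : Ideal S) (hK : K ≠ ⊤) [Finite (S ⧸ K)] :
    ∃ i, maximalIdeal S ^ i ≤ K := by
  have : Nontrivial (S ⧸ K) := Ideal.Quotient.nontrivial_iff.2 hK
  have : IsLocalRing (S ⧸ K) := .of_surjective' (Ideal.Quotient.mk K) Ideal.Quotient.mk_surjective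
  obtain ⟨i, hi⟩ := IsArtinianRing.isNilpotent_jacobson_bot (R := S ⧸ K)
  rw [jacobson_eq_maximalIdeal _ bot_ne_top] at hi
  have h1 : (maximalIdeal S).map (Ideal.Quotient.mk K) ≤ maximalIdeal (S ⧸ K) := by
    rw [Ideal.map_le_iff_le_comap]
    intro x hx
    rw [Ideal.mem_comap]
    by_contra h
    have hu : IsUnit (Ideal.Quotient.mk K x) := by simpa using h
    obtain ⟨y, hy⟩ := Ideal.Quotient.mk_surjective (hu.unit⁻¹ : (S ⧸ K)ˣ).1
    have h2 : x * y - 1 ∈ K := by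
      rw [← Ideal.Quotient.eq, map_mul, map_one, hy]; exact hu.mul_val_inv
    have h3 : (1 : S) ∈ maximalIdeal S := by
      have := Ideal.sub_mem _ (Ideal.mul_mem_right y _ hx) (le_maximalIdeal hK h2)
      rwa [sub_sub_cancel] at this
    exact (Ideal.ne_top_iff_one _).1 (Ideal.IsPrime.ne_top inferInstance) h3
  refine ⟨i, ?_⟩
  rw [← Ideal.mk_ker (I := K), ← Ideal.map_eq_bot_iff_le_ker, Ideal.map_pow, ← le_bot_iff]
  exact (Ideal.pow_right_mono h1 i).trans hi.le

/-- For a proper ideal `K` of finite index in a local ring, `(K : s)` is the maximal ideal for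
some `s`. -/
theorem exists_colon_eq_maximalIdeal (K : Ideal S) (hK : K ≠ ⊤) [Finite (S ⧸ K)] :
    ∃ s, K.colon {s} = maximalIdeal S := by
  have hex := exists_maximalIdeal_pow_le K hK
  classical
  set i := Nat.find hex with hi
  have hle : maximalIdeal S ^ i ≤ K := Nat.find_spec hex
  have hi0 : i ≠ 0 := fun h => by
    rw [h, pow_zero, Ideal.one_eq_top, top_le_iff] at hle
    exact hK hle
  have hlt : ¬ maximalIdeal S ^ (i - 1) ≤ K := Nat.find_min hex (by omega)
  obtain ⟨s, hs, hsK⟩ := SetLike.not_le_iff_exists.1 hlt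
  refine ⟨s, le_antisymm ?_ fun x hx => ?_⟩
  · refine le_maximalIdeal ((Ideal.ne_top_iff_one _).2 fun h => hsK ?_)
    rwa [Submodule.mem_colon_singleton, one_smul] at h
  · rw [Submodule.mem_colon_singleton, smul_eq_mul]
    refine hle ?_
    rw [← Nat.succ_pred_eq_of_ne_zero hi0, pow_succ']
    exact Ideal.mul_mem_mul hx hs

/-- The length at `𝔪_S A` of the quotients of `A` by ideals extended from `S`. -/
theorem lengthAt_quotient_map [Finite (IsLocalRing.ResidueField S)] (θ : S →+* A)
    (h𝔭 : (maximalIdeal S).map θ = 𝔭) (K0 : Ideal S)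
    (hF : ∀ K, K0 ≤ K → ∀ s f, θ s * f ∈ K.map θ → f ∈ (K.colon {s}).map θ) (h : ℕ) :
    ∀ K, K0 ≤ K → Nat.card (S ⧸ K) = Nat.card (IsLocalRing.ResidueField S) ^ h →
      lengthAt 𝔭 (A ⧸ K.map θ) = h := by
  induction h with
  | zero =>
    intro K _ hc
    rw [pow_zero, Nat.card_eq_one_iff_unique] at hc
    have : K = ⊤ := Ideal.Quotient.subsingleton_iff.1 hc.1
    rw [this, Ideal.map_top]
    have : Subsingleton (A ⧸ (⊤ : Ideal A)) := Ideal.Quotient.subsingleton_iff.2 rfl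
    rw [lengthAt_of_subsingleton]; rfl
  | succ h ih =>
    intro K hK hc
    have hpos : 1 < Nat.card (IsLocalRing.ResidueField S) := Finite.one_lt_card
    have hpos' : Nat.card (S ⧸ K) ≠ 0 := by rw [hc]; positivity
    have : Finite (S ⧸ K) := Nat.finite_of_card_ne_zero hpos'
    have hne : K ≠ ⊤ := by
      rintro rfl
      have : Subsingleton (S ⧸ (⊤ : Ideal S)) := Ideal.Quotient.subsingleton_iff.2 rfl
      have h1 : Nat.card (S ⧸ (⊤ : Ideal S)) ≤ 1 := Finite.card_le_one_iff_subsingleton.2 this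
      have h2 := Nat.one_lt_pow (Nat.succ_ne_zero h) hpos
      exact absurd (hc ▸ h1) (not_le.2 h2)
    obtain ⟨s, hs⟩ := exists_colon_eq_maximalIdeal K hne
    have hcol : (K.map θ).colon {θ s} = 𝔭 := by
      apply le_antisymm
      · intro f hf
        rw [Submodule.mem_colon_singleton, smul_eq_mul, mul_comm] at hf
        rw [← h𝔭, ← hs]
        exact hF K hK s f hf
      · rw [← h𝔭, ← hs, Ideal.map_le_iff_le_comap]
        intro x hx
        rw [Submodule.mem_colon_singleton, smul_eq_mul] at hx
        rw [Ideal.mem_comap, Submodule.mem_colon_singleton, smul_eq_mul, ← map_mul]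
        exact Ideal.mem_map_of_mem _ hx
    have hmap : K.map θ ⊔ Ideal.span {θ s} = (K ⊔ Ideal.span {s}).map θ := by
      rw [Ideal.map_sup, Ideal.map_span, Set.image_singleton]
    have hc' := card_quotient_eq_mul K s
    rw [hc, hs, pow_succ'] at hc'
    have := Nat.eq_of_mul_eq_mul_left (by omega) hc'
    rw [lengthAt_quotient_eq_add _ (θ s), hcol, lengthAt_self, hmap,
      ih _ (hK.trans le_sup_left) this.symm, add_comm]
    push_cast; rfl

end Descent

section TopPoints

/-- The only minimal prime of a noetherian local ring is its only prime of maximal dimension. -/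
theorem existsUnique_topPoint {A : Type} [CommRing A] [IsLocalRing A] [IsNoetherianRing A]
    {𝔭 : Ideal A} (h𝔭 : minimalPrimes A = {𝔭}) :
    ∃ a : TopPoint A, a.1.asIdeal = 𝔭 ∧ ∀ b : TopPoint A, b = a := by
  have hmem : 𝔭 ∈ minimalPrimes A := h𝔭 ▸ rfl
  have hprime : 𝔭.IsPrime := hmem.1.1
  have hle (b : PrimeSpectrum A) : 𝔭 ≤ b.asIdeal := by
    obtain ⟨c, hc, hcb⟩ := Ideal.exists_minimalPrimes_le (bot_le : (⊥ : Ideal A) ≤ b.asIdeal)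
    have : c ∈ minimalPrimes A := hc
    rw [h𝔭] at this
    rwa [← Set.mem_singleton_iff.1 this]
  have hdim : ringKrullDim (A ⧸ 𝔭) = ringKrullDim A := by
    rw [ringKrullDim_quotient]
    have : PrimeSpectrum.zeroLocus (𝔭 : Set A) = Set.univ :=
      Set.eq_univ_of_forall fun b => hle b
    rw [this]
    exact Order.krullDim_eq_of_orderIso OrderIso.Set.univ
  refine ⟨⟨⟨𝔭, hprime⟩, hdim⟩, rfl, fun b => Subtype.ext (PrimeSpectrum.ext ?_)⟩
  by_contra hne
  have hlt : 𝔭 < b.1.asIdeal := lt_of_le_of_ne (hle b.1) (Ne.symm hne)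
  obtain ⟨x, hxb, hx⟩ := SetLike.exists_of_lt hlt
  have h1 := ringKrullDim_succ_le_of_surjective (Ideal.Quotient.factor hlt.le)
    (Ideal.Quotient.factor_surjective hlt.le) (r := Ideal.Quotient.mk 𝔭 x)
    (mem_nonZeroDivisors_of_ne_zero (by rwa [Ne, Ideal.Quotient.eq_zero_iff_mem]))
    (by rw [Ideal.Quotient.factor_mk]; exact Ideal.Quotient.eq_zero_iff_mem.2 hxb)
  rw [b.2, hdim] at h1
  have hbot := ringKrullDim_ne_bot (R := A)
  have htop := ringKrullDim_ne_top (R := A)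
  clear hlt hne hxb hdim
  generalize ringKrullDim A = d at h1 hbot htop
  induction d with
  | bot => exact hbot rfl
  | coe d =>
    induction d with
    | top => exact htop rfl
    | coe d =>
      have : ((d + 1 : ℕ) : WithBot ℕ∞) ≤ (d : ℕ) := by exact_mod_cast h1
      have := Nat.cast_le.1 this
      omega

end TopPoints

section Special

open IsLocalRing

variable {O : Type} [CommRing O] [IsDomain O] [IsDiscreteValuationRing O]
variable {S : Type} [CommRing S] [Algebra O S] [Module.Finite O S]

/-- The order of the special fibre of the image of `S` in `O ^ X`, for a set `X` of points
`S → O`. -/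
theorem card_quotient_iInf_ker [Finite (IsLocalRing.ResidueField O)] (T : Set (S →ₐ[O] O))
    [Finite T] :
    Nat.card (S ⧸ (⨅ x ∈ T, RingHom.ker (x : S →+* O)) ⊔ (maximalIdeal O).map (algebraMap O S)) =
      Nat.card (IsLocalRing.ResidueField O) ^ Nat.card T := by
  classical
  set J : Ideal S := ⨅ x ∈ T, RingHom.ker (x : S →+* O) with hJ
  have := Fintype.ofFinite T
  have hmem (s) : s ∈ J ↔ ∀ x ∈ T, x s = 0 := by
    simp [hJ, Submodule.mem_iInf, RingHom.mem_ker]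
  let ev : (S ⧸ J) →ₗ[O] (T → O) := LinearMap.pi fun x =>
    (Ideal.Quotient.liftₐ J x.1 fun s hs => (hmem s).1 hs x x.2).toLinearMap
  have hev : ∀ s x, ev (Ideal.Quotient.mk J s) x = x.1 s := fun _ _ => rfl
  have hinj : Function.Injective ev := by
    rw [injective_iff_map_eq_zero]
    intro s hs
    obtain ⟨s, rfl⟩ := Ideal.Quotient.mk_surjective s
    rw [Ideal.Quotient.eq_zero_iff_mem, hmem]
    exact fun x hx => congrFun hs ⟨x, hx⟩
  have : Module.IsTorsionFree O (S ⧸ J) := hinj.moduleIsTorsionFree _ (fun c m => map_smul ev c m)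
  have hfin : Module.Finite O (S ⧸ J) :=
    Module.Finite.of_surjective (Ideal.Quotient.mkₐ O J).toLinearMap Ideal.Quotient.mk_surjective
  have : Module.Free O (S ⧸ J) := Module.free_of_finite_type_torsion_free'
  -- for each point there is a function that vanishes exactly at the other points
  have hsep (x : T) : ∃ s : S, x.1 s ≠ 0 ∧ ∀ y : T, y ≠ x → y.1 s = 0 := by
    have h1 (y : T) : ∃ s : S, x.1 s ≠ 0 ∧ (y ≠ x → y.1 s = 0) := by
      by_cases hyx : y = x
      · exact ⟨1, by simp, fun h => absurd hyx h⟩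
      · have : ∃ s, y.1 s ≠ x.1 s := by
          by_contra! h
          exact hyx (Subtype.ext (AlgHom.ext h))
        obtain ⟨s, hs⟩ := this
        refine ⟨s - algebraMap O S (y.1 s), ?_, fun _ => ?_⟩
        · rw [map_sub, AlgHom.commutes]
          exact sub_ne_zero.2 (Ne.symm hs)
        · rw [map_sub, AlgHom.commutes]; exact sub_self _
    choose s hs hs' using h1
    refine ⟨∏ y, s y, ?_, fun y hy => ?_⟩
    · rw [map_prod]; exact Finset.prod_ne_zero_iff.2 fun y _ => hs y
    · rw [map_prod]; exact Finset.prod_eq_zero (Finset.mem_univ y) (hs' y hy)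
  choose s hs hs' using hsep
  have hrank : Module.finrank O (S ⧸ J) = Nat.card T := by
    apply le_antisymm
    · have := LinearMap.finrank_le_finrank_of_injective hinj
      rwa [Module.finrank_fintype_fun_eq_card, ← Nat.card_eq_fintype_card] at this
    · rw [Nat.card_eq_fintype_card]
      refine LinearIndependent.fintype_card_le_finrank (b := fun x => Ideal.Quotient.mk J (s x)) ?_
      rw [Fintype.linearIndependent_iff]
      intro c hc x
      have h1 := congrFun (congrArg ev hc) x
      rw [map_sum, Finset.sum_apply, map_zero, Finset.sum_eq_single x] at h1
      · rw [map_smul, Pi.smul_apply, hev, smul_eq_mul] at h1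
        exact (mul_eq_zero.1 h1).resolve_right (hs x)
      · intro y _ hy
        rw [map_smul, Pi.smul_apply, hev, hs' y x hy.symm, smul_zero]
      · simp
  have e := DoubleQuot.quotQuotEquivQuotSup J ((maximalIdeal O).map (algebraMap O S))
  rw [← Nat.card_congr e.toEquiv, Ideal.map_map]
  let b := Module.finBasis O (S ⧸ J)
  rw [← hrank]
  have h1 := Nat.card_congr (basisQuotient b).equivFun.toEquiv
  rwa [Nat.card_fun, Nat.card_eq_fintype_card (α := Fin _), Fintype.card_fin] at h1

end Special

/-! ### Monic polynomials stable under `X ↦ X ^ q` -/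

section StablePoly

open Polynomial

variable {A : Type} [CommRing A] {d : ℕ}

/-- The monic polynomial `(X - 1) ^ d + c₀ + c₁ X + ⋯` of degree `d`, a deformation of
`(X - 1) ^ d`. -/
def deformPoly (c : Fin d → A) : A[X] := (X - 1) ^ d + ∑ i, C (c i) * X ^ (i : ℕ)

theorem deformPoly_map {B : Type} [CommRing B] (f : A →+* B) (c : Fin d → A) :
    (deformPoly c).map f = deformPoly (fun i => f (c i)) := by
  simp [deformPoly, Polynomial.map_sum]

theorem deformPoly_map_dvd {B : Type} [CommRing B] (f : A →+* B) {c : Fin d → A} {L N : ℕ}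
    (h : deformPoly c ∣ (X ^ L - 1) ^ N) : (deformPoly fun i => f (c i)) ∣ (X ^ L - 1) ^ N := by
  have h := Polynomial.map_dvd f h
  rwa [deformPoly_map, Polynomial.map_pow, Polynomial.map_sub, Polynomial.map_pow, map_X,
    Polynomial.map_one] at h

theorem degree_sum_C_mul_X_pow_lt (c : Fin d → A) :
    (∑ i, C (c i) * X ^ (i : ℕ) : A[X]).degree < d := by
  refine (degree_sum_le _ _).trans_lt ((Finset.sup_lt_iff (WithBot.bot_lt_coe d)).2 fun i _ => ?_)
  exact (degree_C_mul_X_pow_le _ _).trans_lt ((Nat.cast_lt (α := WithBot ℕ)).2 i.2)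

theorem coeff_sum_C_mul_X_pow (c : Fin d → A) (i : Fin d) :
    (∑ i, C (c i) * X ^ (i : ℕ) : A[X]).coeff i = c i := by
  simp [coeff_C_mul, coeff_X_pow, Fin.val_inj]

theorem degree_X_sub_one_pow [Nontrivial A] (d : ℕ) : ((X - 1 : A[X]) ^ d).degree = d := by
  have h1 : (X - 1 : A[X]).Monic := monic_X_sub_C 1
  have h2 : (X - 1 : A[X]).natDegree = 1 := natDegree_X_sub_C 1
  rw [degree_eq_natDegree (h1.pow d).ne_zero, h1.natDegree_pow, h2, mul_one]

theorem deformPoly_monic (c : Fin d → A) : (deformPoly c).Monic := by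
  nontriviality A
  have h1 : ((X - 1 : A[X]) ^ d).Monic := (monic_X_sub_C (1 : A)).pow d
  refine h1.add_of_left ?_
  rw [degree_X_sub_one_pow]
  exact degree_sum_C_mul_X_pow_lt c

theorem deformPoly_degree [Nontrivial A] (c : Fin d → A) : (deformPoly c).degree = d := by
  rw [deformPoly, degree_add_eq_left_of_degree_lt, degree_X_sub_one_pow]
  rw [degree_X_sub_one_pow]
  exact degree_sum_C_mul_X_pow_lt c

theorem deformPoly_natDegree [Nontrivial A] (c : Fin d → A) : (deformPoly c).natDegree = d :=
  natDegree_eq_of_degree_eq_some (deformPoly_degree c)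

theorem deformPoly_degree_le (c : Fin d → A) : (deformPoly c).degree ≤ d := by
  cases subsingleton_or_nontrivial A
  · rw [Subsingleton.elim (deformPoly c) 0, degree_zero]; exact bot_le
  · exact (deformPoly_degree c).le

theorem exists_eq_deformPoly {f : A[X]} (hf : f.Monic) (hd : f.natDegree = d) :
    ∃ c : Fin d → A, f = deformPoly c := by
  nontriviality A
  refine ⟨fun i => (f - (X - 1) ^ d).coeff i, ?_⟩
  rw [deformPoly, ← sub_eq_iff_eq_add']
  have hdeg : (f - (X - 1) ^ d).degree < (d : WithBot ℕ) := by
    have hfd : f.degree = d := by rw [degree_eq_natDegree hf.ne_zero, hd]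
    rw [← hfd]
    refine degree_sub_lt_left ?_ hf.ne_zero ?_
    · rw [degree_X_sub_one_pow, hfd]
    · exact hf.leadingCoeff.trans ((monic_X_sub_C (1 : A)).pow d).leadingCoeff.symm
  ext k
  by_cases hk : k < d
  · exact (coeff_sum_C_mul_X_pow (fun i : Fin d => (f - (X - 1) ^ d).coeff i) ⟨k, hk⟩).symm
  · rw [coeff_eq_zero_of_degree_lt (hdeg.trans_le (by exact_mod_cast not_lt.1 hk)),
      coeff_eq_zero_of_degree_lt ((degree_sum_C_mul_X_pow_lt _).trans_le
        (by exact_mod_cast not_lt.1 hk))]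

theorem deformPoly_injective : Function.Injective (deformPoly : (Fin d → A) → A[X]) := by
  intro c c' h
  have h' := add_left_cancel h
  funext i
  rw [← coeff_sum_C_mul_X_pow c i, h', coeff_sum_C_mul_X_pow]

/-- Coefficients of the remainder of `p` modulo `f`. -/
def remVec (f : A[X]) (d : ℕ) (p : A[X]) : Fin d → A := fun i => (p %ₘ f).coeff i

theorem dvd_iff_remVec {f : A[X]} (hf : f.Monic) (hd : f.degree ≤ d) (p : A[X]) :
    f ∣ p ↔ remVec f d p = 0 := by
  nontriviality A
  rw [← modByMonic_eq_zero_iff_dvd hf]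
  constructor
  · intro h
    funext i
    simp [remVec, h]
  · intro h
    ext k
    by_cases hk : k < d
    · exact congrFun h ⟨k, hk⟩
    · rw [coeff_zero, coeff_eq_zero_of_degree_lt]
      refine (degree_modByMonic_lt p hf).trans_le (hd.trans ?_)
      exact_mod_cast not_lt.1 hk

theorem remVec_map {B : Type} [CommRing B] (φ : A →+* B) {f : A[X]} (hf : f.Monic) (d : ℕ)
    (p : A[X]) (i : Fin d) : remVec (f.map φ) d (p.map φ) i = φ (remVec f d p i) := by
  rw [remVec, ← map_modByMonic φ hf, coeff_map]; rfl

theorem eval_pow_eq_zero {f : A[X]} {q : ℕ} (h : f ∣ expand A q f) {B : Type} [CommRing B]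
    [Algebra A B] {x : B} (hx : aeval x f = 0) (t : ℕ) : aeval (x ^ q ^ t) f = 0 := by
  induction t with
  | zero => simpa using hx
  | succ t ih =>
    obtain ⟨g, hg⟩ := h
    have := congrArg (aeval (x ^ q ^ t)) hg
    rw [expand_aeval, map_mul, ih, zero_mul, ← pow_mul, ← pow_succ] at this
    exact this

/-- The product of the differences `X ^ (q ^ t) - X ^ (q ^ s)` for `s < t ≤ n`. -/
def frobeniusDisc (A : Type) [CommRing A] (q n : ℕ) : A[X] :=
  ∏ z ∈ ((Finset.range (n + 1)) ×ˢ (Finset.range (n + 1))).filter (fun z => z.1 < z.2),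
    (X ^ q ^ z.2 - X ^ q ^ z.1)

theorem frobeniusDisc_map {B : Type} [CommRing B] (φ : A →+* B) (q n : ℕ) :
    (frobeniusDisc A q n).map φ = frobeniusDisc B q n := by
  simp [frobeniusDisc, Polynomial.map_prod]

/-- If the roots of `f` are stable under the `q`-th power map and there are at most `n` of them,
two of `x, x ^ q, …, x ^ (q ^ n)` coincide for each root `x`. -/
theorem exists_dvd_frobeniusDisc_pow {f : A[X]} (hf : f.Monic) {q n : ℕ} (hd : f.natDegree ≤ n)
    (h : f ∣ expand A q f) : ∃ N, f ∣ frobeniusDisc A q n ^ N := by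
  classical
  have hnil : IsNilpotent (AdjoinRoot.mk f (frobeniusDisc A q n)) := by
    rw [nilpotent_iff_mem_prime]
    intro P hP
    have hroot : aeval (AdjoinRoot.root f) f = 0 := by
      rw [AdjoinRoot.aeval_eq, AdjoinRoot.mk_self]
    set y : AdjoinRoot f ⧸ P := Ideal.Quotient.mk P (AdjoinRoot.root f) with hy
    have hyf : aeval y f = 0 := by
      have := congrArg (Ideal.Quotient.mkₐ A P) hroot
      rwa [← aeval_algHom_apply, map_zero] at this
    have hmaps : ∀ t ∈ Finset.range (n + 1),
        y ^ q ^ t ∈ (f.map (algebraMap A (AdjoinRoot f ⧸ P))).roots.toFinset := by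
      intro t _
      rw [Multiset.mem_toFinset, mem_roots (hf.map _).ne_zero, IsRoot, eval_map_algebraMap]
      exact eval_pow_eq_zero h hyf t
    have hcard : (f.map (algebraMap A (AdjoinRoot f ⧸ P))).roots.toFinset.card <
        (Finset.range (n + 1)).card := by
      rw [Finset.card_range]
      refine ((Multiset.toFinset_card_le _).trans ((card_roots' _).trans ?_)).trans_lt
        (Nat.lt_succ_of_le hd)
      exact natDegree_map_le
    obtain ⟨s, hs, t, ht, hst, he⟩ := Finset.exists_ne_map_eq_of_card_lt_of_maps_to hcard hmaps
    have key : ∀ s t, s ∈ Finset.range (n + 1) → t ∈ Finset.range (n + 1) → s < t →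
        y ^ q ^ s = y ^ q ^ t → AdjoinRoot.mk f (frobeniusDisc A q n) ∈ P := by
      intro s t hs ht hlt he
      rw [← Ideal.Quotient.eq_zero_iff_mem, frobeniusDisc, map_prod, map_prod]
      refine Finset.prod_eq_zero (i := (s, t)) (by simp_all) ?_
      simp only [map_sub, map_pow, AdjoinRoot.mk_X, ← hy, he, sub_self]
    rcases lt_or_gt_of_ne hst with hlt | hlt
    · exact key s t hs ht hlt he
    · exact key t s ht hs hlt he.symm
  obtain ⟨N, hN⟩ := hnil
  refine ⟨N, ?_⟩
  rwa [← map_pow, AdjoinRoot.mk_eq_zero] at hN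

/-- The exponent in `exists_dvd_frobeniusDisc_pow` can be chosen independently of the ring. -/
theorem exists_uniform_dvd_frobeniusDisc_pow (q n d : ℕ) (hd : d ≤ n) :
    ∃ N, ∀ (A : Type) [CommRing A] (c : Fin d → A), deformPoly c ∣ expand A q (deformPoly c) →
      deformPoly c ∣ frobeniusDisc A q n ^ N := by
  let U := MvPolynomial (Fin d) ℤ
  let f : U[X] := deformPoly MvPolynomial.X
  let J : Ideal U := Ideal.span (Set.range (remVec f d (expand U q f)))
  let u : Fin d → U ⧸ J := fun i => Ideal.Quotient.mk J (MvPolynomial.X i)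
  have hu : deformPoly u = f.map (Ideal.Quotient.mk J) := (deformPoly_map _ _).symm
  have hdvd : deformPoly u ∣ expand (U ⧸ J) q (deformPoly u) := by
    rw [dvd_iff_remVec (deformPoly_monic u) (deformPoly_degree_le u), hu, ← map_expand]
    funext i
    rw [remVec_map _ (deformPoly_monic _)]
    exact Ideal.Quotient.eq_zero_iff_mem.2 (Ideal.subset_span ⟨i, rfl⟩)
  have hdeg : (deformPoly u).natDegree ≤ n := (natDegree_le_of_degree_le
    (deformPoly_degree_le u)).trans hd
  obtain ⟨N, hN⟩ := exists_dvd_frobeniusDisc_pow (deformPoly_monic u) hdeg hdvd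
  refine ⟨N, fun A _ c hc => ?_⟩
  let ev : U →+* A := MvPolynomial.eval₂Hom (Int.castRingHom A) c
  have hev (i) : ev (MvPolynomial.X i) = c i := MvPolynomial.eval₂Hom_X' _ _ _
  have hfc : f.map ev = deformPoly c := by
    rw [deformPoly_map]; simp only [hev]
  have hJ : ∀ x ∈ J, ev x = 0 := by
    intro x hx
    have : J ≤ RingHom.ker ev := by
      rw [Ideal.span_le]
      rintro _ ⟨i, rfl⟩
      rw [SetLike.mem_coe, RingHom.mem_ker, ← remVec_map ev (deformPoly_monic _), map_expand]
      rw [show (deformPoly MvPolynomial.X : U[X]).map ev = deformPoly c from hfc]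
      exact congrFun ((dvd_iff_remVec (deformPoly_monic c) (deformPoly_degree_le c) _).1 hc) i
    exact this hx
  have := Polynomial.map_dvd (Ideal.Quotient.lift J ev hJ) hN
  rw [Polynomial.map_pow, frobeniusDisc_map, deformPoly_map] at this
  simpa only [u, Ideal.Quotient.lift_mk, hev] using this

/-- Modulo a deformation of `(X - 1) ^ d` over a local ring, a polynomial that does not vanish
at `1` modulo the maximal ideal is invertible. -/
theorem isUnit_adjoinRoot_mk [IsLocalRing A] {c : Fin d → A}
    (hc : ∀ i, c i ∈ IsLocalRing.maximalIdeal A) {g : A[X]} (hg : IsUnit (g.eval 1)) :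
    IsUnit (AdjoinRoot.mk (deformPoly c) g) := by
  by_contra hu
  obtain ⟨M, hM, hgM⟩ := exists_max_ideal_of_mem_nonunits hu
  have : Module.Finite A (AdjoinRoot (deformPoly c)) :=
    (deformPoly_monic c).finite_adjoinRoot
  have hcomap : M.comap (algebraMap A (AdjoinRoot (deformPoly c))) = IsLocalRing.maximalIdeal A :=
    IsLocalRing.eq_maximalIdeal (Ideal.isMaximal_comap_of_isIntegral_of_isMaximal M)
  have hA : ∀ a ∈ IsLocalRing.maximalIdeal A,
      Ideal.Quotient.mk M (AdjoinRoot.mk (deformPoly c) (C a)) = 0 := fun a ha => by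
    rw [← hcomap] at ha
    exact Ideal.Quotient.eq_zero_iff_mem.2 ha
  set ψ := (Ideal.Quotient.mk M).comp (AdjoinRoot.mk (deformPoly c)) with hψ
  have h1 : ψ (deformPoly c) = 0 := by rw [hψ, RingHom.comp_apply, AdjoinRoot.mk_self, map_zero]
  have h2 : ψ X = 1 := by
    have hdef : ψ ((X - 1) ^ d + ∑ i, C (c i) * X ^ (i : ℕ)) = 0 := h1
    rw [map_add, map_sum, Finset.sum_eq_zero, add_zero, map_pow, map_sub, map_one] at hdef
    · exact sub_eq_zero.1 (eq_zero_of_pow_eq_zero hdef)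
    · intro i _
      rw [map_mul]
      exact mul_eq_zero_of_left (hA _ (hc i)) _
  have h3 : ψ g = ψ (C (g.eval 1)) := by
    have : X - C 1 ∣ g - C (g.eval 1) := by
      rw [dvd_iff_isRoot]; simp
    obtain ⟨k, hk⟩ := this
    have := congrArg ψ hk
    rwa [map_mul, map_sub, map_sub, h2, map_one, map_one, sub_self, zero_mul, sub_eq_zero] at this
  have h4 : IsUnit (ψ (C (g.eval 1))) := (hg.map C).map ψ
  rw [← h3] at h4
  exact h4.ne_zero (Ideal.Quotient.eq_zero_iff_mem.2 hgM)

/-- For `l ∣ q - 1` and `0 < k < l`, the primes `l` divides `q ^ k - 1` exactly as often as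
`q - 1`. -/
theorem exists_pow_sub_one_eq {l q a : ℕ} (hl : l.Prime) (hq : 1 < q) (hlq : l ∣ q - 1)
    (ha : padicValNat l (q - 1) = a) {k : ℕ} (hk : 0 < k) (hkl : k < l) :
    ∃ u, q ^ k - 1 = l ^ a * u ∧ ¬ l ∣ u := by
  have : Fact l.Prime := ⟨hl⟩
  obtain ⟨u, hu⟩ : l ^ a ∣ q - 1 := ha ▸ pow_padicValNat_dvd
  have hlu : ¬ l ∣ u := by
    rintro ⟨v, rfl⟩
    refine pow_succ_padicValNat_not_dvd (p := l) (n := q - 1) (by omega) ?_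
    rw [ha]
    exact ⟨v, by rw [hu]; ring⟩
  refine ⟨u * ∑ i ∈ Finset.range k, q ^ i, ?_, ?_⟩
  · rw [← mul_assoc, ← hu, ← geom_sum_mul_of_one_le hq.le, mul_comm]
  · rw [hl.dvd_mul]
    rintro (h | h)
    · exact hlu h
    · have h1 : (∑ i ∈ Finset.range k, q ^ i) ≡ ∑ i ∈ Finset.range k, 1 [MOD l] := by
        refine Nat.ModEq.sum fun i _ => ?_
        have := ((Nat.modEq_iff_dvd' hq.le).2 hlq).symm.pow i
        rwa [one_pow] at this
      rw [Finset.sum_const, Finset.card_range, smul_eq_mul, mul_one] at h1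
      exact Nat.not_dvd_of_pos_of_lt hk hkl ((h1.dvd_iff dvd_rfl).1 h)

theorem isUnit_natCast_of_not_dvd [IsLocalRing A] {l : ℕ} (hl : l.Prime)
    (hlA : (l : A) ∈ IsLocalRing.maximalIdeal A) {u : ℕ} (hu : ¬ l ∣ u) : IsUnit (u : A) := by
  have h := (Nat.isCoprime_iff_coprime.2 ((hl.coprime_iff_not_dvd).2 hu)).map (Int.castRingHom A)
  obtain ⟨x, y, hxy⟩ := h
  by_contra hu
  have h1 : (1 : A) ∈ IsLocalRing.maximalIdeal A := by
    rw [← hxy]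
    refine Ideal.add_mem _ (Ideal.mul_mem_left _ _ (by simpa using hlA))
      (Ideal.mul_mem_left _ _ ?_)
    simpa using hu
  exact (Ideal.ne_top_iff_one _).1 (Ideal.IsPrime.ne_top inferInstance) h1

/-- If the roots of a deformation `f` of `(X - 1) ^ d` are stable under the `q`-th power map, then
they are `l ^ a`-th roots of unity, in the sense that `f` divides a power of `X ^ (l ^ a) - 1`. -/
theorem exists_dvd_X_pow_sub_one_pow {l q a n : ℕ} (hl : l.Prime) (hq : 1 < q) (hlq : l ∣ q - 1)
    (ha : padicValNat l (q - 1) = a) (hn : n < l) :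
    ∃ N, n ≤ N ∧ ∀ d ≤ n, ∀ (A : Type) [CommRing A] [IsLocalRing A],
      (l : A) ∈ IsLocalRing.maximalIdeal A → ∀ c : Fin d → A,
      (∀ i, c i ∈ IsLocalRing.maximalIdeal A) → deformPoly c ∣ expand A q (deformPoly c) →
      deformPoly c ∣ (X ^ l ^ a - 1) ^ N := by
  classical
  choose N hN using fun d : Fin (n + 1) =>
    exists_uniform_dvd_frobeniusDisc_pow q n d (Nat.lt_succ_iff.1 d.2)
  set Z := ((Finset.range (n + 1)) ×ˢ (Finset.range (n + 1))).filter (fun z => z.1 < z.2) with hZ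
  refine ⟨n + ∑ d, Z.card * N d, Nat.le_add_right _ _, ?_⟩
  intro d hd A _ _ hlA c hc hdvd
  have h1 := hN ⟨d, Nat.lt_succ_of_le hd⟩ A c hdvd
  have hfac : ∀ z ∈ Z, ∃ w, IsUnit (AdjoinRoot.mk (deformPoly c) w) ∧
      (X ^ q ^ z.2 - X ^ q ^ z.1 : A[X]) = w * (X ^ l ^ a - 1) := by
    intro z hz
    rw [hZ, Finset.mem_filter, Finset.mem_product, Finset.mem_range, Finset.mem_range] at hz
    obtain ⟨⟨h1, h2⟩, h3⟩ := hz
    obtain ⟨u, hu, hlu⟩ := exists_pow_sub_one_eq hl hq hlq ha (k := z.2 - z.1) (by omega) (by omega)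
    have hlq' : ¬ l ∣ q := fun h => hl.one_lt.ne' 
      (Nat.dvd_one.1 ((Nat.dvd_sub_iff_right hq.le h).1 hlq))
    have hu' : IsUnit ((u * q ^ z.1 : ℕ) : A) := isUnit_natCast_of_not_dvd hl hlA (by
      rw [hl.dvd_mul]
      rintro (h | h)
      · exact hlu h
      · exact hlq' (hl.dvd_of_dvd_pow h))
    refine ⟨X ^ q ^ z.1 * ∑ i ∈ Finset.range (u * q ^ z.1), (X ^ l ^ a) ^ i,
      isUnit_adjoinRoot_mk hc ?_, ?_⟩
    · simpa [eval_finsetSum] using hu'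
    · rw [mul_assoc, geom_sum_mul, mul_sub, ← pow_mul, ← pow_add, mul_one]
      congr 2
      have h4 : q ^ z.2 = q ^ z.1 * q ^ (z.2 - z.1) := by rw [← pow_add]; congr 1; omega
      have h5 : 1 ≤ q ^ (z.2 - z.1) := Nat.one_le_pow _ _ (by omega)
      have h6 : q ^ (z.2 - z.1) = l ^ a * u + 1 := by omega
      rw [h4, h6]; ring
  choose! w hw hw' using hfac
  have h2 : frobeniusDisc A q n = (∏ z ∈ Z, w z) * (X ^ l ^ a - 1) ^ Z.card := by
    rw [frobeniusDisc, ← hZ, Finset.prod_congr rfl hw', Finset.prod_mul_distrib, Finset.prod_const]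
  rw [h2, mul_pow, ← AdjoinRoot.mk_eq_zero, map_mul] at h1
  have h3 : IsUnit (AdjoinRoot.mk (deformPoly c)
      ((∏ z ∈ Z, w z) ^ N ⟨d, Nat.lt_succ_of_le hd⟩)) := by
    rw [map_pow, map_prod]
    exact (IsUnit.prod_iff.2 hw).pow _
  rw [h3.mul_right_eq_zero, AdjoinRoot.mk_eq_zero, ← pow_mul] at h1
  refine h1.trans (pow_dvd_pow _ ((Finset.single_le_sum (f := fun d => Z.card * N d)
    (fun _ _ => Nat.zero_le _) (Finset.mem_univ (⟨d, Nat.lt_succ_of_le hd⟩ : Fin (n + 1)))).trans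
    (Nat.le_add_left _ _)))

end StablePoly

/-! ### The ring of characteristic polynomials -/

section PolyRing

open Polynomial IsLocalRing

variable (O : Type) [CommRing O] {r : ℕ} (d : Fin r → ℕ) (q L N : ℕ)

/-- The relations between the coefficients `c` of polynomials `f_j`, deforming `(X - 1) ^ d_j`, that
say that `f_j` divides `f_j (X ^ q)` and `(X ^ L - 1) ^ N`. -/
def polyIdeal : Ideal (MvPolynomial (Σ j, Fin (d j)) O) :=
  ⨆ j, Ideal.span (Set.range (remVec (deformPoly fun i => MvPolynomial.X ⟨j, i⟩) (d j)
      (expand _ q (deformPoly fun i => MvPolynomial.X ⟨j, i⟩))) ∪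
    Set.range (remVec (deformPoly fun i => MvPolynomial.X ⟨j, i⟩) (d j) ((X ^ L - 1) ^ N)))

/-- The ring that classifies the families of polynomials `f_j`, deforming `(X - 1) ^ d_j`, that
divide `f_j (X ^ q)` and `(X ^ L - 1) ^ N`. -/
def PolyRing : Type := MvPolynomial (Σ j, Fin (d j)) O ⧸ polyIdeal O d q L N

instance : CommRing (PolyRing O d q L N) :=
  inferInstanceAs (CommRing (MvPolynomial (Σ j, Fin (d j)) O ⧸ polyIdeal O d q L N))

instance : Algebra O (PolyRing O d q L N) :=
  inferInstanceAs (Algebra O (MvPolynomial (Σ j, Fin (d j)) O ⧸ polyIdeal O d q L N))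

/-- The quotient map to the ring `PolyRing`. -/
def PolyRing.mk : MvPolynomial (Σ j, Fin (d j)) O →ₐ[O] PolyRing O d q L N :=
  Ideal.Quotient.mkₐ O (polyIdeal O d q L N)

theorem PolyRing.mk_surjective : Function.Surjective (PolyRing.mk O d q L N) :=
  Ideal.Quotient.mkₐ_surjective _ _

theorem PolyRing.mk_eq_zero {x} (hx : x ∈ polyIdeal O d q L N) : PolyRing.mk O d q L N x = 0 :=
  Ideal.Quotient.eq_zero_iff_mem.2 hx

/-- The coefficients of the universal family of polynomials. -/
def PolyRing.coeff (j : Fin r) (i : Fin (d j)) : PolyRing O d q L N :=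
  PolyRing.mk O d q L N (MvPolynomial.X ⟨j, i⟩)

theorem PolyRing.map_mk_deformPoly (j : Fin r) :
    (deformPoly fun i => MvPolynomial.X ⟨j, i⟩ : (MvPolynomial (Σ j, Fin (d j)) O)[X]).map
      (PolyRing.mk O d q L N : _ →+* PolyRing O d q L N) =
      deformPoly (PolyRing.coeff O d q L N j) :=
  deformPoly_map _ _

theorem PolyRing.dvd_expand (j : Fin r) : deformPoly (PolyRing.coeff O d q L N j) ∣
    expand _ q (deformPoly (PolyRing.coeff O d q L N j)) := by
  rw [dvd_iff_remVec (deformPoly_monic _) (deformPoly_degree_le _), ← map_mk_deformPoly,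
    ← map_expand]
  funext i
  rw [remVec_map _ (deformPoly_monic _)]
  exact mk_eq_zero _ _ _ _ _ (Submodule.mem_iSup_of_mem j (Ideal.subset_span (Or.inl ⟨i, rfl⟩)))

theorem PolyRing.dvd_pow (j : Fin r) :
    deformPoly (PolyRing.coeff O d q L N j) ∣ (X ^ L - 1) ^ N := by
  have h' : ((X ^ L - 1) ^ N : (PolyRing O d q L N)[X]) =
      ((X ^ L - 1) ^ N : (MvPolynomial (Σ j, Fin (d j)) O)[X]).map
        (PolyRing.mk O d q L N : _ →+* PolyRing O d q L N) := by
    simp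
  rw [dvd_iff_remVec (deformPoly_monic _) (deformPoly_degree_le _), ← map_mk_deformPoly, h']
  funext i
  rw [remVec_map _ (deformPoly_monic _)]
  exact mk_eq_zero _ _ _ _ _ (Submodule.mem_iSup_of_mem j (Ideal.subset_span (Or.inr ⟨i, rfl⟩)))

variable {O d q L N}

variable {A : Type} [CommRing A] [Algebra O A]

theorem PolyRing.exists_lift (c : ∀ j, Fin (d j) → A)
    (h1 : ∀ j, deformPoly (c j) ∣ expand A q (deformPoly (c j)))
    (h2 : ∀ j, deformPoly (c j) ∣ (X ^ L - 1) ^ N) :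
    ∃ f : PolyRing O d q L N →ₐ[O] A, ∀ j i, f (PolyRing.coeff O d q L N j i) = c j i := by
  let ev : MvPolynomial (Σ j, Fin (d j)) O →ₐ[O] A := MvPolynomial.aeval fun z => c z.1 z.2
  have hev (j) : (deformPoly fun i => MvPolynomial.X ⟨j, i⟩ :
      (MvPolynomial (Σ j, Fin (d j)) O)[X]).map (ev : _ →+* A) = deformPoly (c j) := by
    rw [deformPoly_map]; simp [ev]
  have hker : ∀ x ∈ polyIdeal O d q L N, ev x = 0 := by
    have : polyIdeal O d q L N ≤ RingHom.ker (ev : _ →+* A) := by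
      refine iSup_le fun j => ?_
      rw [Ideal.span_le]
      rintro _ (⟨i, rfl⟩ | ⟨i, rfl⟩) <;>
        rw [SetLike.mem_coe, RingHom.mem_ker, ← remVec_map _ (deformPoly_monic _)]
      · rw [map_expand, hev]
        exact congrFun ((dvd_iff_remVec (deformPoly_monic _) (deformPoly_degree_le _) _).1 (h1 j)) i
      · rw [hev]
        have := congrFun ((dvd_iff_remVec (deformPoly_monic _) (deformPoly_degree_le _) _).1
          (h2 j)) i
        simpa using this
    exact fun x hx => this hx
  refine ⟨Ideal.Quotient.liftₐ _ ev hker, fun j i => ?_⟩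
  change ev (MvPolynomial.X ⟨j, i⟩) = c j i
  simp [ev]

theorem PolyRing.algHom_ext {f g : PolyRing O d q L N →ₐ[O] A}
    (h : ∀ j i, f (PolyRing.coeff O d q L N j i) = g (PolyRing.coeff O d q L N j i)) : f = g := by
  have h1 : f.comp (PolyRing.mk O d q L N) = g.comp (PolyRing.mk O d q L N) :=
    MvPolynomial.algHom_ext fun z => h z.1 z.2
  ext x
  obtain ⟨x, rfl⟩ := PolyRing.mk_surjective O d q L N x
  exact DFunLike.congr_fun h1 x

theorem PolyRing.adjoin_coeff : Algebra.adjoin O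
    (Set.range fun z : Σ j, Fin (d j) => PolyRing.coeff O d q L N z.1 z.2)
      = ⊤ := by
  have h := congrArg (Subalgebra.map (PolyRing.mk O d q L N))
    (MvPolynomial.adjoin_range_X (R := O) (σ := Σ j, Fin (d j)))
  rw [AlgHom.map_adjoin, Algebra.map_top, (AlgHom.range_eq_top _).2
    (PolyRing.mk_surjective O d q L N), ← Set.range_comp] at h
  exact h

theorem PolyRing.isIntegral [NeZero L] : Algebra.IsIntegral O (PolyRing O d q L N) := by
  rw [← integralClosure_eq_top_iff, ← top_le_iff, ← PolyRing.adjoin_coeff, Algebra.adjoin_le_iff]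
  rintro _ ⟨⟨j, i⟩, rfl⟩
  have h1 : IsIntegral O ((deformPoly (PolyRing.coeff O d q L N j)).coeff i) := by
    refine isIntegral_coeff_of_dvd ((X ^ L - 1) ^ N) _ ?_ (deformPoly_monic _) ?_ _
    · exact (monic_X_pow_sub_C 1 (NeZero.ne L)).pow N
    · simpa using PolyRing.dvd_pow O d q L N j
  rw [deformPoly, coeff_add, coeff_sum_C_mul_X_pow] at h1
  have h2 : IsIntegral O (((X - 1) ^ d j : (PolyRing O d q L N)[X]).coeff i) := by
    have : ((X - 1) ^ d j : (PolyRing O d q L N)[X]) = ((X - 1) ^ d j : O[X]).map (algebraMap O _) := by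
      simp
    rw [this, coeff_map]
    exact isIntegral_algebraMap
  have := h1.sub h2
  rwa [add_sub_cancel_left] at this

instance [NeZero L] : Module.Finite O (PolyRing O d q L N) := by
  have := PolyRing.isIntegral (O := O) (d := d) (q := q) (L := L) (N := N)
  have : Algebra.FiniteType O (PolyRing O d q L N) :=
    Algebra.FiniteType.of_surjective _ (PolyRing.mk_surjective O d q L N)
  exact Algebra.IsIntegral.finite

theorem X_sub_one_dvd_pow_sub_one {A : Type} [CommRing A] (k : ℕ) :
    (X - 1 : A[X]) ∣ X ^ k - 1 := by
  simpa using sub_dvd_pow_sub_pow (X : A[X]) 1 k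

/-- The family `(X - 1) ^ d_j`. -/
theorem PolyRing.exists_trivial (hN : ∀ j, d j ≤ N) :
    ∃ f : PolyRing O d q L N →ₐ[O] O, ∀ j i, f (PolyRing.coeff O d q L N j i) = 0 := by
  have h0 (j) : deformPoly (fun _ : Fin (d j) => (0 : O)) = (X - 1) ^ d j := by
    simp [deformPoly]
  refine PolyRing.exists_lift (fun _ _ => 0) (fun j => ?_) (fun j => ?_)
  · rw [h0, map_pow]
    refine pow_dvd_pow_of_dvd ?_ _
    rw [map_sub, map_one, expand_X]
    exact X_sub_one_dvd_pow_sub_one q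
  · rw [h0]
    exact (pow_dvd_pow_of_dvd (X_sub_one_dvd_pow_sub_one L) _).trans (pow_dvd_pow _ (hN j))

section Local

variable [IsLocalRing O] {l a : ℕ}

/-- At a maximal ideal of the ring the polynomials `f_j` become `(X - 1) ^ d_j`. -/
theorem PolyRing.coeff_mem_of_isMaximal (hl : l.Prime) (hlO : (l : O) ∈ maximalIdeal O)
    (M : Ideal (PolyRing O d q (l ^ a) N)) [M.IsMaximal] (j : Fin r) (i : Fin (d j)) :
    PolyRing.coeff O d q (l ^ a) N j i ∈ M := by
  have : NeZero (l ^ a) := ⟨pow_ne_zero _ hl.ne_zero⟩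
  have := PolyRing.isIntegral (O := O) (d := d) (q := q) (L := l ^ a) (N := N)
  have hM : M.comap (algebraMap O _) = maximalIdeal O :=
    eq_maximalIdeal (Ideal.isMaximal_comap_of_isIntegral_of_isMaximal M)
  have hl0 : (l : PolyRing O d q (l ^ a) N ⧸ M) = 0 := by
    rw [← hM, Ideal.mem_comap, map_natCast, ← Ideal.Quotient.eq_zero_iff_mem, map_natCast] at hlO
    exact hlO
  let _ := Ideal.Quotient.field M
  have : Fact l.Prime := ⟨hl⟩
  have : CharP (PolyRing O d q (l ^ a) N ⧸ M) l := (CharP.charP_iff_prime_eq_zero hl).2 hl0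
  have h1 := deformPoly_map_dvd (Ideal.Quotient.mk M) (PolyRing.dvd_pow O d q (l ^ a) N j)
  rw [← one_pow (l ^ a), ← sub_pow_char_pow, ← pow_mul] at h1
  have hprime : Prime (X - 1 : (PolyRing O d q (l ^ a) N ⧸ M)[X]) := prime_X_sub_C 1
  obtain ⟨k, hk, hassoc⟩ := (dvd_prime_pow hprime _).1 h1
  have heq := eq_of_monic_of_associated (deformPoly_monic _) ((monic_X_sub_C 1).pow k) hassoc
  have hkd : k = d j := by
    have := congrArg natDegree heq
    rw [deformPoly_natDegree, (monic_X_sub_C (1 : PolyRing O d q (l ^ a) N ⧸ M)).natDegree_pow,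
      natDegree_X_sub_C, mul_one] at this
    exact this.symm
  have h0 : deformPoly (fun _ : Fin (d j) => (0 : PolyRing O d q (l ^ a) N ⧸ M)) =
    (X - 1) ^ d j := by simp [deformPoly]
  rw [hkd] at heq
  exact Ideal.Quotient.eq_zero_iff_mem.1 (congrFun (deformPoly_injective (heq.trans h0.symm)) i)

/-- Every maximal ideal of the ring is the preimage of the maximal ideal of `O` under the point
given by the polynomials `(X - 1) ^ d_j`. -/
theorem PolyRing.isMaximal_iff (hl : l.Prime) (hlO : (l : O) ∈ maximalIdeal O)
    (t : PolyRing O d q (l ^ a) N →ₐ[O] O)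
    (ht : ∀ j i, t (PolyRing.coeff O d q (l ^ a) N j i) = 0)
    (M : Ideal (PolyRing O d q (l ^ a) N)) :
    M.IsMaximal ↔ M = (maximalIdeal O).comap (t : _ →+* O) := by
  have hmax : ((maximalIdeal O).comap (t : PolyRing O d q (l ^ a) N →+* O)).IsMaximal :=
    Ideal.comap_isMaximal_of_surjective _ fun x => ⟨algebraMap O _ x, t.commutes x⟩
  refine ⟨fun hM => ?_, fun h => h ▸ hmax⟩
  have : NeZero (l ^ a) := ⟨pow_ne_zero _ hl.ne_zero⟩
  have := PolyRing.isIntegral (O := O) (d := d) (q := q) (L := l ^ a) (N := N)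
  have hMO : M.comap (algebraMap O _) = maximalIdeal O :=
    eq_maximalIdeal (Ideal.isMaximal_comap_of_isIntegral_of_isMaximal M)
  have hhom : Ideal.Quotient.mkₐ O M = (Algebra.ofId O _).comp t := by
    refine PolyRing.algHom_ext fun j i => ?_
    rw [AlgHom.comp_apply, ht, map_zero]
    exact Ideal.Quotient.eq_zero_iff_mem.2 (PolyRing.coeff_mem_of_isMaximal hl hlO M j i)
  refine (hmax.eq_of_le hM.ne_top fun x hx => ?_).symm
  have h1 : Ideal.Quotient.mk M x = Ideal.Quotient.mk M (algebraMap O _ (t x)) :=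
    DFunLike.congr_fun hhom x
  rw [← Ideal.Quotient.eq_zero_iff_mem, h1, Ideal.Quotient.eq_zero_iff_mem]
  have : t x ∈ M.comap (algebraMap O _) := by rw [hMO]; exact hx
  exact this

theorem PolyRing.isLocalRing (hl : l.Prime) (hlO : (l : O) ∈ maximalIdeal O)
    (hN : ∀ j, d j ≤ N) : IsLocalRing (PolyRing O d q (l ^ a) N) := by
  obtain ⟨t, ht⟩ := PolyRing.exists_trivial (O := O) (q := q) (L := l ^ a) hN
  exact IsLocalRing.of_unique_max_ideal
    ⟨_, (PolyRing.isMaximal_iff hl hlO t ht _).2 rfl, fun M hM =>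
      (PolyRing.isMaximal_iff hl hlO t ht M).1 hM⟩

end Local

end PolyRing

section Complete

open IsLocalRing

variable {O S : Type} [CommRing O] [IsLocalRing O] [IsNoetherianRing O] [CommRing S] [Algebra O S]
  [Module.Finite O S]

theorem isPrecomplete_of_finite {O : Type} [CommRing O] (I : Ideal O) [IsAdicComplete I O]
    (M : Type) [AddCommGroup M]
    [Module O M] [Module.Finite O M] : IsPrecomplete I M := by
  rw [← AdicCompletion.of_surjective_iff]
  intro x
  obtain ⟨y, rfl⟩ := AdicCompletion.ofTensorProduct_surjective_of_finite I M x
  induction y using TensorProduct.induction_on with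
  | zero => exact ⟨0, by simp⟩
  | tmul r m =>
    obtain ⟨r, rfl⟩ := AdicCompletion.of_surjective I O r
    refine ⟨r • m, ?_⟩
    rw [AdicCompletion.ofTensorProduct_tmul]
    rw [map_smul, ← algebraMap_smul (AdicCompletion I O) r]
    rfl
  | add x y hx hy =>
    obtain ⟨a, ha⟩ := hx
    obtain ⟨b, hb⟩ := hy
    exact ⟨a + b, by rw [map_add, map_add, ha, hb]⟩

theorem map_maximalIdeal_le [IsLocalRing S] :
    (maximalIdeal O).map (algebraMap O S) ≤ maximalIdeal S :=
  Ideal.map_le_iff_le_comap.2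
    (eq_maximalIdeal
    (Ideal.isMaximal_comap_of_isIntegral_of_isMaximal (R := O) (maximalIdeal S))).ge

theorem exists_maximalIdeal_pow_le_map [IsLocalRing S] [Finite (IsLocalRing.ResidueField O)] :
    ∃ k, maximalIdeal S ^ k ≤ (maximalIdeal O).map (algebraMap O S) := by
  have : IsNoetherianRing S := IsNoetherianRing.of_finite O S
  have : Module.Finite (O ⧸ maximalIdeal O) (S ⧸ (maximalIdeal O).map (algebraMap O S)) :=
    Module.Finite.of_restrictScalars_finite O _ _
  have : Finite (O ⧸ maximalIdeal O) := ‹Finite (IsLocalRing.ResidueField O)›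
  have : Finite (S ⧸ (maximalIdeal O).map (algebraMap O S)) :=
    Module.finite_of_finite (O ⧸ maximalIdeal O)
  exact exists_maximalIdeal_pow_le _
    (ne_top_of_le_ne_top (Ideal.IsPrime.ne_top inferInstance) map_maximalIdeal_le)

/-- A local ring that is finite over a complete noetherian local ring with finite residue field is
complete. -/
theorem isAdicComplete_of_finite [IsLocalRing S] [Finite (IsLocalRing.ResidueField O)]
    [IsAdicComplete (maximalIdeal O) O] : IsAdicComplete (maximalIdeal S) S := by
  have : IsNoetherianRing S := IsNoetherianRing.of_finite O S
  have hle := map_maximalIdeal_le (O := O) (S := S)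
  obtain ⟨k, hk⟩ := exists_maximalIdeal_pow_le_map (O := O) (S := S)
  have hpre := isPrecomplete_of_finite (maximalIdeal O) S
  have hsm (n) : (maximalIdeal O ^ n • ⊤ : Submodule O S) =
      ((maximalIdeal O).map (algebraMap O S) ^ n).restrictScalars O := by
    rw [Ideal.smul_top_eq_map, Ideal.map_pow]
  refine { haus' := (inferInstance : IsHausdorff (maximalIdeal S) S).haus', prec' := ?_ }
  intro f hf
  have hf' : ∀ {m n : ℕ}, m ≤ n → f m - f n ∈ maximalIdeal S ^ m := fun h => by
    have := hf h
    rwa [SModEq.sub_mem, smul_eq_mul, Ideal.mul_top] at this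
  obtain ⟨c, hc⟩ := hpre.prec (f := fun n => f (k * n)) (fun {m n} h => by
    rw [SModEq.sub_mem, hsm, Submodule.restrictScalars_mem]
    have := hf' (Nat.mul_le_mul_left k h)
    rw [pow_mul] at this
    exact Ideal.pow_right_mono hk m this)
  refine ⟨c, fun n => ?_⟩
  rw [SModEq.sub_mem, smul_eq_mul, Ideal.mul_top]
  have h1 := hc n
  rw [SModEq.sub_mem, hsm, Submodule.restrictScalars_mem] at h1
  have h2 := Ideal.pow_right_mono hle n h1
  rcases le_total n (k * n) with h | h
  · rw [← sub_add_sub_cancel _ (f (k * n)) c]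
    exact Ideal.add_mem _ (hf' h) h2
  · -- here `k ≤ 1`, and the case `k = 0` is degenerate
    rcases Nat.eq_zero_or_pos k with h0 | h0
    · rw [h0, pow_zero, Ideal.one_eq_top, top_le_iff] at hk
      exact absurd (top_le_iff.1 (hk ▸ hle)) (Ideal.IsPrime.ne_top inferInstance)
    · have : k * n = n := le_antisymm h (Nat.le_mul_of_pos_left n h0)
      rwa [this] at h2

end Complete

/-! ### Companion matrices and semilinear maps -/

section Companion

open Polynomial Matrix

variable {A : Type} [CommRing A] {d : ℕ}

theorem remVec_sum (f : A[X]) {ι : Type} (s : Finset ι) (a : ι → A) (g : ι → A[X]) :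
    remVec f d (∑ i ∈ s, C (a i) * g i) = ∑ i ∈ s, a i • remVec f d (g i) := by
  have h (p) : remVec f d p = (LinearMap.pi fun i : Fin d => lcoeff A i ∘ₗ modByMonicHom f) p := rfl
  simp only [h, ← smul_eq_C_mul, map_sum, map_smul]

theorem remVec_eq_of_dvd {f : A[X]} (hf : f.Monic) {p p' : A[X]} (h : f ∣ p - p') :
    remVec f d p = remVec f d p' := by
  have := (modByMonic_eq_zero_iff_dvd hf).2 h
  rw [sub_modByMonic, sub_eq_zero] at this
  funext i
  rw [remVec, this]; rfl

/-- The polynomial of degree less than `d` with given coefficients. -/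
def vecPoly (v : Fin d → A) : A[X] := ∑ i, C (v i) * X ^ (i : ℕ)

theorem remVec_vecPoly (c v : Fin d → A) : remVec (deformPoly c) d (vecPoly v) = v := by
  nontriviality A
  funext i
  rw [remVec, (modByMonic_eq_self_iff (deformPoly_monic c)).2, vecPoly, coeff_sum_C_mul_X_pow]
  rw [deformPoly_degree]
  exact degree_sum_C_mul_X_pow_lt v

theorem vecPoly_remVec (c : Fin d → A) (p : A[X]) :
    vecPoly (remVec (deformPoly c) d p) = p %ₘ deformPoly c := by
  nontriviality A
  ext k
  by_cases hk : k < d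
  · exact coeff_sum_C_mul_X_pow (remVec (deformPoly c) d p) ⟨k, hk⟩
  · have hk' : (d : WithBot ℕ) ≤ k := by exact_mod_cast not_lt.1 hk
    rw [vecPoly, coeff_eq_zero_of_degree_lt ((degree_sum_C_mul_X_pow_lt _).trans_le hk'),
      coeff_eq_zero_of_degree_lt]
    refine (degree_modByMonic_lt p (deformPoly_monic c)).trans_le ?_
    rwa [deformPoly_degree]

theorem remVec_X_pow (c : Fin d → A) (i : Fin d) :
    remVec (deformPoly c) d (X ^ (i : ℕ)) = Pi.single i 1 := by
  have h : vecPoly (Pi.single i 1 : Fin d → A) = X ^ (i : ℕ) := by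
    rw [vecPoly, Finset.sum_eq_single i]
    · simp
    · intro j _ hj; simp [hj]
    · simp
  rw [← h, remVec_vecPoly]

/-- The matrix of multiplication by `X` on `A[X] / f`, for `f = deformPoly c`. -/
def compMat (c : Fin d → A) : Matrix (Fin d) (Fin d) A :=
  of fun i j => remVec (deformPoly c) d (X ^ ((j : ℕ) + 1)) i

/-- The matrix of the map `p ↦ p (X ^ q) w` on `A[X] / f`, for `f = deformPoly c`. -/
def frobMat (q : ℕ) (c w : Fin d → A) : Matrix (Fin d) (Fin d) A :=
  of fun i j => remVec (deformPoly c) d (X ^ (q * (j : ℕ)) * vecPoly w) i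

theorem compMat_mulVec (c : Fin d → A) (p : A[X]) :
    compMat c *ᵥ remVec (deformPoly c) d p = remVec (deformPoly c) d (X * p) := by
  have h1 : remVec (deformPoly c) d (X * p) =
      remVec (deformPoly c) d (X * (p %ₘ deformPoly c)) := by
    refine remVec_eq_of_dvd (deformPoly_monic c) ?_
    rw [← mul_sub]
    refine Dvd.dvd.mul_left ⟨p /ₘ deformPoly c, ?_⟩ _
    rw [sub_eq_iff_eq_add', modByMonic_add_div]
  rw [h1, ← vecPoly_remVec, vecPoly, Finset.mul_sum]
  have h2 (i : Fin d) : (X * (C (remVec (deformPoly c) d p i) * X ^ (i : ℕ)) : A[X]) =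
      C (remVec (deformPoly c) d p i) * X ^ ((i : ℕ) + 1) := by ring
  simp only [h2]
  rw [remVec_sum, mulVec_eq_sum]
  refine Finset.sum_congr rfl fun i _ => ?_
  ext k; simp [compMat, mul_comm]

theorem frobMat_mulVec {q : ℕ} {c : Fin d → A} (hc : deformPoly c ∣ expand A q (deformPoly c))
    (w : Fin d → A) (p : A[X]) :
    frobMat q c w *ᵥ remVec (deformPoly c) d p =
      remVec (deformPoly c) d (expand A q p * vecPoly w) := by
  have h1 : remVec (deformPoly c) d (expand A q p * vecPoly w) =
      remVec (deformPoly c) d (expand A q (p %ₘ deformPoly c) * vecPoly w) := by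
    refine remVec_eq_of_dvd (deformPoly_monic c) ?_
    have h3 : deformPoly c ∣ p - p %ₘ deformPoly c :=
      ⟨p /ₘ deformPoly c, by rw [sub_eq_iff_eq_add', modByMonic_add_div]⟩
    rw [← sub_mul, ← map_sub]
    obtain ⟨k, hk⟩ := h3
    refine Dvd.dvd.mul_right (hc.trans ⟨expand A q k, ?_⟩) _
    rw [hk, map_mul]
  rw [h1, ← vecPoly_remVec, vecPoly, map_sum, Finset.sum_mul]
  have h2 (i : Fin d) : (expand A q (C (remVec (deformPoly c) d p i) * X ^ (i : ℕ)) * vecPoly w) =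
      C (remVec (deformPoly c) d p i) * (X ^ (q * (i : ℕ)) * vecPoly w) := by
    rw [map_mul, expand_C, map_pow, expand_X, pow_mul]; ring
  simp only [h2]
  rw [remVec_sum, mulVec_eq_sum]
  refine Finset.sum_congr rfl fun i _ => ?_
  ext k; simp [frobMat, mul_comm]

theorem aeval_compMat_mulVec (c : Fin d → A) (g p : A[X]) :
    aeval (compMat c) g *ᵥ remVec (deformPoly c) d p = remVec (deformPoly c) d (g * p) := by
  have hpow (k : ℕ) : compMat c ^ k *ᵥ remVec (deformPoly c) d p =
      remVec (deformPoly c) d (X ^ k * p) := by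
    induction k with
    | zero => simp
    | succ k ih => rw [pow_succ', ← mulVec_mulVec, ih, compMat_mulVec, pow_succ', mul_assoc]
  rw [aeval_eq_sum_range, sum_mulVec]
  conv_rhs => rw [as_sum_range_C_mul_X_pow g, Finset.sum_mul]
  simp only [mul_assoc]
  rw [remVec_sum]
  refine Finset.sum_congr rfl fun i _ => ?_
  rw [smul_mulVec, hpow]

theorem matrix_ext_remVec (c : Fin d → A) {M M' : Matrix (Fin d) (Fin d) A}
    (h : ∀ p, M *ᵥ remVec (deformPoly c) d p = M' *ᵥ remVec (deformPoly c) d p) : M = M' := by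
  refine Matrix.ext_of_mulVec_single fun i => ?_
  rw [← remVec_X_pow c i, h]

theorem aeval_compMat_eq_zero {c : Fin d → A} {g : A[X]} (h : deformPoly c ∣ g) :
    aeval (compMat c) g = 0 := by
  refine matrix_ext_remVec c fun p => ?_
  rw [aeval_compMat_mulVec, zero_mulVec, ← dvd_iff_remVec (deformPoly_monic c)
    (deformPoly_degree_le c)]
  exact h.mul_right p

theorem dvd_of_aeval_compMat_eq_zero {c : Fin d → A} {g : A[X]} (h : aeval (compMat c) g = 0) :
    deformPoly c ∣ g := by
  rw [dvd_iff_remVec (deformPoly_monic c) (deformPoly_degree_le c), ← mul_one g,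
    ← aeval_compMat_mulVec, h, zero_mulVec]

theorem frobMat_mul_compMat {q : ℕ} {c : Fin d → A}
    (hc : deformPoly c ∣ expand A q (deformPoly c)) (w : Fin d → A) :
    frobMat q c w * compMat c = compMat c ^ q * frobMat q c w := by
  refine matrix_ext_remVec c fun p => ?_
  have hX : compMat c ^ q = aeval (compMat c) (X ^ q : A[X]) := by simp
  rw [← mulVec_mulVec, ← mulVec_mulVec, compMat_mulVec, frobMat_mulVec hc, frobMat_mulVec hc, hX,
    aeval_compMat_mulVec, map_mul, expand_X, mul_assoc]

theorem compMat_injective {c c' : Fin d → A} (h : compMat c = compMat c') : c = c' := by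
  cases subsingleton_or_nontrivial A
  · exact Subsingleton.elim _ _
  have h1 : deformPoly c' ∣ deformPoly c :=
    dvd_of_aeval_compMat_eq_zero (by rw [← h]; exact aeval_compMat_eq_zero dvd_rfl)
  have h2 : deformPoly c = deformPoly c' := by
    refine eq_of_monic_of_dvd_of_natDegree_le (deformPoly_monic c') (deformPoly_monic c) h1 ?_
    rw [deformPoly_natDegree, deformPoly_natDegree]
  exact deformPoly_injective h2

theorem compMat_mulVec_single (c : Fin d → A) (i : Fin d) (h : (i : ℕ) + 1 < d) :
    compMat c *ᵥ Pi.single i 1 = Pi.single ⟨i + 1, h⟩ 1 := by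
  rw [← remVec_X_pow c i, compMat_mulVec, ← pow_succ', ← remVec_X_pow c ⟨i + 1, h⟩]

theorem frobMat_mulVec_single_zero [NeZero d] (q : ℕ) (c w : Fin d → A) :
    frobMat q c w *ᵥ Pi.single 0 1 = w := by
  ext i
  simp [frobMat, remVec_vecPoly]

theorem compMat_pow_mulVec_single_zero [NeZero d] (c : Fin d → A) (i : Fin d) :
    compMat c ^ (i : ℕ) *ᵥ Pi.single 0 1 = Pi.single i 1 := by
  have hX : compMat c ^ (i : ℕ) = aeval (compMat c) (X ^ (i : ℕ) : A[X]) := by simp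
  rw [← remVec_X_pow c i, ← remVec_X_pow c 0, hX, aeval_compMat_mulVec]
  simp

/-- A matrix that takes each basis vector, except for the last one, to the next one is a companion
matrix. -/
theorem exists_eq_compMat (D : Matrix (Fin d) (Fin d) A)
    (hD : ∀ (i : Fin d) (h : (i : ℕ) + 1 < d), D *ᵥ Pi.single i 1 = Pi.single ⟨i + 1, h⟩ 1) :
    ∃ c, D = compMat c := by
  nontriviality A
  rcases Nat.eq_zero_or_pos d with rfl | hd
  · exact ⟨0, Subsingleton.elim _ _⟩
  set v : Fin d → A := D *ᵥ Pi.single ⟨d - 1, by omega⟩ 1 with hv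
  have hdeg := degree_sum_C_mul_X_pow_lt v
  have hmon : (X ^ d - vecPoly v).Monic := (monic_X_pow d).sub_of_left (by rwa [degree_X_pow])
  obtain ⟨c, hc⟩ := exists_eq_deformPoly (d := d) hmon (by
    refine natDegree_eq_of_degree_eq_some ?_
    rw [degree_sub_eq_left_of_degree_lt, degree_X_pow]
    rwa [degree_X_pow])
  refine ⟨c, Matrix.ext_of_mulVec_single fun i => ?_⟩
  by_cases h : (i : ℕ) + 1 < d
  · rw [hD i h, compMat_mulVec_single c i h]
  · have hi : i = ⟨d - 1, by omega⟩ := Fin.ext (by simp; omega)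
    rw [hi, ← hv, ← remVec_X_pow c, compMat_mulVec, ← pow_succ']
    rw [show (⟨d - 1, by omega⟩ : Fin d).1 + 1 = d by simp; omega]
    rw [remVec_eq_of_dvd (deformPoly_monic c) (p' := vecPoly v) (by rw [hc]), remVec_vecPoly]

/-- A matrix `P` with `P D = D ^ q P`, for a companion matrix `D`, is the matrix of a semilinear
map. -/
theorem exists_eq_frobMat {q : ℕ} {c : Fin d → A} {P : Matrix (Fin d) (Fin d) A}
    (hP : P * compMat c = compMat c ^ q * P) : ∃ w, P = frobMat q c w := by
  rcases Nat.eq_zero_or_pos d with rfl | hd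
  · exact ⟨0, Subsingleton.elim _ _⟩
  have : NeZero d := ⟨hd.ne'⟩
  refine ⟨P *ᵥ Pi.single 0 1, Matrix.ext_of_mulVec_single fun i => ?_⟩
  have hpow (k : ℕ) : P * compMat c ^ k = compMat c ^ (q * k) * P := by
    induction k with
    | zero => simp
    | succ k ih => rw [pow_succ, ← mul_assoc, ih, mul_assoc, hP, ← mul_assoc, ← pow_add]; rfl
  have hX : compMat c ^ (q * (i : ℕ)) = aeval (compMat c) (X ^ (q * (i : ℕ)) : A[X]) := by simp
  rw [← compMat_pow_mulVec_single_zero c i, mulVec_mulVec, hpow, ← mulVec_mulVec, hX]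
  conv_lhs => rw [← remVec_vecPoly c (P *ᵥ Pi.single 0 1), aeval_compMat_mulVec]
  rw [compMat_pow_mulVec_single_zero]
  ext k
  simp [frobMat]

theorem dvd_expand_of_isUnit {q : ℕ} {c : Fin d → A} {P : Matrix (Fin d) (Fin d) A}
    (hu : IsUnit P) (hP : P * compMat c = compMat c ^ q * P) :
    deformPoly c ∣ expand A q (deformPoly c) := by
  refine dvd_of_aeval_compMat_eq_zero ?_
  have hconj (g : A[X]) : P * aeval (compMat c) g = aeval (compMat c ^ q) g * P := by
    have hpow (k : ℕ) : P * compMat c ^ k = (compMat c ^ q) ^ k * P := by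
      induction k with
      | zero => simp
      | succ k ih => rw [pow_succ, ← mul_assoc, ih, mul_assoc, hP, ← mul_assoc, ← pow_succ]
    rw [aeval_eq_sum_range, aeval_eq_sum_range, Finset.mul_sum, Finset.sum_mul]
    exact Finset.sum_congr rfl fun k _ => by rw [mul_smul_comm, hpow, smul_mul_assoc]
  have h := hconj (deformPoly c)
  rw [aeval_compMat_eq_zero dvd_rfl, mul_zero] at h
  rw [expand_aeval]
  exact (hu.mul_left_eq_zero).1 h.symm

theorem compMat_map {B : Type} [CommRing B] (φ : A →+* B) (c : Fin d → A) :
    (compMat c).map φ = compMat fun i => φ (c i) := by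
  ext i j
  simp only [compMat, map_apply, of_apply]
  rw [← remVec_map φ (deformPoly_monic c), deformPoly_map]
  simp

theorem frobMat_map {B : Type} [CommRing B] (φ : A →+* B) (q : ℕ) (c w : Fin d → A) :
    (frobMat q c w).map φ = frobMat q (fun i => φ (c i)) fun i => φ (w i) := by
  ext i j
  simp only [frobMat, map_apply, of_apply]
  rw [← remVec_map φ (deformPoly_monic c), deformPoly_map]
  simp [vecPoly, Polynomial.map_sum]

end Companion

/-! ### Matrices over a nilpotent thickening of a field -/

section Thickening

open Polynomial Matrix

variable {A 𝔽 : Type} [CommRing A] [Field 𝔽] {π : A →+* 𝔽}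
variable {m : Type} [Fintype m] [DecidableEq m]

theorem isUnit_of_isUnit_map [IsLocalHom π] {M : Matrix m m A} (h : IsUnit (M.map π)) :
    IsUnit M := by
  rw [Matrix.isUnit_iff_isUnit_det] at h ⊢
  have h1 : (M.map π).det = π M.det := (RingHom.map_det π M).symm
  rw [h1] at h
  exact isUnit_of_map_unit π _ h

theorem isNilpotent_of_map_eq_zero {k : ℕ} (hπ : RingHom.ker π ^ k = ⊥) {M : Matrix m m A}
    (h : M.map π = 0) : IsNilpotent M := by
  refine ⟨k, ?_⟩
  have hpow : ∀ j i i', (M ^ j) i i' ∈ RingHom.ker π ^ j := fun j => by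
    induction j with
    | zero => intro i i'; simp
    | succ j ih =>
      intro i i'
      rw [pow_succ M, mul_apply, pow_succ]
      refine Ideal.sum_mem _ fun x _ => Ideal.mul_mem_mul (ih i x) ?_
      exact congrFun (congrFun h x) i'
  ext i i'
  have := hpow k i i'
  rwa [hπ] at this

/-- The congruence kernel of a matrix group over a nilpotent thickening of a field of
characteristic `l` consists of elements of `l`-power order. -/
theorem exists_pow_prime_pow_eq_one {l : ℕ} (hl : l.Prime) [CharP 𝔽 l] {k : ℕ}
    (hπ : RingHom.ker π ^ k = ⊥) {M : Matrix m m A} (h : M.map π = 1) :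
    ∃ e, M ^ l ^ e = 1 := by
  obtain ⟨s, hs⟩ : IsNilpotent (M - 1) := isNilpotent_of_map_eq_zero hπ (by
    ext i j
    have := congrFun (congrFun h i) j
    simp only [map_apply] at this
    simp [this, Matrix.one_apply, apply_ite π])
  have hl0 : (l : A) ^ k = 0 := by
    have : (l : A) ∈ RingHom.ker π := by rw [RingHom.mem_ker, map_natCast, CharP.cast_eq_zero]
    have := Ideal.pow_mem_pow this k
    rwa [hπ] at this
  -- work in the commutative ring generated by the matrix
  let T := Algebra.adjoin A {M}
  let x : T := ⟨M, Algebra.self_mem_adjoin_singleton A M⟩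
  have hcomm : IsMulCommutative T := Algebra.isMulCommutative_adjoin A (by
    rintro a rfl b rfl; rfl)
  let _ : CommRing T :=
    { (inferInstance : Ring T) with mul_comm := fun a b => hcomm.is_comm.comm a b }
  have hx : (x - 1) ^ s = 0 := Subtype.ext hs
  have hlT : (l : T) ^ k = 0 := by
    have := congrArg (algebraMap A T) hl0
    simpa using this
  obtain ⟨y, hy⟩ := exists_add_pow_prime_pow_eq hl (x - 1) 1 s
  rw [sub_add_cancel, one_pow] at hy
  have h0 : (x - 1) ^ l ^ s = 0 :=
    pow_eq_zero_of_le (Nat.lt_pow_self hl.one_lt).le hx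
  have hdvd : (l : T) ∣ x ^ l ^ s - 1 := ⟨(x - 1) * 1 * y, by rw [hy, h0]; ring⟩
  have h2 := dvd_sub_pow_of_dvd_sub hdvd k
  rw [one_pow, pow_succ, hlT, zero_mul, zero_dvd_iff, sub_eq_zero, ← pow_mul, ← pow_add] at h2
  exact ⟨s + k, congrArg Subtype.val h2⟩

/-- Matrices with different eigenvalues have no intertwiners. -/
theorem eq_zero_of_intertwine {n : Type} [Fintype n] [DecidableEq n] {s : A} {M : Matrix m m A}
    {N : Matrix n n A} {Z : Matrix m n A} (hM : IsNilpotent (M - s • 1))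
    (hN : IsUnit (N - s • 1)) (h : M * Z = Z * N) : Z = 0 := by
  have h1 : (M - s • 1) * Z = Z * (N - s • 1) := by
    rw [Matrix.sub_mul, Matrix.mul_sub, h]; simp
  have h2 (k : ℕ) : (M - s • 1) ^ k * Z = Z * (N - s • 1) ^ k := by
    induction k with
    | zero => simp
    | succ k ih => rw [pow_succ, Matrix.mul_assoc, h1, ← Matrix.mul_assoc, ih, Matrix.mul_assoc,
        ← pow_succ]
  obtain ⟨k, hk⟩ := hM
  obtain ⟨u, hu⟩ := hN.pow k
  have h3 := h2 k
  rw [hk, Matrix.zero_mul, ← hu] at h3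
  have := congrArg (· * ((u⁻¹ : (Matrix n n A)ˣ) : Matrix n n A)) h3
  simpa [Matrix.mul_assoc] using this.symm

end Thickening

section Blocks

open Matrix

variable {A : Type} [CommRing A] {r : ℕ} {d : Fin r → ℕ}

/-- Block matrices whose diagonal blocks are square of sizes `d j`. -/
abbrev BlockMat {r : ℕ} (d : Fin r → ℕ) (A : Type) : Type :=
  Matrix (Σ j, Fin (d j)) (Σ j, Fin (d j)) A

/-- The blocks of a matrix. -/
def block (M : BlockMat d A) (i j : Fin r) :
    Matrix (Fin (d i)) (Fin (d j)) A := of fun a b => M ⟨i, a⟩ ⟨j, b⟩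

theorem block_ext {A : Type} {M N : BlockMat d A}
    (h : ∀ i j, block M i j = block N i j) : M = N := by
  ext ⟨i, a⟩ ⟨j, b⟩
  exact congrFun (congrFun (h i j) a) b

theorem block_blockDiagonal'_mul (D : ∀ j, Matrix (Fin (d j)) (Fin (d j)) A)
    (M : BlockMat d A) (i j : Fin r) :
    block (blockDiagonal' D * M) i j = D i * block M i j := by
  ext a b
  simp only [block, of_apply, mul_apply, Fintype.sum_sigma]
  rw [Finset.sum_eq_single i]
  · simp
  · intro k _ hk
    refine Finset.sum_eq_zero fun x _ => ?_
    rw [blockDiagonal'_apply_ne _ _ _ (Ne.symm hk), zero_mul]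
  · simp

theorem block_mul_blockDiagonal' (D : ∀ j, Matrix (Fin (d j)) (Fin (d j)) A)
    (M : BlockMat d A) (i j : Fin r) :
    block (M * blockDiagonal' D) i j = block M i j * D j := by
  ext a b
  simp only [block, of_apply, mul_apply, Fintype.sum_sigma]
  rw [Finset.sum_eq_single j]
  · simp
  · intro k _ hk
    refine Finset.sum_eq_zero fun x _ => ?_
    rw [blockDiagonal'_apply_ne _ _ _ hk, mul_zero]
  · simp

theorem block_blockDiagonal'_self (D : ∀ j, Matrix (Fin (d j)) (Fin (d j)) A) (i : Fin r) :
    block (blockDiagonal' D) i i = D i := by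
  ext a b; simp [block]

theorem block_blockDiagonal'_ne (D : ∀ j, Matrix (Fin (d j)) (Fin (d j)) A) {i j : Fin r}
    (h : i ≠ j) : block (blockDiagonal' D) i j = 0 := by
  ext a b; simp [block, blockDiagonal'_apply_ne _ _ _ h]

theorem block_one_self (i : Fin r) :
    block (1 : BlockMat d A) i i = 1 := by
  rw [← blockDiagonal'_one, block_blockDiagonal'_self]; rfl

theorem block_one_ne {i j : Fin r} (h : i ≠ j) :
    block (1 : BlockMat d A) i j = 0 := by
  rw [← blockDiagonal'_one, block_blockDiagonal'_ne _ h]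

theorem block_mul (M N : BlockMat d A) (i j : Fin r) :
    block (M * N) i j = ∑ k, block M i k * block N k j := by
  ext a b
  simp [block, mul_apply, Fintype.sum_sigma, Matrix.sum_apply]

theorem block_map {B : Type} [CommRing B] (φ : A →+* B)
    (M : BlockMat d A) (i j : Fin r) :
    block (M.map φ) i j = (block M i j).map φ := rfl

theorem eq_blockDiagonal'_of_block {M : BlockMat d A}
    (h : ∀ i j, i ≠ j → block M i j = 0) : M = blockDiagonal' fun j => block M j j := by
  refine block_ext fun i j => ?_
  by_cases hij : i = j
  · subst hij; rw [block_blockDiagonal'_self]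
  · rw [h i j hij, block_blockDiagonal'_ne _ hij]

end Blocks

section NormalForm

open Matrix Polynomial

variable {A 𝔽 : Type} [CommRing A] [Field 𝔽] {π : A →+* 𝔽} [IsLocalHom π]
variable {r : ℕ} {d : Fin r → ℕ} [∀ j, NeZero (d j)] {q : ℕ}

/-- The block diagonal matrix of multiplication by `X` on `⨁ A[X] / f_j`. -/
def compMats (c : ∀ j, Fin (d j) → A) : BlockMat d A :=
  blockDiagonal' fun j => compMat (c j)

/-- The block diagonal matrix of the map `p ↦ p (X ^ q) w` on `⨁ A[X] / f_j`. -/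
def frobMats (q : ℕ) (c w : ∀ j, Fin (d j) → A) : BlockMat d A :=
  blockDiagonal' fun j => frobMat q (c j) (w j)

/-- The condition on a matrix that its `(j, 0)`-th column agrees with the standard basis vector in
the coordinates `(j, i)`. -/
def IsMasked (B : BlockMat d A) : Prop :=
  ∀ j, block B j j *ᵥ Pi.single 0 1 = Pi.single 0 1

/-- Uniqueness of the normal form of a lift. -/
theorem normalForm_unique {k : ℕ} (hπ : RingHom.ker π ^ k = ⊥) (hsurj : Function.Surjective π)
    {wbar : ∀ j, Fin (d j) → 𝔽} {α : Fin r → 𝔽} (hα : Function.Injective α)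
    (hnil : ∀ j, IsNilpotent (frobMat q (fun _ => 0) (wbar j) - α j • 1))
    {c c' w w' : ∀ j, Fin (d j) → A} {B B' P : BlockMat d A}
    (hc : ∀ j i, π (c j i) = 0) (hc' : ∀ j i, π (c' j i) = 0)
    (hw : ∀ j i, π (w j i) = wbar j i) (hw' : ∀ j i, π (w' j i) = wbar j i)
    (hB : B.map π = 1) (hmB : IsMasked B) (hmB' : IsMasked B') (hP : B * P = B')
    (hC : compMats c * P = P * compMats c') (hF : frobMats q c w * P = P * frobMats q c' w') :
    c = c' ∧ w = w' ∧ B = B' := by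
  have hmapF : ∀ (c w : ∀ j, Fin (d j) → A), (∀ j i, π (c j i) = 0) →
      (∀ j i, π (w j i) = wbar j i) → ∀ j (s : A),
      (frobMat q (c j) (w j) - s • 1).map π = frobMat q (fun _ => 0) (wbar j) - π s • 1 := by
    intro c w hc hw j s
    rw [Matrix.map_sub π (map_sub π), frobMat_map]
    simp only [hc, hw]
    congr 1
    ext i i'
    simp [Matrix.one_apply, apply_ite π]
  have hoff : ∀ i j, i ≠ j → block P i j = 0 := by
    intro i j hij
    obtain ⟨s, hs⟩ := hsurj (α i)
    have h1 := congrArg (fun M => block M i j) hF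
    simp only [frobMats, block_blockDiagonal'_mul, block_mul_blockDiagonal'] at h1
    refine eq_zero_of_intertwine (s := s) ?_ ?_ h1
    · obtain ⟨e, he⟩ := hnil i
      have h2 : ((frobMat q (c i) (w i) - s • 1) ^ e).map π = 0 := by
        have := map_pow (RingHom.mapMatrix π) (frobMat q (c i) (w i) - s • 1) e
        simp only [RingHom.mapMatrix_apply] at this
        rw [this, hmapF c w hc hw, hs, he]
      obtain ⟨e', he'⟩ := isNilpotent_of_map_eq_zero hπ h2
      exact ⟨e * e', by rw [pow_mul, he']⟩
    · refine isUnit_of_isUnit_map (π := π) ?_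
      rw [hmapF c' w' hc' hw', hs]
      have h3 : frobMat q (fun _ => 0) (wbar j) - α i • 1 =
          (α j - α i) • 1 + (frobMat q (fun _ => 0) (wbar j) - α j • 1) := by
        rw [sub_smul]; abel
      rw [h3]
      have hne : α j - α i ≠ 0 := sub_ne_zero.2 fun h => hij (hα h).symm
      refine (hnil j).isUnit_add_left_of_commute ?_ ?_
      · exact ⟨⟨(α j - α i) • 1, (α j - α i)⁻¹ • 1, by simp [smul_smul, hne], by
          simp [smul_smul, hne]⟩, rfl⟩
      · exact (Commute.one_right _).smul_right _
  have hdiag : ∀ j, block P j j = 1 := by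
    intro j
    have hu : IsUnit (block B j j) := by
      refine isUnit_of_isUnit_map (π := π) ?_
      rw [← block_map, hB, block_one_self]
      exact isUnit_one
    have h1 : block B j j * block P j j = block B' j j := by
      rw [← hP, block_mul, Finset.sum_eq_single j]
      · intro k _ hk; rw [hoff k j hk, Matrix.mul_zero]
      · simp
    have h0 : block P j j *ᵥ Pi.single 0 1 = Pi.single 0 1 := by
      refine Matrix.mulVec_injective_of_isUnit hu ?_
      change block B j j *ᵥ _ = block B j j *ᵥ _
      rw [mulVec_mulVec, h1, hmB' j, hmB j]
    have h2 := congrArg (fun M => block M j j) hC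
    simp only [compMats, block_blockDiagonal'_mul, block_mul_blockDiagonal'] at h2
    have h3 (e : ℕ) : compMat (c j) ^ e * block P j j = block P j j * compMat (c' j) ^ e := by
        induction e with
        | zero => simp
        | succ e ih => rw [pow_succ, mul_assoc, h2, ← mul_assoc, ih, mul_assoc, ← pow_succ]
    refine Matrix.ext_of_mulVec_single fun i => ?_
    rw [one_mulVec]
    conv_lhs => rw [← compMat_pow_mulVec_single_zero (c' j) i, mulVec_mulVec, ← h3,
      ← mulVec_mulVec, h0, compMat_pow_mulVec_single_zero]
  have hP1 : P = 1 := block_ext fun i j => by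
    by_cases hij : i = j
    · subst hij; rw [hdiag, block_one_self]
    · rw [hoff i j hij, block_one_ne hij]
  rw [hP1, mul_one, one_mul] at hC hF
  rw [hP1, mul_one] at hP
  have hcc : c = c' := funext fun j => compMat_injective (congrFun (blockDiagonal'_injective hC) j)
  refine ⟨hcc, funext fun j => ?_, hP⟩
  have := congrArg (fun M => M *ᵥ Pi.single 0 1) (congrFun (blockDiagonal'_injective hF) j)
  simpa only [frobMat_mulVec_single_zero] using this

end NormalForm

section Existence

open Matrix Polynomial

variable {r : ℕ} {d : Fin r → ℕ}

theorem aeval_diagonal {K m : Type} [CommRing K] [Fintype m] [DecidableEq m] (v : m → K)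
    (p : K[X]) : aeval (diagonal v) p = diagonal fun x => p.eval (v x) := by
  have h : diagonal v = diagonalAlgHom K v := rfl
  rw [h, aeval_algHom_apply]
  change diagonal (aeval v p) = _
  congr 1
  funext x
  simp [aeval_def, eval₂_eq_eval_map]

/-- The projection to the `j`-th block. -/
def blockProj (A : Type) [CommRing A] (d : Fin r → ℕ) (j : Fin r) :
    BlockMat d A :=
  diagonal fun x => if x.1 = j then 1 else 0

theorem blockProj_map {A B : Type} [CommRing A] [CommRing B] (φ : A →+* B) (j : Fin r) :
    (blockProj A d j).map φ = blockProj B d j := by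
  rw [blockProj, diagonal_map (map_zero φ), blockProj]
  congr 1
  funext x
  simp [apply_ite φ]

theorem blockProj_complete (A : Type) [CommRing A] :
    CompleteOrthogonalIdempotents (blockProj A d) := by
  refine ⟨⟨fun j => ?_, fun i j hij => ?_⟩, ?_⟩
  · rw [IsIdempotentElem, blockProj, diagonal_mul_diagonal]
    congr 1; funext x; split_ifs <;> simp
  · change blockProj A d i * blockProj A d j = 0
    rw [blockProj, blockProj, diagonal_mul_diagonal, ← diagonal_zero]
    congr 1; funext x
    by_cases h : x.1 = i
    · rw [if_neg (fun h' => hij (h.symm.trans h')), mul_zero]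
    · rw [if_neg h, zero_mul]
  · ext x y
    rw [Matrix.sum_apply]
    by_cases h : x = y
    · subst h; simp [blockProj]
    · simp [blockProj, h]

variable {A 𝔽 : Type} [CommRing A] [Field 𝔽] {π : A →+* 𝔽}

theorem aeval_map_matrix {m : Type} [Fintype m] [DecidableEq m] (M : Matrix m m A) (p : A[X]) :
    (aeval M p).map π = aeval (M.map π) (p.map π) := by
  have h := hom_eval₂ p (algebraMap A (Matrix m m A)) (RingHom.mapMatrix π) M
  rw [aeval_def, aeval_def, eval₂_map]
  change RingHom.mapMatrix π _ = _
  rw [h]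
  congr 1
  ext a i j
  simp [Matrix.algebraMap_matrix_apply, apply_ite π]

variable {q l : ℕ}

theorem compMats_pow (c : ∀ j, Fin (d j) → A) (k : ℕ) :
    compMats c ^ k = blockDiagonal' fun j => compMat (c j) ^ k := by
  rw [compMats, ← blockDiagonal'_pow]; rfl

/-- A lift of the companion matrix of `(X - 1) ^ d` has finite order, a power of `l`. -/
theorem exists_pow_eq_one_of_map_eq_compMats (hl : l.Prime) [CharP 𝔽 l] {k : ℕ}
    (hπ : RingHom.ker π ^ k = ⊥) {T : BlockMat d A}
    (hT : T.map π = compMats fun _ _ => 0) : ∃ m, T ^ l ^ m = 1 := by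
  have : Fact l.Prime := ⟨hl⟩
  set e := ∑ j, d j with he
  have h1 : (T ^ l ^ e).map π = 1 := by
    have := map_pow (RingHom.mapMatrix π) T (l ^ e)
    simp only [RingHom.mapMatrix_apply] at this
    rw [this, hT, compMats_pow, ← blockDiagonal'_one]
    congr 1
    funext j
    have h2 : deformPoly (fun _ : Fin (d j) => (0 : 𝔽)) ∣ X ^ l ^ e - 1 := by
      rw [← one_pow (l ^ e), ← sub_pow_char_pow]
      simp only [deformPoly, map_zero, zero_mul, Finset.sum_const_zero, add_zero]
      refine pow_dvd_pow _ (le_trans ?_ (Nat.lt_pow_self hl.one_lt).le)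
      exact Finset.single_le_sum (f := d) (fun _ _ => Nat.zero_le _) (Finset.mem_univ j)
    have h3 := aeval_compMat_eq_zero h2
    rw [map_sub, map_pow, aeval_X, map_one, sub_eq_zero] at h3
    exact h3
  obtain ⟨m, hm⟩ := exists_pow_prime_pow_eq_one hl hπ h1
  exact ⟨e + m, by rw [pow_add, pow_mul, hm]⟩

theorem pow_mul_of_mul_eq {M : Type} [Monoid M] {Φ T : M} (h : Φ * T = T ^ q * Φ) (k : ℕ) :
    Φ ^ k * T = T ^ q ^ k * Φ ^ k := by
  have h1 (e : ℕ) : Φ * T ^ e = T ^ (q * e) * Φ := by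
    induction e with
    | zero => simp
    | succ e ih => rw [pow_succ, ← mul_assoc, ih, mul_assoc, h, ← mul_assoc, ← pow_add]; rfl
  induction k with
  | zero => simp
  | succ k ih => rw [pow_succ', mul_assoc, ih, ← mul_assoc, h1, mul_assoc, pow_succ' q]

/-- The idempotents of a lift of a direct sum of representations with different eigenvalues of
Frobenius. -/
theorem exists_idempotents (hl : l.Prime) [CharP 𝔽 l] {k : ℕ} (hπ : RingHom.ker π ^ k = ⊥)
    (hsurj : Function.Surjective π) (hql : q ≡ 1 [MOD l])
    {wbar : ∀ j, Fin (d j) → 𝔽} {α : Fin r → 𝔽} (hα : Function.Injective α)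
    (hnil : ∀ j, IsNilpotent (frobMat q (fun _ => 0) (wbar j) - α j • 1))
    {Φ T : BlockMat d A}
    (hΦ : Φ.map π = frobMats q (fun _ _ => 0) wbar) (hT : T.map π = compMats fun _ _ => 0)
    (hrel : Φ * T = T ^ q * Φ) :
    ∃ e : Fin r → BlockMat d A, CompleteOrthogonalIdempotents e ∧
      (∀ j, e j * Φ = Φ * e j) ∧ (∀ j, e j * T = T * e j) ∧
      ∀ j, (e j).map π = blockProj 𝔽 d j := by
  have : Fact l.Prime := ⟨hl⟩
  obtain ⟨m, hm⟩ := exists_pow_eq_one_of_map_eq_compMats hl hπ hT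
  choose s hs using hnil
  set K := m + ∑ j, s j with hK
  have hcomm : Φ ^ l ^ K * T = T * Φ ^ l ^ K := by
    rw [pow_mul_of_mul_eq hrel]
    congr 1
    have h1 : q ^ l ^ K ≡ 1 [MOD l ^ m] := by
      have h2 : (l : ℤ) ∣ (q : ℤ) - 1 := by
        have := (Nat.modEq_iff_dvd.1 hql.symm)
        exact_mod_cast this
      have h3 := dvd_sub_pow_of_dvd_sub h2 K
      rw [one_pow] at h3
      refine (Nat.modEq_iff_dvd.2 ?_).symm
      push_cast
      exact (pow_dvd_pow _ (by omega)).trans h3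
    rw [pow_eq_pow_mod _ hm, h1, ← pow_eq_pow_mod _ hm, pow_one]
  have hle (j) : s j ≤ l ^ K :=
    ((Finset.single_le_sum (f := s) (fun _ _ => Nat.zero_le _) (Finset.mem_univ j)).trans
      (Nat.le_add_left _ _)).trans (Nat.lt_pow_self hl.one_lt).le
  have hΨ : (Φ ^ l ^ K).map π = diagonal fun x => α x.1 ^ l ^ K := by
    have := map_pow (RingHom.mapMatrix π) Φ (l ^ K)
    simp only [RingHom.mapMatrix_apply] at this
    rw [this, hΦ, frobMats, ← blockDiagonal'_pow]
    have h1 (j) : frobMat q (fun _ => 0) (wbar j) ^ l ^ K =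
        diagonal fun _ => α j ^ l ^ K := by
      have hsm : (α j • 1 : Matrix (Fin (d j)) (Fin (d j)) 𝔽) = diagonal fun _ => α j := by
        ext a b; simp [Matrix.one_apply, diagonal_apply]
      rcases isEmpty_or_nonempty (Fin (d j)) with hemp | hne
      · exact Subsingleton.elim _ _
      have hchar : CharP (Matrix (Fin (d j)) (Fin (d j)) 𝔽) l := inferInstance
      have h2 : (frobMat q (fun _ => 0) (wbar j) - α j • 1) ^ l ^ K = 0 :=
        pow_eq_zero_of_le (hle j) (hs j)
      rw [sub_pow_char_pow_of_commute, sub_eq_zero] at h2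
      · rw [h2, hsm, diagonal_pow]; rfl
      · exact (Commute.one_right _).smul_right _
    rw [show (fun j => frobMat q (fun _ => 0) (wbar j)) ^ l ^ K = _ from funext h1]
    ext ⟨i, a⟩ ⟨j, b⟩
    by_cases hij : i = j
    · subst hij
      rw [blockDiagonal'_apply_eq, diagonal_apply, diagonal_apply]
      simp
    · rw [blockDiagonal'_apply_ne _ _ _ hij, diagonal_apply_ne _ (by simp [hij])]
  let R := Subalgebra.centralizer A ({Φ, T} : Set (BlockMat d A))
  let f : R →+* BlockMat d 𝔽 :=
    (RingHom.mapMatrix π).comp (R.val : R →+* _)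
  have hf : ∀ x : R, f x = x.1.map π := fun _ => rfl
  have hker : ∀ x ∈ RingHom.ker f, IsNilpotent x := by
    intro x hx
    obtain ⟨e, he⟩ := isNilpotent_of_map_eq_zero hπ (M := x.1) hx
    exact ⟨e, Subtype.ext he⟩
  have hΨR : Φ ^ l ^ K ∈ R := by
    rw [Subalgebra.mem_centralizer_iff]
    rintro g (rfl | rfl)
    · exact (pow_succ' _ _).symm.trans (pow_succ _ _)
    · exact hcomm.symm
  have hβ : Set.InjOn (fun j => α j ^ l ^ K) (Finset.univ : Finset (Fin r)) := by
    intro i _ j _ hij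
    exact hα (iterateFrobenius_inj 𝔽 l K (by simpa [iterateFrobenius_def] using hij))
  have hrange : ∀ j, blockProj 𝔽 d j ∈ f.range := by
    intro j
    obtain ⟨p, hp⟩ := Polynomial.map_surjective π hsurj
      (Lagrange.basis Finset.univ (fun j => α j ^ l ^ K) j)
    refine ⟨aeval (⟨_, hΨR⟩ : R) p, ?_⟩
    have h1 : (aeval (⟨_, hΨR⟩ : R) p).1 = aeval (Φ ^ l ^ K) p :=
      (aeval_algHom_apply R.val (⟨_, hΨR⟩ : R) p).symm
    rw [hf, h1, aeval_map_matrix, hΨ, hp, aeval_diagonal, blockProj]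
    congr 1
    funext x
    by_cases hx : x.1 = j
    · rw [if_pos hx, hx]
      exact Lagrange.eval_basis_self hβ (Finset.mem_univ j)
    · rw [if_neg hx]
      exact Lagrange.eval_basis_of_ne (v := fun j => α j ^ l ^ K) (Ne.symm hx) (Finset.mem_univ _)
  obtain ⟨e, he, hfe⟩ := CompleteOrthogonalIdempotents.lift_of_isNilpotent_ker f hker
    (blockProj_complete (d := d) 𝔽) hrange
  refine ⟨fun j => (e j).1, he.map R.val.toRingHom, fun j => ?_, fun j => ?_,
    fun j => congrFun hfe j⟩
  · exact ((Subalgebra.mem_centralizer_iff A).1 (e j).2 Φ (by simp)).symm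
  · exact ((Subalgebra.mem_centralizer_iff A).1 (e j).2 T (by simp)).symm

variable [IsLocalHom π] [∀ j, NeZero (d j)]

/-- Existence of the normal form of a lift. -/
theorem exists_normalForm (hl : l.Prime) [CharP 𝔽 l] {k : ℕ} (hπ : RingHom.ker π ^ k = ⊥)
    (hsurj : Function.Surjective π) (hql : q ≡ 1 [MOD l])
    {wbar : ∀ j, Fin (d j) → 𝔽} {α : Fin r → 𝔽} (hα : Function.Injective α)
    (hnil : ∀ j, IsNilpotent (frobMat q (fun _ => 0) (wbar j) - α j • 1))
    {Φ T : BlockMat d A} (hΦu : IsUnit Φ)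
    (hΦ : Φ.map π = frobMats q (fun _ _ => 0) wbar) (hT : T.map π = compMats fun _ _ => 0)
    (hrel : Φ * T = T ^ q * Φ) :
    ∃ (c w : ∀ j, Fin (d j) → A) (B : BlockMat d A),
      (∀ j i, π (c j i) = 0) ∧ (∀ j i, π (w j i) = wbar j i) ∧ B.map π = 1 ∧ IsMasked B ∧
      T * B = B * compMats c ∧ Φ * B = B * frobMats q c w ∧
      ∀ j, deformPoly (c j) ∣ expand A q (deformPoly (c j)) := by
  obtain ⟨e, he, heΦ, heT, heπ⟩ := exists_idempotents hl hπ hsurj hql hα hnil hΦ hT hrel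
  -- a vector `y j` whose image `b j` in the `j`-th summand has the prescribed coordinates
  have hy : ∀ j, ∃ y : (Σ j, Fin (d j)) → A, blockProj A d j *ᵥ (e j *ᵥ y) = Pi.single ⟨j, 0⟩ 1 ∧
      (fun x => π (y x)) = Pi.single ⟨j, 0⟩ 1 := by
    intro j
    set E := blockProj A d j with hE
    have hEE : E * E = E := (blockProj_complete (d := d) A).idem j
    have hEs : E *ᵥ Pi.single ⟨j, 0⟩ 1 = Pi.single ⟨j, 0⟩ 1 := by
      rw [hE, blockProj, diagonal_mulVec_single]; simp
    set G := E * e j * E + (1 - E) with hG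
    have hGπ : G.map π = 1 := by
      have h1 : RingHom.mapMatrix π G = 1 := by
        rw [hG, map_add, map_mul, map_mul, map_sub, map_one]
        simp only [RingHom.mapMatrix_apply, hE, blockProj_map, heπ]
        rw [(blockProj_complete (d := d) 𝔽).idem j, (blockProj_complete (d := d) 𝔽).idem j,
          add_sub_cancel]
      exact h1
    obtain ⟨u, hu⟩ := isUnit_of_isUnit_map (π := π) (M := G) (by rw [hGπ]; exact isUnit_one)
    have hGy : G *ᵥ (u⁻¹.1 *ᵥ Pi.single ⟨j, 0⟩ 1) = Pi.single ⟨j, 0⟩ 1 := by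
      rw [mulVec_mulVec, ← hu, Units.mul_inv, one_mulVec]
    set y := u⁻¹.1 *ᵥ Pi.single (⟨j, 0⟩ : Σ j, Fin (d j)) (1 : A) with hy
    have hEy : E *ᵥ y = y := by
      have h1 : (1 - E) * G = 1 - E := by
        rw [hG, mul_add, ← mul_assoc, ← mul_assoc, sub_mul 1 E E, one_mul, hEE, sub_self, zero_mul,
          zero_mul, zero_add, mul_sub, sub_mul 1 E E, one_mul, hEE, sub_self, mul_one, sub_zero]
      have h2 := congrArg ((1 - E) *ᵥ ·) hGy
      simp only [mulVec_mulVec] at h2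
      rw [h1, sub_mulVec, sub_mulVec, hEs, one_mulVec, one_mulVec, sub_self, sub_eq_zero] at h2
      exact h2.symm
    refine ⟨y, ?_, ?_⟩
    · have h1 : E * G = E * e j * E := by
        rw [hG, mul_add, mul_sub, hEE, mul_one, sub_self, add_zero, ← mul_assoc, ← mul_assoc, hEE]
      have h2 := congrArg (E *ᵥ ·) hGy
      simp only [mulVec_mulVec] at h2
      rw [h1, hEs, ← mulVec_mulVec, hEy] at h2
      rw [mulVec_mulVec, h2]
    · have h1 : u⁻¹.1.map π = 1 := by
        have h2 := congrArg (RingHom.mapMatrix π) (u.mul_inv)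
        rw [map_mul, map_one, hu] at h2
        simp only [RingHom.mapMatrix_apply] at h2
        rwa [hGπ, one_mul] at h2
      funext x
      have h3 := RingHom.map_mulVec π u⁻¹.1 (Pi.single ⟨j, 0⟩ 1) x
      rw [← hy] at h3
      rw [h3, h1, one_mulVec]
      simp [Pi.single_apply, apply_ite π]
  choose y hy1 hy2 using hy
  let b : Fin r → (Σ j, Fin (d j)) → A := fun j => e j *ᵥ y j
  have heb (i) (j) : e i *ᵥ b j = if i = j then b j else 0 := by
    rw [mulVec_mulVec]
    split_ifs with h
    · subst h; rw [he.idem i]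
    · rw [he.ortho h, zero_mulVec]
  let B : BlockMat d A := of fun x z => (T ^ (z.2 : ℕ) *ᵥ b z.1) x
  have hBcol (z) : B *ᵥ Pi.single z 1 = T ^ (z.2 : ℕ) *ᵥ b z.1 := by
    ext x; simp [B]
  have hbπ (j) : (fun x => π (b j x)) = Pi.single ⟨j, 0⟩ 1 := by
    funext x
    rw [RingHom.map_mulVec, heπ]
    change (blockProj 𝔽 d j *ᵥ fun x => π (y j x)) x = _
    rw [hy2, blockProj, diagonal_mulVec_single]; simp
  have hBπ : B.map π = 1 := by
    ext x ⟨j, i⟩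
    simp only [map_apply, B, of_apply]
    rw [RingHom.map_mulVec]
    have h1 : (T ^ (i : ℕ)).map π = blockDiagonal' fun j => compMat (fun _ => 0) ^ (i : ℕ) := by
      have := map_pow (RingHom.mapMatrix π) T (i : ℕ)
      simp only [RingHom.mapMatrix_apply] at this
      rw [this, hT, compMats_pow]
    change ((T ^ (i : ℕ)).map π *ᵥ fun x => π (b j x)) x = _
    rw [h1, hbπ, mulVec_single_one, col_apply]
    obtain ⟨j', i'⟩ := x
    by_cases hj : j' = j
    · subst hj
      rw [blockDiagonal'_apply_eq]
      have h2 := congrFun (compMat_pow_mulVec_single_zero (fun _ : Fin (d j') => (0 : 𝔽)) i) i'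
      rw [mulVec_single_one, col_apply] at h2
      rw [h2]
      simp [Pi.single_apply, Matrix.one_apply]
    · rw [blockDiagonal'_apply_ne _ _ _ hj, one_apply_ne (by simp [hj])]
  obtain ⟨u, hu⟩ := isUnit_of_isUnit_map (π := π) (M := B) (by rw [hBπ]; exact isUnit_one)
  have hBl : ∀ {M M' : Matrix _ _ A}, B * M = B * M' → M = M' := fun {M M'} h =>
    u.mul_right_inj.1 (by rw [hu]; exact h)
  have heB (j) : e j * B = B * blockProj A d j := by
    refine Matrix.ext_of_mulVec_single fun z => ?_
    have h1 (i : ℕ) : e j * T ^ i = T ^ i * e j := (show Commute _ _ from heT j).pow_right i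
    rw [← mulVec_mulVec, hBcol, mulVec_mulVec, h1, ← mulVec_mulVec, heb, ← mulVec_mulVec,
      blockProj, diagonal_mulVec_single]
    by_cases h : z.1 = j
    · rw [if_pos h.symm, if_pos h, mul_one, hBcol]
    · rw [if_neg (Ne.symm h), if_neg h, zero_mul, Pi.single_zero, mulVec_zero, mulVec_zero]
  -- a matrix that commutes with the idempotents is block diagonal in the basis `B`
  have hblock : ∀ M, (∀ j, e j * M = M * e j) → ∃ D : ∀ j, Matrix (Fin (d j)) (Fin (d j)) A,
      M * B = B * blockDiagonal' D := by
    intro M hM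
    set P := u⁻¹.1 * (M * B) with hP
    have hBP : M * B = B * P := by rw [hP, ← hu, Units.mul_inv_cancel_left]
    have hcomm (j) : blockProj A d j * P = P * blockProj A d j := by
      have h1 : B * (blockProj A d j * P) = B * (P * blockProj A d j) := by
        rw [← mul_assoc, ← heB, mul_assoc, ← hBP, ← mul_assoc, hM, mul_assoc, heB, ← mul_assoc, hBP,
          mul_assoc]
      exact hBl h1
    refine ⟨fun j => block P j j, ?_⟩
    rw [← eq_blockDiagonal'_of_block, hBP]
    intro i j hij
    ext a b
    have h1 := congrFun (congrFun (hcomm i) ⟨i, a⟩) ⟨j, b⟩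
    rw [blockProj, diagonal_mul, mul_diagonal] at h1
    simp only [if_true, one_mul, if_neg (Ne.symm hij), mul_zero] at h1
    exact h1
  obtain ⟨D, hD⟩ := hblock T heT
  obtain ⟨F, hF⟩ := hblock Φ heΦ
  have hBinj : ∀ {v v' : (Σ j, Fin (d j)) → A}, B *ᵥ v = B *ᵥ v' → v = v' := fun {v v'} h => by
    have := congrArg (u⁻¹.1 *ᵥ ·) h
    simpa only [mulVec_mulVec, ← hu, Units.inv_mul, one_mulVec] using this
  have hDshift : ∀ j (i : Fin (d j)) (h : (i : ℕ) + 1 < d j),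
      D j *ᵥ Pi.single i 1 = Pi.single ⟨i + 1, h⟩ 1 := by
    intro j i h
    have h1 : blockDiagonal' D *ᵥ Pi.single ⟨j, i⟩ 1 =
        Pi.single (⟨j, ⟨i + 1, h⟩⟩ : Σ j, Fin (d j)) 1 := by
      apply hBinj
      rw [mulVec_mulVec, ← hD, ← mulVec_mulVec, hBcol, hBcol, mulVec_mulVec, ← pow_succ']
    ext a
    have h2 := congrFun h1 ⟨j, a⟩
    rw [mulVec_single_one, col_apply, blockDiagonal'_apply_eq] at h2
    rw [mulVec_single_one, col_apply, h2]
    simp [Pi.single_apply]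
  choose c hc using fun j => exists_eq_compMat (D j) (hDshift j)
  have hFD : ∀ j, F j * D j = D j ^ q * F j := by
    have h1 : blockDiagonal' F * blockDiagonal' D = blockDiagonal' D ^ q * blockDiagonal' F := by
      have hDq (k : ℕ) : T ^ k * B = B * blockDiagonal' D ^ k := by
        induction k with
        | zero => simp
        | succ k ih => rw [pow_succ, mul_assoc, hD, ← mul_assoc, ih, mul_assoc, ← pow_succ]
      have h2 : B * (blockDiagonal' F * blockDiagonal' D) =
          B * (blockDiagonal' D ^ q * blockDiagonal' F) := by
        rw [← mul_assoc, ← hF, mul_assoc, ← hD, ← mul_assoc, hrel, mul_assoc, hF, ← mul_assoc, hDq,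
          mul_assoc]
      exact hBl h2
    rw [← blockDiagonal'_pow, ← blockDiagonal'_mul, ← blockDiagonal'_mul] at h1
    exact fun j => congrFun (blockDiagonal'_injective h1) j
  have hFu : ∀ j, IsUnit (F j) := by
    intro j
    obtain ⟨v, hv⟩ := hΦu
    have h1 : blockDiagonal' F * (u⁻¹.1 * v⁻¹.1 * B) = 1 := by
      have h2 : B * (blockDiagonal' F *
          (u⁻¹.1 * v⁻¹.1 * B)) = B * 1 := by
        rw [← mul_assoc, ← hF, mul_assoc, ← mul_assoc B, ← mul_assoc B, ← hu, Units.mul_inv, one_mul,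
          ← mul_assoc, ← hv, Units.mul_inv, one_mul, mul_one]
      exact hBl h2
    have h3 := congrArg (fun M => block M j j) h1
    simp only [block_blockDiagonal'_mul, block_one_self] at h3
    exact IsUnit.of_mul_eq_one _ h3
  have hFc (j) : F j * compMat (c j) = compMat (c j) ^ q * F j := by
    rw [← hc j]; exact hFD j
  choose w hw using fun j => exists_eq_frobMat (hFc j)
  have hDc : blockDiagonal' D = compMats c := congrArg blockDiagonal' (funext hc)
  have hFw : blockDiagonal' F = frobMats q c w := congrArg blockDiagonal' (funext hw)
  have hmapc : ∀ j i, π (c j i) = 0 := by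
    have h1 := congrArg (RingHom.mapMatrix π) hD
    rw [map_mul, map_mul] at h1
    simp only [RingHom.mapMatrix_apply] at h1
    rw [hBπ, mul_one, one_mul, hT, blockDiagonal'_map _ _ (map_zero π)] at h1
    intro j i
    have h2 := congrFun (blockDiagonal'_injective h1) j
    rw [hc j, compMat_map] at h2
    exact (congrFun (compMat_injective h2) i).symm
  refine ⟨c, w, B, hmapc, ?_, hBπ, ?_, by rw [← hDc, hD], by rw [← hFw, hF],
    fun j => dvd_expand_of_isUnit (hFu j) (hFc j)⟩
  · have h1 := congrArg (RingHom.mapMatrix π) hF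
    rw [map_mul, map_mul] at h1
    simp only [RingHom.mapMatrix_apply] at h1
    rw [hBπ, mul_one, one_mul, hΦ, blockDiagonal'_map _ _ (map_zero π)] at h1
    intro j i
    have h2 := congrFun (blockDiagonal'_injective h1) j
    rw [hw j, frobMat_map] at h2
    have h3 := congrArg (fun M => M *ᵥ Pi.single 0 1) h2
    simp only [frobMat_mulVec_single_zero] at h3
    exact (congrFun h3 i).symm
  · intro j
    ext a
    have h1 := congrFun (hy1 j) ⟨j, a⟩
    rw [blockProj, mulVec_diagonal] at h1
    rw [mulVec_single_one, col_apply]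
    simp only [if_true, one_mul] at h1
    simp only [block, of_apply, B]
    simp only [Fin.val_zero, pow_zero, one_mulVec]
    rw [show b j ⟨j, a⟩ = _ from h1]
    simp [Pi.single_apply]

end Existence

/-! ### Coefficient rings -/

section CoefficientRings

open IsLocalRing Matrix

variable {l : ℕ} [Fact l.Prime] {E : IntermediateField ℚ_[l] (PadicAlgCl l)}

section Reduction

variable (E) (A : Type) [CommRing A] [IsLocalRing A] [Algebra (integers E) A]
  [IsCoefficientRing E A]

/-- The reduction map from a coefficient ring to the residue field of `E`. -/
def reduction : A →ₐ[integers E] ResidueField E where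
  toRingHom := ((RingEquiv.ofBijective (IsLocalRing.ResidueField.map (algebraMap (integers E) A))
    ⟨RingHom.injective _, IsCoefficientRing.surjective⟩).symm : _ →+* _).comp (residue A)
  commutes' x := by
    change (RingEquiv.ofBijective (IsLocalRing.ResidueField.map (algebraMap (integers E) A))
      ⟨RingHom.injective _, IsCoefficientRing.surjective⟩).symm (residue A _) = residue _ x
    rw [RingEquiv.symm_apply_eq]
    rfl

theorem map_reduction (a : A) :
    IsLocalRing.ResidueField.map (algebraMap (integers E) A) (reduction E A a) = residue A a :=
  (RingEquiv.ofBijective (IsLocalRing.ResidueField.map (algebraMap (integers E) A))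
    ⟨RingHom.injective _, IsCoefficientRing.surjective⟩).apply_symm_apply (residue A a)

theorem reduction_surjective : Function.Surjective (reduction E A) := fun y => by
  obtain ⟨x, rfl⟩ := residue_surjective y
  exact ⟨algebraMap _ A x, (reduction E A).commutes x⟩

theorem ker_reduction : RingHom.ker (reduction E A : A →+* ResidueField E) = maximalIdeal A :=
  eq_maximalIdeal (RingHom.ker_isMaximal_of_surjective _ (reduction_surjective E A))

instance : IsLocalHom (reduction E A : A →+* ResidueField E) :=
  Function.Surjective.isLocalHom _ (reduction_surjective E A)

variable {A} {B : Type} [CommRing B] [Algebra (integers E) B]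

theorem algHom_eq_reduction (g : A →ₐ[integers E] ResidueField E) : g = reduction E A := by
  have hsurj : Function.Surjective g := fun y => by
    obtain ⟨x, rfl⟩ := residue_surjective y
    exact ⟨algebraMap _ A x, g.commutes x⟩
  have hker : RingHom.ker (g : A →+* ResidueField E) = maximalIdeal A :=
    eq_maximalIdeal (RingHom.ker_isMaximal_of_surjective _ hsurj)
  ext a
  obtain ⟨x, hx⟩ := residue_surjective (reduction E A a)
  have hm : a - algebraMap _ A x ∈ maximalIdeal A := by
    rw [← ker_reduction E A, RingHom.mem_ker, map_sub, sub_eq_zero]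
    exact hx.symm.trans ((reduction E A).commutes x).symm
  have h2 := hm
  rw [← ker_reduction E A, RingHom.mem_ker, map_sub, sub_eq_zero] at h2
  rw [← hker, RingHom.mem_ker, map_sub, sub_eq_zero] at hm
  exact hm.trans ((g.commutes x).trans (((reduction E A).commutes x).symm.trans h2.symm))

theorem reduction_eq_zero_iff {a : A} : reduction E A a = 0 ↔ a ∈ maximalIdeal A := by
  rw [← ker_reduction E A]; rfl

theorem isCoefficientRing_of_algHom [IsLocalRing B] (g : B →ₐ[integers E] ResidueField E) :
    IsCoefficientRing E B where
  map_nonunit x hx := by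
    have h : IsUnit (algebraMap (integers E) (ResidueField E) x) := by
      rw [← g.commutes]; exact hx.map g
    exact isUnit_of_map_unit (residue (integers E)) x h
  surjective := by
    have hloc : IsLocalHom (algebraMap (integers E) B) := ⟨fun x hx => by
      have h : IsUnit (algebraMap (integers E) (ResidueField E) x) := by
        rw [← g.commutes]; exact hx.map g
      exact isUnit_of_map_unit (residue (integers E)) x h⟩
    intro y
    obtain ⟨b, rfl⟩ := residue_surjective y
    obtain ⟨x, hx⟩ := residue_surjective (g b)
    refine ⟨residue _ x, ?_⟩
    rw [ResidueField.map_residue, eq_comm, ← sub_eq_zero, ← map_sub, residue_eq_zero_iff,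
      mem_maximalIdeal]
    intro hu
    have h0 : g (b - algebraMap (integers E) B x) = 0 := by
      rw [map_sub, sub_eq_zero, g.commutes, ← hx]
      rfl
    exact (hu.map g).ne_zero h0

theorem reduction_algHom [IsLocalRing B] [IsCoefficientRing E B] (f : A →ₐ[integers E] B) (a : A) :
    reduction E B (f a) = reduction E A a :=
  DFunLike.congr_fun (algHom_eq_reduction E ((reduction E B).comp f)) a

theorem algHom_mem_maximalIdeal [IsLocalRing B] [IsCoefficientRing E B]
    (f : A →ₐ[integers E] B) {a : A} (ha : a ∈ maximalIdeal A) : f a ∈ maximalIdeal B := by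
  rw [← reduction_eq_zero_iff E] at ha ⊢
  rw [reduction_algHom, ha]

variable {p : ℕ} [Fact p.Prime] {F : IntermediateField ℚ_[p] (PadicAlgCl p)} {n : ℕ} in
theorem isLift_iff {ρbar : GaloisGroup F →* GL (Fin n) (ResidueField E)}
    {ρ : GaloisGroup F →* GL (Fin n) A} : IsLift ρbar ρ ↔
      (glMap (reduction E A : A →+* ResidueField E)).comp ρ = ρbar := by
  constructor
  · intro h
    ext g i j
    have h1 := congrArg (fun x : GL (Fin n) (IsLocalRing.ResidueField A) => x.1 i j)
      (DFunLike.congr_fun h g)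
    have h2 : residue A ((ρ g).1 i j) = IsLocalRing.ResidueField.map
      (algebraMap (integers E) A) ((ρbar g).1 i j) := h1
    rw [← map_reduction E] at h2
    exact (IsLocalRing.ResidueField.map (algebraMap (integers E) A)).injective h2
  · rintro rfl
    refine MonoidHom.ext fun g => GeneralLinearGroup.ext fun i j => ?_
    exact (map_reduction E A _).symm

end Reduction

section Frame

variable {m : Type} [Fintype m] {n : ℕ}

/-- Matrices indexed by `m` as matrices indexed by `Fin n` through `e`, conjugated by `U`. -/
def conjFrame {A : Type} [CommRing A] (U : GL (Fin n) A) (e : m ≃ Fin n) :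
    Matrix m m A ≃* Matrix (Fin n) (Fin n) A where
  toFun M := U.1 * M.submatrix e.symm e.symm * U⁻¹.1
  invFun M := (U⁻¹.1 * M * U.1).submatrix e e
  left_inv M := by
    have : U⁻¹.1 * (U.1 * M.submatrix e.symm e.symm * U⁻¹.1) * U.1 =
        M.submatrix e.symm e.symm := by
      simp only [mul_assoc, Units.inv_mul, mul_one, Units.inv_mul_cancel_left]
    beta_reduce
    rw [this]
    ext i j; simp
  right_inv M := by
    simp only [Matrix.submatrix_submatrix, Equiv.self_comp_symm, Matrix.submatrix_id_id]
    simp only [mul_assoc, Units.mul_inv, mul_one, Units.mul_inv_cancel_left]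
  map_mul' M N := by
    rw [← Matrix.submatrix_mul_equiv M N e.symm e.symm e.symm]
    simp only [mul_assoc, Units.inv_mul_cancel_left]

/-- The identification of matrices indexed by `m` with matrices of size `n` given by the basis `b`,
indexed by `m` through `e`. -/
def frame (b : GL (Fin n) (integers E)) (e : m ≃ Fin n) (A : Type) [CommRing A]
    [Algebra (integers E) A] : Matrix m m A ≃* Matrix (Fin n) (Fin n) A :=
  conjFrame (glMap (algebraMap (integers E) A) b) e

theorem conjFrame_map {A B : Type} [CommRing A] [CommRing B] (U : GL (Fin n) A) (e : m ≃ Fin n)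
    (f : A →+* B) (M : Matrix m m A) : (conjFrame U e M).map f =
      conjFrame (glMap f U) e (M.map f) := by
  change (U.1 * M.submatrix e.symm e.symm * U⁻¹.1).map f = _
  rw [Matrix.map_mul, Matrix.map_mul]
  rfl

theorem frame_map (b : GL (Fin n) (integers E)) (e : m ≃ Fin n) {A B : Type} [CommRing A]
    [Algebra (integers E) A] [CommRing B] [Algebra (integers E) B] (f : A →ₐ[integers E] B)
    (M : Matrix m m A) : (frame b e A M).map f = frame b e B (M.map f) := by
  refine (conjFrame_map _ e (f : A →+* B) M).trans ?_
  unfold frame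
  rw [show glMap (f : A →+* B) (glMap
    (algebraMap (integers E) A) b) = glMap (algebraMap (integers E) B) b from
    GeneralLinearGroup.ext fun i j => f.commutes _]
  rfl

end Frame

section Wild


variable {p : ℕ} [Fact p.Prime] {F : IntermediateField ℚ_[p] (PadicAlgCl p)}
  {n : ℕ}

/-- Lifts of a representation that is trivial on the wild inertia are trivial there, since the
kernel of the reduction is an `l`-group. -/
theorem lift_wildInertia (hlp : l ≠ p) {A 𝔽 : Type} [CommRing A] [Field 𝔽] [CharP 𝔽 l]
    {π : A →+* 𝔽} {k : ℕ} (hπ : RingHom.ker π ^ k = ⊥) {ρ : GaloisGroup F →* GL (Fin n) A}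
    (hρ : IsOpen (ρ.ker : Set (GaloisGroup F)))
    (hw : ∀ g ∈ wildInertia F, (ρ g).1.map π = 1) :
    ∀ g ∈ wildInertia F, ρ g = 1 := by
  intro g hg
  obtain ⟨e, he⟩ := exists_pow_prime_pow_eq_one (Fact.out : l.Prime) hπ (hw g hg)
  refine wildInertia_mem_of_pow_mem (U := ρ.ker) (Subgroup.isClosed_of_isOpen _ hρ) hg
    (m := l ^ e) (fun h => hlp ?_) ?_
  · exact ((Nat.prime_dvd_prime_iff_eq Fact.out Fact.out).1
      ((Fact.out : p.Prime).dvd_of_dvd_pow h)).symm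
  · rw [MonoidHom.mem_ker, map_pow]
    exact Units.ext he

end Wild

section AdicLimit

variable {R : Type} [CommRing R] {I : Ideal R}

theorem eq_of_forall_mk_eq [IsHausdorff I R] {x y : R}
    (h : ∀ k, Ideal.Quotient.mk (I ^ k) x = Ideal.Quotient.mk (I ^ k) y) : x = y := by
  rw [← sub_eq_zero]
  refine IsHausdorff.haus inferInstance (I := I) _ fun k => ?_
  rw [SModEq.zero, smul_eq_mul, Ideal.mul_top]
  exact Ideal.Quotient.eq.1 (h k)

theorem exists_forall_mk_eq [IsPrecomplete I R] (s : ∀ k, R ⧸ I ^ k)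
    (hs : ∀ k, Ideal.Quotient.factor (Ideal.pow_le_pow_right k.le_succ) (s (k + 1)) = s k) :
    ∃ x : R, ∀ k, Ideal.Quotient.mk (I ^ k) x = s k := by
  choose f hf using fun k => Ideal.Quotient.mk_surjective (s k)
  have h1 (k : ℕ) : f (k + 1) - f k ∈ I ^ k := by
    rw [← Ideal.Quotient.eq, hf, ← hs, ← hf (k + 1)]
    rfl
  have h2 {m n : ℕ} (h : m ≤ n) : f n - f m ∈ I ^ m := by
    induction n, h using Nat.le_induction with
    | base => simp
    | succ n hn ih =>
      have := add_mem (Ideal.pow_le_pow_right hn (h1 n)) ih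
      simpa using this
  obtain ⟨x, hx⟩ := IsPrecomplete.prec (inferInstance : IsPrecomplete I R) (f := f)
    fun {m n} h => by
      rw [SModEq.sub_mem, smul_eq_mul, Ideal.mul_top, ← neg_sub]
      exact neg_mem (h2 h)
  refine ⟨x, fun k => ?_⟩
  have := hx k
  rw [SModEq.sub_mem, smul_eq_mul, Ideal.mul_top, ← Ideal.Quotient.eq, hf] at this
  exact this.symm

/-- A compatible system of representations over the quotients of a complete ring comes from a
representation over the ring. -/
theorem exists_representation_of_adic [IsAdicComplete I R] {G : Type} [Group G] {n : ℕ}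
    (ρ : ∀ k, G →* GL (Fin n) (R ⧸ I ^ k))
    (hρ : ∀ k, (glMap
      (Ideal.Quotient.factor (Ideal.pow_le_pow_right k.le_succ))).comp (ρ (k + 1)) = ρ k) :
    ∃ ρ' : G →* GL (Fin n) R,
      ∀ k, (glMap (Ideal.Quotient.mk (I ^ k))).comp ρ' = ρ k := by
  choose M hM using fun (g : G) (i j : Fin n) => exists_forall_mk_eq
    (fun k => (ρ k g).1 i j) fun k => congrArg (fun x : GL (Fin n) (R ⧸ I ^ k) => x.1 i j)
      (DFunLike.congr_fun (hρ k) g)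
  have hM' (g : G) (k : ℕ) :
      (Ideal.Quotient.mk (I ^ k)).mapMatrix (Matrix.of (M g)) = (ρ k g).1 := by
    ext i j; exact hM g i j k
  have hext {X Y : Matrix (Fin n) (Fin n) R} (h : ∀ k, (Ideal.Quotient.mk (I ^ k)).mapMatrix X =
      (Ideal.Quotient.mk (I ^ k)).mapMatrix Y) : X = Y := by
    ext i j
    exact eq_of_forall_mk_eq fun k => congrFun (congrFun (h k) i) j
  let ρ' : G →* Matrix (Fin n) (Fin n) R :=
    { toFun := fun g => Matrix.of (M g)
      map_one' := hext fun k => by rw [hM', map_one, map_one]; rfl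
      map_mul' := fun g h => hext fun k => by rw [hM', map_mul, map_mul, hM', hM']; rfl }
  refine ⟨ρ'.toHomUnits, fun k => MonoidHom.ext fun g => Units.ext (hM' g k)⟩

end AdicLimit

end CoefficientRings

/-! ### The universal lift -/

section ContinuousLift

open IsLocalRing Matrix

variable {p l : ℕ} [Fact p.Prime] [Fact l.Prime] {F : IntermediateField ℚ_[p] (PadicAlgCl p)}
  [FiniteDimensional ℚ_[p] F] {E : IntermediateField ℚ_[l] (PadicAlgCl l)} {n : ℕ}

variable (E) in
/-- The reduction map on the quotients of a coefficient ring by powers of the maximal ideal. -/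
theorem exists_reduction_quotient (A : Type) [CommRing A] [IsLocalRing A] [Algebra (integers E) A]
    [IsCoefficientRing E A] (k : ℕ) : ∃ π : A ⧸ maximalIdeal A ^ (k + 1) →+* ResidueField E,
      (∀ a, π (Ideal.Quotient.mk _ a) = reduction E A a) ∧ RingHom.ker π ^ (k + 1) = ⊥ := by
  have hle : ∀ a ∈ maximalIdeal A ^ (k + 1), (reduction E A : A →+* ResidueField E) a = 0 :=
    fun a ha => (reduction_eq_zero_iff E).2 (Ideal.pow_le_self k.succ_ne_zero ha)
  refine ⟨Ideal.Quotient.lift _ (reduction E A : A →+* ResidueField E) hle, fun a => rfl, ?_⟩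
  have hker : RingHom.ker (Ideal.Quotient.lift _ (reduction E A : A →+* ResidueField E) hle) =
      (maximalIdeal A).map (Ideal.Quotient.mk (maximalIdeal A ^ (k + 1))) := by
    exact (Ideal.ker_quotient_lift _ hle).trans (by rw [ker_reduction E A])
  rw [hker, ← Ideal.map_pow, Ideal.map_quotient_self]

variable [FiniteDimensional ℚ_[l] E]

/-- Over a complete coefficient ring, a continuous lift is determined by matrices for `φ` and `σ`
that lift the given ones and satisfy the tame relation. -/
theorem exists_continuous_lift {φ : GaloisGroup F} (hφ : IsFrobenius F φ) {σ : inertia F}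
    (hσ : IsTameGenerator F σ) (hl : l ∣ residueCard F - 1)
    {ρbar : GaloisGroup F →* GL (Fin n) (ResidueField E)}
    (hρbar : IsOpen (ρbar.ker : Set (GaloisGroup F)))
    (hw : ∀ g ∈ wildInertia F, ρbar g = 1) (hσl : ∃ m, ρbar σ ^ l ^ m = 1)
    {R : Type} [CommRing R] [IsLocalRing R] [IsNoetherianRing R] [Algebra (integers E) R]
    [IsCoefficientRing E R] [IsAdicComplete (maximalIdeal R) R] (Φ T : GL (Fin n) R)
    (hΦ : glMap (reduction E R : R →+* ResidueField E) Φ = ρbar φ)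
    (hT : glMap (reduction E R : R →+* ResidueField E) T = ρbar σ)
    (hrel : Φ * T = T ^ residueCard F * Φ) :
    ∃ ρ : GaloisGroup F →* GL (Fin n) R, ρ φ = Φ ∧ ρ σ = T ∧
      (∀ k, IsOpen (((glMap
        (Ideal.Quotient.mk (maximalIdeal R ^ k))).comp ρ).ker : Set (GaloisGroup F))) ∧
      IsLift ρbar ρ ∧ ∀ g ∈ wildInertia F, ρ g = 1 := by
  have hfin : Finite (R ⧸ maximalIdeal R) := by
    have e : R ⧸ RingHom.ker (reduction E R : R →+* ResidueField E) ≃+* ResidueField E :=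
      RingHom.quotientKerEquivOfSurjective (reduction_surjective E R)
    rw [ker_reduction] at e
    exact Finite.of_equiv _ e.symm.toEquiv
  have hfin' (k : ℕ) : Finite (R ⧸ maximalIdeal R ^ k) :=
    Ideal.finite_quotient_pow (IsNoetherian.noetherian _) k
  have hpow (k : ℕ) : ∃ m, glMap
      (Ideal.Quotient.mk (maximalIdeal R ^ k)) T ^ l ^ m = 1 := by
    cases k with
    | zero =>
      have : Subsingleton (R ⧸ maximalIdeal R ^ 0) :=
        Ideal.Quotient.subsingleton_iff.2 (by simp)
      exact ⟨0, Units.ext (Subsingleton.elim _ _)⟩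
    | succ k =>
      obtain ⟨m, hm⟩ := hσl
      obtain ⟨π, hπ, hk⟩ := exists_reduction_quotient E R k
      obtain ⟨e, he⟩ := exists_pow_prime_pow_eq_one (M := (glMap
        (Ideal.Quotient.mk (maximalIdeal R ^ (k + 1))) T ^ l ^ m).1) (Fact.out : l.Prime) hk (by
          rw [← hT, ← map_pow] at hm
          rw [← map_pow]
          ext i j
          refine (hπ _).trans ?_
          exact congrArg (fun x : GL (Fin n) (ResidueField E) => x.1 i j) hm)
      exact ⟨m + e, by rw [pow_add l, pow_mul]; exact Units.ext he⟩
  choose m hm using hpow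
  have hex (k : ℕ) := exists_tame_hom hφ hσ hl (glMap
      (Ideal.Quotient.mk (maximalIdeal R ^ k)) Φ) (glMap
      (Ideal.Quotient.mk (maximalIdeal R ^ k)) T) (hm k) (by
        rw [← map_mul, hrel, map_mul, map_pow])
  choose ρ hρo hρφ hρσ hρw using hex
  have hmap {A B : Type} [CommRing A] [CommRing B] (f : A →+* B)
      (ρ : GaloisGroup F →* GL (Fin n) A) (h : IsOpen (ρ.ker : Set (GaloisGroup F))) :
      IsOpen ((((glMap f).comp ρ).ker : Subgroup (GaloisGroup F)) :
        Set (GaloisGroup F)) := by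
    refine Subgroup.isOpen_mono (H₁ := ρ.ker) (fun g hg => ?_) h
    rw [MonoidHom.mem_ker, MonoidHom.comp_apply, MonoidHom.mem_ker.1 hg, map_one]
  obtain ⟨ρ', hρ'⟩ := exists_representation_of_adic (I := maximalIdeal R) ρ fun k => by
    refine hom_ext_of_tame hφ hσ (hmap _ _ (hρo _)) (hρo k) ?_ ?_ fun g hg => ?_
    · rw [hρφ, MonoidHom.comp_apply, hρφ, ← GeneralLinearGroup.map_comp_apply]; rfl
    · rw [hρσ, MonoidHom.comp_apply, hρσ]; rfl
    · rw [hρw k g hg, MonoidHom.comp_apply, hρw _ g hg, map_one]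
  have hext {X Y : GL (Fin n) R} (h : ∀ k, glMap
      (Ideal.Quotient.mk (maximalIdeal R ^ k)) X = glMap
      (Ideal.Quotient.mk (maximalIdeal R ^ k)) Y) : X = Y := by
    refine GeneralLinearGroup.ext fun i j => ?_
    exact eq_of_forall_mk_eq (I := maximalIdeal R) fun k =>
      congrArg (fun x : GL (Fin n) (R ⧸ maximalIdeal R ^ k) => x.1 i j) (h k)
  have h1 : ρ' φ = Φ := hext fun k => (DFunLike.congr_fun (hρ' k) φ).trans (hρφ k)
  have h2 : ρ' σ = T := hext fun k => (DFunLike.congr_fun (hρ' k) _).trans (hρσ k)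
  have h3 : ∀ g ∈ wildInertia F, ρ' g = 1 := fun g hg => hext fun k =>
    (DFunLike.congr_fun (hρ' k) g).trans ((hρw k g hg).trans (map_one _).symm)
  refine ⟨ρ', h1, h2, fun k => by rw [hρ']; exact hρo k, ?_, h3⟩
  rw [isLift_iff]
  obtain ⟨π, hπ, -⟩ := exists_reduction_quotient E R 0
  have he : (glMap (reduction E R : R →+* ResidueField E)).comp ρ' =
      (glMap π).comp (ρ (0 + 1)) := by
    rw [← hρ']
    exact MonoidHom.ext fun g => GeneralLinearGroup.ext fun i j => (hπ _).symm
  refine hom_ext_of_tame hφ hσ ?_ hρbar ?_ ?_ fun g hg => ?_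
  · rw [he]
    exact hmap _ _ (hρo _)
  · rw [MonoidHom.comp_apply, h1, hΦ]
  · rw [MonoidHom.comp_apply, h2, hT]
  · rw [MonoidHom.comp_apply, h3 g hg, hw g hg, map_one]

end ContinuousLift

section UniversalMatrices

open IsLocalRing Matrix Polynomial

variable (O : Type) [CommRing O] {r : ℕ} (d : Fin r → ℕ) (q L N : ℕ)

/-- The ring of power series over `PolyRing` that will be the universal lifting ring; the variables
are the entries of a change of basis and of a Frobenius matrix. -/
abbrev UnivRing : Type :=
  MvPowerSeries ((Σ j, Fin (d j)) × (Σ j, Fin (d j))) (PolyRing O d q L N)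

/-- The inclusion of `PolyRing` as the constants. -/
def UnivRing.const : PolyRing O d q L N →ₐ[O] UnivRing O d q L N where
  toRingHom := MvPowerSeries.C
  commutes' x := by
    rw [MvPowerSeries.algebraMap_apply]
    rfl

/-- The coefficients of the universal characteristic polynomials of `σ`. -/
def UnivRing.coeff (j : Fin r) (i : Fin (d j)) : UnivRing O d q L N :=
  UnivRing.const O d q L N (PolyRing.coeff O d q L N j i)

theorem UnivRing.dvd_expand (j : Fin r) : deformPoly (UnivRing.coeff O d q L N j) ∣
    expand _ q (deformPoly (UnivRing.coeff O d q L N j)) := by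
  have e : (deformPoly (PolyRing.coeff O d q L N j)).map
      (UnivRing.const O d q L N : PolyRing O d q L N →+* UnivRing O d q L N) =
      deformPoly (UnivRing.coeff O d q L N j) := deformPoly_map _ _
  obtain ⟨g, hg⟩ := PolyRing.dvd_expand O d q L N j
  rw [← e, ← map_expand, hg, Polynomial.map_mul]
  exact Dvd.intro _ rfl

variable [∀ j, NeZero (d j)]

/-- The universal Frobenius vectors, lifting `w`: their deviations from `w` are the variables that do
not occur in the change of basis. -/
def UnivRing.vec (w : ∀ j, Fin (d j) → O) (j : Fin r) (i : Fin (d j)) : UnivRing O d q L N :=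
  algebraMap O _ (w j i) + MvPowerSeries.X (⟨j, i⟩, ⟨j, 0⟩)

/-- The universal masked change of basis. -/
def UnivRing.basis : BlockMat d (UnivRing O d q L N) :=
  Matrix.of fun x y => (1 : BlockMat d (UnivRing O d q L N)) x y +
    if x.1 = y.1 ∧ y.2 = 0 then 0 else MvPowerSeries.X (x, y)

end UniversalMatrices

section Masked

open Matrix

variable {A : Type} [CommRing A] {r : ℕ} {d : Fin r → ℕ} [∀ j, NeZero (d j)]

theorem isMasked_iff {B : BlockMat d A} : IsMasked B ↔
    ∀ x y : Σ j, Fin (d j), x.1 = y.1 ∧ y.2 = 0 →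
      B x y = (1 : BlockMat d A) x y := by
  have key (j : Fin r) (i : Fin (d j)) :
      (1 : BlockMat d A) ⟨j, i⟩ ⟨j, 0⟩ =
        (Pi.single 0 1 : Fin (d j) → A) i := by
    rw [Matrix.one_apply, Pi.single_apply]
    simp
  constructor
  · rintro h ⟨j, i⟩ ⟨j', i'⟩ ⟨h1, h2⟩
    dsimp only at h1 h2
    subst h1
    rw [h2]
    rw [key, ← h j, mulVec_single_one]
    rfl
  · intro h j
    funext i
    rw [mulVec_single_one, ← key]
    exact h _ _ ⟨rfl, rfl⟩

theorem frobMats_mul_compMats {r : ℕ} {d : Fin r → ℕ} {q : ℕ} {c : ∀ j, Fin (d j) → A}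
    (hc : ∀ j, deformPoly (c j) ∣ Polynomial.expand A q (deformPoly (c j)))
    (w : ∀ j, Fin (d j) → A) :
    frobMats q c w * compMats c = compMats c ^ q * frobMats q c w := by
  rw [compMats_pow, frobMats, compMats, ← blockDiagonal'_mul, ← blockDiagonal'_mul]
  congr 1
  funext j
  exact frobMat_mul_compMat (hc j) (w j)

theorem compMats_map {r : ℕ} {d : Fin r → ℕ} {B : Type} [CommRing B] (f : A →+* B)
    (c : ∀ j, Fin (d j) → A) :
    (compMats c).map f = compMats fun j i => f (c j i) := by
  rw [compMats, blockDiagonal'_map _ _ (map_zero f), compMats]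
  congr 1
  funext j
  exact compMat_map f (c j)

theorem frobMats_map {r : ℕ} {d : Fin r → ℕ} {B : Type} [CommRing B] (f : A →+* B) (q : ℕ)
    (c w : ∀ j, Fin (d j) → A) :
    (frobMats q c w).map f = frobMats q (fun j i => f (c j i)) fun j i => f (w j i) := by
  rw [frobMats, blockDiagonal'_map _ _ (map_zero f), frobMats]
  congr 1
  funext j
  exact frobMat_map f q (c j) (w j)

end Masked

section Residual

variable {p l : ℕ} [Fact p.Prime] [Fact l.Prime] {F : IntermediateField ℚ_[p] (PadicAlgCl p)}
  {E : IntermediateField ℚ_[l] (PadicAlgCl l)} {n : ℕ}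

/-- A basis that puts a residual representation in normal form: `φ` and `σ` become block diagonal,
the block of `σ` is the companion matrix of `(X - 1) ^ d_j`, and the block of `φ` has the single
eigenvalue `α_j`. -/
structure ResidualBasis (φ : GaloisGroup F) (σ : inertia F)
    (ρbar : GaloisGroup F →* GL (Fin n) (ResidueField E)) where
  r : ℕ
  d : Fin r → ℕ
  neZero : ∀ j, NeZero (d j)
  b : GL (Fin n) (integers E)
  e : (Σ j, Fin (d j)) ≃ Fin n
  w : ∀ j, Fin (d j) → ResidueField E
  α : Fin r → ResidueField E
  injective : Function.Injective α
  nilpotent : ∀ j, IsNilpotent (frobMat (residueCard F) (fun _ => 0) (w j) - α j • 1)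
  map_frob : (ρbar φ).1 = frame b e (ResidueField E) (frobMats (residueCard F) (fun _ _ => 0) w)
  map_tame : (ρbar σ).1 = frame b e (ResidueField E) (compMats fun _ _ => 0)

instance {φ : GaloisGroup F} {σ : inertia F} {ρbar : GaloisGroup F →* GL (Fin n) (ResidueField E)}
    (D : ResidualBasis φ σ ρbar) (j : Fin D.r) : NeZero (D.d j) := D.neZero j

theorem ResidualBasis.le {φ : GaloisGroup F} {σ : inertia F}
    {ρbar : GaloisGroup F →* GL (Fin n) (ResidueField E)}
    (D : ResidualBasis φ σ ρbar) (j : Fin D.r) : D.d j ≤ n := by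
  have := Fintype.card_congr D.e
  rw [Fintype.card_sigma, Fintype.card_fin] at this
  refine le_of_le_of_eq ?_ this
  simpa using Finset.single_le_sum (f := fun j => Fintype.card (Fin (D.d j)))
    (fun _ _ => Nat.zero_le _) (Finset.mem_univ j)

end Residual

section Universal

open IsLocalRing Matrix Polynomial

variable {l : ℕ} [Fact l.Prime] {E : IntermediateField ℚ_[l] (PadicAlgCl l)}

theorem natCast_mem_maximalIdeal : (l : integers E) ∈ maximalIdeal (integers E) := by
  rw [← residue_eq_zero_iff, map_natCast]
  exact CharP.cast_eq_zero _ l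

theorem natCast_mem_maximalIdeal_of_coefficientRing (A : Type) [CommRing A] [IsLocalRing A]
    [Algebra (integers E) A] [IsCoefficientRing E A] : (l : A) ∈ maximalIdeal A := by
  rw [← reduction_eq_zero_iff E, map_natCast]
  exact CharP.cast_eq_zero _ l

variable {r : ℕ} {d : Fin r → ℕ} {q a N : ℕ}

theorem reduction_coeff [IsLocalRing (PolyRing (integers E) d q (l ^ a) N)]
    [IsCoefficientRing E (UnivRing (integers E) d q (l ^ a) N)] (j : Fin r) (i : Fin (d j)) :
    reduction E (UnivRing (integers E) d q (l ^ a) N) (UnivRing.coeff _ d q (l ^ a) N j i) = 0 := by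
  let f := (reduction E (UnivRing (integers E) d q (l ^ a) N)).comp (UnivRing.const _ d q (l ^ a) N)
  have hf : Function.Surjective f := fun y => by
    obtain ⟨x, rfl⟩ := residue_surjective y
    exact ⟨algebraMap _ _ x, f.commutes x⟩
  have hM : (RingHom.ker (f : PolyRing (integers E) d q (l ^ a) N →+* ResidueField E)).IsMaximal :=
    RingHom.ker_isMaximal_of_surjective _ hf
  exact PolyRing.coeff_mem_of_isMaximal (Fact.out : l.Prime) natCast_mem_maximalIdeal
    (RingHom.ker (f : PolyRing (integers E) d q (l ^ a) N →+* ResidueField E)) j i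

theorem X_mem_maximalIdeal [IsLocalRing (PolyRing (integers E) d q (l ^ a) N)]
    (z : (Σ j, Fin (d j)) × (Σ j, Fin (d j))) :
    (MvPowerSeries.X z : UnivRing (integers E) d q (l ^ a) N) ∈ maximalIdeal _ := by
  rw [mem_maximalIdeal_powerSeries, MvPowerSeries.constantCoeff_X]
  exact zero_mem _

variable [∀ j, NeZero (d j)]

theorem reduction_basis [IsLocalRing (PolyRing (integers E) d q (l ^ a) N)]
    [IsCoefficientRing E (UnivRing (integers E) d q (l ^ a) N)] :
    (UnivRing.basis (integers E) d q (l ^ a) N).map (reduction E _) = 1 := by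
  ext x y
  rw [map_apply, UnivRing.basis, of_apply, map_add, one_apply, one_apply]
  have : reduction E (UnivRing (integers E) d q (l ^ a) N)
      (if x.1 = y.1 ∧ y.2 = 0 then 0 else MvPowerSeries.X (x, y)) = 0 := by
    split_ifs
    · exact map_zero _
    · exact (reduction_eq_zero_iff E).2 (X_mem_maximalIdeal _)
  rw [this, add_zero]
  split_ifs <;> simp

theorem reduction_vec [IsLocalRing (PolyRing (integers E) d q (l ^ a) N)]
    [IsCoefficientRing E (UnivRing (integers E) d q (l ^ a) N)] (w : ∀ j, Fin (d j) → integers E)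
    (j : Fin r) (i : Fin (d j)) :
    reduction E _ (UnivRing.vec (integers E) d q (l ^ a) N w j i) = residue _ (w j i) := by
  rw [UnivRing.vec, map_add, (reduction_eq_zero_iff E).2 (X_mem_maximalIdeal _), add_zero]
  exact (reduction E _).commutes _

end Universal

section Universal

open IsLocalRing Matrix Polynomial

variable {p l : ℕ} [Fact p.Prime] [Fact l.Prime] {F : IntermediateField ℚ_[p] (PadicAlgCl p)}
  [FiniteDimensional ℚ_[p] F] {E : IntermediateField ℚ_[l] (PadicAlgCl l)} {n : ℕ}

/-- The points of `UnivRing` with nilpotent coordinates are the normal forms. -/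
theorem exists_univRing_hom {r : ℕ} {d : Fin r → ℕ} [∀ j, NeZero (d j)] {O : Type} [CommRing O]
    {q L N : ℕ}
    {A : Type} [CommRing A] [Algebra O A] (w₀ : ∀ j, Fin (d j) → O)
    {c w : ∀ j, Fin (d j) → A} {B : BlockMat d A}
    (h1 : ∀ j, deformPoly (c j) ∣ expand A q (deformPoly (c j)))
    (h2 : ∀ j, deformPoly (c j) ∣ (X ^ L - 1) ^ N)
    (hw : ∀ j i, IsNilpotent (w j i - algebraMap O A (w₀ j i)))
    (hB : ∀ x y, IsNilpotent ((B - 1) x y)) (hmask : IsMasked B) :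
    ∃ f : UnivRing O d q L N →ₐ[O] A, (∀ j i, f (UnivRing.coeff O d q L N j i) = c j i) ∧
      (∀ j i, f (UnivRing.vec O d q L N w₀ j i) = w j i) ∧
      (UnivRing.basis O d q L N).map f = B := by
  obtain ⟨g, hg⟩ := PolyRing.exists_lift (O := O) c h1 h2
  let y : (Σ j, Fin (d j)) × (Σ j, Fin (d j)) → A := fun z =>
    if z.1.1 = z.2.1 ∧ z.2.2 = 0 then w z.1.1 z.1.2 - algebraMap O A (w₀ z.1.1 z.1.2)
    else (B - 1) z.1 z.2
  obtain ⟨f, hfC, hfX⟩ := exists_powerSeries_hom_of_nilpotent (g : PolyRing O d q L N →+* A)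
    (a := y) fun z => by
      dsimp only [y]
      split_ifs
      · exact hw _ _
      · exact hB _ _
  have hfa (x : O) : f (algebraMap O _ x) = algebraMap O A x := by
    rw [← (UnivRing.const O d q L N).commutes]
    exact (hfC _).trans (g.commutes x)
  refine ⟨{ toRingHom := f, commutes' := hfa }, fun j i => (hfC _).trans (hg j i), fun j i => ?_, ?_⟩
  · change f _ = _
    rw [UnivRing.vec, map_add, hfX, hfa]
    simp [y]
  · ext s t
    change f (UnivRing.basis O d q L N s t) = B s t
    rw [UnivRing.basis, of_apply, map_add]
    have e : f ((1 : BlockMat d _) s t) =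
        (1 : BlockMat d A) s t := by
      rw [one_apply, one_apply]; split_ifs <;> simp
    rw [e]
    split_ifs with h
    · rw [map_zero, add_zero, isMasked_iff.1 hmask s t h]
    · rw [hfX]
      simp [y, h]

theorem univRing_hom_ext {r : ℕ} {d : Fin r → ℕ} [∀ j, NeZero (d j)] {O : Type} [CommRing O]
    {q L N : ℕ} {A : Type} [CommRing A] [Algebra O A] (w₀ : ∀ j, Fin (d j) → O) {I : Ideal A}
    {k : ℕ} (hI : I ^ k = ⊥) {f f' : UnivRing O d q L N →ₐ[O] A}
    (hX : ∀ z, f (MvPowerSeries.X z) ∈ I)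
    (hc : ∀ j i, f (UnivRing.coeff O d q L N j i) = f' (UnivRing.coeff O d q L N j i))
    (hw : ∀ j i, f (UnivRing.vec O d q L N w₀ j i) = f' (UnivRing.vec O d q L N w₀ j i))
    (hB : (UnivRing.basis O d q L N).map f = (UnivRing.basis O d q L N).map f') : f = f' := by
  have hS : f.comp (UnivRing.const O d q L N) = f'.comp (UnivRing.const O d q L N) :=
    PolyRing.algHom_ext hc
  refine AlgHom.coe_ringHom_injective (powerSeries_hom_ext hI (fun s => DFunLike.congr_fun hS s)
    (fun z => ?_) hX)
  change f (MvPowerSeries.X z) = f' (MvPowerSeries.X z)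
  obtain ⟨⟨j, i⟩, ⟨j', i'⟩⟩ := z
  by_cases h : j = j' ∧ i' = 0
  · obtain ⟨rfl, rfl⟩ := h
    have := hw j i
    rw [UnivRing.vec, map_add, map_add, f.commutes, f'.commutes] at this
    exact add_left_cancel this
  · have := congrFun (congrFun hB ⟨j, i⟩) ⟨j', i'⟩
    rw [map_apply, map_apply, UnivRing.basis, of_apply, if_neg h, map_add, map_add] at this
    have e (g : UnivRing O d q L N →ₐ[O] A) : g ((1 : BlockMat d _)
        ⟨j, i⟩ ⟨j', i'⟩) = (1 : BlockMat d A) ⟨j, i⟩ ⟨j', i'⟩ := by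
      rw [one_apply, one_apply]; split_ifs <;> simp
    rw [e, e] at this
    exact add_left_cancel this

theorem isMasked_univRing_basis {r : ℕ} {d : Fin r → ℕ} [∀ j, NeZero (d j)] {O : Type} [CommRing O]
    {q L N : ℕ} {A : Type} [CommRing A] [Algebra O A] (f : UnivRing O d q L N →ₐ[O] A) :
    IsMasked ((UnivRing.basis O d q L N).map f) := by
  rw [isMasked_iff]
  intro x y h
  rw [map_apply, UnivRing.basis, of_apply, if_pos h, add_zero, one_apply, one_apply]
  split_ifs <;> simp

section Abstract

variable {φ : GaloisGroup F} {σ : inertia F} {ρbar : GaloisGroup F →* GL (Fin n) (ResidueField E)}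
  (D : ResidualBasis φ σ ρbar) {R : Type} [CommRing R] [IsLocalRing R] [Algebra (integers E) R]
  [IsCoefficientRing E R]

/-- A matrix in normal form, over a complete coefficient ring, gives a continuous lift. -/
theorem exists_lift_of_normalForm [FiniteDimensional ℚ_[l] E] [IsNoetherianRing R]
    [IsAdicComplete (maximalIdeal R) R]
    (hφ : IsFrobenius F φ) (hσ : IsTameGenerator F σ) (hl : l ∣ residueCard F - 1)
    (hρbar : IsOpen (ρbar.ker : Set (GaloisGroup F)))
    (hw : ∀ g ∈ wildInertia F, ρbar g = 1) {c w : ∀ j, Fin (D.d j) → R}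
    {B : BlockMat D.d R}
    (hcπ : ∀ j i, reduction E R (c j i) = 0) (hwπ : ∀ j i, reduction E R (w j i) = D.w j i)
    (hBπ : B.map (reduction E R : R →+* ResidueField E) = 1)
    (hdvd : ∀ j, deformPoly (c j) ∣ expand R (residueCard F) (deformPoly (c j))) :
    ∃ (ρ : GaloisGroup F →* GL (Fin n) R) (Φ T : BlockMat D.d R),
      (ρ φ).1 = frame D.b D.e R Φ ∧ (ρ σ).1 = frame D.b D.e R T ∧ IsUnit B ∧
      Φ * B = B * frobMats (residueCard F) c w ∧ T * B = B * compMats c ∧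
      (∀ k, IsOpen (((glMap
        (Ideal.Quotient.mk (maximalIdeal R ^ k))).comp ρ).ker : Set (GaloisGroup F))) ∧
      IsLift ρbar ρ ∧ ∀ g ∈ wildInertia F, ρ g = 1 := by
  let π : R →+* ResidueField E := reduction E R
  have hFπ : (frobMats (residueCard F) c w).map π = frobMats (residueCard F) (fun _ _ => 0) D.w := by
    rw [frobMats_map]
    congr 1
    · funext j i; exact hcπ j i
    · funext j i; exact hwπ j i
  have hCπ : (compMats c).map π = compMats fun _ _ => 0 := by
    rw [compMats_map]
    congr 1
    funext j i; exact hcπ j i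
  have hFu : IsUnit (frobMats (residueCard F) (fun _ _ => 0) D.w) := by
    rw [← MulEquiv.isUnit_map (frame D.b D.e (ResidueField E)), ← D.map_frob]
    exact (ρbar φ).isUnit
  have hCu : IsUnit (compMats fun (j : Fin D.r) (_ : Fin (D.d j)) => (0 : ResidueField E)) := by
    rw [← MulEquiv.isUnit_map (frame D.b D.e (ResidueField E)), ← D.map_tame]
    exact (ρbar σ).isUnit
  obtain ⟨uB, huB⟩ := isUnit_of_isUnit_map (π := π) (M := B) (by rw [hBπ]; exact isUnit_one)
  obtain ⟨uF, huF⟩ := isUnit_of_isUnit_map (π := π) (M := frobMats (residueCard F) c w)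
    (by rw [hFπ]; exact hFu)
  obtain ⟨uC, huC⟩ := isUnit_of_isUnit_map (π := π) (M := compMats c) (by rw [hCπ]; exact hCu)
  have hrel : uF * uC = uC ^ residueCard F * uF := Units.ext (by
    rw [Units.val_mul, Units.val_mul, Units.val_pow_eq_pow_val, huF, huC]
    exact frobMats_mul_compMats hdvd w)
  let Θ : (BlockMat D.d R)ˣ ≃* GL (Fin n) R :=
    Units.mapEquiv (frame D.b D.e R)
  have hBinv : (uB⁻¹).1.map π = 1 := by
    have h : (uB⁻¹).1.map π * B.map π = 1 := by
      rw [← Matrix.map_mul, ← huB, uB.inv_mul]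
      exact map_one π.mapMatrix
    rwa [hBπ, mul_one] at h
  have hconj (u : (BlockMat D.d R)ˣ) :
      (Θ (uB * u * uB⁻¹)).1.map (reduction E R) =
        frame D.b D.e (ResidueField E) (u.1.map π) := by
    change (frame D.b D.e R (uB * u * uB⁻¹).1).map (reduction E R) = _
    rw [frame_map]
    congr 1
    have h : ((uB * u * uB⁻¹).1).map π = u.1.map π := by
      rw [Units.val_mul, Units.val_mul, Matrix.map_mul, Matrix.map_mul, huB, hBπ, hBinv, mul_one,
        one_mul]
    exact h
  have hσl : ∃ m, ρbar σ ^ l ^ m = 1 := by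
    obtain ⟨m, hm⟩ := exists_pow_eq_one_of_map_eq_compMats (π := RingHom.id (ResidueField E))
      (T := compMats fun (j : Fin D.r) (_ : Fin (D.d j)) => (0 : ResidueField E))
      (Fact.out : l.Prime) (k := 1)
      (by rw [pow_one]; exact (RingHom.injective_iff_ker_eq_bot _).1 Function.injective_id) rfl
    refine ⟨m, Units.ext ?_⟩
    rw [Units.val_pow_eq_pow_val, D.map_tame, ← map_pow, hm, map_one, Units.val_one]
  obtain ⟨ρ, hρφ, hρσ, hρo, hρl, hρw⟩ := exists_continuous_lift hφ hσ hl hρbar hw hσl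
    (Θ (uB * uF * uB⁻¹)) (Θ (uB * uC * uB⁻¹))
    (Units.ext ((hconj uF).trans (by rw [D.map_frob, huF, hFπ])))
    (Units.ext ((hconj uC).trans (by rw [D.map_tame, huC, hCπ])))
    (by
      rw [← map_mul, ← map_pow, ← map_mul, conj_pow]
      congr 1
      calc uB * uF * uB⁻¹ * (uB * uC * uB⁻¹) = uB * (uF * uC) * uB⁻¹ := by group
        _ = _ := by rw [hrel]; group)
  refine ⟨ρ, (uB * uF * uB⁻¹).1, (uB * uC * uB⁻¹).1, by rw [hρφ]; rfl, by rw [hρσ]; rfl,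
    huB ▸ uB.isUnit, ?_, ?_, hρo, hρl, hρw⟩
  · rw [Units.val_mul, Units.val_mul, ← huB, mul_assoc, mul_assoc, uB.inv_mul, mul_one, huF]
  · rw [Units.val_mul, Units.val_mul, ← huB, mul_assoc, mul_assoc, uB.inv_mul, mul_one, huC]

/-- The specialization of a lift in normal form is described by the specialization of its normal
form. -/
theorem comp_eq_iff_normalForm (hφ : IsFrobenius F φ) (hσ : IsTameGenerator F σ)
    {c w : ∀ j, Fin (D.d j) → R}
    {B Φ T : BlockMat D.d R}
    {ρ : GaloisGroup F →* GL (Fin n) R}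
    (hρφ : (ρ φ).1 = frame D.b D.e R Φ) (hρσ : (ρ σ).1 = frame D.b D.e R T) (hB : IsUnit B)
    (hF : Φ * B = B * frobMats (residueCard F) c w) (hT : T * B = B * compMats c)
    (hρo : ∀ k, IsOpen (((glMap
        (Ideal.Quotient.mk (maximalIdeal R ^ k))).comp ρ).ker : Set (GaloisGroup F)))
    (hρw : ∀ g ∈ wildInertia F, ρ g = 1)
    {A : Type} [CommRing A] [IsLocalRing A] [Algebra (integers E) A] [IsCoefficientRing E A]
    {k : ℕ} (hk : maximalIdeal A ^ k = ⊥) {ρA : GaloisGroup F →* GL (Fin n) A}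
    (hρA : IsOpen (ρA.ker : Set (GaloisGroup F))) (hρAw : ∀ g ∈ wildInertia F, ρA g = 1)
    (f : R →ₐ[integers E] A) :
    (glMap (f : R →+* A)).comp ρ = ρA ↔
        (frame D.b D.e A).symm (ρA φ).1 * B.map f = B.map f * frobMats (residueCard F)
          (fun j i => f (c j i)) (fun j i => f (w j i)) ∧
        (frame D.b D.e A).symm (ρA σ).1 * B.map f = B.map f * compMats fun j i => f (c j i) := by
  have hBf : IsUnit (B.map f) := hB.map (f : R →+* A).mapMatrix
  have hf (M N : BlockMat D.d R) (hMN : M * B = B * N)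
      (g : GaloisGroup F) (hg : (ρ g).1 = frame D.b D.e R M) :
      ((glMap (f : R →+* A)).comp ρ) g = ρA g ↔
        (frame D.b D.e A).symm (ρA g).1 * B.map f = B.map f * N.map f := by
    rw [Units.ext_iff]
    have e : (((glMap (f : R →+* A)).comp ρ) g).1 =
        frame D.b D.e A (M.map f) := by
      rw [← frame_map, ← hg]; rfl
    have h2 : M.map f * B.map f = B.map f * N.map f := by
      have := congrArg (f : R →+* A).mapMatrix hMN
      rw [map_mul, map_mul] at this
      exact this
    rw [e, ← MulEquiv.eq_symm_apply, eq_comm, ← h2]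
    exact (hBf.mul_left_inj).symm
  have hfF : (frobMats (residueCard F) c w).map f = frobMats (residueCard F)
      (fun j i => f (c j i)) (fun j i => f (w j i)) := frobMats_map (f : R →+* A) _ _ _
  have hfC : (compMats c).map f = compMats fun j i => f (c j i) := compMats_map (f : R →+* A) _
  rw [← hfF, ← hfC, ← hf _ _ hF φ hρφ, ← hf _ _ hT σ hρσ]
  refine ⟨fun h => by rw [h]; exact ⟨rfl, rfl⟩, fun h => ?_⟩
  refine hom_ext_of_tame hφ hσ ?_ hρA h.1 h.2 fun g hg => ?_
  · refine Subgroup.isOpen_mono (fun g hg => ?_) (hρo k)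
    rw [MonoidHom.mem_ker] at hg ⊢
    refine GeneralLinearGroup.ext fun i j => ?_
    have h1 : Ideal.Quotient.mk (maximalIdeal R ^ k) ((ρ g).1 i j) =
        Ideal.Quotient.mk (maximalIdeal R ^ k) ((1 : Matrix (Fin n) (Fin n) R) i j) := by
      refine (congrArg (fun x : GL (Fin n) (R ⧸ maximalIdeal R ^ k) => x.1 i j) hg).trans ?_
      rw [Units.val_one, one_apply, one_apply]
      split_ifs <;> simp
    rw [Ideal.Quotient.eq] at h1
    have h2 : f ((ρ g).1 i j - (1 : Matrix (Fin n) (Fin n) R) i j) ∈ maximalIdeal A ^ k := by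
      have hle : (maximalIdeal R).map (f : R →+* A) ≤ maximalIdeal A :=
        Ideal.map_le_iff_le_comap.2 fun x hx => algHom_mem_maximalIdeal E f hx
      have := Ideal.mem_map_of_mem (f : R →+* A) h1
      rw [Ideal.map_pow] at this
      exact Ideal.pow_right_mono hle k this
    rw [hk, Ideal.mem_bot, map_sub, sub_eq_zero] at h2
    refine h2.trans ?_
    rw [one_apply, Units.val_one, one_apply]
    split_ifs <;> simp
  · rw [hρAw g hg, MonoidHom.comp_apply, hρw g hg, map_one]

end Abstract

end Universal

section Universal

open IsLocalRing Matrix Polynomial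

variable {p l : ℕ} [Fact p.Prime] [Fact l.Prime] {F : IntermediateField ℚ_[p] (PadicAlgCl p)}
  [FiniteDimensional ℚ_[p] F] {E : IntermediateField ℚ_[l] (PadicAlgCl l)}
  {n : ℕ}

variable {φ : GaloisGroup F} {σ : inertia F} {ρbar : GaloisGroup F →* GL (Fin n) (ResidueField E)}
  (D : ResidualBasis φ σ ρbar)

/-- The lift over a ring that carries the universal normal form is universal. -/
theorem existsUnique_of_normalForm {R : Type} [CommRing R] [IsLocalRing R] [Algebra (integers E) R]
    [IsCoefficientRing E R]
    (hφ : IsFrobenius F φ) (hσ : IsTameGenerator F σ) (hl : l ∣ residueCard F - 1) (hlp : l ≠ p)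
    (hw : ∀ g ∈ wildInertia F, ρbar g = 1) {c w : ∀ j, Fin (D.d j) → R}
    {B Φ T : BlockMat D.d R}
    (hcπ : ∀ j i, reduction E R (c j i) = 0) (hwπ : ∀ j i, reduction E R (w j i) = D.w j i)
    (hBπ : B.map (reduction E R : R →+* ResidueField E) = 1)
    {ρ : GaloisGroup F →* GL (Fin n) R}
    (hρφ : (ρ φ).1 = frame D.b D.e R Φ) (hρσ : (ρ σ).1 = frame D.b D.e R T) (hB : IsUnit B)
    (hF : Φ * B = B * frobMats (residueCard F) c w) (hT : T * B = B * compMats c)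
    (hρo : ∀ k, IsOpen (((glMap
        (Ideal.Quotient.mk (maximalIdeal R ^ k))).comp ρ).ker : Set (GaloisGroup F)))
    (hρw : ∀ g ∈ wildInertia F, ρ g = 1)
    {A : Type} [CommRing A] [IsLocalRing A] [IsArtinianRing A] [Algebra (integers E) A]
    [IsCoefficientRing E A]
    (hmask : ∀ f : R →ₐ[integers E] A, IsMasked (B.map f))
    (hex : ∀ (c' w' : ∀ j, Fin (D.d j) → A) (B' : BlockMat D.d A),
      (∀ j i, reduction E A (c' j i) = 0) → (∀ j i, reduction E A (w' j i) = D.w j i) →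
      B'.map (reduction E A : A →+* ResidueField E) = 1 → IsMasked B' →
      (∀ j, deformPoly (c' j) ∣ expand A (residueCard F) (deformPoly (c' j))) →
      ∃ f : R →ₐ[integers E] A, (∀ j i, f (c j i) = c' j i) ∧ (∀ j i, f (w j i) = w' j i) ∧
        B.map f = B')
    (hext : ∀ f f' : R →ₐ[integers E] A, (∀ j i, f (c j i) = f' (c j i)) →
      (∀ j i, f (w j i) = f' (w j i)) → B.map f = B.map f' → f = f')
    {ρA : GaloisGroup F →* GL (Fin n) A} (hρA : IsOpen (ρA.ker : Set (GaloisGroup F)))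
    (hlift : IsLift ρbar ρA) :
    ∃! f : R →ₐ[integers E] A, (glMap (f : R →+* A)).comp ρ = ρA := by
  have hql : residueCard F ≡ 1 [MOD l] :=
    ((Nat.modEq_iff_dvd' (one_lt_residueCard F).le).2 hl).symm
  obtain ⟨k, hk⟩ := IsArtinianRing.isNilpotent_jacobson_bot (R := A)
  rw [IsLocalRing.jacobson_eq_maximalIdeal ⊥ bot_ne_top, Ideal.zero_eq_bot] at hk
  have hker : RingHom.ker (reduction E A : A →+* ResidueField E) ^ k = ⊥ := by
    rw [ker_reduction, hk]
  have hAsurj : Function.Surjective (reduction E A : A →+* ResidueField E) :=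
    reduction_surjective E A
  have hred := (isLift_iff E).1 hlift
  have hredg (g : GaloisGroup F) : (ρA g).1.map (reduction E A) = (ρbar g).1 :=
    congrArg Units.val (DFunLike.congr_fun hred g)
  have hρAw : ∀ g ∈ wildInertia F, ρA g = 1 := by
    refine lift_wildInertia hlp hker hρA fun g hg => ?_
    refine (hredg g).trans ?_
    rw [hw g hg, Units.val_one]
  have hcomp := fun f => comp_eq_iff_normalForm D hφ hσ hρφ hρσ hB hF hT hρo hρw hk hρA hρAw f
  have hrelA : (frame D.b D.e A).symm (ρA φ).1 * (frame D.b D.e A).symm (ρA σ).1 =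
      (frame D.b D.e A).symm (ρA σ).1 ^ residueCard F * (frame D.b D.e A).symm (ρA φ).1 := by
    rw [← map_mul, ← map_pow, ← map_mul, ← Units.val_mul, ← Units.val_pow_eq_pow_val,
      ← Units.val_mul]
    congr 2
    have h := hρAw _ (tame_relation hφ σ.2)
    rw [map_mul, map_inv, map_pow, inv_mul_eq_one, map_mul, map_mul, map_inv,
      eq_mul_inv_iff_mul_eq] at h
    exact h.symm
  have hredF : ((frame D.b D.e A).symm (ρA φ).1).map (reduction E A) =
      frobMats (residueCard F) (fun _ _ => 0) D.w := by
    apply (frame D.b D.e (ResidueField E)).injective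
    rw [← frame_map, MulEquiv.apply_symm_apply, hredg, D.map_frob]
  have hredC : ((frame D.b D.e A).symm (ρA σ).1).map (reduction E A) =
      compMats fun _ _ => 0 := by
    apply (frame D.b D.e (ResidueField E)).injective
    rw [← frame_map, MulEquiv.apply_symm_apply, hredg, D.map_tame]
  obtain ⟨c', w', B', hc', hw', hB', hm', hT', hF', hd'⟩ := exists_normalForm
    (Fact.out : l.Prime) hker hAsurj hql D.injective D.nilpotent
    ((ρA φ).isUnit.map (frame D.b D.e A).symm) hredF hredC hrelA
  obtain ⟨f, hfc, hfw, hfB⟩ := hex c' w' B' hc' hw' hB' hm' hd'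
  refine ⟨f, (hcomp f).2 ?_, fun f' hf' => ?_⟩
  · simp only [hfc, hfw, hfB]
    exact ⟨hF', hT'⟩
  · obtain ⟨h1, h2⟩ := (hcomp f').1 hf'
    have hBf' : (B.map f').map (reduction E A : A →+* ResidueField E) = 1 := by
      rw [← hBπ]
      ext i j
      exact reduction_algHom E f' _
    obtain ⟨U, hU⟩ := isUnit_of_isUnit_map (π := (reduction E A : A →+* ResidueField E))
      (M := B.map f') (by rw [hBf']; exact isUnit_one)
    have hP (M N N' : BlockMat D.d A)
        (h : M * B.map f' = B.map f' * N) (h' : M * B' = B' * N') :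
        N * (U⁻¹.1 * B') = (U⁻¹.1 * B') * N' := by
      rw [← hU] at h
      have e : N = U⁻¹.1 * M * U.1 := by rw [mul_assoc, h, Units.inv_mul_cancel_left]
      rw [e, mul_assoc, Units.mul_inv_cancel_left, mul_assoc, h', mul_assoc]
    have hcw := normalForm_unique (P := U⁻¹.1 * B') (B := B.map f') (B' := B') hker hAsurj
      D.injective D.nilpotent (c := fun j i => f' (c j i)) (c' := c') (w := fun j i => f' (w j i))
      (w' := w') (fun j i => (reduction_algHom E f' _).trans (hcπ j i)) hc'
      (fun j i => (reduction_algHom E f' _).trans (hwπ j i)) hw' hBf' (hmask f') hm'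
      (by rw [← hU, Units.mul_inv_cancel_left]) (hP _ _ _ h2 hT') (hP _ _ _ h1 hF')
    refine hext f' f (fun j i => ?_) (fun j i => ?_) ?_
    · rw [hfc, ← hcw.1]
    · rw [hfw, ← hcw.2.1]
    · rw [hfB, ← hcw.2.2]

/-- The universal lifting ring is a ring of power series over `PolyRing`. -/
theorem exists_universalLift [FiniteDimensional ℚ_[l] E] (hφ : IsFrobenius F φ)
    (hσ : IsTameGenerator F σ)
    (hl : l ∣ residueCard F - 1) (hlp : l ≠ p)
    (hρbar : IsOpen (ρbar.ker : Set (GaloisGroup F)))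
    (hw : ∀ g ∈ wildInertia F, ρbar g = 1) {a N : ℕ}
    (hN : ∀ d ≤ n, ∀ (A : Type) [CommRing A] [IsLocalRing A],
      (l : A) ∈ maximalIdeal A → ∀ c : Fin d → A, (∀ i, c i ∈ maximalIdeal A) →
      deformPoly c ∣ expand A (residueCard F) (deformPoly c) →
      deformPoly c ∣ (X ^ l ^ a - 1) ^ N)
    [NeZero (l ^ a)]
    [IsLocalRing (PolyRing (integers E) D.d (residueCard F) (l ^ a) N)]
    [IsCoefficientRing E (UnivRing (integers E) D.d (residueCard F) (l ^ a) N)] :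
    ∃ ρ : GaloisGroup F →* GL (Fin n) (UnivRing (integers E) D.d (residueCard F) (l ^ a) N),
      IsUniversalLift ρbar ρ ∧ (∀ g ∈ wildInertia F, ρ g = 1) ∧
      ∃ T P, (ρ σ).1 = frame D.b D.e _ T ∧ IsUnit P ∧
        T * P = P * compMats (UnivRing.coeff (integers E) D.d (residueCard F) (l ^ a) N) := by
  have := isAdicComplete_of_finite (O := integers E)
    (S := PolyRing (integers E) D.d (residueCard F) (l ^ a) N)
  have : IsNoetherianRing (PolyRing (integers E) D.d (residueCard F) (l ^ a) N) :=
    IsNoetherianRing.of_finite (integers E) _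
  have := isAdicComplete_powerSeries
    (ι := (Σ j, Fin (D.d j)) × (Σ j, Fin (D.d j)))
    (S := PolyRing (integers E) D.d (residueCard F) (l ^ a) N)
  choose w₀ hw₀ using fun j i => residue_surjective (D.w j i)
  have hwπ (j i) := (reduction_vec (E := E) (d := D.d) (q := residueCard F) (a := a) (N := N)
    w₀ j i).trans (hw₀ j i)
  obtain ⟨ρ, Φ, T, hρφ, hρσ, hB, hF, hT, hρo, hρl, hρw⟩ := exists_lift_of_normalForm D hφ hσ hl
    hρbar hw (c := UnivRing.coeff (integers E) D.d (residueCard F) (l ^ a) N)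
    (w := UnivRing.vec (integers E) D.d (residueCard F) (l ^ a) N w₀) reduction_coeff
    hwπ reduction_basis (UnivRing.dvd_expand _ _ _ _ _)
  refine ⟨ρ, ⟨inferInstance, inferInstance, hρo, hρl, fun A _ _ _ _ _ ρA hρA hlift => ?_⟩, hρw,
    T, _, hρσ, hB, hT⟩
  refine existsUnique_of_normalForm D hφ hσ hl hlp hw reduction_coeff hwπ reduction_basis
    hρφ hρσ hB hF hT hρo hρw (fun f => isMasked_univRing_basis f)
    (fun c' w' B' hc' hw' hB' hm' hd' => ?_) (fun f f' h1 h2 h3 => ?_) hρA hlift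
  · obtain ⟨k, hk⟩ := IsArtinianRing.isNilpotent_jacobson_bot (R := A)
    rw [IsLocalRing.jacobson_eq_maximalIdeal ⊥ bot_ne_top, Ideal.zero_eq_bot] at hk
    have hnil {x : A} (hx : reduction E A x = 0) : IsNilpotent x := by
      refine ⟨k, ?_⟩
      have := Ideal.pow_mem_pow ((reduction_eq_zero_iff E).1 hx) k
      rwa [hk] at this
    refine exists_univRing_hom w₀ hd' (fun j => hN _ (D.le j) A
      (natCast_mem_maximalIdeal_of_coefficientRing (E := E) A) _
      (fun i => (reduction_eq_zero_iff E).1 (hc' j i)) (hd' j)) (fun j i => hnil ?_)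
      (fun x y => hnil ?_) hm'
    · rw [map_sub, hw', ← hw₀, sub_eq_zero]
      exact ((reduction E A).commutes _).symm
    · have := congrFun (congrFun hB' x) y
      rw [map_apply] at this
      rw [Matrix.sub_apply, map_sub, sub_eq_zero]
      refine this.trans ?_
      rw [one_apply, one_apply]
      split_ifs <;> simp
  · obtain ⟨k, hk⟩ := IsArtinianRing.isNilpotent_jacobson_bot (R := A)
    rw [IsLocalRing.jacobson_eq_maximalIdeal ⊥ bot_ne_top, Ideal.zero_eq_bot] at hk
    exact univRing_hom_ext w₀ hk (fun z => algHom_mem_maximalIdeal E f (X_mem_maximalIdeal z))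
      h1 h2 h3

end Universal

/-! ### Distinguished representations in normal form -/

section Cyclic

open Polynomial Module

variable {K V : Type} [Field K] [AddCommGroup V] [Module K V] {T : End K V} {v : V} {d : ℕ}

theorem aeval_vecPoly_apply (g : Fin d → K) :
    aeval T (vecPoly g) v = ∑ i, g i • (T ^ (i : ℕ)) v := by
  simp [vecPoly, LinearMap.sum_apply, map_sum, algebraMap_end_apply]

theorem deformPoly_zero (A : Type) [CommRing A] (d : ℕ) :
    deformPoly (fun _ : Fin d => (0 : A)) = (X - 1) ^ d := by
  simp [deformPoly]

/-- A vector annihilated by `(T - 1) ^ d` is annihilated by the remainders modulo `(X - 1) ^ d`. -/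
theorem aeval_apply_eq_sum_remVec (h : aeval T ((X - 1 : K[X]) ^ d) v = 0) (p : K[X]) :
    aeval T p v = ∑ i, remVec (deformPoly fun _ : Fin d => (0 : K)) d p i • (T ^ (i : ℕ)) v := by
  rw [← aeval_vecPoly_apply, vecPoly_remVec, deformPoly_zero]
  conv_lhs => rw [← modByMonic_add_div p ((X - 1 : K[X]) ^ d)]
  rw [map_add, LinearMap.add_apply, mul_comm ((X - 1 : K[X]) ^ d), map_mul, Module.End.mul_apply,
    h, map_zero, add_zero]

theorem linearIndependent_pow_apply (h : aeval T ((X - 1 : K[X]) ^ d) v = 0)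
    (h' : aeval T ((X - 1 : K[X]) ^ (d - 1)) v ≠ 0) :
    LinearIndependent K fun i : Fin d => (T ^ (i : ℕ)) v := by
  classical
  rw [Fintype.linearIndependent_iff]
  intro g hg
  rw [← aeval_vecPoly_apply] at hg
  have hd : d ≠ 0 := by
    rintro rfl
    exact h' (by simpa using h)
  suffices h0 : vecPoly g = 0 by
    intro i
    have := remVec_vecPoly (fun _ => 0) g
    rw [h0] at this
    rw [← this]
    simp [remVec]
  by_contra h0
  have hprime : Prime (X - 1 : K[X]) := by
    rw [← C_1]; exact prime_X_sub_C 1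
  obtain ⟨k, hk, hassoc⟩ := (dvd_prime_pow hprime d).1
    (EuclideanDomain.gcd_dvd_right (vecPoly g) ((X - 1) ^ d))
  have hkd : k ≤ d - 1 := by
    rcases hk.lt_or_eq with hlt | heq
    · omega
    · exfalso
      rw [heq] at hassoc
      have hdvd : (X - 1 : K[X]) ^ d ∣ vecPoly g :=
        hassoc.symm.dvd.trans (EuclideanDomain.gcd_dvd_left _ _)
      have hdeg := degree_le_of_dvd hdvd h0
      rw [degree_X_sub_one_pow] at hdeg
      exact absurd hdeg (not_le.2 (degree_sum_C_mul_X_pow_lt g))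
  have hgcd : aeval T (EuclideanDomain.gcd (vecPoly g) ((X - 1 : K[X]) ^ d)) v = 0 := by
    rw [EuclideanDomain.gcd_eq_gcd_ab, mul_comm (vecPoly g), mul_comm ((X - 1 : K[X]) ^ d),
      map_add, map_mul, map_mul, LinearMap.add_apply, Module.End.mul_apply, Module.End.mul_apply,
      hg, h, map_zero, map_zero, add_zero]
  obtain ⟨s, hs⟩ := hassoc.dvd.trans (pow_dvd_pow (X - 1 : K[X]) hkd)
  refine h' ?_
  rw [hs, mul_comm, map_mul, Module.End.mul_apply, hgcd, map_zero]

end Cyclic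

section Blocks

open Matrix

variable {A : Type} [CommRing A] {r : ℕ} {d : Fin r → ℕ} {m : Type} [Fintype m]

theorem mul_eq_mul_blockDiagonal' {u : (Σ j, Fin (d j)) → m → A} {M : Matrix m m A}
    {G : ∀ j, Matrix (Fin (d j)) (Fin (d j)) A}
    (h : ∀ j i, M *ᵥ u ⟨j, i⟩ = ∑ k, G j k i • u ⟨j, k⟩) :
    M * (Matrix.of u)ᵀ = (Matrix.of u)ᵀ * blockDiagonal' G := by
  ext x ⟨j, i⟩
  have h1 := congrFun (h j i) x
  rw [Finset.sum_apply] at h1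
  rw [Matrix.mul_apply]
  refine Eq.trans ?_ (h1.trans ?_)
  · rfl
  · rw [Matrix.mul_apply, Fintype.sum_sigma, Finset.sum_eq_single j]
    · refine Finset.sum_congr rfl fun k _ => ?_
      rw [blockDiagonal'_apply_eq]
      exact mul_comm _ _
    · intro j' _ hj'
      refine Finset.sum_eq_zero fun k _ => ?_
      rw [blockDiagonal'_apply_ne _ _ _ hj', mul_zero]
    · intro h; exact absurd (Finset.mem_univ _) h

end Blocks

section NormalBasis

open Matrix Polynomial Module

variable {K : Type} [Field K]

theorem exists_cyclic_vector {V : Type} [AddCommGroup V] [Module K V] {T : End K V}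
    {W : Submodule K V} (h : ∀ v ∈ W, T v ∈ W) (hd : 0 < finrank K W)
    (hmin : minpoly K (T.restrict h) = (X - 1) ^ finrank K W) :
    ∃ v, (∀ k, (T ^ k) v ∈ W) ∧ aeval T ((X - 1 : K[X]) ^ finrank K W) v = 0 ∧
      aeval T ((X - 1 : K[X]) ^ (finrank K W - 1)) v ≠ 0 := by
  have hpow (k : ℕ) : ∀ v ∈ W, (T ^ k) v ∈ W := by
    induction k with
    | zero => intro v hv; simpa using hv
    | succ k ih =>
      intro v hv
      rw [pow_succ', Module.End.mul_apply]
      exact h _ (ih v hv)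
  have hrestr (P : K[X]) (v : W) : ((aeval (T.restrict h) P v : W) : V) = aeval T P v := by
    induction P using Polynomial.induction_on' with
    | add P P' h1 h2 => simp only [map_add, LinearMap.add_apply, Submodule.coe_add, h1, h2]
    | monomial k a =>
      rw [← C_mul_X_pow_eq_monomial]
      simp only [map_mul, aeval_C, map_pow, aeval_X, Module.End.mul_apply,
        Module.algebraMap_end_apply, Submodule.coe_smul]
      rw [Module.End.pow_restrict]
      rfl
  have hne : aeval (T.restrict h) ((X - 1 : K[X]) ^ (finrank K W - 1)) ≠ 0 := by
    intro h0
    have hdvd := minpoly.dvd _ _ h0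
    rw [hmin] at hdvd
    have hdeg := degree_le_of_dvd hdvd (pow_ne_zero _ (by rw [← C_1]; exact X_sub_C_ne_zero 1))
    rw [degree_X_sub_one_pow, degree_X_sub_one_pow, Nat.cast_le] at hdeg
    omega
  obtain ⟨v, hv⟩ : ∃ v, aeval (T.restrict h) ((X - 1 : K[X]) ^ (finrank K W - 1)) v ≠ 0 := by
    by_contra! hcon
    exact hne (LinearMap.ext hcon)
  refine ⟨v, fun k => hpow k v v.2, ?_, fun h0 => hv (Subtype.ext ((hrestr _ v).trans h0))⟩
  have h0 := minpoly.aeval K (T.restrict h)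
  rw [hmin] at h0
  rw [← hrestr _ v, h0]
  rfl

/-- Matrices `Φ`, `T` that satisfy the tame relation are in normal form in a suitable basis when `T`
acts on each generalised eigenspace of `Φ` by a full unipotent Jordan block. -/
theorem exists_normal_basis {n q : ℕ} {Φ T : Matrix (Fin n) (Fin n) K} (hrel : Φ * T = T ^ q * Φ)
    (hstd : ∀ i : Fin n, ∃ α, (Pi.single i 1 : Fin n → K) ∈ End.maxGenEigenspace (toLin' Φ) α)
    (huni : ∀ α, End.HasEigenvalue (toLin' Φ) α →
      ∃ h : ∀ v ∈ End.maxGenEigenspace (toLin' Φ) α, toLin' T v ∈ End.maxGenEigenspace (toLin' Φ) α,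
        minpoly K ((toLin' T).restrict h) =
          (X - 1) ^ finrank K (End.maxGenEigenspace (toLin' Φ) α))
    {r : ℕ} {α : Fin r → K} (hα : Function.Injective α)
    (heig : ∀ a, End.HasEigenvalue (toLin' Φ) a ↔ a ∈ Set.range α) {d : Fin r → ℕ}
    (hd : ∀ j, d j = finrank K (End.maxGenEigenspace (toLin' Φ) (α j))) :
    (∀ j, 0 < d j) ∧
    ∃ (e : (Σ j, Fin (d j)) ≃ Fin n) (P : Matrix (Fin n) (Fin n) K) (w : ∀ j, Fin (d j) → K),
      IsUnit P ∧ Φ * P = P * (frobMats q (fun _ _ => 0) w).submatrix e.symm e.symm ∧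
      T * P = P * (compMats fun _ _ => 0).submatrix e.symm e.symm ∧
      ∀ j, IsNilpotent (frobMat q (fun _ => 0) (w j) - α j • 1) := by
  let V : Fin r → Submodule K (Fin n → K) := fun j => End.maxGenEigenspace (toLin' Φ) (α j)
  have heig' (j : Fin r) := (heig (α j)).2 ⟨j, rfl⟩
  have hd0 (j : Fin r) : 0 < d j := by
    rw [hd, Module.finrank_pos_iff_exists_ne_zero]
    obtain ⟨v, hv⟩ := (heig' j).exists_hasEigenvector
    exact ⟨⟨v, (End.genEigenspace _ _).monotone le_top hv.1⟩,
      fun h => hv.2 (congrArg Subtype.val h)⟩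
  refine ⟨hd0, ?_⟩
  have hcyc (j : Fin r) : ∃ v, (∀ k, (toLin' T ^ k) v ∈ V j) ∧
      aeval (toLin' T) ((X - 1 : K[X]) ^ d j) v = 0 ∧
      aeval (toLin' T) ((X - 1 : K[X]) ^ (d j - 1)) v ≠ 0 := by
    obtain ⟨h, hmin⟩ := huni _ (heig' j)
    rw [hd]
    exact exists_cyclic_vector h (by rw [← hd]; exact hd0 j) hmin
  choose v hTV hv0 hv1 using hcyc
  have hli (j : Fin r) := linearIndependent_pow_apply (hv0 j) (hv1 j)
  let bas (j : Fin r) : Basis (Fin (d j)) K (V j) :=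
    have : Nonempty (Fin (d j)) := ⟨⟨0, hd0 j⟩⟩
    basisOfLinearIndependentOfCardEqFinrank (b := fun i => ⟨(toLin' T ^ (i : ℕ)) (v j), hTV j i⟩)
      (LinearIndependent.of_comp (V j).subtype (hli j)) ((Fintype.card_fin _).trans (hd j))
  have hbas (j i) : (bas j i : Fin n → K) = (toLin' T ^ (i : ℕ)) (v j) := by
    simp [bas]
  have hint : DirectSum.IsInternal V := by
    refine DirectSum.isInternal_submodule_of_iSupIndep_of_iSup_eq_top
      ((Module.End.independent_maxGenEigenspace (toLin' Φ)).comp hα) ?_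
    rw [eq_top_iff, ← (Pi.basisFun K (Fin n)).span_eq, Submodule.span_le]
    rintro _ ⟨i, rfl⟩
    rw [Pi.basisFun_apply]
    obtain ⟨β, hβ⟩ := hstd i
    obtain ⟨j, rfl⟩ : β ∈ Set.range α := by
      rw [← heig]
      refine (Module.End.hasUnifEigenvalue_iff_hasUnifEigenvalue_one (k := ⊤) (by simp)).1 ?_
      intro hbot
      rw [Module.End.maxGenEigenspace, hbot, Submodule.mem_bot] at hβ
      simpa using congrFun hβ i
    exact Submodule.mem_iSup_of_mem (p := V) j hβ
  let u : Basis (Σ j, Fin (d j)) K (Fin n → K) := hint.collectedBasis bas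
  have hu (j i) : u ⟨j, i⟩ = (toLin' T ^ (i : ℕ)) (v j) := by
    simp only [u, DirectSum.IsInternal.collectedBasis_coe, hbas]
  have hcard : Fintype.card (Σ j, Fin (d j)) = n := by
    rw [← Module.finrank_eq_card_basis u, Module.finrank_fin_fun]
  let e : (Σ j, Fin (d j)) ≃ Fin n := Fintype.equivFinOfCardEq hcard
  -- the action of `Φ` on the cyclic vectors
  have hΦv (j : Fin r) : ∃ w : Fin (d j) → K,
      toLin' Φ (v j) = aeval (toLin' T) (vecPoly w) (v j) := by
    have hmem : toLin' Φ (v j) ∈ V j :=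
      Module.End.mapsTo_maxGenEigenspace_of_comm rfl (α j) (by
        have := hTV j 0
        rwa [pow_zero, Module.End.one_apply] at this)
    refine ⟨fun i => (bas j).repr ⟨_, hmem⟩ i, ?_⟩
    rw [aeval_vecPoly_apply]
    refine (congrArg Subtype.val ((bas j).sum_repr ⟨_, hmem⟩)).symm.trans ?_
    rw [AddSubmonoidClass.coe_finsetSum]
    exact Finset.sum_congr rfl fun i _ => by rw [Submodule.coe_smul, hbas]
  choose w hw using hΦv
  have hΦT (k : ℕ) (x : Fin n → K) :
      toLin' Φ ((toLin' T ^ k) x) = (toLin' T ^ (q * k)) (toLin' Φ x) := by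
    have h1 : Φ * T ^ k = T ^ (q * k) * Φ := by
      induction k with
      | zero => simp
      | succ k ih => rw [pow_succ, ← mul_assoc, ih, mul_assoc, hrel, ← mul_assoc, ← pow_add,
          mul_add, mul_one]
    rw [← toLin'_pow, ← toLin'_pow, ← toLin'_mul_apply, ← toLin'_mul_apply, h1]
  have hX (m : ℕ) : toLin' T ^ m = aeval (toLin' T) (X ^ m : K[X]) := by simp
  have hcolΦ (j : Fin r) (i : Fin (d j)) : Φ *ᵥ u ⟨j, i⟩ =
      ∑ k, frobMat q (fun _ => 0) (w j) k i • u ⟨j, k⟩ := by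
    rw [← toLin'_apply, hu, hΦT, hw, hX, ← Module.End.mul_apply, ← map_mul,
      aeval_apply_eq_sum_remVec (hv0 j)]
    simp only [hu]
    rfl
  have hcolT (j : Fin r) (i : Fin (d j)) : T *ᵥ u ⟨j, i⟩ =
      ∑ k, compMat (fun _ => (0 : K)) k i • u ⟨j, k⟩ := by
    rw [← toLin'_apply, hu, ← Module.End.mul_apply, ← pow_succ', hX, aeval_apply_eq_sum_remVec (hv0 j)]
    simp only [hu]
    rfl
  have hPΦ := mul_eq_mul_blockDiagonal' (u := u) hcolΦ
  have hPT := mul_eq_mul_blockDiagonal' (u := u) hcolT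
  refine ⟨e, (Matrix.of u)ᵀ.submatrix id e.symm, w, ?_, ?_, ?_, fun j => ?_⟩
  · rw [← linearIndependent_cols_iff_isUnit]
    exact u.linearIndependent.comp e.symm e.symm.injective
  · rw [submatrix_mul_equiv, frobMats, ← hPΦ]
    rfl
  · rw [submatrix_mul_equiv, compMats, ← hPT]
    rfl
  · let L : (Fin (d j) → K) →ₗ[K] (Fin n → K) :=
      Fintype.linearCombination K fun k => u ⟨j, k⟩
    have hLu (x : Fin (d j) → K) : L x = ∑ k, x k • u ⟨j, k⟩ := rfl
    have hL (x : Fin (d j) → K) :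
        (toLin' Φ - α j • 1) (L x) = L ((frobMat q (fun _ => 0) (w j) - α j • 1) *ᵥ x) := by
      rw [sub_mulVec, map_sub, LinearMap.sub_apply, smul_mulVec, one_mulVec, map_smul]
      congr 1
      rw [hLu, hLu, map_sum]
      simp only [map_smul, toLin'_apply, hcolΦ, Finset.smul_sum, mulVec, dotProduct, smul_smul,
        Finset.sum_smul]
      rw [Finset.sum_comm]
      simp only [mul_comm]
    have hLpow (m : ℕ) (x : Fin (d j) → K) : ((toLin' Φ - α j • 1) ^ m) (L x) =
        L ((frobMat q (fun _ => 0) (w j) - α j • 1) ^ m *ᵥ x) := by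
      induction m generalizing x with
      | zero => simp
      | succ m ih => rw [pow_succ, Module.End.mul_apply, hL, ih, pow_succ, mulVec_mulVec]
    refine ⟨finrank K (Fin n → K), ?_⟩
    refine Matrix.ext_of_mulVec_single fun i => ?_
    have hmem : L (Pi.single i 1) ∈ V j := by
      have : L (Pi.single i 1) = u ⟨j, i⟩ := by simp [L]
      rw [this, hu]
      exact hTV j i
    have h0 : ((toLin' Φ - α j • 1) ^ finrank K (Fin n → K)) (L (Pi.single i 1)) = 0 := by
      simp only [V] at hmem
      rwa [Module.End.maxGenEigenspace_eq_genEigenspace_finrank,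
        Module.End.mem_genEigenspace_nat] at hmem
    rw [hLpow] at h0
    have hli' : LinearIndependent K fun k => u ⟨j, k⟩ :=
      u.linearIndependent.comp (fun k => ⟨j, k⟩) fun a b h => by simpa using h
    rw [zero_mulVec]
    exact (linearIndependent_iff_injective_fintypeLinearCombination.1 hli') (by rw [map_zero]; exact h0)

end NormalBasis

section Residual

open IsLocalRing Matrix

variable {p l : ℕ} [Fact p.Prime] [Fact l.Prime] {F : IntermediateField ℚ_[p] (PadicAlgCl p)}
  {E : IntermediateField ℚ_[l] (PadicAlgCl l)} {n : ℕ}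
  {φ : GaloisGroup F} {σ : inertia F} {ρbar : GaloisGroup F →* GL (Fin n) (ResidueField E)}

theorem tame_relation_of_wild {H : Type*} [Group H] {ρ : GaloisGroup F →* H}
    (hφ : IsFrobenius F φ) (hw : ∀ g ∈ wildInertia F, ρ g = 1) :
    ρ φ * ρ σ = ρ σ ^ residueCard F * ρ φ := by
  have h := hw _ (tame_relation hφ σ.2)
  rw [map_mul, map_inv, map_pow, inv_mul_eq_one, map_mul, map_mul, map_inv,
    eq_mul_inv_iff_mul_eq] at h
  exact h.symm

theorem exists_residualBasis (hφ : IsFrobenius F φ) (hw : ∀ g ∈ wildInertia F, ρbar g = 1)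
    (hdist : IsDistinguished φ σ ρbar) {Q : Part} (hQ : IsFrobeniusPartition φ ρbar Q) :
    ∃ D : ResidualBasis φ σ ρbar, ∀ i, Q.1 i = if h : i < D.r then D.d ⟨i, h⟩ else 0 := by
  obtain ⟨r, α, hα, heig, hQ⟩ := hQ
  have hrel : (ρbar φ).1 * (ρbar σ).1 = (ρbar σ).1 ^ residueCard F * (ρbar φ).1 := by
    rw [← Units.val_mul, tame_relation_of_wild hφ hw]
    rfl
  obtain ⟨hd, e, P, w, hP, hPΦ, hPT, hnil⟩ := exists_normal_basis hrel hdist.standard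
    hdist.unipotent hα heig (d := fun j => Module.finrank (ResidueField E)
      (frobeniusSpace ρbar φ (α j))) fun j => rfl
  choose b hb using fun i j => residue_surjective (R := integers E) (P i j)
  have hbP : (Matrix.of b).map (residue (integers E)) = P := by
    ext i j; exact hb i j
  obtain ⟨U, hU⟩ := isUnit_of_isUnit_map (π := residue (integers E)) (M := Matrix.of b)
    (by rw [hbP]; exact hP)
  have hUP : (glMap (algebraMap (integers E) (ResidueField E)) U).1 = P := by
    rw [← hbP, ← hU]
    rfl
  have key {M : Matrix (Fin n) (Fin n) (ResidueField E)} {G} (h : M * P = P * G.submatrix e.symm e.symm) :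
      M = frame U e (ResidueField E) G := by
    change _ = (glMap (algebraMap (integers E) (ResidueField E)) U).1 *
      G.submatrix e.symm e.symm *
      (glMap (algebraMap (integers E) (ResidueField E)) U)⁻¹.1
    rw [Units.eq_mul_inv_iff_mul_eq, hUP, h]
  exact ⟨⟨r, _, fun j => ⟨(hd j).ne'⟩, U, e, w, α, hα, hnil, key hPΦ, key hPT⟩, hQ⟩

end Residual

/-! ### Uniqueness of the universal lifting ring -/

section AdicLimit

variable {O A : Type} [CommRing O] [CommRing A] [Algebra O A] {I : Ideal A}

theorem eq_of_forall_mk_succ_eq [IsHausdorff I A] {x y : A}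
    (h : ∀ k, Ideal.Quotient.mk (I ^ (k + 1)) x = Ideal.Quotient.mk (I ^ (k + 1)) y) : x = y :=
  eq_of_forall_mk_eq (I := I) fun k =>
    Ideal.Quotient.eq.2 (Ideal.pow_le_pow_right k.le_succ (Ideal.Quotient.eq.1 (h k)))

theorem exists_algHom_of_adic [IsAdicComplete I A] {R : Type} [CommRing R] [Algebra O R]
    (f : ∀ k, R →ₐ[O] A ⧸ I ^ (k + 1))
    (hf : ∀ k, (Ideal.Quotient.factorₐ O (Ideal.pow_le_pow_right (k + 1).le_succ)).comp (f (k + 1))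
    =
      f k) :
    ∃ g : R →ₐ[O] A, ∀ k x, Ideal.Quotient.mk (I ^ (k + 1)) (g x) = f k x := by
  have hmono : StrictMono fun k : ℕ => k + 1 := strictMono_id.add_const 1
  have hcompat (k : ℕ) : (Ideal.Quotient.factorPow I
      (hmono.monotone k.le_succ)).comp (f (k + 1)).toRingHom = (f k).toRingHom :=
    congrArg AlgHom.toRingHom (hf k)
  have hg (k : ℕ) (x : R) := IsAdicComplete.StrictMono.mk_liftRingHom I hmono
      (fun k => (f k).toRingHom) (fun {k} => hcompat k) (n := k) x
  refine ⟨AlgHom.mk (IsAdicComplete.StrictMono.liftRingHom I hmono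
    (fun k => (f k).toRingHom) fun {k} => hcompat k) fun x => ?_, hg⟩
  exact eq_of_forall_mk_succ_eq (I := I) fun k => (hg k _).trans ((f k).commutes x)

end AdicLimit

section Uniqueness

open IsLocalRing Matrix

variable {p l : ℕ} [Fact p.Prime] [Fact l.Prime] {F : IntermediateField ℚ_[p] (PadicAlgCl p)}
  {E : IntermediateField ℚ_[l] (PadicAlgCl l)} {n : ℕ}
  {ρbar : GaloisGroup F →* GL (Fin n) (ResidueField E)}

variable {R : Type} [CommRing R] [IsLocalRing R] [Algebra (integers E) R] [IsCoefficientRing E R]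
  {ρ : GaloisGroup F →* GL (Fin n) R} {A : Type} [CommRing A] [IsLocalRing A]
  [Algebra (integers E) A] [IsCoefficientRing E A] {ρA : GaloisGroup F →* GL (Fin n) A}

/-- The universal property for lifts to the quotients of a coefficient ring by the powers of its
maximal ideal. -/
theorem IsUniversalLift.existsUnique_quotient (h : IsUniversalLift ρbar ρ)
    (hA : IsUniversalLift ρbar ρA)
    (k : ℕ) : ∃! f : R →ₐ[integers E] A ⧸ maximalIdeal A ^ (k + 1),
      (glMap (f : R →+* A ⧸ maximalIdeal A ^ (k + 1))).comp ρ =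
        (glMap (Ideal.Quotient.mk (maximalIdeal A ^ (k + 1)))).comp ρA := by
  have hne : maximalIdeal A ^ (k + 1) ≠ ⊤ :=
    ne_top_of_le_ne_top (maximalIdeal.isMaximal A).ne_top (Ideal.pow_le_self k.succ_ne_zero)
  have : Nontrivial (A ⧸ maximalIdeal A ^ (k + 1)) := Ideal.Quotient.nontrivial_iff.2 hne
  have hloc : IsLocalRing (A ⧸ maximalIdeal A ^ (k + 1)) :=
    IsLocalRing.of_surjective' (Ideal.Quotient.mk _) Ideal.Quotient.mk_surjective
  have hle : ∀ a ∈ maximalIdeal A ^ (k + 1), reduction E A a = 0 :=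
    fun a ha => (reduction_eq_zero_iff E).2 (Ideal.pow_le_self k.succ_ne_zero ha)
  have hcoef : IsCoefficientRing E (A ⧸ maximalIdeal A ^ (k + 1)) :=
    isCoefficientRing_of_algHom E (Ideal.Quotient.liftₐ _ (reduction E A) hle)
  have hnoeth := hA.noetherian
  have hart : IsArtinianRing (A ⧸ maximalIdeal A ^ (k + 1)) := by
    rw [isArtinianRing_iff_isNilpotent_maximalIdeal]
    refine ⟨k + 1, ?_⟩
    have := IsLocalRing.map_maximalIdeal_of_surjective (Ideal.Quotient.mk (maximalIdeal A ^ (k + 1)))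
      Ideal.Quotient.mk_surjective
    rw [← this, ← Ideal.map_pow, Ideal.map_quotient_self]
    rfl
  refine h.universal _ _ (hA.continuous (k + 1)) ?_
  rw [isLift_iff, ← (isLift_iff E).1 hA.isLift]
  refine MonoidHom.ext fun g => GeneralLinearGroup.ext fun i j => ?_
  exact reduction_algHom E (Ideal.Quotient.mkₐ (integers E) (maximalIdeal A ^ (k + 1))) _

theorem IsUniversalLift.hom_ext (h : IsUniversalLift ρbar ρ) (hA : IsUniversalLift ρbar ρA)
    {f f' : R →ₐ[integers E] A} (hf : (glMap (f : R →+* A)).comp ρ = ρA)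
    (hf' : (glMap (f' : R →+* A)).comp ρ = ρA) : f = f' := by
  have hcomp := hA.complete
  ext x
  refine eq_of_forall_mk_eq (I := maximalIdeal A) fun k => ?_
  have key : (Ideal.Quotient.mkₐ (integers E) (maximalIdeal A ^ (k + 1))).comp f =
      (Ideal.Quotient.mkₐ (integers E) (maximalIdeal A ^ (k + 1))).comp f' := by
    refine (h.existsUnique_quotient hA k).unique ?_ ?_
    · rw [← hf]; rfl
    · rw [← hf']; rfl
  have := DFunLike.congr_fun key x
  exact Ideal.Quotient.eq.2 (Ideal.pow_le_pow_right k.le_succ (Ideal.Quotient.eq.1 this))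

theorem IsUniversalLift.exists_hom (h : IsUniversalLift ρbar ρ) (hA : IsUniversalLift ρbar ρA) :
    ∃ f : R →ₐ[integers E] A, (glMap (f : R →+* A)).comp ρ = ρA := by
  have hcomp := hA.complete
  choose f hf huniq using fun k => h.existsUnique_quotient hA k
  obtain ⟨g, hg⟩ := exists_algHom_of_adic (I := maximalIdeal A) f fun k =>
    huniq k _ (congrArg (fun ψ => (glMap (Ideal.Quotient.factor
      (Ideal.pow_le_pow_right (I := maximalIdeal A) (Nat.le_succ (k + 1))))).comp ψ) (hf (k + 1)))
  refine ⟨g, ?_⟩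
  refine MonoidHom.ext fun s => GeneralLinearGroup.ext fun i j =>
    eq_of_forall_mk_succ_eq (I := maximalIdeal A) fun k => ?_
  exact (hg k _).trans (congrArg (fun x : GL (Fin n) (A ⧸ maximalIdeal A ^ (k + 1)) => x.1 i j)
      (DFunLike.congr_fun (hf k) s))

theorem IsUniversalLift.exists_equiv (h : IsUniversalLift ρbar ρ) (hA : IsUniversalLift ρbar ρA) :
    ∃ f : R ≃ₐ[integers E] A,
      (glMap (f : R →+* A)).comp ρ = ρA := by
  obtain ⟨f, hf⟩ := h.exists_hom hA
  obtain ⟨g, hg⟩ := hA.exists_hom h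
  have hfg {X Y Z : Type} [CommRing X] [CommRing Y] [CommRing Z] [Algebra (integers E) X]
      [Algebra (integers E) Y] [Algebra (integers E) Z] (a : X →ₐ[integers E] Y)
      (b : Y →ₐ[integers E] Z) (ψ : GaloisGroup F →* GL (Fin n) X) :
      (glMap ((b.comp a : X →ₐ[integers E] Z) : X →+* Z)).comp ψ =
        (glMap (b : Y →+* Z)).comp
          ((glMap (a : X →+* Y)).comp ψ) := rfl
  have hid {X : Type} [CommRing X] [Algebra (integers E) X] (ψ : GaloisGroup F →* GL (Fin n) X) :
      (glMap ((AlgHom.id (integers E) X : X →ₐ[integers E] X) :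
        X →+* X)).comp ψ = ψ := rfl
  exact ⟨AlgEquiv.ofAlgHom f g (hA.hom_ext hA (by rw [hfg, hg, hf]) (hid _))
    (h.hom_ext h (by rw [hfg, hf, hg]) (hid _)), hf⟩

end Uniqueness

/-! ### Continuity at the points of a lifting ring -/

section Points

open IsLocalRing Matrix

variable {l : ℕ} [Fact l.Prime] {E : IntermediateField ℚ_[l] (PadicAlgCl l)} {R : Type}
  [CommRing R] [IsLocalRing R] [Algebra (integers E) R]

/-- Otherwise the inverse of `x m` would be integral, and an equation of integral dependence would
give a unit of `R` that `x` maps to `0`. -/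
theorem norm_lt_one_of_mem_maximalIdeal (x : R →ₐ[integers E] PadicAlgCl l) {m : R}
    (hm : m ∈ maximalIdeal R) : ‖x m‖ < 1 := by
  by_contra! hcon
  have h0 : x m ≠ 0 := fun h => by rw [h, norm_zero] at hcon; linarith
  set z := (x m)⁻¹ with hz
  have hz1 : ‖z‖ ≤ 1 := by rw [hz, norm_inv]; exact inv_le_one_of_one_le₀ hcon
  have hint : IsIntegral ℚ_[l] z := Algebra.IsIntegral.isIntegral z
  set f := minpoly ℚ_[l] z with hf
  have hcoeff : ∀ i, ‖f.coeff i‖ ≤ 1 := (spectralValue_le_one_iff (minpoly.monic hint)).1 hz1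
  let a (i : ℕ) : integers E := ⟨algebraMap ℚ_[l] E (f.coeff i), mem_integers.2 (by
    refine le_of_eq_of_le ?_ (hcoeff i)
    exact PadicAlgCl.norm_extends l (f.coeff i))⟩
  have ha (i : ℕ) : algebraMap (integers E) (PadicAlgCl l) (a i) =
      algebraMap ℚ_[l] (PadicAlgCl l) (f.coeff i) := rfl
  have h1 : ∑ i ∈ Finset.range (f.natDegree + 1),
      algebraMap ℚ_[l] (PadicAlgCl l) (f.coeff i) * z ^ i = 0 := by
    have := minpoly.aeval ℚ_[l] z
    rw [Polynomial.aeval_eq_sum_range] at this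
    simpa only [Algebra.smul_def] using this
  have hu : IsUnit (∑ i ∈ Finset.range (f.natDegree + 1),
      algebraMap (integers E) R (a i) * m ^ (f.natDegree - i)) := by
    rw [Finset.sum_range_succ, Nat.sub_self, pow_zero, mul_one]
    have e : a f.natDegree = 1 := by
      refine Subtype.ext ?_
      change algebraMap ℚ_[l] E f.leadingCoeff = 1
      rw [(minpoly.monic hint).leadingCoeff, map_one]
    rw [e, map_one]
    by_contra hnu
    have hs : ∑ i ∈ Finset.range f.natDegree,
        algebraMap (integers E) R (a i) * m ^ (f.natDegree - i) ∈ maximalIdeal R :=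
      Ideal.sum_mem _ fun i hi => Ideal.mul_mem_left _ _ (Ideal.pow_mem_of_mem _ hm _
        (Nat.sub_pos_of_lt (Finset.mem_range.1 hi)))
    have := (Ideal.add_mem_iff_right _ hs).1 ((mem_maximalIdeal _).2 hnu)
    exact (Ideal.ne_top_iff_one _).1 (maximalIdeal.isMaximal R).ne_top this
  refine (hu.map x).ne_zero ?_
  rw [map_sum]
  have h2 := congrArg (· * x m ^ f.natDegree) h1
  simp only [Finset.sum_mul, zero_mul] at h2
  rw [← h2]
  refine Finset.sum_congr rfl fun i hi => ?_
  rw [map_mul, map_pow, x.commutes, ha, mul_assoc]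
  congr 1
  have hi' : i ≤ f.natDegree := Nat.lt_succ_iff.1 (Finset.mem_range.1 hi)
  rw [hz, inv_pow, ← Nat.sub_add_cancel hi', pow_add, Nat.add_sub_cancel, mul_comm (x m ^ _),
    inv_mul_cancel_left₀ (pow_ne_zero _ h0)]

variable [IsCoefficientRing E R]

theorem norm_le_one_of_point (x : R →ₐ[integers E] PadicAlgCl l) (y : R) : ‖x y‖ ≤ 1 := by
  obtain ⟨o, ho⟩ := residue_surjective (reduction E R y)
  have hm : y - algebraMap (integers E) R o ∈ maximalIdeal R := by
    rw [← reduction_eq_zero_iff E, map_sub, sub_eq_zero, (reduction E R).commutes, ← ho]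
    rfl
  have e : x y = x (y - algebraMap (integers E) R o) + algebraMap (integers E) (PadicAlgCl l) o := by
    rw [map_sub, x.commutes, sub_add_cancel]
  rw [e]
  exact (PadicAlgCl.isNonarchimedean l _ _).trans
    (max_le (norm_lt_one_of_mem_maximalIdeal x hm).le o.2)

theorem exists_norm_le_pow [IsNoetherianRing R] (x : R →ₐ[integers E] PadicAlgCl l) :
    ∃ c : ℝ, 0 ≤ c ∧ c < 1 ∧ ∀ k, ∀ m ∈ maximalIdeal R ^ k, ‖x m‖ ≤ c ^ k := by
  obtain ⟨s, hs⟩ := (IsNoetherian.noetherian (maximalIdeal R) : (maximalIdeal R).FG)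
  let c : NNReal := s.sup fun t => ‖x t‖₊
  have hc : c < 1 := (Finset.sup_lt_iff (by simp)).2 fun t ht =>
    norm_lt_one_of_mem_maximalIdeal x (hs ▸ Ideal.subset_span ht)
  let J (k : ℕ) : Ideal R :=
    { carrier := {y | ‖x y‖ ≤ (c : ℝ) ^ k}
      zero_mem' := by simp
      add_mem' := fun {a b} ha hb => by
        change ‖x (a + b)‖ ≤ _
        rw [map_add]
        exact (PadicAlgCl.isNonarchimedean l _ _).trans (max_le ha hb)
      smul_mem' := fun r y hy => by
        change ‖x (r * y)‖ ≤ _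
        rw [map_mul, norm_mul]
        exact (mul_le_of_le_one_left (norm_nonneg _) (norm_le_one_of_point x r)).trans hy }
  refine ⟨c, c.2, hc, fun k => ?_⟩
  suffices h : maximalIdeal R ^ k ≤ J k from fun m hm => h hm
  induction k with
  | zero => exact fun y _ => (norm_le_one_of_point x y).trans (pow_zero (c : ℝ)).ge
  | succ k ih =>
    rw [pow_succ, Ideal.mul_le]
    intro a ha b hb
    have hb' : ‖x b‖ ≤ c := by
      have hle : maximalIdeal R ≤ J 1 := by
        rw [← hs, Ideal.span_le]
        intro t ht
        change ‖x t‖ ≤ (c : ℝ) ^ 1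
        rw [pow_one]
        exact_mod_cast Finset.le_sup (f := fun t => ‖x t‖₊) ht
      simpa [J] using hle hb
    change ‖x (a * b)‖ ≤ (c : ℝ) ^ (k + 1)
    rw [map_mul, norm_mul, pow_succ]
    exact mul_le_mul (ih ha) hb' (norm_nonneg _) (by positivity)

variable {p : ℕ} [Fact p.Prime] {F : IntermediateField ℚ_[p] (PadicAlgCl p)} {n : ℕ}

theorem continuous_point [IsNoetherianRing R] {ρ : GaloisGroup F →* GL (Fin n) R}
    (hρo : ∀ k, IsOpen (((glMap
      (Ideal.Quotient.mk (maximalIdeal R ^ k))).comp ρ).ker : Set (GaloisGroup F)))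
    (x : R →ₐ[integers E] PadicAlgCl l) :
    Continuous fun g => (ρ g).1.map x := by
  obtain ⟨c, hc0, hc1, hc⟩ := exists_norm_le_pow x
  refine continuous_matrix fun i j => continuous_iff_continuousAt.2 fun g => ?_
  rw [ContinuousAt, Metric.tendsto_nhds]
  intro ε hε
  obtain ⟨k, hk⟩ := exists_pow_lt_of_lt_one hε hc1
  have ho : IsOpen ((fun h => g⁻¹ * h) ⁻¹' (((glMap
      (Ideal.Quotient.mk (maximalIdeal R ^ k))).comp ρ).ker : Set (GaloisGroup F))) :=
    (hρo k).preimage (continuous_const.mul continuous_id)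
  filter_upwards [ho.mem_nhds (by simp)] with h hh
  have hh' : (glMap (Ideal.Quotient.mk (maximalIdeal R ^ k))) (ρ g) =
      (glMap (Ideal.Quotient.mk (maximalIdeal R ^ k))) (ρ h) := by
    have := MonoidHom.mem_ker.1 hh
    rw [map_mul, map_inv, inv_mul_eq_one] at this
    exact this
  have hm : (ρ h).1 i j - (ρ g).1 i j ∈ maximalIdeal R ^ k :=
    Ideal.Quotient.eq.1 (congrArg
      (fun y : GL (Fin n) (R ⧸ maximalIdeal R ^ k) => y.1 i j) hh').symm
  rw [dist_eq_norm, Matrix.map_apply, Matrix.map_apply, ← map_sub]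
  exact (hc k _ hm).trans_lt hk

end Points

/-! ### Jordan decompositions -/

section Jordan

open Polynomial Module

variable {K : Type} [Field K]

theorem exists_equiv_of_ker_eq {M V W : Type} [AddCommGroup M] [Module K M] [AddCommGroup V]
    [Module K V] [AddCommGroup W] [Module K W] {Φ : M →ₗ[K] V} {Ψ : M →ₗ[K] W}
    (hΦ : Function.Surjective Φ) (hΨ : Function.Surjective Ψ) (h : ∀ x, Φ x = 0 ↔ Ψ x = 0) :
    ∃ L : V ≃ₗ[K] W, ∀ x, L (Φ x) = Ψ x := by
  have hker : LinearMap.ker Φ = LinearMap.ker Ψ := by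
    ext x
    exact h x
  refine ⟨((Φ.quotKerEquivOfSurjective hΦ).symm.trans (Submodule.quotEquivOfEq _ _ hker)).trans
    (Ψ.quotKerEquivOfSurjective hΨ), fun x => ?_⟩
  have e : (Φ.quotKerEquivOfSurjective hΦ).symm (Φ x) = Submodule.Quotient.mk x := by
    rw [LinearEquiv.symm_apply_eq]
    rfl
  rw [LinearEquiv.trans_apply, LinearEquiv.trans_apply, e]
  rfl

/-- The endomorphism `T` is a direct sum of Jordan blocks, the block `s` having eigenvalue `ζ s` and
size `m s` (possibly `0`).  The block is realised as multiplication by `X` on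
`K[X] / (X - ζ s) ^ m s`. -/
def HasJordan {V : Type} [AddCommGroup V] [Module K V] (T : End K V) {S : Type} (ζ : S → K)
    (m : S → ℕ) : Prop :=
  ∃ L : V ≃ₗ[K] (∀ s, AdjoinRoot ((X - C (ζ s)) ^ m s)),
    ∀ v s, L (T v) s = AdjoinRoot.root _ * L v s

variable {V V' : Type} [AddCommGroup V] [Module K V] [AddCommGroup V'] [Module K V']
  {T : End K V} {T' : End K V'}

theorem HasJordan.conj {S : Type} {ζ : S → K} {m : S → ℕ} (h : HasJordan T' ζ m) (e : V ≃ₗ[K] V')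
    (he : ∀ v, e (T v) = T' (e v)) : HasJordan T ζ m := by
  obtain ⟨L, hL⟩ := h
  exact ⟨e.trans L, fun v s => by rw [LinearEquiv.trans_apply, he, hL, LinearEquiv.trans_apply]⟩

theorem HasJordan.pi {J : Type} {W : J → Type} [∀ j, AddCommGroup (W j)] [∀ j, Module K (W j)]
    {U : ∀ j, End K (W j)} {S : J → Type} {ζ : ∀ j, S j → K} {m : ∀ j, S j → ℕ}
    (h : ∀ j, HasJordan (U j) (ζ j) (m j)) (e : V ≃ₗ[K] (∀ j, W j))
    (he : ∀ v j, e (T v) j = U j (e v j)) :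
    HasJordan T (fun s : Σ j, S j => ζ s.1 s.2) fun s => m s.1 s.2 := by
  choose L hL using h
  refine ⟨(e.trans (LinearEquiv.piCongrRight L)).trans (LinearEquiv.piCurry K
    fun j s => AdjoinRoot ((X - C (ζ j s)) ^ m j s)).symm, fun v s => ?_⟩
  change L s.1 (e (T v) s.1) s.2 = _ * L s.1 (e v s.1) s.2
  rw [he, hL]

theorem prod_X_sub_C_pow_dvd_iff {ι : Type} [Fintype ι] {ζ : ι → K} (hζ : Function.Injective ζ)
    (a : ι → ℕ) (p : K[X]) :
    (∏ i, (X - C (ζ i)) ^ a i) ∣ p ↔ ∀ i, (X - C (ζ i)) ^ a i ∣ p := by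
  refine ⟨fun h i => 
    (Finset.dvd_prod_of_mem (fun i => (X - C (ζ i)) ^ a i) (Finset.mem_univ i)).trans h, fun h =>
    ?_⟩
  refine Fintype.prod_dvd_of_coprime (s := fun i => (X - C (ζ i)) ^ a i) (fun i j hij => ?_) h
  have hco : IsCoprime (X - C (ζ i)) (X - C (ζ j)) := pairwise_coprime_X_sub_C hζ hij
  exact hco.pow

/-- The Chinese remainder theorem. -/
theorem hasJordan_of_cyclic {ι : Type} [Fintype ι] {ζ : ι → K} (hζ : Function.Injective ζ)
    {a : ι → ℕ} {v : V} (hs : ∀ w, ∃ p : K[X], aeval T p v = w)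
    (hk : ∀ p : K[X], aeval T p v = 0 ↔ (∏ i, (X - C (ζ i)) ^ a i) ∣ p) : HasJordan T ζ a := by
  let Φ : K[X] →ₗ[K] V := (LinearMap.applyₗ v).comp (aeval T).toLinearMap
  let Ψ : K[X] →ₗ[K] (∀ i, AdjoinRoot ((X - C (ζ i)) ^ a i)) :=
    LinearMap.pi fun i => (AdjoinRoot.mkₐ ((X - C (ζ i)) ^ a i)).toLinearMap
  have hΨ : Function.Surjective Ψ := by
    intro w
    choose p hp using fun i => AdjoinRoot.mk_surjective (w i)
    have hco : Pairwise (Function.onFun IsCoprime fun i => Ideal.span {(X - C (ζ i)) ^ a i}) := by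
      intro i j hij
      change IsCoprime (Ideal.span {(X - C (ζ i)) ^ a i}) (Ideal.span {(X - C (ζ j)) ^ a j})
      rw [Ideal.isCoprime_span_singleton_iff]
      have hco : IsCoprime (X - C (ζ i)) (X - C (ζ j)) := pairwise_coprime_X_sub_C hζ hij
      exact hco.pow
    obtain ⟨x, hx⟩ := Ideal.exists_forall_sub_mem_ideal hco p
    refine ⟨x, funext fun i => ?_⟩
    rw [← hp]
    exact Ideal.Quotient.eq.2 (hx i)
  obtain ⟨L, hL⟩ := exists_equiv_of_ker_eq (Φ := Φ) (Ψ := Ψ) hs hΨ fun p => by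
    change aeval T p v = 0 ↔ _
    rw [hk, prod_X_sub_C_pow_dvd_iff hζ, funext_iff]
    exact forall_congr' fun i => AdjoinRoot.mk_eq_zero.symm
  refine ⟨L, fun w i => ?_⟩
  obtain ⟨p, rfl⟩ := hs w
  have e : T (aeval T p v) = Φ (X * p) := by
    change _ = aeval T (X * p) v
    rw [map_mul, aeval_X]
    rfl
  rw [e, hL]
  change _ = _ * L (Φ p) i
  rw [hL]
  change AdjoinRoot.mk _ (X * p) = _ * AdjoinRoot.mk _ p
  rw [map_mul, AdjoinRoot.mk_X]

theorem hasJordan_single [FiniteDimensional K V] {ζ : K} {m : ℕ} (hm : finrank K V = m) {v : V}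
    (h : (T - algebraMap K _ ζ) ^ m = 0) (h' : 0 < m)
    (hv : ((T - algebraMap K _ ζ) ^ (m - 1)) v ≠ 0) :
    HasJordan T (fun _ : Unit => ζ) fun _ => m := by
  have e (k : ℕ) : aeval T ((X - C ζ) ^ k) = (T - algebraMap K _ ζ) ^ k := by
    rw [map_pow, map_sub, aeval_X, aeval_C]
  have hk (p : K[X]) : aeval T p v = 0 ↔ (X - C ζ) ^ m ∣ p := by
    refine ⟨fun hp => ?_, ?_⟩
    · let I : Ideal K[X] :=
        { carrier := {p | aeval T p v = 0}
          zero_mem' := by simp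
          add_mem' := fun {a b} ha hb => by
            change aeval T (a + b) v = 0
            rw [map_add, LinearMap.add_apply, ha, hb, add_zero]
          smul_mem' := fun a b hb => by
            change aeval T (a * b) v = 0
            rw [map_mul, Module.End.mul_apply, hb, map_zero] }
      have hI : (X - C ζ) ^ m ∈ I := by
        change aeval T ((X - C ζ) ^ m) v = 0
        rw [e, h, LinearMap.zero_apply]
      rw [← Ideal.span_singleton_generator I, Ideal.mem_span_singleton] at hI
      obtain ⟨k, hkm, hkI⟩ := (dvd_prime_pow (prime_X_sub_C ζ) m).1 hI
      have hpI : p ∈ I := hp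
      rw [← Ideal.span_singleton_generator I, Ideal.mem_span_singleton,
        hkI.dvd_iff_dvd_left] at hpI
      rcases hkm.lt_or_eq with hlt | rfl
      · exfalso
        have : (X - C ζ) ^ (m - 1) ∈ I := by
          rw [← Ideal.span_singleton_generator I, Ideal.mem_span_singleton, hkI.dvd_iff_dvd_left]
          exact pow_dvd_pow _ (by omega)
        refine hv ?_
        rw [← e]
        exact this
      · exact hpI
    · rintro ⟨u, rfl⟩
      rw [mul_comm, map_mul, e, h, mul_zero, LinearMap.zero_apply]
  refine hasJordan_of_cyclic (v := v) (fun _ _ _ => rfl) (fun w => ?_) fun p => by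
    rw [hk, Fintype.prod_unique]
  have hli : LinearIndependent K fun i : Fin m => (T ^ (i : ℕ)) v := by
    rw [Fintype.linearIndependent_iff]
    intro g hg i
    rw [← aeval_vecPoly_apply, hk] at hg
    have hdeg : (vecPoly g).degree < ((X - C ζ) ^ m).degree := by
      rw [degree_pow, degree_X_sub_C, nsmul_one]
      exact degree_sum_C_mul_X_pow_lt g
    have h0 := eq_zero_of_dvd_of_degree_lt hg hdeg
    rw [← coeff_sum_C_mul_X_pow g i]
    exact (congrArg (fun f : K[X] => f.coeff i) h0).trans (coeff_zero _)
  have hspan := hli.span_eq_top_of_card_eq_finrank' (by rw [Fintype.card_fin, hm])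
  obtain ⟨g, hg⟩ := (Submodule.mem_span_range_iff_exists_fun K).1 (hspan ▸ Submodule.mem_top : w ∈ _)
  exact ⟨vecPoly g, by rw [aeval_vecPoly_apply, hg]⟩

theorem hasJordan_compMat {d : ℕ} (c : Fin d → K) {ι : Type} [Fintype ι] {ζ : ι → K}
    (hζ : Function.Injective ζ) {a : ι → ℕ}
    (h : deformPoly c = ∏ i, (X - C (ζ i)) ^ a i) :
    HasJordan (Matrix.toLin' (compMat c)) ζ a := by
  have e (p : K[X]) : aeval (Matrix.toLin' (compMat c)) p (remVec (deformPoly c) d 1) =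
      remVec (deformPoly c) d p := by
    have : aeval (Matrix.toLin' (compMat c)) p = Matrix.toLin' (aeval (compMat c) p) :=
      Polynomial.aeval_algHom_apply (Matrix.toLinAlgEquiv' : Matrix (Fin d) (Fin d) K ≃ₐ[K] _)
        (compMat c) p
    rw [this, Matrix.toLin'_apply, aeval_compMat_mulVec, mul_one]
  refine hasJordan_of_cyclic hζ (v := remVec (deformPoly c) d 1)
    (fun w => ⟨vecPoly w, by rw [e, remVec_vecPoly]⟩) fun p => ?_
  rw [e, ← h, dvd_iff_remVec (deformPoly_monic c) (deformPoly_degree_le c)]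

theorem hasJordan_blockDiagonal' {J : Type} [Fintype J] [DecidableEq J] {ι : J → Type}
    [∀ j, Fintype (ι j)] [∀ j, DecidableEq (ι j)] {M : ∀ j, Matrix (ι j) (ι j) K} {S : J → Type}
    {ζ : ∀ j, S j → K} {m : ∀ j, S j → ℕ}
    (h : ∀ j, HasJordan (Matrix.toLin' (M j)) (ζ j) (m j)) :
    HasJordan (Matrix.toLin' (Matrix.blockDiagonal' M)) (fun s : Σ j, S j => ζ s.1 s.2)
      fun s => m s.1 s.2 := by
  refine HasJordan.pi h (LinearEquiv.piCurry K fun j (_ : ι j) => K) fun v j => ?_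
  funext i
  change (Matrix.blockDiagonal' M).mulVec v ⟨j, i⟩ = (M j).mulVec (fun i' => v ⟨j, i'⟩) i
  rw [Matrix.mulVec, dotProduct, Fintype.sum_sigma, Finset.sum_eq_single j, Matrix.mulVec,
    dotProduct]
  · simp only [Matrix.blockDiagonal'_apply_eq]
  · intro j' _ hj
    refine Finset.sum_eq_zero fun i' _ => ?_
    rw [Matrix.blockDiagonal'_apply_ne _ _ _ hj.symm, zero_mul]
  · intro hj
    exact absurd (Finset.mem_univ _) hj

end Jordan

/-! ### Uniqueness of Jordan decompositions -/

section JordanUnique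

open Polynomial Module

variable {K : Type} [Field K]

theorem finrank_ker_mul_mk {g h : K[X]} (hg : g ≠ 0) (hh : h ≠ 0) :
    finrank K (LinearMap.ker (LinearMap.mulLeft K (AdjoinRoot.mk (g * h) g))) = g.natDegree := by
  let Φ : K[X] →ₗ[K] LinearMap.ker (LinearMap.mulLeft K (AdjoinRoot.mk (g * h) g)) :=
    LinearMap.codRestrict _ ((AdjoinRoot.mkₐ (g * h)).toLinearMap.comp (LinearMap.mulLeft K h))
      fun p => by
        rw [LinearMap.mem_ker]
        change AdjoinRoot.mk (g * h) g * AdjoinRoot.mk (g * h) (h * p) = 0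
        rw [← map_mul, AdjoinRoot.mk_eq_zero, ← mul_assoc]
        exact dvd_mul_right _ _
  have hΦ : Function.Surjective Φ := by
    rintro ⟨y, hy⟩
    obtain ⟨p, rfl⟩ := AdjoinRoot.mk_surjective y
    rw [LinearMap.mem_ker, LinearMap.mulLeft_apply, ← map_mul, AdjoinRoot.mk_eq_zero] at hy
    obtain ⟨u, rfl⟩ := (mul_dvd_mul_iff_left hg).1 hy
    exact ⟨u, rfl⟩
  have hΨ : Function.Surjective (AdjoinRoot.mkₐ g).toLinearMap := AdjoinRoot.mk_surjective
  obtain ⟨L, -⟩ := exists_equiv_of_ker_eq hΦ hΨ fun p => by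
    rw [← Subtype.coe_inj]
    change AdjoinRoot.mk (g * h) (h * p) = 0 ↔ AdjoinRoot.mk g p = 0
    rw [AdjoinRoot.mk_eq_zero, AdjoinRoot.mk_eq_zero, mul_comm g, mul_dvd_mul_iff_left hh]
  rw [L.finrank_eq, (AdjoinRoot.powerBasis hg).finrank, AdjoinRoot.powerBasis_dim]

theorem finrank_ker_root_sub_pow (ζ ζ0 : K) [Decidable (ζ = ζ0)] (m k : ℕ) :
    finrank K (LinearMap.ker (LinearMap.mulLeft K
      ((AdjoinRoot.root ((X - C ζ) ^ m) - algebraMap K _ ζ0) ^ k))) =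
      if ζ = ζ0 then min k m else 0 := by
  have e : (AdjoinRoot.root ((X - C ζ) ^ m) - algebraMap K _ ζ0) ^ k =
      AdjoinRoot.mk ((X - C ζ) ^ m) ((X - C ζ0) ^ k) := by
    rw [map_pow, map_sub, AdjoinRoot.mk_X, AdjoinRoot.mk_C]
    rfl
  rw [e]
  split_ifs with h
  · subst h
    rcases le_total k m with hkm | hkm
    · obtain ⟨i, rfl⟩ := Nat.exists_eq_add_of_le hkm
      rw [pow_add, finrank_ker_mul_mk (pow_ne_zero _ (X_sub_C_ne_zero ζ))
        (pow_ne_zero _ (X_sub_C_ne_zero ζ)), natDegree_pow, natDegree_X_sub_C, mul_one,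
        min_eq_left hkm]
    · rw [AdjoinRoot.mk_eq_zero.2 (pow_dvd_pow _ hkm), LinearMap.mulLeft_zero_eq_zero,
        LinearMap.ker_zero, finrank_top,
        (AdjoinRoot.powerBasis (pow_ne_zero m (X_sub_C_ne_zero ζ))).finrank,
        AdjoinRoot.powerBasis_dim, natDegree_pow, natDegree_X_sub_C, mul_one, min_eq_right hkm]
  · have hu : IsUnit (AdjoinRoot.mk ((X - C ζ) ^ m) ((X - C ζ0) ^ k)) := by
      have hco : IsCoprime (X - C ζ0) (X - C ζ) :=
        isCoprime_X_sub_C_of_isUnit_sub (sub_ne_zero_of_ne (Ne.symm h)).isUnit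
      obtain ⟨u, v, huv⟩ := (hco.pow : IsCoprime ((X - C ζ0) ^ k) ((X - C ζ) ^ m))
      refine IsUnit.of_mul_eq_one (AdjoinRoot.mk _ u) ?_
      rw [← map_mul, mul_comm, ← sub_eq_zero, ← map_one (AdjoinRoot.mk _), ← map_sub,
        AdjoinRoot.mk_eq_zero, ← huv]
      exact ⟨-v, by ring⟩
    generalize AdjoinRoot.mk ((X - C ζ) ^ m) ((X - C ζ0) ^ k) = u at hu ⊢
    have hinj : Function.Injective (LinearMap.mulLeft K u) := fun _ _ h => hu.mul_left_cancel h
    rw [LinearMap.ker_eq_bot.2 hinj, finrank_bot]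

variable {V V' : Type} [AddCommGroup V] [Module K V] [AddCommGroup V'] [Module K V']
  {T : End K V} {T' : End K V'} {S S' : Type} {ζ : S → K} {ζ' : S' → K} {m : S → ℕ} {m' : S' → ℕ}

open Classical in
theorem HasJordan.finrank_ker [Fintype S] (h : HasJordan T ζ m) (ζ0 : K) (k : ℕ) :
    finrank K (LinearMap.ker ((T - algebraMap K _ ζ0) ^ k)) =
      ∑ s, if ζ s = ζ0 then min k (m s) else 0 := by
  obtain ⟨L, hL⟩ := h
  have hpow (v : V) (s : S) : L (((T - algebraMap K _ ζ0) ^ k) v) s =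
      (AdjoinRoot.root _ - algebraMap K _ ζ0) ^ k * L v s := by
    induction k generalizing v with
    | zero => simp
    | succ k ih =>
      rw [pow_succ, Module.End.mul_apply, ih, LinearMap.sub_apply, map_sub, Pi.sub_apply, hL,
        Module.algebraMap_end_apply, map_smul, Pi.smul_apply, Algebra.smul_def, ← sub_mul,
        ← mul_assoc, pow_succ]
  let M (s : S) := LinearMap.ker (LinearMap.mulLeft K
      ((AdjoinRoot.root ((X - C (ζ s)) ^ m s) - algebraMap K _ ζ0) ^ k))
  have hmem (v : V) : v ∈ LinearMap.ker ((T - algebraMap K _ ζ0) ^ k) ↔ ∀ s, L v s ∈ M s := by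
    rw [LinearMap.mem_ker, ← L.map_eq_zero_iff, funext_iff]
    refine forall_congr' fun s => ?_
    rw [hpow]
    rfl
  let e : LinearMap.ker ((T - algebraMap K _ ζ0) ^ k) ≃ₗ[K] (∀ s, M s) :=
    { toFun := fun v s => ⟨L v.1 s, (hmem v.1).1 v.2 s⟩
      map_add' := fun v w => by
        funext s
        exact Subtype.ext (congrFun (map_add L v.1 w.1) s)
      map_smul' := fun c v => by
        funext s
        exact Subtype.ext (congrFun (map_smul L c v.1) s)
      invFun := fun w => ⟨L.symm fun s => (w s).1, (hmem _).2 fun s => by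
        rw [L.apply_symm_apply]
        exact (w s).2⟩
      left_inv := fun v => Subtype.ext (L.symm_apply_apply v.1)
      right_inv := fun w => by
        funext s
        exact Subtype.ext (congrFun (L.apply_symm_apply _) s) }
  have (s : S) : FiniteDimensional K (AdjoinRoot ((X - C (ζ s)) ^ m s)) :=
    (AdjoinRoot.powerBasis (pow_ne_zero _ (X_sub_C_ne_zero _))).finite
  rw [e.finrank_eq, finrank_pi_fintype]
  exact Finset.sum_congr rfl fun s _ => finrank_ker_root_sub_pow _ _ _ _

/-- The second differences of `k ↦ ∑ min k (m s)` count the `s` with `m s` of a given value. -/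
theorem card_eq_of_sum_min_eq {S S' : Type} [Fintype S] [Fintype S'] {p : S → Prop} {p' : S' → Prop}
    [DecidablePred p] [DecidablePred p'] {m : S → ℕ} {m' : S' → ℕ}
    (h : ∀ k, (∑ s, if p s then min k (m s) else 0) = ∑ s, if p' s then min k (m' s) else 0)
    {c : ℕ} (hc : c ≠ 0) :
    Nat.card {s // p s ∧ m s = c} = Nat.card {s // p' s ∧ m' s = c} := by
  have key {S : Type} [Fintype S] {p : S → Prop} [DecidablePred p] {m : S → ℕ} {c : ℕ} :
      (∑ s, if p s then min (c + 1 + 1) (m s) else 0) + (∑ s, if p s then min c (m s) else 0) +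
        Nat.card {s // p s ∧ m s = c + 1} = 2 * ∑ s, if p s then min (c + 1) (m s) else 0 := by
    rw [Nat.card_eq_fintype_card, Fintype.card_subtype, Finset.card_filter, ← Finset.sum_add_distrib,
      ← Finset.sum_add_distrib, Finset.mul_sum]
    refine Finset.sum_congr rfl fun s _ => ?_
    split_ifs <;> grind
  obtain ⟨c, rfl⟩ := Nat.exists_eq_succ_of_ne_zero hc
  have h1 := key (p := p) (m := m) (c := c)
  have h2 := key (p := p') (m := m') (c := c)
  rw [h, h, h] at h1
  exact Nat.add_left_cancel (h1.trans h2.symm)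

theorem HasJordan.restrict (h : HasJordan T ζ m) :
    HasJordan T (fun s : {s // m s ≠ 0} => ζ s) fun s => m s := by
  classical
  obtain ⟨L, hL⟩ := h
  have hsub (s : S) (hs : m s = 0) : Subsingleton (AdjoinRoot ((X - C (ζ s)) ^ m s)) := by
    rw [hs, pow_zero]
    exact Ideal.Quotient.subsingleton_iff.2 Ideal.span_singleton_one
  let e : (∀ s, AdjoinRoot ((X - C (ζ s)) ^ m s)) ≃ₗ[K]
      (∀ s : {s // m s ≠ 0}, AdjoinRoot ((X - C (ζ s)) ^ m s)) :=
    { toFun := fun v s => v s.1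
      map_add' := fun _ _ => rfl
      map_smul' := fun _ _ => rfl
      invFun := fun w s => if hs : m s ≠ 0 then w ⟨s, hs⟩ else 0
      left_inv := fun v => by
        funext s
        by_cases hs : m s = 0
        · exact (hsub s hs).elim _ _
        · simp [hs]
      right_inv := fun w => by
        funext s
        simp [s.2] }
  exact ⟨L.trans e, fun v s => hL v s⟩

theorem HasJordan.reindex (e : S ≃ S') (h : HasJordan T (fun s => ζ' (e s)) fun s => m' (e s)) :
    HasJordan T ζ' m' := by
  obtain ⟨L, hL⟩ := h
  refine ⟨L.trans (LinearEquiv.piCongrLeft K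
    (fun s' => AdjoinRoot ((X - C (ζ' s')) ^ m' s')) e), fun v s' => ?_⟩
  obtain ⟨s, rfl⟩ := e.surjective s'
  have key (w : ∀ s, AdjoinRoot ((X - C (ζ' (e s))) ^ m' (e s))) : LinearEquiv.piCongrLeft K
      (fun s' => AdjoinRoot ((X - C (ζ' s')) ^ m' s')) e w (e s) = w s :=
    Equiv.piCongrLeft_apply_apply (fun s' => AdjoinRoot ((X - C (ζ' s')) ^ m' s')) e w s
  rw [LinearEquiv.trans_apply, LinearEquiv.trans_apply, key, key, hL]

/-- Two endomorphisms are conjugate if and only if they have the same number of Jordan blocks of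
each eigenvalue and size. -/
theorem HasJordan.conj_iff [Finite S] [Finite S'] (h : HasJordan T ζ m) (h' : HasJordan T' ζ' m') :
    (∃ e : V ≃ₗ[K] V', ∀ v, e (T v) = T' (e v)) ↔
      ∀ ζ0 c, c ≠ 0 → Nat.card {s // ζ s = ζ0 ∧ m s = c} = Nat.card {s // ζ' s = ζ0 ∧ m' s = c} := by
  classical
  obtain ⟨i1⟩ := nonempty_fintype S
  obtain ⟨i2⟩ := nonempty_fintype S'
  refine ⟨?_, fun hcard => ?_⟩
  · rintro ⟨e, he⟩ ζ0 c hc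
    refine card_eq_of_sum_min_eq (fun k => ?_) hc
    rw [← (h'.conj e he).finrank_ker, h.finrank_ker]
  · have hfib : Nonempty (∀ z : K × ℕ, {s : {s // m s ≠ 0} // (ζ s.1, m s.1) = z} ≃
        {s : {s // m' s ≠ 0} // (ζ' s.1, m' s.1) = z}) := by
      refine ⟨fun z => Classical.choice (Finite.card_eq.1 ?_)⟩
      by_cases hz : z.2 = 0
      · have e1 : IsEmpty {s : {s // m s ≠ 0} // (ζ s.1, m s.1) = z} :=
          ⟨fun s => s.1.2 ((congrArg Prod.snd s.2).trans hz)⟩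
        have e2 : IsEmpty {s : {s // m' s ≠ 0} // (ζ' s.1, m' s.1) = z} :=
          ⟨fun s => s.1.2 ((congrArg Prod.snd s.2).trans hz)⟩
        rw [Nat.card_of_isEmpty, Nat.card_of_isEmpty]
      · have key {S : Type} (ζ : S → K) (m : S → ℕ) :
            Nat.card {s : {s // m s ≠ 0} // (ζ s.1, m s.1) = z} =
              Nat.card {s // ζ s = z.1 ∧ m s = z.2} :=
          Nat.card_congr
            { toFun := fun s => ⟨s.1.1, congrArg Prod.fst s.2, congrArg Prod.snd s.2⟩
              invFun := fun s => ⟨⟨s.1, fun h0 => hz (s.2.2.symm.trans h0)⟩, Prod.ext s.2.1 s.2.2⟩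
              left_inv := fun _ => rfl
              right_inv := fun _ => rfl }
        rw [key, key, hcard _ _ hz]
    obtain ⟨f⟩ := hfib
    let e := Equiv.ofFiberEquiv f
    have he (s : {s // m s ≠ 0}) : (ζ' (e s).1, m' (e s).1) = (ζ s.1, m s.1) :=
      Equiv.ofFiberEquiv_map f s
    have h1 : HasJordan T (fun s : {s // m' s ≠ 0} => ζ' s) fun s => m' s := by
      refine HasJordan.reindex e ?_
      have h2 := h.restrict
      rwa [← funext fun s => congrArg Prod.fst (he s), ← funext fun s => congrArg Prod.snd (he s)]
        at h2
    obtain ⟨L, hL⟩ := h1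
    obtain ⟨L', hL'⟩ := h'.restrict
    refine ⟨L.trans L'.symm, fun v => ?_⟩
    rw [LinearEquiv.trans_apply, LinearEquiv.symm_apply_eq]
    funext s
    rw [hL', LinearEquiv.trans_apply, L'.apply_symm_apply, hL]

end JordanUnique

/-! ### Counting fibres of finitely supported functions -/

section Fibres

theorem exists_perm_iff {f g : ℕ → ℕ} (hf : (Function.support f).Finite)
    (hg : (Function.support g).Finite) : (∃ e : Equiv.Perm ℕ, ∀ j, f j = g (e j)) ↔
      ∀ c, c ≠ 0 → Nat.card {j // f j = c} = Nat.card {j // g j = c} := by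
  refine ⟨?_, fun h => ?_⟩
  · rintro ⟨e, he⟩ c -
    exact Nat.card_congr (e.subtypeEquiv fun j => by rw [he])
  · have hfib : Nonempty (∀ c, {j // f j = c} ≃ {j // g j = c}) := by
      refine ⟨fun c => Classical.choice ?_⟩
      rcases eq_or_ne c 0 with rfl | hc
      · have key {f : ℕ → ℕ} (hf : (Function.support f).Finite) : Infinite {j // f j = 0} := by
          have := hf.infinite_compl.to_subtype
          exact Infinite.of_injective (fun j : ((Function.support f)ᶜ : Set ℕ) =>
            (⟨j.1, Function.notMem_support.1 j.2⟩ : {j // f j = 0})) fun _ _ h =>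
              Subtype.ext (Subtype.mk.inj h)
        have := key hf
        have := key hg
        exact nonempty_equiv_of_countable
      · have key {f : ℕ → ℕ} (hf : (Function.support f).Finite) : Finite {j // f j = c} :=
          (hf.subset fun j (hj : f j = c) => by
            rw [Function.mem_support, hj]
            exact hc : {j | f j = c}.Finite).to_subtype
        have := key hf
        have := key hg
        exact Finite.card_eq.1 (h c hc)
    obtain ⟨F⟩ := hfib
    exact ⟨Equiv.ofFiberEquiv F, fun j => (Equiv.ofFiberEquiv_map F j).symm⟩

end Fibres

/-! ### Exponentials of nilpotent matrices -/

section Exponential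

open Polynomial Module Matrix

variable {K : Type} [Field K]

theorem exists_exp_eq {A : Type} [Ring A] [Algebra K A] [CharZero K] [Module ℚ A] {B : A}
    (h : IsNilpotent B) :
    ∃ w : K[X], IsNilpotent.exp B = 1 + aeval B (X * (1 + X * w)) := by
  obtain ⟨k, hk⟩ := h
  refine ⟨∑ i ∈ Finset.range k, C ((((i + 1 + 1).factorial : ℚ)⁻¹ : ℚ) : K) * X ^ i, ?_⟩
  have hk' : B ^ (k + 1 + 1) = 0 := by rw [pow_succ, pow_succ, hk, zero_mul, zero_mul]
  rw [IsNilpotent.exp_eq_sum hk', Finset.sum_range_succ', Finset.sum_range_succ', mul_add, mul_one,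
    map_add, aeval_X, map_mul, map_mul, aeval_X, map_sum, Finset.mul_sum, Finset.mul_sum]
  simp only [zero_add, Nat.factorial_zero, Nat.factorial_one, Nat.cast_one, inv_one, one_smul,
    pow_zero, pow_one]
  rw [add_comm, add_comm (∑ i ∈ _, _) B]
  congr 2
  refine Finset.sum_congr rfl fun i _ => ?_
  rw [map_mul, aeval_C, map_pow, aeval_X, ← Algebra.smul_def, Rat.cast_smul_eq_qsmul, mul_smul_comm,
    mul_smul_comm, ← pow_succ', ← pow_succ']

/-- The nilpotent Jordan block. -/
def shiftMat (K : Type) [Field K] (m : ℕ) : Matrix (Fin m) (Fin m) K :=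
  Matrix.of fun b b' => if b.1 = b'.1 + 1 then 1 else 0

theorem shiftMat_pow (m k : ℕ) : shiftMat K m ^ k =
    Matrix.of fun b b' : Fin m => if b.1 = b'.1 + k then 1 else 0 := by
  induction k with
  | zero =>
    ext b b'
    simp [Matrix.one_apply, Fin.ext_iff]
  | succ k ih =>
    ext b b'
    rw [pow_succ, ih, Matrix.mul_apply]
    by_cases h : b'.1 + 1 < m
    · rw [Finset.sum_eq_single ⟨b'.1 + 1, h⟩]
      · simp only [shiftMat, Matrix.of_apply, if_true, mul_one, add_assoc, add_comm 1 k]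
      · intro c _ hc
        have : ¬ c.1 = b'.1 + 1 := fun h => hc (Fin.ext h)
        simp [shiftMat, this]
      · intro h
        exact absurd (Finset.mem_univ _) h
    · have h1 : ¬ b.1 = b'.1 + (k + 1) := by omega
      rw [Finset.sum_eq_zero]
      · simp [h1]
      · intro c _
        have : ¬ c.1 = b'.1 + 1 := by omega
        simp [shiftMat, this]

theorem shiftMat_pow_self (m : ℕ) : shiftMat K m ^ m = 0 := by
  rw [shiftMat_pow]
  ext b b'
  have : ¬ b.1 = b'.1 + m := by omega
  simp [this]

theorem one_kronecker_pow {d m : ℕ} (N : Matrix (Fin m) (Fin m) K) (k : ℕ) :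
    (kronecker (1 : Matrix (Fin d) (Fin d) K) N) ^ k = kronecker 1 (N ^ k) := by
  induction k with
  | zero => rw [pow_zero, pow_zero]; exact one_kronecker_one.symm
  | succ k ih => rw [pow_succ, pow_succ, ih]; exact (mul_kronecker_mul _ _ _ _).symm.trans (by rw [mul_one]; rfl)

/-- A Jordan block of eigenvalue `z` and size `m`, in exponential form. -/
theorem hasJordan_smul_exp [CharZero K] {d m : ℕ} (hd : d = 1) (hm : m ≠ 0) {z : K} (hz : z ≠ 0)
    [Module ℚ (Matrix (Fin d × Fin m) (Fin d × Fin m) K)] :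
    HasJordan (toLin' (z • IsNilpotent.exp (kronecker (1 : Matrix (Fin d) (Fin d) K)
      (shiftMat K m)))) (fun _ : Unit => z) fun _ => m := by
  subst hd
  have hB : (kronecker (1 : Matrix (Fin 1) (Fin 1) K) (shiftMat K m)) ^ m = 0 := by
    rw [one_kronecker_pow, shiftMat_pow_self]
    exact kronecker_zero _
  obtain ⟨w, hw⟩ := exists_exp_eq (K := K) (B := kronecker (1 : Matrix (Fin 1) (Fin 1) K)
    (shiftMat K m)) ⟨m, hB⟩
  have hm1 : m - 1 + 1 = m := Nat.succ_pred_eq_of_ne_zero hm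
  set B := kronecker (1 : Matrix (Fin 1) (Fin 1) K) (shiftMat K m) with hBdef
  have e (k : ℕ) : (toLin' (z • IsNilpotent.exp B) - algebraMap K _ z) ^ k =
      toLin' (z ^ k • (B ^ k * aeval B ((1 + X * w) ^ k))) := by
    have : toLin' (z • IsNilpotent.exp B) - algebraMap K _ z =
        toLinAlgEquiv' (z • aeval B (X * (1 + X * w))) := by
      rw [hw, smul_add, map_add, Algebra.algebraMap_eq_smul_one,
        show toLin' (z • (1 : Matrix (Fin 1 × Fin m) (Fin 1 × Fin m) K)) = z • 1 by
        rw [map_smul, toLin'_one]; rfl, add_sub_cancel_left]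
      rfl
    rw [this, ← map_pow, _root_.smul_pow, ← map_pow, mul_pow, map_mul, map_pow, aeval_X]
    rfl
  refine hasJordan_single (v := Pi.single (0, ⟨0, Nat.pos_of_ne_zero hm⟩) 1) ?_ ?_
    (Nat.pos_of_ne_zero hm) ?_
  · rw [finrank_fintype_fun_eq_card, Fintype.card_prod, Fintype.card_fin, Fintype.card_fin, one_mul]
  · rw [e, hB, zero_mul, smul_zero, map_zero]
  · have h1 : (X : K[X]) ∣ (1 + X * w) ^ (m - 1) - 1 := by
      have := sub_dvd_pow_sub_pow (1 + X * w) 1 (m - 1)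
      rw [one_pow] at this
      exact (Dvd.intro w (by ring)).trans this
    obtain ⟨w', hw'⟩ := h1
    rw [sub_eq_iff_eq_add] at hw'
    rw [e, hw', map_add, map_one, map_mul, aeval_X, mul_add, mul_one, ← mul_assoc, ← pow_succ, hm1,
      hB, zero_mul, zero_add, hBdef, one_kronecker_pow, shiftMat_pow, toLin'_apply]
    intro h0
    have h2 := congrFun h0 (0, ⟨m - 1, by omega⟩)
    rw [mulVec_single_one, Matrix.col_apply] at h2
    simp [kronecker, kroneckerMap_apply, hz] at h2

end Exponential

/-! ### The inertial types as representations -/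

section InertialTypes

open Matrix

variable {p : ℕ} [Fact p.Prime] {F : IntermediateField ℚ_[p] (PadicAlgCl p)}
  {l : ℕ} [Fact l.Prime]

theorem BasicRep.continuous (τ : BasicRep F l) : Continuous fun g => (τ.rep g).1 := by
  obtain ⟨ρ, hρ, -, h⟩ := τ.isBasic
  have e : (fun g => (τ.rep g).1) = fun g : inertia F => (ρ g).1 := by
    funext g
    rw [h]
  rw [e]
  exact Units.continuous_val.comp (hρ.comp continuous_subtype_val)

variable {P : TypeDatum F l}

open Classical in
theorem spInertia_one : spInertia P 1 = 1 := by
  classical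
  rw [spInertia]
  simp only [map_one, Units.val_one]
  refine (congrArg blockDiagonal' (funext fun s => ?_)).trans blockDiagonal'_one
  exact one_kronecker_one

theorem spInertia_mul (g h : inertia F) :
    spInertia P (g * h) = spInertia P g * spInertia P h := by
  classical
  rw [spInertia, spInertia, spInertia, ← blockDiagonal'_mul]
  refine congrArg blockDiagonal' (funext fun s => ?_)
  rw [map_mul, Units.val_mul]
  refine Eq.trans ?_ (mul_kronecker_mul _ _ _ _)
  rw [one_mul]
  rfl

theorem spInertia_commute (g : inertia F) : Commute (spInertia P g) (spMonodromy P) := by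
  classical
  rw [Commute, SemiconjBy, spInertia, spMonodromy, ← blockDiagonal'_mul, ← blockDiagonal'_mul]
  refine congrArg blockDiagonal' (funext fun s => ?_)
  refine (mul_kronecker_mul _ _ _ _).symm.trans (Eq.trans ?_ (mul_kronecker_mul _ _ _ _))
  rw [one_mul, mul_one, one_mul, mul_one]

theorem one_kronecker_shiftMat_pow (s : BlockIndex P) :
    kronecker (1 : Matrix (Fin (BasicType.out s.1.1).dim) (Fin (BasicType.out s.1.1).dim)
      (PadicAlgCl l)) (shiftMat (PadicAlgCl l) ((P s.1).1 s.2)) ^ ((P s.1).1 s.2) = 0 := by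
  rw [one_kronecker_pow, shiftMat_pow_self]
  exact kronecker_zero _

open Classical in
theorem isNilpotent_spBlocks : IsNilpotent fun s : BlockIndex P =>
    kronecker (1 : Matrix (Fin (BasicType.out s.1.1).dim) (Fin (BasicType.out s.1.1).dim)
      (PadicAlgCl l)) (shiftMat (PadicAlgCl l) ((P s.1).1 s.2)) := by
  refine ⟨∑ s : BlockIndex P, (P s.1).1 s.2, funext fun s => ?_⟩
  rw [Pi.pow_apply]
  exact pow_eq_zero_of_le (Finset.single_le_sum
    (f := fun s : BlockIndex P => (P s.1).1 s.2) (fun _ _ => Nat.zero_le _) (Finset.mem_univ s))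
    (one_kronecker_shiftMat_pow s)

open Classical in
theorem isNilpotent_spMonodromy : IsNilpotent (spMonodromy P) :=
  (isNilpotent_spBlocks (P := P)).map (blockDiagonal'RingHom _ (PadicAlgCl l))

/-- The coefficient `t_l(g)` of the monodromy operator in `inertialType σ P g`. -/
def tameCoeff (l : ℕ) [Fact l.Prime] (σ g : inertia F) : PadicAlgCl l :=
  algebraMap ℚ_[l] (PadicAlgCl l) ((tameLog l σ g).toAdd : ℚ_[l])

theorem tameCoeff_mul (σ g h : inertia F) :
    tameCoeff l σ (g * h) = tameCoeff l σ g + tameCoeff l σ h := by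
  rw [tameCoeff, map_mul, toAdd_mul, PadicInt.coe_add, map_add]
  rfl

open Classical in
theorem inertialType_eq (σ : inertia F) (g : inertia F) :
    inertialType σ P g = spInertia P g * IsNilpotent.exp (tameCoeff l σ g • spMonodromy P) := rfl

theorem inertialType_of_tameLog {σ g : inertia F} (h : tameLog l σ g = 1) :
    inertialType σ P g = spInertia P g := by
  classical
  have h0 : (tameCoeff l σ g) = 0 := by
    rw [tameCoeff, h, toAdd_one, PadicInt.coe_zero, map_zero]
  rw [inertialType_eq, h0, zero_smul, IsNilpotent.exp_zero, mul_one]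

open Classical in
theorem inertialType_one (σ : inertia F) : inertialType σ P 1 = 1 := by
  rw [inertialType_of_tameLog (map_one _), spInertia_one]

open Classical in
theorem commute_exp_of_commute {A : Type} [Ring A] [Module ℚ A] {a b : A} (h : Commute a b)
    (hb : IsNilpotent b) : Commute a (IsNilpotent.exp b) := by
  obtain ⟨k, hk⟩ := hb
  rw [IsNilpotent.exp_eq_sum hk]
  exact Commute.sum_right _ _ _ fun i _ => by
    have := h.pow_right i
    rw [Commute, SemiconjBy, mul_smul_comm, smul_mul_assoc, this.eq]

theorem inertialType_mul (σ g h : inertia F) :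
    inertialType σ P (g * h) = inertialType σ P g * inertialType σ P h := by
  classical
  have hn (c : PadicAlgCl l) : IsNilpotent (c • spMonodromy P) := isNilpotent_spMonodromy.smul c
  have hc (c : PadicAlgCl l) : Commute (spInertia P h) (IsNilpotent.exp (c • spMonodromy P)) :=
    commute_exp_of_commute ((spInertia_commute h).smul_right c) (hn c)
  have he : IsNilpotent.exp ((tameCoeff l σ g + tameCoeff l σ h) • spMonodromy P) =
      IsNilpotent.exp ((tameCoeff l σ g) • spMonodromy P) *
        IsNilpotent.exp ((tameCoeff l σ h) • spMonodromy P) := by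
    rw [add_smul]
    exact IsNilpotent.exp_add_of_commute
      (((Commute.refl (spMonodromy P)).smul_right _).smul_left _) (hn _) (hn _)
  rw [inertialType_eq, inertialType_eq, inertialType_eq, tameCoeff_mul, he, spInertia_mul, mul_assoc,
    mul_assoc, ← mul_assoc (spInertia P h), (hc _).eq, mul_assoc]

theorem continuous_spInertia : Continuous fun g => spInertia P g := by
  classical
  refine continuous_matrix fun x y => ?_
  obtain ⟨s, a⟩ := x
  obtain ⟨s', a'⟩ := y
  by_cases h : s = s'
  · subst h
    simp only [spInertia, blockDiagonal'_apply_eq]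
    refine Continuous.mul ?_ continuous_const
    exact (BasicRep.continuous (BasicType.out s.1.1)).matrix_elem a.1 a'.1
  · simp only [spInertia, blockDiagonal'_apply_ne _ _ _ h]
    exact continuous_const

theorem continuous_inertialType {σ : inertia F} (h : Continuous (tameLog l σ)) :
    Continuous fun g => inertialType σ P g := by
  classical
  have ht : Continuous fun g => (tameCoeff l σ g) :=
    (continuous_algebraMap ℚ_[l] (PadicAlgCl l)).comp
      (continuous_subtype_val.comp (continuous_toAdd.comp h))
  obtain ⟨k, hk⟩ := isNilpotent_spMonodromy (P := P)
  have e (g : inertia F) : inertialType σ P g = spInertia P g * ∑ i ∈ Finset.range k,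
      (((i.factorial : ℚ)⁻¹ : ℚ) : PadicAlgCl l) • (tameCoeff l σ g ^ i • spMonodromy P ^ i) := by
    have hk' : (tameCoeff l σ g • spMonodromy P) ^ k = 0 := by rw [smul_pow, hk, smul_zero]
    rw [inertialType_eq, IsNilpotent.exp_eq_sum hk']
    refine congrArg _ (Finset.sum_congr rfl fun i _ => ?_)
    rw [smul_pow, Rat.cast_smul_eq_qsmul]
  simp only [e]
  refine continuous_spInertia.mul (continuous_finsetSum _ fun i _ => ?_)
  have hi : Continuous fun g => tameCoeff l σ g ^ i • spMonodromy P ^ i :=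
    (ht.pow i).smul (continuous_const (y := spMonodromy P ^ i))
  exact hi.const_smul (((i.factorial : ℚ)⁻¹ : ℚ) : PadicAlgCl l)

/-- The elements at which `M` intertwines `ρ` and `τ`. -/
def intertwiners {G K κ : Type} [Group G] [Field K] [Fintype κ] [DecidableEq κ] {n : ℕ}
    (ρ : G →* GL (Fin n) K) (τ : G →* Matrix κ κ K) (M : Matrix κ (Fin n) K) : Subgroup G where
  carrier := {g | M * (ρ g).1 = τ g * M}
  one_mem' := by
    change M * (ρ 1).1 = τ 1 * M
    rw [map_one, map_one, Units.val_one, Matrix.mul_one, Matrix.one_mul]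
  mul_mem' := fun {g h} hg hh => by
    change M * (ρ (g * h)).1 = τ (g * h) * M
    change M * (ρ g).1 = _ at hg
    change M * (ρ h).1 = _ at hh
    rw [map_mul, map_mul, Units.val_mul, ← Matrix.mul_assoc, hg, Matrix.mul_assoc, hh,
      Matrix.mul_assoc]
  inv_mem' := fun {g} hg => by
    change M * (ρ g).1 = _ at hg
    change M * (ρ g⁻¹).1 = τ g⁻¹ * M
    have h1 : τ g⁻¹ * τ g = 1 := by rw [← map_mul, inv_mul_cancel, map_one]
    have h2 : (ρ g).1 * (ρ g⁻¹).1 = 1 := by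
      rw [← Units.val_mul, ← map_mul, mul_inv_cancel, map_one, Units.val_one]
    calc M * (ρ g⁻¹).1 = τ g⁻¹ * τ g * (M * (ρ g⁻¹).1) := by rw [h1, Matrix.one_mul]
      _ = τ g⁻¹ * (τ g * M * (ρ g⁻¹).1) := by simp only [Matrix.mul_assoc]
      _ = τ g⁻¹ * M := by rw [← hg, Matrix.mul_assoc, h2, Matrix.mul_one]

theorem isClosed_intertwiners {G K κ : Type} [Group G] [TopologicalSpace G] [Field K]
    [TopologicalSpace K] [IsTopologicalRing K] [T2Space K] [Fintype κ] [DecidableEq κ] {n : ℕ}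
    {ρ : G →* GL (Fin n) K} {τ : G →* Matrix κ κ K} (hρ : Continuous fun g => (ρ g).1)
    (hτ : Continuous τ) (M : Matrix κ (Fin n) K) :
    IsClosed (intertwiners ρ τ M : Set G) :=
  isClosed_eq (continuous_const.matrix_mul hρ) (hτ.matrix_mul continuous_const)

theorem mem_intertwiners {G K κ : Type} [Group G] [Field K] [Fintype κ] [DecidableEq κ] {n : ℕ}
    {ρ : G →* GL (Fin n) K} {τ : G →* Matrix κ κ K} {M : Matrix κ (Fin n) K}
    {T : (Fin n → K) ≃ₗ[K] (κ → K)} (hM : ∀ v, M.mulVec v = T v) {g : G} :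
    g ∈ intertwiners ρ τ M ↔ ∀ v, T ((ρ g).1.mulVec v) = (τ g).mulVec (T v) := by
  change M * (ρ g).1 = τ g * M ↔ _
  simp only [← hM, mulVec_mulVec]
  exact ⟨fun h v => by rw [h], fun h => Matrix.toLin'.injective (LinearMap.ext h)⟩

open Classical in
/-- It suffices to test an isomorphism with an inertial type on the generator `σ`. -/
theorem hasType_iff {σ : inertia F} (hσ : IsTameGenerator F σ) (ht : Continuous (tameLog l σ))
    (hP : ∀ g : inertia F, (g : GaloisGroup F) ∈ wildInertia F → inertialType σ P g = 1)
    {n : ℕ} {ρ : GaloisGroup F →* GL (Fin n) (PadicAlgCl l)} (hρ : Continuous fun g => (ρ g).1)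
    (hw : ∀ g ∈ wildInertia F, ρ g = 1) :
    HasType σ ρ P ↔
      ∃ T : (Fin n → PadicAlgCl l) ≃ₗ[PadicAlgCl l] (SpIndex P → PadicAlgCl l),
        ∀ v, T (toLin' (ρ σ).1 v) = toLin' (inertialType σ P σ) (T v) := by
  classical
  refine ⟨fun ⟨T, hT⟩ => ⟨T, hT σ⟩, fun ⟨T, hT⟩ => ⟨T, ?_⟩⟩
  let M := LinearMap.toMatrix' T.toLinearMap
  have hM (v : Fin n → PadicAlgCl l) : M.mulVec v = T v := by
    rw [← Matrix.toLin'_apply, toLin'_toMatrix']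
    rfl
  let τ : inertia F →* Matrix (SpIndex P) (SpIndex P) (PadicAlgCl l) :=
    { toFun := inertialType σ P
      map_one' := inertialType_one σ
      map_mul' := inertialType_mul σ }
  have hρ' : Continuous fun g : inertia F => ((ρ.comp (inertia F).subtype) g).1 :=
    hρ.comp continuous_subtype_val
  have hV := hσ.eq_top (V := intertwiners (ρ.comp (inertia F).subtype) τ M)
    (isClosed_intertwiners hρ' (continuous_inertialType ht) M) ((mem_intertwiners hM).2 hT) fun g
    hg => by
      change M * (ρ g).1 = inertialType σ P g * M
      rw [hw g hg, hP g hg, Units.val_one]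
      exact (Matrix.mul_one M).trans (Matrix.one_mul M).symm
  exact fun g => (mem_intertwiners hM).1 (hV ▸ Subgroup.mem_top g)

open Classical in
/-- The Jordan blocks of `τ_P(σ)`, when `σ` acts on every constituent by a scalar. -/
theorem hasJordan_inertialType {σ : inertia F} (hσ : tameLog l σ σ = Multiplicative.ofAdd 1)
    {z : BasicType F l → PadicAlgCl l}
    (hz : ∀ τ ∈ P.support, τ.out.dim = 1 ∧ (τ.out.rep σ).1 = Matrix.scalar _ (z τ)) :
    HasJordan (toLin' (inertialType σ P σ)) (fun s : BlockIndex P => z s.1)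
      fun s => (P s.1).1 s.2 := by
  classical
  have h1 : (tameCoeff l σ σ) = 1 := by
    rw [tameCoeff, hσ, toAdd_ofAdd, PadicInt.coe_one, map_one]
  have hexp : IsNilpotent.exp (spMonodromy P) = blockDiagonal' fun s : BlockIndex P =>
      IsNilpotent.exp (kronecker (1 : Matrix (Fin (BasicType.out s.1.1).dim)
        (Fin (BasicType.out s.1.1).dim) (PadicAlgCl l))
        (shiftMat (PadicAlgCl l) ((P s.1).1 s.2))) := by
    have e1 := IsNilpotent.map_exp (isNilpotent_spBlocks (P := P))
      (blockDiagonal'RingHom (fun s : BlockIndex P =>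
        Fin (BasicType.out s.1.1).dim × Fin ((P s.1).1 s.2)) (PadicAlgCl l))
    refine e1.symm.trans (congrArg blockDiagonal' (funext fun s => ?_))
    exact IsNilpotent.map_exp (isNilpotent_spBlocks (P := P)) (Pi.evalRingHom (fun s : BlockIndex P =>
      Matrix (Fin (BasicType.out s.1.1).dim × Fin ((P s.1).1 s.2))
        (Fin (BasicType.out s.1.1).dim × Fin ((P s.1).1 s.2)) (PadicAlgCl l)) s)
  have e : inertialType σ P σ = blockDiagonal' fun s : BlockIndex P =>
      z s.1 • IsNilpotent.exp (kronecker (1 : Matrix (Fin (BasicType.out s.1.1).dim)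
        (Fin (BasicType.out s.1.1).dim) (PadicAlgCl l))
        (shiftMat (PadicAlgCl l) ((P s.1).1 s.2))) := by
    rw [inertialType_eq, h1, one_smul, hexp, spInertia, ← blockDiagonal'_mul]
    refine congrArg blockDiagonal' (funext fun s => ?_)
    have e1 : kronecker ((BasicType.out s.1.1).rep σ).1
        (1 : Matrix (Fin ((P s.1).1 s.2)) (Fin ((P s.1).1 s.2)) (PadicAlgCl l)) = z s.1 • 1 := by
      rw [(hz s.1 s.1.2).2, Matrix.scalar_apply, ← smul_one_eq_diagonal]
      refine (smul_kronecker _ _ _).trans ?_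
      rw [one_kronecker_one]
    rw [e1, smul_mul_assoc, one_mul]
  have hb (s : BlockIndex P) : HasJordan (toLin' (z s.1 • IsNilpotent.exp (kronecker
      (1 : Matrix (Fin (BasicType.out s.1.1).dim) (Fin (BasicType.out s.1.1).dim) (PadicAlgCl l))
      (shiftMat (PadicAlgCl l) ((P s.1).1 s.2))))) (fun _ : Unit => z s.1)
      fun _ => (P s.1).1 s.2 := by
    refine hasJordan_smul_exp (hz s.1 s.1.2).1 (Finsupp.mem_support_iff.1 s.2.2) ?_
    intro h0
    have hu := Units.isUnit ((BasicType.out s.1.1).rep σ)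
    rw [(hz s.1 s.1.2).2, h0, map_zero] at hu
    have hd := (hz s.1 s.1.2).1
    have : Nonempty (Fin (BasicType.out s.1.1).dim) := ⟨⟨0, by omega⟩⟩
    exact not_isUnit_zero hu
  rw [e]
  have h := hasJordan_blockDiagonal' hb
  exact h.reindex (ζ' := fun s : BlockIndex P => z s.1) (m' := fun s : BlockIndex P => (P s.1).1 s.2)
    (Equiv.sigmaUnique (BlockIndex P) fun _ => Unit)

end InertialTypes

/-! ### Tame characters -/

section TameCharacters

open IsLocalRing

variable {p : ℕ} [Fact p.Prime] {F : IntermediateField ℚ_[p] (PadicAlgCl p)}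

theorem residue_eq_iff {x y : integers F} : residue (integers F) x = residue (integers F) y ↔
    ‖algebraMap F (PadicAlgCl p) x - algebraMap F (PadicAlgCl p) y‖ < 1 := by
  rw [← sub_eq_zero, ← map_sub, residue_eq_zero_iff, mem_maximalIdeal_integers]
  rfl

variable [FiniteDimensional ℚ_[p] F]

theorem exists_unit_of_pow_eq_one {φ : GaloisGroup F} (hφ : IsFrobenius F φ) {x : PadicAlgCl p}
    (hx : x ^ (residueCard F - 1) = 1) :
    ∃ u : (integers F)ˣ, algebraMap F (PadicAlgCl p) (u : integers F) = x := by
  have hq1 := one_lt_residueCard F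
  have hN : ¬ p ∣ residueCard F - 1 := not_dvd_of_dvd_residueCard_sub_one dvd_rfl
  have hfix : MulAction.stabilizer (GaloisGroup F) x = ⊤ := by
    refine eq_top_of_frobenius_mem hφ (Subgroup.isClosed_of_isOpen _
      (stabilizer_isOpen_of_isIntegral (K := F) _)) ?_ ?_
    · change φ x = x
      rw [frobenius_apply_rootOfUnity hφ hN hx, ← Nat.sub_add_cancel hq1.le, pow_succ, hx, one_mul]
    · exact fun g hg => inertia_apply_rootOfUnity hg hN hx
  obtain ⟨y, hy⟩ := (InfiniteGalois.mem_range_algebraMap_iff_fixed (k := F) x).2 fun f =>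
    (hfix ▸ Subgroup.mem_top f : f ∈ MulAction.stabilizer (GaloisGroup F) x)
  have hn : ‖(y : PadicAlgCl p)‖ = 1 := by
    change ‖algebraMap F (PadicAlgCl p) y‖ = 1
    rw [hy]
    exact norm_eq_one_of_pow_eq_one (Nat.sub_pos_of_lt hq1).ne' hx
  have hu : IsUnit (⟨y, mem_integers.2 hn.le⟩ : integers F) := integers_isUnit_iff.2 hn
  exact ⟨hu.unit, hy⟩

/-- The canonical surjection `I_F → k_F^×`. -/
theorem exists_tameQuotient {φ : GaloisGroup F} (hφ : IsFrobenius F φ) {σ : inertia F}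
    (hσ : IsTameGenerator F σ) :
    ∃ θ : inertia F →* (ResidueField F)ˣ, IsOpen (θ.ker : Set (inertia F)) ∧
      (∀ g : inertia F, (g : GaloisGroup F) ∈ wildInertia F → θ g = 1) ∧
      (∀ x, x ∈ Subgroup.zpowers (θ σ)) ∧
      (∀ (g : inertia F) (ϖ : integers F) (y : PadicAlgCl p) (u : (integers F)ˣ),
        Irreducible ϖ → y ^ (residueCard F - 1) = algebraMap F (PadicAlgCl p) ϖ →
        (g : GaloisGroup F) y = algebraMap F (PadicAlgCl p) (u : integers F) * y →
        Units.map (residue (integers F)).toMonoidHom u = θ g) ∧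
      ∃ (ϖ : integers F) (y : PadicAlgCl p), Irreducible ϖ ∧
        y ^ (residueCard F - 1) = algebraMap F (PadicAlgCl p) ϖ ∧ ∀ g : inertia F,
        ∃ u : (integers F)ˣ, (g : GaloisGroup F) y =
          algebraMap F (PadicAlgCl p) (u : integers F) * y := by
  have hq1 := one_lt_residueCard F
  have hN0 : 0 < residueCard F - 1 := Nat.sub_pos_of_lt hq1
  have hN : ¬ p ∣ residueCard F - 1 := not_dvd_of_dvd_residueCard_sub_one dvd_rfl
  obtain ⟨ϖ, hϖ⟩ := IsDiscreteValuationRing.exists_irreducible (integers F)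
  obtain ⟨y, hy⟩ := IsAlgClosed.exists_pow_nat_eq (algebraMap F (PadicAlgCl p) ϖ) hN0
  have hy0 := ne_zero_of_pow_eq_irreducible F hϖ hN0 hy
  set κ := kummer y hy0 _ hN (ϖ : F) hy with hκ
  have hκN (g : inertia F) : (κ g : PadicAlgCl p) ^ (residueCard F - 1) = 1 := by
    rw [← Units.val_pow_eq_pow_val, kummer_pow_eq_one, Units.val_one]
  choose u hu using fun g : inertia F => exists_unit_of_pow_eq_one hφ (hκN g)
  have hinj {a b : (integers F)ˣ} (h : algebraMap F (PadicAlgCl p) (a : integers F) =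
      algebraMap F (PadicAlgCl p) (b : integers F)) : a = b :=
    Units.ext (Subtype.ext ((algebraMap F (PadicAlgCl p)).injective h))
  let υ : inertia F →* (integers F)ˣ :=
    { toFun := u
      map_one' := hinj (by rw [hu, map_one, Units.val_one, Units.val_one]; exact (map_one _).symm)
      map_mul' := fun g h => hinj (by
        rw [hu, map_mul, Units.val_mul, Units.val_mul, ← hu g, ← hu h]
        exact (map_mul _ _ _).symm) }
  let θ := (Units.map (residue (integers F)).toMonoidHom).comp υ
  have hθ1 (g : inertia F) (h : κ g = 1) : θ g = 1 := by
    have : u g = 1 := hinj (by rw [hu, h, Units.val_one, Units.val_one]; exact (map_one _).symm)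
    change Units.map _ (u g) = 1
    rw [this, map_one]
  have hopen : IsOpen (θ.ker : Set (inertia F)) :=
    Subgroup.isOpen_mono (H₁ := κ.ker) (fun g hg => hθ1 g hg) (isOpen_ker_kummer _ _ _ _ _ _)
  have hgy (g : inertia F) : (g : GaloisGroup F) y =
      algebraMap F (PadicAlgCl p) (u g : integers F) * y := by rw [hu, kummer_mul]
  refine ⟨θ, hopen, fun g hg => hθ1 g (kummer_wild _ _ _ _ _ _ hg), ?_, ?_,
    ϖ, y, hϖ, hy, fun g => ⟨u g, hgy g⟩⟩
  · have hdvd : residueCard F - 1 ∣ orderOf (θ σ) := by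
      rw [← orderOf_kummer hφ hσ hN0 (fun _ _ h => h) hϖ hy0 hN hy, orderOf_dvd_iff_pow_eq_one]
      have h1 : θ (σ ^ orderOf (θ σ)) = θ 1 := by rw [map_pow, pow_orderOf_eq_one, map_one]
      rw [← map_pow]
      refine Units.ext (eq_of_pow_eq_one_of_norm_sub_lt hN (hκN _) ?_ ?_)
      · rw [Units.val_one, one_pow]
      · have h2 : residue (integers F) (u (σ ^ orderOf (θ σ))) = residue (integers F) 1 := by
          have := congrArg Units.val h1
          rw [map_one θ, Units.val_one] at this
          rw [map_one]
          exact this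
        rw [residue_eq_iff, hu] at h2
        rw [Units.val_one]
        simpa using h2
    have hcard : Nat.card (ResidueField F)ˣ = residueCard F - 1 := by
      rw [residueCard, Nat.card_units]
    intro x
    have htop : Subgroup.zpowers (θ σ) = ⊤ := by
      refine Subgroup.eq_top_of_card_eq _ (le_antisymm (Subgroup.card_le_card_group _) ?_)
      rw [Nat.card_zpowers, hcard]
      exact Nat.le_of_dvd (orderOf_pos _) hdvd
    rw [htop]
    exact Subgroup.mem_top x
  · intro g ϖ' y' u' hϖ' hy' hgy'
    have hy0' := ne_zero_of_pow_eq_irreducible F hϖ' hN0 hy'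
    have hnorm : ‖y'‖ = ‖y‖ := by
      refine (pow_left_inj₀ (norm_nonneg _) (norm_nonneg _) hN0.ne').1 ?_
      obtain ⟨v, hv⟩ := IsDiscreteValuationRing.associated_of_irreducible _ hϖ hϖ'
      have hv1 := integers_isUnit_iff.1 v.isUnit
      rw [← norm_pow, ← norm_pow, hy, hy', ← hv]
      refine (congrArg norm (map_mul (algebraMap F (PadicAlgCl p)) (ϖ : F) ((v : integers F) : F))).trans ?_
      rw [norm_mul]
      refine Eq.trans ?_ (mul_one _)
      exact congrArg _ hv1
    have h1 := inertia_ratio g.2 hy0' hy0 hnorm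
    rw [hgy', hgy, mul_div_cancel_right₀ _ hy0', mul_div_cancel_right₀ _ hy0] at h1
    exact Units.ext (residue_eq_iff.2 h1)

end TameCharacters

/-! ### Basic types of tame inertia -/

section Schur

open Matrix Module

theorem exists_scalar_of_commute {G K : Type} [Group G] [Field K] [IsAlgClosed K] {d : ℕ}
    {ρ : G →* GL (Fin d) K} (h : IsIrreducible ρ) {M : Matrix (Fin d) (Fin d) K}
    (hM : ∀ g, Commute M (ρ g).1) : ∃ c, M = scalar _ c := by
  obtain ⟨hd, hirr⟩ := h
  have : Nonempty (Fin d) := ⟨⟨0, hd⟩⟩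
  obtain ⟨c, hc⟩ := Module.End.exists_eigenvalue (toLin' M)
  rcases hirr (Module.End.eigenspace (toLin' M) c) (fun g v hv => by
    rw [Module.End.mem_eigenspace_iff, toLin'_apply] at hv ⊢
    rw [mulVec_mulVec, (hM g).eq, ← mulVec_mulVec, hv, mulVec_smul]) with h | h
  · exact absurd h hc
  · refine ⟨c, toLin'.injective (LinearMap.ext fun v => ?_)⟩
    have hv : v ∈ Module.End.eigenspace (toLin' M) c := h ▸ Submodule.mem_top
    rw [Module.End.mem_eigenspace_iff] at hv
    rw [hv, toLin'_apply, scalar_apply, ← smul_one_eq_diagonal, smul_mulVec, one_mulVec]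

theorem eq_one_of_forall_scalar {G K : Type} [Group G] [Field K] {d : ℕ}
    {ρ : G →* GL (Fin d) K} (h : IsIrreducible ρ) (hs : ∀ g, ∃ c, (ρ g).1 = scalar _ c) :
    d = 1 := by
  obtain ⟨hd, hirr⟩ := h
  have hv : (Pi.single ⟨0, hd⟩ 1 : Fin d → K) ≠ 0 := by
    intro h0
    have := congrFun h0 ⟨0, hd⟩
    rw [Pi.single_eq_same] at this
    exact one_ne_zero this
  rcases hirr (Submodule.span K {Pi.single ⟨0, hd⟩ 1}) (fun g v hv => by
    obtain ⟨c, hc⟩ := hs g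
    rw [hc, scalar_apply, ← smul_one_eq_diagonal, smul_mulVec, one_mulVec]
    exact Submodule.smul_mem _ c hv) with h | h
  · exact absurd (Submodule.span_singleton_eq_bot.1 h) hv
  · have h1 := finrank_span_singleton (K := K) hv
    rw [h, finrank_top, finrank_fintype_fun_eq_card, Fintype.card_fin] at h1
    exact h1

end Schur

section BasicTame

open Matrix Module

variable {p : ℕ} [Fact p.Prime] {F : IntermediateField ℚ_[p] (PadicAlgCl p)}
  [FiniteDimensional ℚ_[p] F] {l : ℕ} [Fact l.Prime] {φ : GaloisGroup F} {σ : inertia F}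
  {d : ℕ} {ρ : GaloisGroup F →* GL (Fin d) (PadicAlgCl l)}

theorem commute_of_tame (hφ : IsFrobenius F φ) (hσ : IsTameGenerator F σ)
    (hρ : Continuous fun g => (ρ g).1) (hw : ∀ g ∈ wildInertia F, ρ g = 1)
    {M : Matrix (Fin d) (Fin d) (PadicAlgCl l)} (h1 : Commute M (ρ σ).1) :
    (∀ g ∈ inertia F, Commute M (ρ g).1) ∧
      (Commute M (ρ φ).1 → ∀ g, Commute M (ρ g).1) := by
  let U := intertwiners ρ ((Units.coeHom _).comp ρ) M
  have hU : IsClosed (U : Set (GaloisGroup F)) := isClosed_intertwiners hρ hρ M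
  have hI : inertia F ≤ U := hσ.inertia_le hU h1 fun g hg => by
    change M * (ρ g).1 = (ρ g).1 * M
    rw [hw g hg, Units.val_one, mul_one, one_mul]
  exact ⟨hI, fun h2 g => (eq_top_of_frobenius_mem hφ hU h2 hI ▸ Subgroup.mem_top g : g ∈ U)⟩

/-- The fixed space of `ρ(σ) ^ L` is nonzero, and stable under `φ` since `φ σ φ⁻¹ = σ ^ q` and `q` is
invertible. -/
theorem pow_eq_one_of_isIrreducible (hφ : IsFrobenius F φ) (hσ : IsTameGenerator F σ)
    (hρ : Continuous ρ) (hirr : IsIrreducible ρ) (hw : ∀ g ∈ wildInertia F, ρ g = 1) {L : ℕ}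
    (hnil : IsNilpotent ((ρ σ).1 ^ L - 1)) : (ρ σ).1 ^ L = 1 := by
  have hρ' : Continuous fun g => (ρ g).1 := Units.continuous_val.comp hρ
  set U := (ρ σ).1 ^ L - 1 with hU
  have hcI := (commute_of_tame hφ hσ hρ' hw (M := U)
    (((Commute.refl (ρ σ).1).pow_left L).sub_left (Commute.one_left _))).1
  let W := LinearMap.ker (toLin' U)
  have hW (v : Fin d → PadicAlgCl l) : v ∈ W ↔ U.mulVec v = 0 := Iff.rfl
  let H : Subgroup (GaloisGroup F) :=
    { carrier := {g | ∀ v ∈ W, (ρ g).1.mulVec v ∈ W ∧ (ρ g⁻¹).1.mulVec v ∈ W}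
      one_mem' := fun v hv => by simpa using hv
      mul_mem' := fun {a b} ha hb v hv => by
        rw [_root_.mul_inv_rev, map_mul, map_mul, Units.val_mul, Units.val_mul, ← mulVec_mulVec,
          ← mulVec_mulVec]
        exact ⟨(ha _ (hb v hv).1).1, (hb _ (ha v hv).2).2⟩
      inv_mem' := fun {a} ha v hv => by
        rw [inv_inv]
        exact (ha v hv).symm }
  have hH : IsClosed (H : Set (GaloisGroup F)) := by
    have e : (H : Set (GaloisGroup F)) = ⋂ v ∈ W,
        {g | U.mulVec ((ρ g).1.mulVec v) = 0} ∩ {g | U.mulVec ((ρ g⁻¹).1.mulVec v) = 0} := by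
      ext g
      simp only [Set.mem_iInter]
      rfl
    rw [e]
    refine isClosed_biInter fun v _ => IsClosed.inter ?_ ?_
    · exact isClosed_eq (continuous_const.matrix_mulVec (hρ'.matrix_mulVec continuous_const))
        continuous_const
    · exact isClosed_eq (continuous_const.matrix_mulVec
        ((hρ'.comp continuous_inv).matrix_mulVec continuous_const)) continuous_const
  have hIH : inertia F ≤ H := by
    have key (g : GaloisGroup F) (hg : g ∈ inertia F) (v : Fin d → PadicAlgCl l) (hv : v ∈ W) :
        (ρ g).1.mulVec v ∈ W := by
      rw [hW] at hv ⊢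
      rw [mulVec_mulVec, (hcI g hg).eq, ← mulVec_mulVec, hv, mulVec_zero]
    exact fun g hg v hv => ⟨key g hg v hv, key _ (inv_mem hg) v hv⟩
  have hrel : (ρ φ).1 * (ρ σ).1 = (ρ σ).1 ^ residueCard F * (ρ φ).1 :=
    congrArg Units.val (tame_relation_of_wild (σ := σ) hφ hw)
  have hrelL : (ρ φ).1 * U = (((ρ σ).1 ^ L) ^ residueCard F - 1) * (ρ φ).1 := by
    have : SemiconjBy (ρ φ).1 (ρ σ).1 ((ρ σ).1 ^ residueCard F) := hrel
    have h2 := this.pow_right L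
    rw [hU, mul_sub, mul_one, h2.eq, ← pow_mul, ← pow_mul, mul_comm L, sub_mul,
      one_mul]
  obtain ⟨S, hS, hSu⟩ : ∃ S, ((ρ σ).1 ^ L) ^ residueCard F - 1 = S * U ∧ IsUnit S := by
    refine ⟨∑ i ∈ Finset.range (residueCard F), ((ρ σ).1 ^ L) ^ i, ?_, ?_⟩
    · exact (geom_sum_mul _ _).symm
    · obtain ⟨w, hw⟩ : ∃ w, ∑ i ∈ Finset.range (residueCard F), ((ρ σ).1 ^ L) ^ i =
          algebraMap (PadicAlgCl l) _ (residueCard F : PadicAlgCl l) + w * U ∧ Commute w U := by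
        refine ⟨∑ i ∈ Finset.range (residueCard F), ∑ j ∈ Finset.range i, ((ρ σ).1 ^ L) ^ j, ?_, ?_⟩
        · rw [Finset.sum_mul]
          simp only [hU, geom_sum_mul, Finset.sum_sub_distrib]
          simp
        · refine Commute.sum_left _ _ _ fun i _ => Commute.sum_left _ _ _ fun j _ => ?_
          exact ((Commute.refl _).pow_left j).sub_right (Commute.one_right _)
      rw [hw.1, add_comm]
      refine (hw.2.isNilpotent_mul_left hnil).isUnit_add_right_of_commute ?_ ?_
      · refine IsUnit.map _ (isUnit_iff_ne_zero.2 ?_)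
        have := one_lt_residueCard F
        exact_mod_cast (by omega : residueCard F ≠ 0)
      · exact (Algebra.commutes _ _).symm
  have hφW (v : Fin d → PadicAlgCl l) : (ρ φ).1.mulVec v ∈ W ↔ v ∈ W := by
    have inj {M : Matrix (Fin d) (Fin d) (PadicAlgCl l)} (hM : IsUnit M)
        {w : Fin d → PadicAlgCl l} : M.mulVec w = 0 ↔ w = 0 := by
      refine ⟨fun h => ?_, fun h => by rw [h, mulVec_zero]⟩
      obtain ⟨u, rfl⟩ := hM
      rw [← one_mulVec w, ← Units.inv_mul u, ← mulVec_mulVec, h, mulVec_zero]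
    rw [hW, hW, ← inj hSu, ← inj (Units.isUnit (ρ φ)) (w := U.mulVec v), mulVec_mulVec, ← hS,
      mulVec_mulVec, mulVec_mulVec, hrelL]
  have hφH : φ ∈ H := fun v hv => ⟨(hφW v).2 hv, (hφW _).1 (by
    rw [mulVec_mulVec, ← Units.val_mul, ← map_mul, mul_inv_cancel, map_one, Units.val_one,
      one_mulVec]
    exact hv)⟩
  have htop := eq_top_of_frobenius_mem hφ hH hφH hIH
  rcases hirr.2 W fun g v hv => ((htop ▸ Subgroup.mem_top g : g ∈ H) v hv).1 with h | h
  · exfalso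
    have : Nonempty (Fin d) := ⟨⟨0, hirr.1⟩⟩
    have hu : IsUnit (toLin' U) := LinearMap.isUnit_iff_ker_eq_bot _ |>.2 h
    have hn : IsNilpotent (toLin' U) := hnil.map (toLinAlgEquiv' :
      Matrix (Fin d) (Fin d) (PadicAlgCl l) ≃ₐ[PadicAlgCl l] _)
    exact hn.not_isUnit hu
  · have h0 : toLin' U = 0 := LinearMap.ker_eq_top.1 h
    exact sub_eq_zero.1 (toLin'.injective (h0.trans (map_zero _).symm))

theorem exists_scalar_of_isIrreducible (hφ : IsFrobenius F φ) (hσ : IsTameGenerator F σ)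
    (hρ : Continuous ρ) (hirr : IsIrreducible ρ) (hw : ∀ g ∈ wildInertia F, ρ g = 1) {L : ℕ}
    (hL : L ∣ residueCard F - 1) (hnil : IsNilpotent ((ρ σ).1 ^ L - 1)) :
    d = 1 ∧ ∃ z : PadicAlgCl l, z ^ L = 1 ∧ (ρ σ).1 = scalar _ z := by
  have hρ' : Continuous fun g => (ρ g).1 := Units.continuous_val.comp hρ
  have hpow := pow_eq_one_of_isIrreducible hφ hσ hρ hirr hw hnil
  have hq : (ρ σ).1 ^ residueCard F = (ρ σ).1 := by
    obtain ⟨k, hk⟩ := hL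
    rw [← Nat.sub_add_cancel (one_lt_residueCard F).le, pow_succ, hk, pow_mul, hpow, one_pow,
      one_mul]
  have hrel : (ρ φ).1 * (ρ σ).1 = (ρ σ).1 ^ residueCard F * (ρ φ).1 :=
    congrArg Units.val (tame_relation_of_wild (σ := σ) hφ hw)
  rw [hq] at hrel
  have hcs : ∀ g, Commute (ρ σ).1 (ρ g).1 :=
    (commute_of_tame hφ hσ hρ' hw (Commute.refl _)).2 hrel.symm
  have hcf : ∀ g, Commute (ρ φ).1 (ρ g).1 :=
    (commute_of_tame hφ hσ hρ' hw (hcs φ).symm).2 (Commute.refl _)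
  obtain ⟨z, hz⟩ := exists_scalar_of_commute hirr hcs
  have hall (g : GaloisGroup F) : ∃ c, (ρ g).1 = scalar _ c := by
    refine exists_scalar_of_commute hirr fun h => ?_
    exact ((commute_of_tame hφ hσ hρ' hw (hcs g).symm).2 (hcf g).symm) h
  have hd := eq_one_of_forall_scalar hirr hall
  refine ⟨hd, z, ?_, hz⟩
  subst hd
  rw [hz, ← map_pow] at hpow
  have := congrFun (congrFun hpow 0) 0
  rwa [scalar_apply, diagonal_apply_eq, one_apply_eq] at this

end BasicTame

/-! ### Classification of the tame basic types -/

section TameTypes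

open Matrix

variable {p : ℕ} [Fact p.Prime] {F : IntermediateField ℚ_[p] (PadicAlgCl p)}
  [FiniteDimensional ℚ_[p] F] {l : ℕ} [Fact l.Prime] {φ : GaloisGroup F} {σ : inertia F}

/-- The basic types that are characters of `k_F^×` are one-dimensional and trivial on wild inertia, and
are determined by their values `z τ` at `σ`. -/
def IsTameScalar {l : ℕ} [Fact l.Prime] (σ : inertia F) (z : BasicType F l → PadicAlgCl l) : Prop :=
  (∀ τ, τ.IsTameChar → τ.out.dim = 1 ∧ (τ.out.rep σ).1 = scalar _ (z τ) ∧
    z τ ^ l ^ tameExponent F l = 1 ∧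
    ∀ g : inertia F, (g : GaloisGroup F) ∈ wildInertia F → τ.out.rep g = 1) ∧
  ∀ τ τ', τ.IsTameChar → τ'.IsTameChar → z τ = z τ' → τ = τ'

theorem exists_tameScalar (hφ : IsFrobenius F φ) (hσ : IsTameGenerator F σ) (l : ℕ)
    [Fact l.Prime] : ∃ z : BasicType F l → PadicAlgCl l, IsTameScalar σ z := by
  obtain ⟨θ, -, hwild, hgen, hθ, ϖ, y, hϖ, hy, hu⟩ := exists_tameQuotient hφ hσ
  have hex (τ : BasicType F l) (hτ : τ.IsTameChar) :
      ∃ χ : (ResidueField F)ˣ →* (PadicAlgCl l)ˣ, (∀ c, χ c ^ l ^ tameExponent F l = 1) ∧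
        τ.out.dim = 1 ∧ ∀ g, (τ.out.rep g).1 = scalar _ (χ (θ g) : PadicAlgCl l) := by
    obtain ⟨χ, h1, h2, h3⟩ := hτ
    refine ⟨χ, h1, h2, fun g => ?_⟩
    obtain ⟨u, hgu⟩ := hu g
    rw [h3 g ϖ y u hϖ hy hgu, hθ g ϖ y u hϖ hy hgu]
  choose! χ h1 h2 h3 using hex
  refine ⟨fun τ => χ τ (θ σ), fun τ hτ => ⟨h2 τ hτ, h3 τ hτ σ, ?_, fun g hg => ?_⟩,
    fun τ τ' hτ hτ' h => ?_⟩
  · rw [← Units.val_pow_eq_pow_val, h1 τ hτ, Units.val_one]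
  · refine Units.ext ?_
    rw [h3 τ hτ, hwild g hg, map_one, Units.val_one, Units.val_one, map_one]
  · have hχ (c : (ResidueField F)ˣ) : χ τ c = χ τ' c := by
      obtain ⟨k, rfl⟩ := hgen c
      change χ τ (θ σ ^ k) = χ τ' (θ σ ^ k)
      rw [map_zpow, map_zpow, Units.ext h]
    have hmul {d : ℕ} (c : PadicAlgCl l) (v : Fin d → PadicAlgCl l) :
        (scalar (Fin d) c).mulVec v = c • v := by
      rw [scalar_apply, ← smul_one_eq_diagonal, smul_mulVec, one_mulVec]
    rw [← Quotient.out_eq (s := basicRepSetoid F l) τ, ← Quotient.out_eq (s := basicRepSetoid F l) τ']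
    refine Quotient.sound (s := basicRepSetoid F l) ?_
    change ∃ T : (Fin τ.out.dim → PadicAlgCl l) ≃ₗ[PadicAlgCl l] (Fin τ'.out.dim → PadicAlgCl l),
      ∀ g v, T ((τ.out.rep g).1.mulVec v) = (τ'.out.rep g).1.mulVec (T v)
    refine ⟨LinearEquiv.funCongrLeft _ _ (finCongr ((h2 τ' hτ').trans (h2 τ hτ).symm)),
      fun g v => ?_⟩
    rw [h3 τ hτ, h3 τ' hτ', hmul, hmul, hχ, map_smul]

theorem continuous_of_isOpen_ker {G H X : Type} [Group G] [TopologicalSpace G]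
    [IsTopologicalGroup G] [Group H] [TopologicalSpace X] {θ : G →* H}
    (h : IsOpen (θ.ker : Set G)) (f : H → X) : Continuous fun g => f (θ g) := by
  refine IsLocallyConstant.continuous ((IsLocallyConstant.iff_eventually_eq _).2 fun g => ?_)
  have ho : IsOpen ((fun x => g⁻¹ * x) ⁻¹' (θ.ker : Set G)) := h.preimage (continuous_const_mul _)
  filter_upwards [ho.mem_nhds (by simp)] with x hx
  have : θ (g⁻¹ * x) = 1 := hx
  rw [map_mul, map_inv, inv_mul_eq_one] at this
  rw [this]

theorem isTameChar_of_isNilpotent (hφ : IsFrobenius F φ) (hσ : IsTameGenerator F σ)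
    {τ : BasicType F l}
    (hw : ∀ g : inertia F, (g : GaloisGroup F) ∈ wildInertia F → τ.out.rep g = 1)
    (hnil : IsNilpotent ((τ.out.rep σ).1 ^ l ^ tameExponent F l - 1)) : τ.IsTameChar := by
  obtain ⟨θ, hopen, hwild, hgen, hθ, -⟩ := exists_tameQuotient hφ hσ
  have hL : l ^ tameExponent F l ∣ residueCard F - 1 := pow_padicValNat_dvd
  obtain ⟨ρ, hρ, hirr, hres⟩ := τ.out.isBasic
  obtain ⟨hd, z, hzL, hz⟩ := exists_scalar_of_isIrreducible (σ := σ) hφ hσ hρ hirr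
    (fun g hg => (hres ⟨g, wildInertia_le_inertia hg⟩).trans (hw _ hg)) hL (by rwa [hres])
  rw [hres] at hz
  have hz0 : z ≠ 0 := by
    rintro rfl
    rw [zero_pow (pow_ne_zero _ (Fact.out : l.Prime).ne_zero)] at hzL
    exact zero_ne_one hzL
  have hzu : Units.mk0 z hz0 ^ l ^ tameExponent F l = 1 :=
    Units.ext (by rw [Units.val_pow_eq_pow_val, Units.val_mk0, hzL, Units.val_one])
  have hord : orderOf (θ σ) = residueCard F - 1 := by
    rw [orderOf_eq_card_of_forall_mem_zpowers hgen, Nat.card_units, residueCard]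
  let χ := monoidHomOfForallMemZpowers (g' := Units.mk0 z hz0) hgen
    (hord ▸ (orderOf_dvd_of_pow_eq_one hzu).trans hL)
  have hχσ : χ (θ σ) = Units.mk0 z hz0 := monoidHomOfForallMemZpowers_apply_gen _ _
  refine ⟨χ, fun c => ?_, hd, fun g ϖ y u hϖ hy hgu => ?_⟩
  · obtain ⟨k, rfl⟩ := hgen c
    change χ (θ σ ^ k) ^ _ = 1
    rw [map_zpow, hχσ, ← zpow_natCast, ← _root_.zpow_mul, mul_comm, _root_.zpow_mul, zpow_natCast, hzu, _root_.one_zpow]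
  · let τ' : inertia F →* Matrix (Fin τ.out.dim) (Fin τ.out.dim) (PadicAlgCl l) :=
      (scalar (Fin τ.out.dim)).toMonoidHom.comp ((Units.coeHom _).comp (χ.comp θ))
    have hτ' (g : inertia F) : τ' g = scalar _ (χ (θ g) : PadicAlgCl l) := rfl
    have hV := hσ.eq_top (V := intertwiners τ.out.rep τ' 1)
      (isClosed_intertwiners τ.out.continuous
        (continuous_of_isOpen_ker hopen fun c => scalar _ (χ c : PadicAlgCl l)) 1) (by
        change 1 * (τ.out.rep σ).1 = τ' σ * 1
        rw [one_mul, mul_one, hz, hτ', hχσ, Units.val_mk0]) fun g hg => by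
        change 1 * (τ.out.rep g).1 = τ' g * 1
        rw [hτ', hw g hg, hwild g hg, map_one, Units.val_one, Units.val_one, map_one]
    have hg : g ∈ intertwiners τ.out.rep τ' 1 := hV ▸ Subgroup.mem_top g
    change 1 * (τ.out.rep g).1 = τ' g * 1 at hg
    rw [one_mul, mul_one, hτ'] at hg
    rw [hg, hθ g ϖ y u hϖ hy hgu]

/-- The homomorphism of rings `x ↦ x ⊗ 1`. -/
def kroneckerOne (K : Type) [Field K] (d m : ℕ) :
    Matrix (Fin d) (Fin d) K →+* Matrix (Fin d × Fin m) (Fin d × Fin m) K where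
  toFun x := kronecker x 1
  map_one' := one_kronecker_one
  map_mul' x y := by
    refine Eq.trans ?_ (mul_kronecker_mul _ _ _ _)
    rw [one_mul]
    rfl
  map_zero' := zero_kronecker _
  map_add' x y := add_kronecker _ _ _

open Classical in
/-- The block diagonal matrix with blocks `x s ⊗ 1`. -/
def spBlocks (P : TypeDatum F l) :
    (∀ s : BlockIndex P, Matrix (Fin (BasicType.out s.1.1).dim) (Fin (BasicType.out s.1.1).dim)
      (PadicAlgCl l)) →+* Matrix (SpIndex P) (SpIndex P) (PadicAlgCl l) :=
  (blockDiagonal'RingHom _ _).comp (RingHom.pi fun s =>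
    (kroneckerOne (PadicAlgCl l) (BasicType.out s.1.1).dim ((P s.1).1 s.2)).comp
      (Pi.evalRingHom _ s))

theorem spBlocks_injective {F : IntermediateField ℚ_[p] (PadicAlgCl p)} (P : TypeDatum F l) :
    Function.Injective (spBlocks P) := by
  classical
  intro x y h
  funext s
  ext a a'
  have hm : 0 < (P s.1).1 s.2 := Nat.pos_of_ne_zero (Finsupp.mem_support_iff.1 s.2.2)
  have h1 := congrFun (congrFun h ⟨s, a, ⟨0, hm⟩⟩) ⟨s, a', ⟨0, hm⟩⟩
  have e (x : ∀ s : BlockIndex P, Matrix (Fin (BasicType.out s.1.1).dim)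
      (Fin (BasicType.out s.1.1).dim) (PadicAlgCl l)) :
      spBlocks P x ⟨s, a, ⟨0, hm⟩⟩ ⟨s, a', ⟨0, hm⟩⟩ = x s a a' := by
    refine (blockDiagonal'_apply_eq (fun s : BlockIndex P =>
      kroneckerOne (PadicAlgCl l) (BasicType.out s.1.1).dim ((P s.1).1 s.2) (x s)) s _ _).trans ?_
    change x s a a' * (1 : Matrix _ _ (PadicAlgCl l)) _ _ = _
    rw [one_apply_eq, mul_one]
  rwa [e, e] at h1

theorem isNilpotent_pow_sub_one {A : Type} [Ring A] {D U : A} (h : Commute D U) {L : ℕ}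
    (hU : IsNilpotent (U - 1)) (hDU : IsNilpotent ((D * U) ^ L - 1)) : IsNilpotent (D ^ L - 1) := by
  have h1 : IsNilpotent (U ^ L - 1) := by
    rw [← geom_sum_mul]
    exact Commute.isNilpotent_mul_left (Commute.sum_left _ _ _ fun i _ =>
      ((Commute.refl U).pow_left i).sub_right (Commute.one_right _)) hU
  have hc : Commute (D ^ L) (U ^ L) := (h.pow_pow L L)
  have h2 : IsNilpotent (D ^ L * (U ^ L - 1)) :=
    Commute.isNilpotent_mul_left (hc.sub_right (Commute.one_right _)) h1
  have e : D ^ L - 1 = ((D * U) ^ L - 1) - D ^ L * (U ^ L - 1) := by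
    rw [h.mul_pow, mul_sub, mul_one]
    abel
  rw [e]
  refine Commute.isNilpotent_sub ?_ hDU h2
  rw [h.mul_pow]
  have hcD : Commute (D ^ L * U ^ L) (D ^ L) := (Commute.refl _).mul_left hc.symm
  have hcU : Commute (D ^ L * U ^ L) (U ^ L) := hc.mul_left (Commute.refl _)
  exact (hcD.mul_right (hcU.sub_right (Commute.one_right _))).sub_left (Commute.one_left _)

open Classical in
theorem isTame_of_hasType (hφ : IsFrobenius F φ) (hσ : IsTameGenerator F σ)
    (hl : l ∣ residueCard F - 1) {P : TypeDatum F l} {n : ℕ}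
    {ρ : GaloisGroup F →* GL (Fin n) (PadicAlgCl l)} (hw : ∀ g ∈ wildInertia F, ρ g = 1)
    (hnil : IsNilpotent ((ρ σ).1 ^ l ^ tameExponent F l - 1)) (h : HasType σ ρ P) : P.IsTame := by
  obtain ⟨T, hT⟩ := h
  have hsp (g : inertia F) : spInertia P g =
      spBlocks P fun s => ((BasicType.out s.1.1).rep g).1 := rfl
  have hP {k : BasicType F l} (hk : k ∈ P.support) (hne : P k ≠ 0) : ∃ i, (P k).1 i ≠ 0 := by
    by_contra! hcon
    exact hne (Subtype.ext (Finsupp.ext hcon))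
  have hwild (g : inertia F) (hg : (g : GaloisGroup F) ∈ wildInertia F) (s : BlockIndex P) :
      (BasicType.out s.1.1).rep g = 1 := by
    have h1 : inertialType σ P g = 1 := by
      refine toLin'.injective (LinearMap.ext fun v => ?_)
      obtain ⟨w, rfl⟩ := T.surjective v
      rw [toLin'_apply, ← hT, hw g hg, Units.val_one, one_mulVec, toLin'_one, LinearMap.id_apply]
    rw [inertialType_of_tameLog (tameLog_wild hφ hσ hl hg), hsp, ← map_one (spBlocks P)] at h1
    exact Units.ext (congrFun (spBlocks_injective P h1) s)
  have hnil1 : IsNilpotent (inertialType σ P σ ^ l ^ tameExponent F l - 1) := by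
    have e : toLin' (inertialType σ P σ) = T.conj (toLin' (ρ σ).1) := by
      refine LinearMap.ext fun v => ?_
      rw [LinearEquiv.conj_apply_apply, toLin'_apply, toLin'_apply, hT, T.apply_symm_apply]
    obtain ⟨k, hk⟩ := hnil
    refine ⟨k, (toLinAlgEquiv' : Matrix (SpIndex P) (SpIndex P) (PadicAlgCl l) ≃ₐ[PadicAlgCl l] _).injective ?_⟩
    have hA := congrArg (toLinAlgEquiv' : Matrix (Fin n) (Fin n) (PadicAlgCl l) ≃ₐ[PadicAlgCl l] _) hk
    rw [map_pow, map_sub, map_pow, map_one, map_zero] at hA ⊢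
    have hB := congrArg T.conjRingEquiv hA
    rw [map_pow, map_sub, map_pow, map_one, map_zero] at hB
    refine Eq.trans ?_ hB
    exact congrArg (fun f => (f ^ _ - 1) ^ k) e
  have hnil2 : IsNilpotent (spInertia P σ ^ l ^ tameExponent F l - 1) := by
    have hN : IsNilpotent (tameCoeff l σ σ • spMonodromy P) := isNilpotent_spMonodromy.smul _
    rw [inertialType_eq] at hnil1
    exact isNilpotent_pow_sub_one (commute_exp_of_commute ((spInertia_commute σ).smul_right _) hN)
      (IsNilpotent.isNilpotent_exp_sub_one hN) hnil1
  rw [hsp, ← map_pow, ← map_one (spBlocks P), ← map_sub,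
    IsNilpotent.map_iff (spBlocks_injective P)] at hnil2
  intro τ hτ
  obtain ⟨i, hi⟩ := hP hτ (Finsupp.mem_support_iff.1 hτ)
  let s : BlockIndex P := ⟨⟨τ, hτ⟩, ⟨i, Finsupp.mem_support_iff.2 hi⟩⟩
  refine isTameChar_of_isNilpotent hφ hσ (fun g hg => hwild g hg s) ?_
  exact hnil2.map (Pi.evalRingHom (fun s : BlockIndex P => Matrix (Fin (BasicType.out s.1.1).dim)
    (Fin (BasicType.out s.1.1).dim) (PadicAlgCl l)) s)

end TameTypes

/-! ### Root multiplicities and bipartitions -/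

section Bipartitions

open Polynomial

variable {K : Type} [Field K] {L r : ℕ}

/-- The matrix of the multiplicities of the `ζ i` as roots of the `f j`, extended by zero. -/
def rootMatrix (ζ : Fin L → K) (f : Fin r → K[X]) : ℕ × ℕ →₀ ℕ :=
  Finsupp.onFinset (Finset.range L ×ˢ Finset.range r)
    (fun x => if h : x.1 < L ∧ x.2 < r then rootMultiplicity (ζ ⟨x.1, h.1⟩) (f ⟨x.2, h.2⟩) else 0)
    fun x hx => by
      by_contra hcon
      rw [Finset.mem_product, Finset.mem_range, Finset.mem_range] at hcon
      exact hx (dif_neg hcon)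

theorem rootMatrix_apply (ζ : Fin L → K) (f : Fin r → K[X]) (i : Fin L) (j : Fin r) :
    rootMatrix ζ f (i, j) = rootMultiplicity (ζ i) (f j) :=
  dif_pos (⟨i.2, j.2⟩ : i.1 < L ∧ j.1 < r)

theorem rootMatrix_eq_zero (ζ : Fin L → K) (f : Fin r → K[X]) {i j : ℕ} (h : ¬ (i < L ∧ j < r)) :
    rootMatrix ζ f (i, j) = 0 :=
  dif_neg h

theorem eq_prod_rootMultiplicity [NeZero L] [IsAlgClosed K] {ζ : Fin L → K}
    (hζ : Function.Injective ζ)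
    (hL : ∀ i, ζ i ^ L = 1) {N : ℕ} {f : K[X]} (hf : f.Monic) (h : f ∣ (X ^ L - 1) ^ N) :
    f = ∏ i, (X - C (ζ i)) ^ rootMultiplicity (ζ i) f := by
  classical
  have hroot (x : K) (hx : x ∈ f.roots) : ∃ i, ζ i = x := by
    have hL0 := NeZero.pos L
    have hx1 : x ^ L = 1 := by
      have := (dvd_iff_isRoot.2 (isRoot_of_mem_roots hx)).trans h
      rw [dvd_iff_isRoot, IsRoot.def, eval_pow, eval_sub, eval_pow, eval_X, eval_one] at this
      exact sub_eq_zero.1 (eq_zero_of_pow_eq_zero this)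
    have hsub : Finset.univ.image ζ ⊆ (nthRoots L (1 : K)).toFinset := by
      intro y hy
      obtain ⟨i, -, rfl⟩ := Finset.mem_image.1 hy
      rw [Multiset.mem_toFinset, mem_nthRoots hL0, hL]
    have heq := Finset.eq_of_subset_of_card_le hsub (by
      rw [Finset.card_image_of_injective _ hζ, Finset.card_univ, Fintype.card_fin]
      exact (Multiset.toFinset_card_le _).trans (card_nthRoots L 1))
    have hmem : x ∈ (nthRoots L (1 : K)).toFinset := by
      rw [Multiset.mem_toFinset, mem_nthRoots hL0, hx1]
    rw [← heq] at hmem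
    obtain ⟨i, -, hi⟩ := Finset.mem_image.1 hmem
    exact ⟨i, hi⟩
  have h1 : f = (f.roots.map fun a => X - C a).prod :=
    (IsAlgClosed.splits f).eq_prod_roots_of_monic hf
  conv_lhs => rw [h1]
  rw [Finset.prod_multiset_map_count, Finset.prod_subset (s₂ := Finset.univ.image ζ)
    (f := fun x => (X - C x) ^ f.roots.count x), Finset.prod_image fun _ _ _ _ h => hζ h]
  · exact Finset.prod_congr rfl fun i _ => by rw [count_roots]
  · intro x hx
    obtain ⟨i, rfl⟩ := hroot x (Multiset.mem_toFinset.1 hx)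
    exact Finset.mem_image_of_mem _ (Finset.mem_univ i)
  · intro x _ hx
    rw [Multiset.mem_toFinset, ← Multiset.count_eq_zero] at hx
    rw [hx, pow_zero]

theorem rootMultiplicity_prod {ζ : Fin L → K} (hζ : Function.Injective ζ) (a : Fin L → ℕ)
    (i : Fin L) : rootMultiplicity (ζ i) (∏ k, (X - C (ζ k)) ^ a k) = a i := by
  classical
  have hne : ∏ k, (X - C (ζ k)) ^ a k ≠ 0 :=
    Finset.prod_ne_zero_iff.2 fun k _ => pow_ne_zero _ (X_sub_C_ne_zero _)
  rw [← count_roots, roots_prod _ _ hne, Multiset.count_bind]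
  simp only [roots_pow, roots_X_sub_C, Multiset.count_nsmul, Multiset.count_singleton]
  rw [← Finset.sum_eq_multiset_sum, Finset.sum_eq_single i]
  · rw [if_pos rfl, mul_one]
  · intro k _ hk
    rw [if_neg fun h => hk (hζ h).symm, mul_zero]
  · exact fun h => absurd (Finset.mem_univ i) h

theorem Part.deg_eq_finsum (P : Part) : P.deg = ∑ᶠ j, P.1 j :=
  (finsum_eq_sum_of_support_subset _ (by rw [Finsupp.fun_support_eq])).symm

theorem sum_row_of_perm {P : Part} {A : ℕ → ℕ} (h : ∃ e : Equiv.Perm ℕ, ∀ j, A j = P.1 (e j)) :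
    ∑ᶠ j, A j = P.deg := by
  obtain ⟨e, he⟩ := h
  rw [P.deg_eq_finsum]
  exact (finsum_congr he).trans (finsum_comp_equiv e)

/-- The points of `PolyRing O d q L N` such that the multiplicities of the `L`-th roots of unity as
roots of the corresponding polynomials are as prescribed by the partitions `P i`. -/
def typePoints {O : Type} [CommRing O] [Algebra O K] {d : Fin r → ℕ} {q N : ℕ} (ζ : Fin L → O)
    (P : ℕ → Part) : Set (PolyRing O d q L N →ₐ[O] O) :=
  {s | HasWeight P (rootMatrix (fun i => algebraMap O K (ζ i)) fun j =>
    deformPoly fun i => algebraMap O K (s (PolyRing.coeff O d q L N j i)))}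

theorem card_typePoints [NeZero L] [IsAlgClosed K] {O : Type} [CommRing O] [Algebra O K]
    (hOK : Function.Injective (algebraMap O K)) {d : Fin r → ℕ} {q N : ℕ} {ζ : Fin L → O}
    (hζ : Function.Injective ζ) (hL : ∀ i, ζ i ^ L = 1) (hq : 0 < q) (hLq : L ∣ q - 1)
    {P : ℕ → Part} (hP : ∀ i, ¬ i < L → P i = 0) {Q : Part}
    (hQ : ∀ j, Q.1 j = if h : j < r then d ⟨j, h⟩ else 0) (hN : ∀ j, d j ≤ N) :
    Nat.card (typePoints (K := K) (d := d) (q := q) (N := N) ζ P) = Bip P Q := by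
  have hζK : Function.Injective fun i => algebraMap O K (ζ i) := hOK.comp hζ
  have hLK (i : Fin L) : algebraMap O K (ζ i) ^ L = 1 := by rw [← map_pow, hL, map_one]
  have hfac (s : PolyRing O d q L N →ₐ[O] O) (j : Fin r) :=
    eq_prod_rootMultiplicity
      (f := deformPoly fun i => algebraMap O K (s (PolyRing.coeff O d q L N j i))) hζK hLK
      (deformPoly_monic _)
      (deformPoly_map_dvd ((algebraMap O K).comp s.toRingHom) (PolyRing.dvd_pow O d q L N j))
  refine Nat.card_congr (Equiv.ofBijective (fun s => ⟨rootMatrix (fun i => algebraMap O K (ζ i))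
    fun j => deformPoly fun i => algebraMap O K (s.1 (PolyRing.coeff O d q L N j i)),
    ⟨fun i => sum_row_of_perm (s.2 i), fun j => ?_⟩, s.2⟩) ⟨?_, ?_⟩)
  · rw [hQ]
    split_ifs with hj
    · have e := congrArg natDegree (hfac s.1 ⟨j, hj⟩)
      rw [deformPoly_natDegree, natDegree_prod_of_monic _ _
        fun i _ => (monic_X_sub_C _).pow _] at e
      simp only [natDegree_pow, natDegree_X_sub_C, mul_one] at e
      rw [e, finsum_eq_sum_of_support_subset (s := Finset.range L), Finset.sum_range]
      · exact Finset.sum_congr rfl fun i _ => rootMatrix_apply _ _ i ⟨j, hj⟩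
      · intro i hi
        rw [Finset.coe_range, Set.mem_Iio]
        by_contra hcon
        exact hi (rootMatrix_eq_zero _ _ fun h => hcon h.1)
    · exact finsum_eq_zero_of_forall_eq_zero fun i => rootMatrix_eq_zero _ _ fun h => hj h.2
  · intro s t hst
    have hst' := congrArg Subtype.val hst
    dsimp only at hst'
    refine Subtype.ext (PolyRing.algHom_ext fun j i => hOK ?_)
    refine congrFun (deformPoly_injective ((hfac s.1 j).trans (Eq.trans (Finset.prod_congr rfl
      fun k _ => congrArg ((X - C (algebraMap O K (ζ k))) ^ ·) ?_) (hfac t.1 j).symm))) i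
    simpa only [rootMatrix_apply] using DFunLike.congr_fun hst' (k.1, j.1)
  · rintro ⟨A, ⟨hrow, hcol⟩, hw⟩
    have hA0 {i j : ℕ} (hi : ¬ i < L) : A (i, j) = 0 := by
      obtain ⟨e, he⟩ := hw i
      rw [he, hP i hi]
      rfl
    have hsum (j : ℕ) : ∑ i : Fin L, A (i, j) = Q.1 j := by
      rw [← hcol, finsum_eq_sum_of_support_subset (s := Finset.range L), Finset.sum_range]
      intro i hi
      rw [Finset.coe_range, Set.mem_Iio]
      by_contra hcon
      exact hi (hA0 hcon)
    have hAj {i j : ℕ} (hj : ¬ j < r) : A (i, j) = 0 := by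
      by_cases hi : i < L
      · have h1 := hsum j
        rw [hQ, dif_neg hj, Finset.sum_eq_zero_iff] at h1
        exact h1 ⟨i, hi⟩ (Finset.mem_univ _)
      · exact hA0 hi
    let f (j : Fin r) : O[X] := ∏ i, (X - C (ζ i)) ^ A (i.1, j.1)
    have hfm (j : Fin r) : (f j).Monic := monic_prod_of_monic _ _ fun i _ => (monic_X_sub_C _).pow _
    have hOn : Nontrivial O := (algebraMap O K).domain_nontrivial
    have hfd (j : Fin r) : (f j).natDegree = d j := by
      rw [natDegree_prod_of_monic _ _ fun i _ => (monic_X_sub_C _).pow _]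
      have h1 := hsum j
      rw [hQ, dif_pos j.2] at h1
      refine Eq.trans (Finset.sum_congr rfl fun i _ => ?_) h1
      rw [(monic_X_sub_C _).natDegree_pow, natDegree_X_sub_C, mul_one]
    choose c hc using fun j => exists_eq_deformPoly (hfm j) (hfd j)
    have hmap (j : Fin r) : (f j).map (algebraMap O K) =
        ∏ i, (X - C (algebraMap O K (ζ i))) ^ A (i.1, j.1) := by
      rw [Polynomial.map_prod]
      refine Finset.prod_congr rfl fun i _ => ?_
      rw [Polynomial.map_pow, Polynomial.map_sub, map_X, map_C]
    obtain ⟨s, hs⟩ := PolyRing.exists_lift (O := O) (A := O) (q := q) (L := L) (N := N) c (fun j => by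
      rw [← hc]
      rw [show expand O q (f j) = ∏ i, (X ^ q - C (ζ i)) ^ A (i.1, j.1) by
        rw [map_prod]
        refine Finset.prod_congr rfl fun i _ => ?_
        rw [map_pow, map_sub, expand_X, expand_C]]
      refine Finset.prod_dvd_prod_of_dvd _ _ fun i _ => pow_dvd_pow_of_dvd ?_ _
      have hζq : ζ i ^ q = ζ i := by
        obtain ⟨k, hk⟩ := hLq
        rw [← Nat.sub_add_cancel hq, pow_succ, hk, pow_mul, hL, one_pow, one_mul]
      have := sub_dvd_pow_sub_pow (X : O[X]) (C (ζ i)) q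
      rwa [← C_pow, hζq] at this) fun j => by
      rw [← hc, ← Polynomial.map_dvd_map _ hOK (hfm j), hmap, prod_X_sub_C_pow_dvd_iff hζK]
      intro i
      rw [Polynomial.map_pow, Polynomial.map_sub, Polynomial.map_pow, map_X, Polynomial.map_one]
      have hle : A (i.1, j.1) ≤ N := by
        refine le_trans ?_ (hN j)
        have h1 := hsum j
        rw [hQ, dif_pos j.2] at h1
        exact h1 ▸ Finset.single_le_sum (f := fun i : Fin L => A (i.1, j.1))
          (fun _ _ => Nat.zero_le _) (Finset.mem_univ i)
      refine (pow_dvd_pow _ hle).trans (pow_dvd_pow_of_dvd ?_ _)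
      rw [dvd_iff_isRoot, IsRoot.def, eval_sub, eval_pow, eval_X, eval_one, hLK, sub_self]
    have hfin : rootMatrix (fun i => algebraMap O K (ζ i)) (fun j => deformPoly fun i =>
        algebraMap O K (s (PolyRing.coeff O d q L N j i))) = A := by
      refine Finsupp.ext fun ⟨i, j⟩ => ?_
      by_cases h : i < L ∧ j < r
      · refine (rootMatrix_apply _ _ ⟨i, h.1⟩ ⟨j, h.2⟩).trans ?_
        have e : (deformPoly fun i => algebraMap O K (s (PolyRing.coeff O d q L N ⟨j, h.2⟩ i))) =
            (f ⟨j, h.2⟩).map (algebraMap O K) := by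
          rw [hc, deformPoly_map]
          simp only [hs]
        rw [e, hmap, rootMultiplicity_prod hζK (fun i : Fin L => A (i.1, j)) ⟨i, h.1⟩]
      · rw [rootMatrix_eq_zero _ _ h]
        by_cases hi : i < L
        · exact (hAj fun hj => h ⟨hi, hj⟩).symm
        · exact (hA0 hi).symm
    refine ⟨⟨s, ?_⟩, Subtype.ext hfin⟩
    change HasWeight P _
    rw [hfin]
    exact hw

end Bipartitions

/-! ### The inertial type of a point -/

section TypeOfPoint

open Matrix Polynomial

variable {p l : ℕ} [Fact p.Prime] [Fact l.Prime] {F : IntermediateField ℚ_[p] (PadicAlgCl p)}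
  [FiniteDimensional ℚ_[p] F] {E : IntermediateField ℚ_[l] (PadicAlgCl l)} {n : ℕ}
  {φ : GaloisGroup F} {σ : inertia F}

theorem exists_equiv_of_unit {K κ : Type} [Field K] [Fintype κ] [DecidableEq κ]
    (u : (Matrix κ κ K)ˣ) : ∃ e : (κ → K) ≃ₗ[K] (κ → K), ∀ v, e v = u.1.mulVec v := by
  refine ⟨LinearEquiv.ofLinearMap (toLin' u.1) (toLin' u⁻¹.1) ?_ ?_, fun v => rfl⟩
  · rw [← toLin'_mul, Units.mul_inv, toLin'_one]
  · rw [← toLin'_mul, Units.inv_mul, toLin'_one]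

theorem exists_equiv_frame {K κ : Type} [Field K] [Algebra (integers E) K] [Fintype κ]
    [DecidableEq κ] (b : GL (Fin n) (integers E)) (e : κ ≃ Fin n) {T P C : Matrix κ κ K}
    (hP : IsUnit P) (h : T * P = P * C) :
    ∃ f : (Fin n → K) ≃ₗ[K] (κ → K), ∀ v, f (toLin' (frame b e K T) v) = toLin' C (f v) := by
  obtain ⟨u, rfl⟩ := hP
  set U := glMap (algebraMap (integers E) K) b with hU
  obtain ⟨f1, h1⟩ := exists_equiv_of_unit U⁻¹
  obtain ⟨f2, h2⟩ := exists_equiv_of_unit u⁻¹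
  refine ⟨(f1.trans (LinearEquiv.funCongrLeft K K e)).trans f2, fun v => ?_⟩
  have e1 (w : Fin n → K) : LinearEquiv.funCongrLeft K K e w = w ∘ e := rfl
  have e2 : frame b e K T = U.1 * T.submatrix e.symm e.symm * U⁻¹.1 := rfl
  have e3 (w : Fin n → K) : (T.submatrix e.symm e.symm).mulVec w ∘ e = T.mulVec (w ∘ e) := by
    rw [submatrix_mulVec_equiv]
    funext i
    simp
  have e4 : u⁻¹.1 * T = C * u⁻¹.1 := by
    rw [Units.inv_mul_eq_iff_eq_mul, ← mul_assoc, ← h, mul_assoc, Units.mul_inv, mul_one]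
  simp only [LinearEquiv.trans_apply, h1, h2, e1, e2, toLin'_apply, mulVec_mulVec]
  rw [mul_assoc, ← mul_assoc U⁻¹.1, Units.inv_mul, one_mul, ← mulVec_mulVec, e3, mulVec_mulVec, e4]

theorem hasJordan_compMats {K : Type} [Field K] {r : ℕ} {d : Fin r → ℕ}
    (c : ∀ j, Fin (d j) → K) {ι : Type} [Fintype ι] {ζ : ι → K} (hζ : Function.Injective ζ)
    (h : ∀ j, deformPoly (c j) = ∏ i, (X - C (ζ i)) ^ rootMultiplicity (ζ i) (deformPoly (c j))) :
    HasJordan (toLin' (compMats c)) (fun s : Σ _ : Fin r, ι => ζ s.2)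
      fun s => rootMultiplicity (ζ s.2) (deformPoly (c s.1)) := by
  have h' (j : Fin r) : HasJordan (toLin' (compMat (c j))) ζ
      (fun i => rootMultiplicity (ζ i) (deformPoly (c j))) := hasJordan_compMat (c j) hζ (h j)
  rw [compMats]
  exact hasJordan_blockDiagonal' (S := fun _ => ι) (ζ := fun _ => ζ)
    (m := fun j i => rootMultiplicity (ζ i) (deformPoly (c j))) h'

theorem card_blocks_eq_iff {I K : Type} [Field K] {L r : ℕ} {P : I →₀ Part} {t : I → Prop}
    (hP : ∀ τ ∈ P.support, t τ) (χ : Fin L ≃ {τ // t τ}) {z : I → K}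
    (hz : ∀ τ τ', t τ → t τ' → z τ = z τ' → τ = τ') (f : Fin r → K[X]) {S : ℕ → Part}
    (hS : ∀ i : Fin L, S i = P (χ i)) (hS0 : ∀ i, ¬ i < L → S i = 0) :
    (∀ ζ0 c, c ≠ 0 →
      Nat.card {s : Σ _ : Fin r, Fin L //
        z (χ s.2) = ζ0 ∧ rootMultiplicity (z (χ s.2)) (f s.1) = c} =
      Nat.card {s : Σ τ : P.support, (P τ).1.support // z s.1 = ζ0 ∧ (P s.1).1 s.2 = c}) ↔
    HasWeight S (rootMatrix (fun i => z (χ i)) f) := by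
  have hzχ {i i' : Fin L} (h : z (χ i) = z (χ i')) : i = i' :=
    χ.injective (Subtype.ext (hz _ _ (χ i).2 (χ i').2 h))
  have h1 (i : Fin L) (c : ℕ) (hc : c ≠ 0) :
      Nat.card {s : Σ _ : Fin r, Fin L //
        z (χ s.2) = z (χ i) ∧ rootMultiplicity (z (χ s.2)) (f s.1) = c} =
      Nat.card {j // rootMatrix (fun i => z (χ i)) f (i.1, j) = c} := by
    refine Nat.card_congr (Equiv.ofBijective (fun s => ⟨s.1.1.1, ?_⟩) ⟨?_, ?_⟩)
    · have h := s.2.2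
      rw [s.2.1] at h
      rw [rootMatrix_apply, h]
    · rintro ⟨⟨j, k⟩, hk, hc⟩ ⟨⟨j', k'⟩, hk', hc'⟩ h
      obtain rfl : j = j' := Fin.ext (Subtype.mk.inj h)
      obtain rfl : k = k' := hzχ (hk.trans hk'.symm)
      rfl
    · rintro ⟨j, hj⟩
      by_cases hjr : j < r
      · have h := rootMatrix_apply (fun i => z (χ i)) f i ⟨j, hjr⟩
        exact ⟨⟨⟨⟨j, hjr⟩, i⟩, ⟨rfl, h.symm.trans hj⟩⟩, rfl⟩
      · exact absurd (hj.symm.trans (rootMatrix_eq_zero _ _ fun h => hjr h.2)) hc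
  have h2 (i : Fin L) (c : ℕ) (hc : c ≠ 0) :
      Nat.card {s : Σ τ : P.support, (P τ).1.support // z s.1 = z (χ i) ∧ (P s.1).1 s.2 = c} =
      Nat.card {j // (S i).1 j = c} := by
    rw [hS]
    have key (s : {s : Σ τ : P.support, (P τ).1.support //
        z s.1 = z (χ i) ∧ (P s.1).1 s.2 = c}) : (s.1.1 : I) = χ i :=
      hz _ _ (hP _ s.1.1.2) (χ i).2 s.2.1
    refine Nat.card_congr (Equiv.ofBijective (fun s => ⟨(s.1.2 : ℕ), ?_⟩) ⟨?_, ?_⟩)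
    · exact (congrArg (fun τ => (P τ).1 s.1.2) (key s)).symm.trans s.2.2
    · rintro ⟨⟨τ, k⟩, hs⟩ ⟨⟨τ', k'⟩, hs'⟩ h
      obtain rfl : τ = τ' := Subtype.ext ((key ⟨⟨τ, k⟩, hs⟩).trans (key ⟨⟨τ', k'⟩, hs'⟩).symm)
      obtain rfl : k = k' := Subtype.ext (Subtype.mk.inj h)
      rfl
    · rintro ⟨j, hj⟩
      have hne : (P (χ i)).1 j ≠ 0 := hj ▸ hc
      have hsupp : (χ i : I) ∈ P.support := by
        rw [Finsupp.mem_support_iff]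
        intro h0
        rw [h0] at hne
        exact hne rfl
      exact ⟨⟨⟨⟨χ i, hsupp⟩, ⟨j, Finsupp.mem_support_iff.2 hne⟩⟩, rfl, hj⟩, rfl⟩
  have hfin (i : ℕ) : (Function.support fun j => rootMatrix (fun i => z (χ i)) f (i, j)).Finite :=
    (rootMatrix (fun i => z (χ i)) f).hasFiniteSupport.preimage (Prod.mk_right_injective i).injOn
  have h3 : HasWeight S (rootMatrix (fun i => z (χ i)) f) ↔ ∀ i c, c ≠ 0 →
      Nat.card {j // rootMatrix (fun i => z (χ i)) f (i, j) = c} = Nat.card {j // (S i).1 j = c} :=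
    forall_congr' fun i => exists_perm_iff (hfin i) (S i).1.hasFiniteSupport
  rw [h3]
  refine ⟨fun h i c hc => ?_, fun h ζ0 c hc => ?_⟩
  · by_cases hi : i < L
    · exact (h1 ⟨i, hi⟩ c hc).symm.trans ((h _ c hc).trans (h2 ⟨i, hi⟩ c hc))
    · have e1 : IsEmpty {j // rootMatrix (fun i => z (χ i)) f (i, j) = c} :=
        ⟨fun j => hc (j.2.symm.trans (rootMatrix_eq_zero _ _ fun h => hi h.1))⟩
      have e2 : IsEmpty {j // (S i).1 j = c} :=
        ⟨fun j => hc (j.2.symm.trans (congrArg (fun Q : Part => Q.1 j) (hS0 i hi)))⟩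
      rw [Nat.card_of_isEmpty, Nat.card_of_isEmpty]
  · by_cases hζ0 : ∃ i, z (χ i) = ζ0
    · obtain ⟨i, rfl⟩ := hζ0
      rw [h1 i c hc, h2 i c hc, h i c hc]
    · have e1 : IsEmpty {s : Σ _ : Fin r, Fin L //
          z (χ s.2) = ζ0 ∧ rootMultiplicity (z (χ s.2)) (f s.1) = c} :=
        ⟨fun s => hζ0 ⟨s.1.2, s.2.1⟩⟩
      have e2 : IsEmpty {s : Σ τ : P.support, (P τ).1.support // z s.1 = ζ0 ∧ (P s.1).1 s.2 = c} :=
        ⟨fun s => hζ0 ⟨χ.symm ⟨s.1.1, hP _ s.1.1.2⟩, by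
          rw [χ.apply_symm_apply]
          exact s.2.1⟩⟩
      rw [Nat.card_of_isEmpty, Nat.card_of_isEmpty]

open Classical in
theorem inertialType_wild (hφ : IsFrobenius F φ) (hσ : IsTameGenerator F σ)
    (hl : l ∣ residueCard F - 1) {P : TypeDatum F l}
    (hP : ∀ τ ∈ P.support, ∀ g : inertia F, (g : GaloisGroup F) ∈ wildInertia F →
      τ.out.rep g = 1) {g : inertia F} (hg : (g : GaloisGroup F) ∈ wildInertia F) :
    inertialType σ P g = 1 := by
  rw [inertialType_of_tameLog (tameLog_wild hφ hσ hl hg)]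
  have e : spInertia P g = spBlocks P fun s => ((BasicType.out s.1.1).rep g).1 := rfl
  rw [e, ← map_one (spBlocks P)]
  exact congrArg _ (funext fun s => congrArg Units.val (hP _ s.1.2 g hg))

/-- A point is of type `τ_P` if and only if the root multiplicities of its characteristic polynomials
are rearrangements of the partitions in `P`. -/
theorem hasType_iff_hasWeight (hφ : IsFrobenius F φ) (hσ : IsTameGenerator F σ)
    (hl : l ∣ residueCard F - 1) {P : TypeDatum F l} (hP : P.IsTame)
    (χ : Fin (l ^ tameExponent F l) ≃ {τ : BasicType F l // τ.IsTameChar})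
    {z : BasicType F l → PadicAlgCl l} (hz : IsTameScalar σ z)
    {ρ : GaloisGroup F →* GL (Fin n) (PadicAlgCl l)} (hρ : Continuous fun g => (ρ g).1)
    (hw : ∀ g ∈ wildInertia F, ρ g = 1) {r : ℕ} {d : Fin r → ℕ} {b : GL (Fin n) (integers E)}
    {e : (Σ j, Fin (d j)) ≃ Fin n} {c : ∀ j, Fin (d j) → PadicAlgCl l}
    {T B : BlockMat d (PadicAlgCl l)}
    (hρσ : (ρ σ).1 = frame b e _ T) (hB : IsUnit B) (hT : T * B = B * compMats c) {N : ℕ}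
    (hc : ∀ j, deformPoly (c j) ∣ (X ^ l ^ tameExponent F l - 1) ^ N) :
    HasType σ ρ P ↔
      HasWeight (P.seq χ) (rootMatrix (fun i => z (χ i)) fun j => deformPoly (c j)) := by
  classical
  have : NeZero (l ^ tameExponent F l) := ⟨pow_ne_zero _ (Fact.out : l.Prime).ne_zero⟩
  have hinj : Function.Injective fun i => z (χ i) := fun i i' h =>
    χ.injective (Subtype.ext (hz.2 _ _ (χ i).2 (χ i').2 h))
  obtain ⟨f, hf⟩ := exists_equiv_frame b e hB hT
  have h1 := (hasJordan_compMats c hinj fun j => eq_prod_rootMultiplicity hinj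
    (fun i => (hz.1 _ (χ i).2).2.2.1) (deformPoly_monic _) (hc j)).conj f hf
  have h2 := hasJordan_inertialType (P := P) (tameLog_spec hφ hσ hl).2 (z := z)
    fun τ hτ => ⟨(hz.1 τ (hP τ hτ)).1, (hz.1 τ (hP τ hτ)).2.1⟩
  rw [hasType_iff hσ (tameLog_spec hφ hσ hl).1 (fun g hg => inertialType_wild hφ hσ hl
    (fun τ hτ => (hz.1 τ (hP τ hτ)).2.2.2) hg) hρ hw, hρσ, ← card_blocks_eq_iff hP χ hz.2 _
    (S := P.seq χ) (fun i => dif_pos i.2) fun i hi => dif_neg hi]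
  exact h1.conj_iff h2

/-- Conversely, only tame types occur. -/
theorem isTame_of_hasType_frame (hφ : IsFrobenius F φ) (hσ : IsTameGenerator F σ)
    (hl : l ∣ residueCard F - 1) {P : TypeDatum F l}
    {ρ : GaloisGroup F →* GL (Fin n) (PadicAlgCl l)}
    (hw : ∀ g ∈ wildInertia F, ρ g = 1) {r : ℕ} {d : Fin r → ℕ} {b : GL (Fin n) (integers E)}
    {e : (Σ j, Fin (d j)) ≃ Fin n} {c : ∀ j, Fin (d j) → PadicAlgCl l}
    {T B : BlockMat d (PadicAlgCl l)}
    (hρσ : (ρ σ).1 = frame b e _ T) (hB : IsUnit B) (hT : T * B = B * compMats c) {N : ℕ}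
    (hc : ∀ j, deformPoly (c j) ∣ (X ^ l ^ tameExponent F l - 1) ^ N) (h : HasType σ ρ P) :
    P.IsTame := by
  refine isTame_of_hasType hφ hσ hl hw ⟨N, ?_⟩ h
  have h1 : (compMats c ^ l ^ tameExponent F l - 1) ^ N = 0 := by
    rw [compMats, ← blockDiagonal'_pow, ← blockDiagonal'_one, ← blockDiagonal'_sub,
      ← blockDiagonal'_pow, ← blockDiagonal'_zero]
    refine congrArg _ (funext fun j => ?_)
    have := aeval_compMat_eq_zero (hc j)
    rw [map_pow, map_sub, map_pow, aeval_X, map_one] at this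
    exact this
  obtain ⟨u, rfl⟩ := hB
  obtain rfl : T = u.1 * compMats c * u⁻¹.1 := by rw [← hT, Units.mul_inv_cancel_right]
  have h2 : ((u.1 * compMats c * u⁻¹.1) ^ l ^ tameExponent F l - 1) ^ N = 0 := by
    rw [Units.conj_pow, ← mul_one (u.1 * _ * _ - 1 : Matrix _ _ (PadicAlgCl l))]
    have e1 : u.1 * compMats c ^ l ^ tameExponent F l * u⁻¹.1 - 1 =
        u.1 * (compMats c ^ l ^ tameExponent F l - 1) * u⁻¹.1 := by
      rw [mul_sub, sub_mul, mul_one, Units.mul_inv]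
    rw [mul_one, e1, Units.conj_pow, h1, mul_zero, zero_mul]
  have e2 : (ρ σ).1 ^ l ^ tameExponent F l = frame b e _ ((u.1 * compMats c * u⁻¹.1) ^
      l ^ tameExponent F l) := by rw [hρσ, map_pow]
  set U := glMap (algebraMap (integers E) (PadicAlgCl l)) b with hU
  have e3 (M : BlockMat d (PadicAlgCl l)) :
      frame b e _ M = U.1 * M.submatrix e.symm e.symm * U⁻¹.1 := rfl
  have e4 (M : BlockMat d (PadicAlgCl l)) :
      frame b e _ M - 1 = frame b e _ (M - 1) := by
    rw [← map_one (frame b e (PadicAlgCl l)), e3, e3, e3, ← sub_mul, ← mul_sub]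
    rfl
  rw [e2, e4, ← map_pow, h2, e3, submatrix_zero]
  simp

end TypeOfPoint

/-! ### The special fibre of a power series ring -/

section SpecialFibre

open IsLocalRing

theorem finite_algHom {O S : Type} [CommRing O] [IsDomain O] [CommRing S] [Algebra O S]
    [Module.Finite O S] : Finite (S →ₐ[O] O) :=
  Finite.of_injective (fun f => (IsScalarTower.toAlgHom O O (FractionRing O)).comp f)
    fun _ _ h => AlgHom.ext fun x => FaithfulSMul.algebraMap_injective O (FractionRing O)
      (DFunLike.congr_fun h x)

variable {O : Type} [CommRing O] [IsDomain O] [IsDiscreteValuationRing O]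
variable {S : Type} [CommRing S] [Algebra O S] {ι R : Type} [CommRing R] [Algebra O R]

/-- The homomorphism `S → R ⊗ k` for a power series ring `R` over `S`. -/
def fibreMap (e : R ≃ₐ[O] MvPowerSeries ι S) :
    S →+* R ⧸ (maximalIdeal O).map (algebraMap O R) :=
  (Ideal.Quotient.mk _).comp ((e.symm : MvPowerSeries ι S →+* R).comp MvPowerSeries.C)

variable (e : R ≃ₐ[O] MvPowerSeries ι S)

theorem map_fibreMap (K : Ideal S) : K.map (fibreMap e) =
    ((K.map (MvPowerSeries.C (σ := ι))).comap (e : R →+* MvPowerSeries ι S)).map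
      (Ideal.Quotient.mk ((maximalIdeal O).map (algebraMap O R))) := by
  rw [fibreMap, ← Ideal.map_map, ← Ideal.map_map]
  congr 1
  exact Ideal.map_symm (I := K.map (MvPowerSeries.C (σ := ι))) (e : R ≃+* MvPowerSeries ι S)

theorem map_algebraMap_eq_comap : (maximalIdeal O).map (algebraMap O R) =
    (((maximalIdeal O).map (algebraMap O S)).map (MvPowerSeries.C (σ := ι))).comap
      (e : R →+* MvPowerSeries ι S) := by
  have h : (((maximalIdeal O).map (algebraMap O S)).map (MvPowerSeries.C (σ := ι))).map
      (e.symm : MvPowerSeries ι S →+* R) = (maximalIdeal O).map (algebraMap O R) := by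
    rw [Ideal.map_map, Ideal.map_map]
    congr 1
    ext x
    rw [← e.symm.commutes x, MvPowerSeries.algebraMap_apply]
    rfl
  rw [← h]
  exact Ideal.map_symm (I := ((maximalIdeal O).map (algebraMap O S)).map (MvPowerSeries.C (σ := ι)))
    (e : R ≃+* MvPowerSeries ι S)

theorem map_fibreMap_eq_bot_of_le {K : Ideal S} (hK : K ≤ (maximalIdeal O).map (algebraMap O S)) :
    K.map (fibreMap e) = ⊥ := by
  rw [Ideal.map_eq_bot_iff_le_ker]
  refine hK.trans (Ideal.map_le_iff_le_comap.2 fun x hx => ?_)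
  have h : (Ideal.Quotient.mk ((maximalIdeal O).map (algebraMap O R))) (algebraMap O R x) = 0 :=
    Ideal.Quotient.eq_zero_iff_mem.2 (Ideal.mem_map_of_mem _ hx)
  rw [← e.symm.commutes x, MvPowerSeries.algebraMap_apply] at h
  exact h

theorem mem_map_fibreMap_mk {K : Ideal S} (hK : (maximalIdeal O).map (algebraMap O S) ≤ K) {x : R} :
    Ideal.Quotient.mk _ x ∈ K.map (fibreMap e) ↔
      e x ∈ K.map (MvPowerSeries.C (σ := ι)) := by
  rw [map_fibreMap, ← Ideal.mem_comap, Ideal.comap_map_of_surjective' _ Ideal.Quotient.mk_surjective,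
    Ideal.mk_ker, map_algebraMap_eq_comap e,
    sup_eq_left.2 (Ideal.comap_mono (Ideal.map_mono hK))]
  rfl

variable [IsLocalRing S] [Module.Finite O S]

theorem isPrime_map_fibreMap : ((maximalIdeal S).map (fibreMap e)).IsPrime := by
  have : IsNoetherianRing S := IsNoetherianRing.of_finite O S
  have := isPrime_map_C (ι := ι) (maximalIdeal S)
  rw [map_fibreMap]
  refine Ideal.map_isPrime_of_surjective Ideal.Quotient.mk_surjective ?_
  rw [Ideal.mk_ker, map_algebraMap_eq_comap e]
  exact Ideal.comap_mono (Ideal.map_mono map_maximalIdeal_le)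

variable [Finite (IsLocalRing.ResidueField O)]

theorem minimalPrimes_fibre : minimalPrimes (R ⧸ (maximalIdeal O).map (algebraMap O R)) =
    {(maximalIdeal S).map (fibreMap e)} := by
  have hp := isPrime_map_fibreMap e
  obtain ⟨k, hk⟩ := exists_maximalIdeal_pow_le_map (O := O) (S := S)
  have hle (q : Ideal (R ⧸ (maximalIdeal O).map (algebraMap O R))) (hq : q.IsPrime) :
      (maximalIdeal S).map (fibreMap e) ≤ q := by
    refine hq.le_of_pow_le (n := k) ?_
    rw [← Ideal.map_pow, map_fibreMap_eq_bot_of_le e hk]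
    exact bot_le
  ext q
  refine ⟨fun hq => ?_, ?_⟩
  · exact (hq.2 ⟨hp, bot_le⟩ (hle q hq.1.1)).antisymm (hle q hq.1.1)
  · rintro rfl
    exact ⟨⟨hp, bot_le⟩, fun q hq _ => hle q hq.1⟩

/-- The length at the minimal prime of the special fibre of the closure of a set of points. -/
theorem lengthAt_fibre (t : S →ₐ[O] O) (T : Set (S →ₐ[O] O))
    (𝔭 : Ideal (R ⧸ (maximalIdeal O).map (algebraMap O R))) [𝔭.IsPrime]
    (h𝔭 : (maximalIdeal S).map (fibreMap e) = 𝔭) :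
    lengthAt 𝔭 ((R ⧸ (maximalIdeal O).map (algebraMap O R)) ⧸
      (⨅ x ∈ T, RingHom.ker (x : S →+* O)).map (fibreMap e)) = Nat.card T := by
  have : IsNoetherianRing S := IsNoetherianRing.of_finite O S
  have := finite_algHom (O := O) (S := S)
  set J := ⨅ x ∈ T, RingHom.ker (x : S →+* O) with hJ
  set K0 := (maximalIdeal O).map (algebraMap O S) with hK0
  have e1 : J.map (fibreMap e) = (J ⊔ K0).map (fibreMap e) := by
    rw [Ideal.map_sup, map_fibreMap_eq_bot_of_le e le_rfl, sup_bot_eq]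
  -- The point `t` identifies the residue fields.
  have hkS : Nat.card (IsLocalRing.ResidueField S) = Nat.card (IsLocalRing.ResidueField O) := by
    have hs : Function.Surjective (t : S →+* O) := fun x => ⟨algebraMap O S x, t.commutes x⟩
    have h : RingHom.ker ((residue O).comp (t : S →+* O)) = maximalIdeal S :=
      eq_maximalIdeal (RingHom.ker_isMaximal_of_surjective _ (residue_surjective.comp hs))
    exact Nat.card_congr ((Ideal.quotEquivOfEq h.symm).trans
      (RingHom.quotientKerEquivOfSurjective (residue_surjective.comp hs))).toEquiv
  have : Finite (IsLocalRing.ResidueField S) := Nat.finite_of_card_ne_zero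
    (by rw [hkS]; exact Nat.card_pos.ne')
  rw [e1]
  refine lengthAt_quotient_map 𝔭 (fibreMap e) h𝔭 K0 (fun K hK s f hf => ?_) _ _ le_sup_right ?_
  · obtain ⟨f, rfl⟩ := Ideal.Quotient.mk_surjective f
    have hK' : K0 ≤ K.colon {s} := hK.trans Ideal.le_colon
    rw [mem_map_fibreMap_mk e hK']
    refine mem_map_C_colon K s ?_
    have : fibreMap e s * Ideal.Quotient.mk _ f = Ideal.Quotient.mk _ (e.symm (MvPowerSeries.C s) * f) :=
      rfl
    rw [this, mem_map_fibreMap_mk e hK, map_mul, e.apply_symm_apply] at hf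
    exact hf
  · rw [hkS]
    exact card_quotient_iInf_ker T

end SpecialFibre

/-! ### The points of a given inertial type -/

section TypeIdeal

open Matrix Polynomial IsLocalRing

variable {p l : ℕ} [Fact p.Prime] [Fact l.Prime] {F : IntermediateField ℚ_[p] (PadicAlgCl p)}
  {E : IntermediateField ℚ_[l] (PadicAlgCl l)} {n : ℕ} {φ : GaloisGroup F} {σ : inertia F}

theorem typeIdeal_eq_comap {R R' : Type} [CommRing R] [CommRing R'] [Algebra (integers E) R]
    [Algebra (integers E) R'] (e : R ≃ₐ[integers E] R') {ρ : GaloisGroup F →* GL (Fin n) R}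
    {ρ' : GaloisGroup F →* GL (Fin n) R'}
    (h : (glMap (e : R →+* R')).comp ρ = ρ') (P : TypeDatum F l) :
    typeIdeal E σ ρ P = (typeIdeal E σ ρ' P).comap (e : R →+* R') := by
  subst h
  ext f
  simp only [typeIdeal, Ideal.mem_comap, Submodule.mem_iInf, RingHom.mem_ker]
  refine ⟨fun h x hx => h (x.comp (e : R →ₐ[integers E] R')) hx, fun h x hx => ?_⟩
  have h' := h (x.comp (e.symm : R' →ₐ[integers E] R)) ?_
  · change x (e.symm (e f)) = 0 at h'
    rwa [e.symm_apply_apply] at h'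
  · convert hx using 1
    ext g i j
    change x (e.symm (e ((ρ g).1 i j))) = x ((ρ g).1 i j)
    rw [e.symm_apply_apply]

theorem normalForm_point {R : Type} [CommRing R]
    [Algebra (integers E) R] {ρ : GaloisGroup F →* GL (Fin n) R}
    (hw : ∀ g ∈ wildInertia F, ρ g = 1) {r : ℕ} {d : Fin r → ℕ} {b : GL (Fin n) (integers E)}
    {e : (Σ j, Fin (d j)) ≃ Fin n} {c : ∀ j, Fin (d j) → R}
    {T B : BlockMat d R}
    (hρσ : (ρ σ).1 = frame b e _ T) (hT : T * B = B * compMats c) {L N : ℕ}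
    (hc : ∀ j, deformPoly (c j) ∣ (X ^ L - 1) ^ N) (x : R →ₐ[integers E] PadicAlgCl l) :
    (∀ g ∈ wildInertia F, (glMap (x : R →+* PadicAlgCl l)).comp ρ g = 1) ∧
    ((glMap (x : R →+* PadicAlgCl l)).comp ρ σ).1 =
      frame b e _ (T.map x) ∧
    T.map x * B.map x = B.map x * compMats (fun j i => x (c j i)) ∧
    ∀ j, (deformPoly fun i => x (c j i)) ∣ (X ^ L - 1) ^ N := by
  refine ⟨fun g hg => ?_, ?_, ?_, fun j => deformPoly_map_dvd (x : R →+* PadicAlgCl l) (hc j)⟩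
  · rw [MonoidHom.comp_apply, hw g hg, map_one]
  · rw [← frame_map, ← hρσ]; rfl
  · have h := congrArg (fun M => M.map (x : R →+* PadicAlgCl l)) hT
    simp only [Matrix.map_mul] at h
    rwa [compMats_map] at h

variable [FiniteDimensional ℚ_[p] F]

theorem hasType_point_iff (hφ : IsFrobenius F φ) (hσ : IsTameGenerator F σ)
    (hl : l ∣ residueCard F - 1) {P : TypeDatum F l} (hP : P.IsTame)
    (χ : Fin (l ^ tameExponent F l) ≃ {τ : BasicType F l // τ.IsTameChar})
    {z : BasicType F l → PadicAlgCl l} (hz : IsTameScalar σ z)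
    {R : Type} [CommRing R] [IsLocalRing R] [Algebra (integers E) R] [IsCoefficientRing E R]
    {ρbar : GaloisGroup F →* GL (Fin n) (ResidueField E)}
    {ρ : GaloisGroup F →* GL (Fin n) R} (hρ : IsUniversalLift ρbar ρ)
    (hw : ∀ g ∈ wildInertia F, ρ g = 1) {r : ℕ} {d : Fin r → ℕ} {b : GL (Fin n) (integers E)}
    {e : (Σ j, Fin (d j)) ≃ Fin n} {c : ∀ j, Fin (d j) → R}
    {T B : BlockMat d R}
    (hρσ : (ρ σ).1 = frame b e _ T) (hB : IsUnit B) (hT : T * B = B * compMats c) {N : ℕ}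
    (hc : ∀ j, deformPoly (c j) ∣ (X ^ l ^ tameExponent F l - 1) ^ N)
    (x : R →ₐ[integers E] PadicAlgCl l) :
    HasType σ ((glMap (x : R →+* PadicAlgCl l)).comp ρ) P ↔
      HasWeight (P.seq χ) (rootMatrix (fun i => z (χ i)) fun j => deformPoly fun i => x (c j i)) := by
  have := hρ.noetherian
  obtain ⟨h1, h2, h3, h4⟩ := normalForm_point hw hρσ hT hc x
  exact hasType_iff_hasWeight hφ hσ hl hP χ hz (continuous_point hρ.continuous x) h1 h2
    (hB.map (x : R →+* PadicAlgCl l).mapMatrix) h3 h4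

theorem isTame_of_hasType_point (hφ : IsFrobenius F φ) (hσ : IsTameGenerator F σ)
    (hl : l ∣ residueCard F - 1) {P : TypeDatum F l} {R : Type} [CommRing R]
    [Algebra (integers E) R] {ρ : GaloisGroup F →* GL (Fin n) R}
    (hw : ∀ g ∈ wildInertia F, ρ g = 1) {r : ℕ} {d : Fin r → ℕ} {b : GL (Fin n) (integers E)}
    {e : (Σ j, Fin (d j)) ≃ Fin n} {c : ∀ j, Fin (d j) → R}
    {T B : BlockMat d R}
    (hρσ : (ρ σ).1 = frame b e _ T) (hB : IsUnit B) (hT : T * B = B * compMats c) {N : ℕ}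
    (hc : ∀ j, deformPoly (c j) ∣ (X ^ l ^ tameExponent F l - 1) ^ N)
    (x : R →ₐ[integers E] PadicAlgCl l)
    (h : HasType σ ((glMap (x : R →+* PadicAlgCl l)).comp ρ) P) : P.IsTame := by
  obtain ⟨h1, h2, h3, h4⟩ := normalForm_point hw hρσ hT hc x
  exact isTame_of_hasType_frame hφ hσ hl h1 h2
    (hB.map (x : R →+* PadicAlgCl l).mapMatrix) h3 h4 h

end TypeIdeal

section Descent

open Polynomial

variable {O K : Type} [CommRing O] [Field K] [Algebra O K]

theorem deformPoly_coeff {A : Type} [CommRing A] {d : ℕ} (c : Fin d → A) (i : Fin d) :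
    (deformPoly c).coeff i = ((X - 1) ^ d : A[X]).coeff i + c i := by
  simp [deformPoly, Polynomial.coeff_X_pow, Fin.val_inj]

/-- A point of `PolyRing` with values in a field is defined over `O` as soon as `O` contains the `L`-th
roots of unity. -/
theorem PolyRing.exists_eq_comp (hOK : Function.Injective (algebraMap O K)) [IsAlgClosed K] {r : ℕ}
    {d : Fin r → ℕ} {q L N : ℕ} [NeZero L] {ζ : Fin L → O} (hζ : Function.Injective ζ)
    (hL : ∀ i, ζ i ^ L = 1) (y : PolyRing O d q L N →ₐ[O] K) :
    ∃ s : PolyRing O d q L N →ₐ[O] O, ∀ a, y a = algebraMap O K (s a) := by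
  have hmem (j) (i : Fin (d j)) : y (PolyRing.coeff O d q L N j i) ∈ (Algebra.ofId O K).range := by
    have hprod := eq_prod_rootMultiplicity (hOK.comp hζ)
      (fun i => (map_pow _ _ _).symm.trans ((congrArg _ (hL i)).trans (map_one _)))
      (deformPoly_monic _) (deformPoly_map_dvd (y : PolyRing O d q L N →+* K)
        (PolyRing.dvd_pow O d q L N j))
    have hlift (m : Fin L → ℕ) : ∏ k, (X - C (algebraMap O K (ζ k))) ^ m k =
        (∏ k, (X - C (ζ k)) ^ m k).map (algebraMap O K) := by
      simp [Polynomial.map_prod]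
    replace hprod := hprod.trans (hlift _)
    have h := congrArg (fun f => Polynomial.coeff f i) hprod
    simp only [coeff_map, deformPoly_coeff] at h
    have h1 : ((X - 1) ^ d j : K[X]) = ((X - 1) ^ d j : O[X]).map (algebraMap O K) := by simp
    rw [h1, coeff_map, ← eq_sub_iff_add_eq', ← map_sub] at h
    exact ⟨_, h.symm⟩
  have hrange : y.range ≤ (Algebra.ofId O K).range := by
    rw [← Algebra.map_top, ← PolyRing.adjoin_coeff, AlgHom.map_adjoin, Algebra.adjoin_le_iff]
    rintro _ ⟨_, ⟨z, rfl⟩, rfl⟩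
    exact hmem z.1 z.2
  refine ⟨(AlgEquiv.ofInjective (Algebra.ofId O K) hOK).symm.toAlgHom.comp
    ((Subalgebra.inclusion hrange).comp y.rangeRestrict), fun a => ?_⟩
  exact (congrArg Subtype.val ((AlgEquiv.ofInjective (Algebra.ofId O K) hOK).apply_symm_apply
    (Subalgebra.inclusion hrange (y.rangeRestrict a)))).symm

end Descent

/-! ### The ideal of a tame type -/

section TameType

open Matrix Polynomial IsLocalRing

variable {p l : ℕ} [Fact p.Prime] [Fact l.Prime] {F : IntermediateField ℚ_[p] (PadicAlgCl p)}
  [FiniteDimensional ℚ_[p] F] {E : IntermediateField ℚ_[l] (PadicAlgCl l)} {n : ℕ}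
  {φ : GaloisGroup F} {σ : inertia F}

theorem exists_integer_of_pow_eq_one
    (hE : ∃ ζ : E, IsPrimitiveRoot ζ (residueCard F ^ n.factorial - 1))
    {y : PadicAlgCl l} (hy : y ^ l ^ tameExponent F l = 1) :
    ∃ c : integers E, algebraMap (integers E) (PadicAlgCl l) c = y := by
  obtain ⟨ζ, hζ⟩ := hE
  have hq : 1 < residueCard F := one_lt_residueCard F
  have hpos : 0 < residueCard F ^ n.factorial - 1 :=
    Nat.sub_pos_of_lt (Nat.one_lt_pow n.factorial_ne_zero hq)
  have hζ' : IsPrimitiveRoot (algebraMap E (PadicAlgCl l) ζ) (residueCard F ^ n.factorial - 1) :=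
    hζ.map_of_injective (algebraMap E (PadicAlgCl l)).injective
  have hdvd : l ^ tameExponent F l ∣ residueCard F ^ n.factorial - 1 :=
    pow_padicValNat_dvd.trans (by simpa using Nat.sub_dvd_pow_sub_pow (residueCard F) 1 n.factorial)
  obtain ⟨k, hk⟩ := hdvd
  have := NeZero.mk hpos.ne'
  obtain ⟨i, -, rfl⟩ := hζ'.eq_pow_of_pow_eq_one (ξ := y) (by rw [hk, pow_mul, hy, one_pow])
  refine ⟨⟨ζ ^ i, mem_integers.2 ?_⟩, rfl⟩
  have h := congrArg norm hy
  rw [norm_pow, norm_one] at h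
  exact ((pow_eq_one_iff_of_nonneg (norm_nonneg _) (pow_ne_zero _ (Fact.out : l.Prime).ne_zero)).1 h).le

theorem UnivRing.dvd_pow {O : Type} [CommRing O] {r : ℕ} (d : Fin r → ℕ) (q L N : ℕ) (j : Fin r) :
    deformPoly (UnivRing.coeff O d q L N j) ∣ (X ^ L - 1) ^ N :=
  deformPoly_map_dvd (UnivRing.const O d q L N : PolyRing O d q L N →+* UnivRing O d q L N)
    (PolyRing.dvd_pow O d q L N j)

/-- The ideal of a tame type is generated by the elements of `PolyRing` that vanish at the points of
this type. -/
theorem typeIdeal_eq_map [FiniteDimensional ℚ_[l] E] (hφ : IsFrobenius F φ)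
    (hσ : IsTameGenerator F σ)
    (hl : l ∣ residueCard F - 1) {P : TypeDatum F l} (hP : P.IsTame)
    (χ : Fin (l ^ tameExponent F l) ≃ {τ : BasicType F l // τ.IsTameChar})
    {z : BasicType F l → PadicAlgCl l} (hz : IsTameScalar σ z)
    {ζ : Fin (l ^ tameExponent F l) → integers E}
    (hζ : ∀ i, algebraMap (integers E) (PadicAlgCl l) (ζ i) = z (χ i))
    {r : ℕ} {d : Fin r → ℕ} {N : ℕ} [NeZero (l ^ tameExponent F l)]
    [IsLocalRing (PolyRing (integers E) d (residueCard F) (l ^ tameExponent F l) N)]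
    [IsCoefficientRing E (UnivRing (integers E) d (residueCard F) (l ^ tameExponent F l) N)]
    {ρbar : GaloisGroup F →* GL (Fin n) (ResidueField E)}
    {ρ : GaloisGroup F →* GL (Fin n)
      (UnivRing (integers E) d (residueCard F) (l ^ tameExponent F l) N)}
    (hρ : IsUniversalLift ρbar ρ) (hw : ∀ g ∈ wildInertia F, ρ g = 1) {b : GL (Fin n) (integers E)}
    {e : (Σ j, Fin (d j)) ≃ Fin n}
    {T B : BlockMat d (UnivRing (integers E) d (residueCard F) (l ^ tameExponent F l) N)}
    (hρσ : (ρ σ).1 = frame b e _ T) (hB : IsUnit B)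
    (hT : T * B = B * compMats
      (UnivRing.coeff (integers E) d (residueCard F) (l ^ tameExponent F l) N)) :
    typeIdeal E σ ρ P =
      (⨅ s ∈ typePoints (K := PadicAlgCl l) (d := d) (q := residueCard F) (N := N) ζ (P.seq χ),
        RingHom.ker (s : _ →+* integers E)).map MvPowerSeries.C := by
  have : IsNoetherianRing (PolyRing (integers E) d (residueCard F) (l ^ tameExponent F l) N) :=
    IsNoetherianRing.of_finite (integers E) _
  have hOK : Function.Injective (algebraMap (integers E) (PadicAlgCl l)) :=
    fun x y h => Subtype.ext (Subtype.ext h)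
  have hzχ {i i'} (h : z (χ i) = z (χ i')) : i = i' :=
    χ.injective (Subtype.ext (hz.2 _ _ (χ i).2 (χ i').2 h))
  have hζi : Function.Injective ζ := fun i i' h => hzχ (by rw [← hζ, ← hζ, h])
  have hζL (i) : ζ i ^ l ^ tameExponent F l = 1 := hOK (by
    rw [map_pow, hζ, (hz.1 _ (χ i).2).2.2.1, map_one])
  have hiff (x : UnivRing (integers E) d (residueCard F) (l ^ tameExponent F l) N →ₐ[integers E]
        PadicAlgCl l)
      (s : PolyRing (integers E) d (residueCard F) (l ^ tameExponent F l) N →ₐ[integers E] integers E)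
      (hs : ∀ a, x (MvPowerSeries.C a) = algebraMap _ _ (s a)) :
      HasType σ ((glMap (x : _ →+* PadicAlgCl l)).comp ρ) P ↔
        s ∈ typePoints (K := PadicAlgCl l) ζ (P.seq χ) := by
    rw [hasType_point_iff hφ hσ hl hP χ hz hρ hw hρσ hB hT (UnivRing.dvd_pow _ _ _ _) x]
    have e1 : (fun i => z (χ i)) = fun i => algebraMap (integers E) (PadicAlgCl l) (ζ i) :=
      funext fun i => (hζ i).symm
    have e2 : (fun j => deformPoly fun i => x (UnivRing.coeff _ d _ _ N j i)) =
        fun j => deformPoly fun i => algebraMap _ _ (s (PolyRing.coeff _ d _ _ N j i)) :=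
      funext fun j => congrArg deformPoly (funext fun i => hs _)
    rw [e1, e2]
    rfl
  ext f
  rw [mem_map_C_iff]
  simp only [typeIdeal, Submodule.mem_iInf, RingHom.mem_ker]
  constructor
  · intro h k s hs
    by_contra hne
    -- Choose a point above `s` at which `f` does not vanish.
    obtain ⟨x, hx, hxf⟩ := exists_powerSeries_hom_ne_zero (f := f)
      (s : PolyRing (integers E) d (residueCard F) (l ^ tameExponent F l) N →+* integers E)
      fun h0 => hne (congrArg (MvPowerSeries.coeff k) h0)
    let x' : UnivRing (integers E) d (residueCard F) (l ^ tameExponent F l) N →ₐ[integers E]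
        integers E :=
      { x with
        commutes' := fun a => (congrArg x (MvPowerSeries.algebraMap_apply (r := a))).trans
          ((hx _).trans (s.commutes a)) }
    refine hxf (hOK ((h ((Algebra.ofId _ _).comp x')
      ((hiff _ s fun a => congrArg (algebraMap _ _) (hx a)).2 hs)).trans (map_zero _).symm))
  · intro h x hx
    obtain ⟨s, hs⟩ := PolyRing.exists_eq_comp hOK hζi hζL
      (x.comp (UnivRing.const _ d _ _ N))
    have hsT := (hiff x s hs).1 hx
    have hf : f ∈ (RingHom.ker (s : _ →+* integers E)).map MvPowerSeries.C :=
      (mem_map_C_iff _).2 fun k => h k s hsT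
    refine (Ideal.map_le_iff_le_comap.2 fun a ha => ?_ : _ ≤ RingHom.ker (x : _ →+* PadicAlgCl l)) hf
    rw [Ideal.mem_comap, RingHom.mem_ker]
    exact (hs a).trans ((congrArg (algebraMap _ _) (ha : s a = 0)).trans (map_zero _))

end TameType

open Classical in
theorem pointCycle_self {A : Type} [CommRing A] (a : TopPoint A) : pointCycle a a = 1 :=
  Pi.single_eq_same _ _

end LiftingRing

end

/-! ### The lifting ring and its cycles -/

open LiftingRing in
theorem corollary7p8 (p l n : ℕ) [Fact p.Prime] [Fact l.Prime]
    (F : IntermediateField ℚ_[p] (PadicAlgCl p)) [FiniteDimensional ℚ_[p] F]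
    (E : IntermediateField ℚ_[l] (PadicAlgCl l)) [FiniteDimensional ℚ_[l] E]
    (hE : ∃ ζ : E, IsPrimitiveRoot ζ (residueCard F ^ n.factorial - 1))
    (hln : n < l) (hlq : l ∣ residueCard F - 1)
    (φ : GaloisGroup F) (hφ : IsFrobenius F φ)
    (σ : inertia F) (hσ : IsTameGenerator F σ)
    (ρbar : GaloisGroup F →* GL (Fin n) (ResidueField E))
    (hρbar : IsOpen (ρbar.ker : Set (GaloisGroup F)))
    (hdist : IsDistinguished φ σ ρbar)
    (Q : Part) (hQ : IsFrobeniusPartition φ ρbar Q) :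
    (∃ (R : Type) (_ : CommRing R) (_ : IsLocalRing R) (_ : Algebra (integers E) R)
      (_ : IsCoefficientRing E R) (ρ : GaloisGroup F →* GL (Fin n) R),
      IsUniversalLift ρbar ρ) ∧
    ∀ (R : Type) [CommRing R] [IsLocalRing R] [Algebra (integers E) R] [IsCoefficientRing E R]
      (ρ : GaloisGroup F →* GL (Fin n) R), IsUniversalLift ρbar ρ →
      (∀ P : TypeDatum F l, ¬ P.IsTame → Subsingleton (TypeRing E σ ρ P)) ∧
      ∃ 𝔭 : TopPoint (SpecialFibre E R),
        minimalPrimes (SpecialFibre E R) = {𝔭.1.asIdeal} ∧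
        ∀ P : TypeDatum F l, P.IsTame →
          ∀ χ : Fin (l ^ tameExponent F l) ≃ {τ : BasicType F l // τ.IsTameChar},
            cycle (SpecialFibre E R) (TypeSpecialFibre E σ ρ P) =
              Bip (P.seq χ) Q • pointCycle 𝔭 := by
  have hl : l.Prime := Fact.out
  have hlp : l ≠ p := by
    rintro rfl
    exact not_dvd_of_dvd_residueCard_sub_one hlq dvd_rfl
  have hw (g) (hg : g ∈ wildInertia F) : ρbar g = 1 :=
    hdist.trivial ⟨g, wildInertia_le_inertia hg⟩ (wildInertia_le_proKernel hσ hlp hg)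
  obtain ⟨D, hD⟩ := exists_residualBasis hφ hw hdist hQ
  -- The exponent `N` serves all coefficient rings and all degrees at most `n`.
  obtain ⟨N, hnN, hN⟩ := exists_dvd_X_pow_sub_one_pow hl (one_lt_residueCard F) hlq
    (a := tameExponent F l) rfl hln
  have : NeZero (l ^ tameExponent F l) := ⟨pow_ne_zero _ hl.ne_zero⟩
  have hdN (j) : D.d j ≤ N := (D.le j).trans hnN
  have : IsLocalRing (PolyRing (integers E) D.d (residueCard F) (l ^ tameExponent F l) N) :=
    PolyRing.isLocalRing hl natCast_mem_maximalIdeal hdN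
  obtain ⟨t, -⟩ := PolyRing.exists_trivial (O := integers E) (q := residueCard F)
    (L := l ^ tameExponent F l) hdN
  have : IsCoefficientRing E
      (UnivRing (integers E) D.d (residueCard F) (l ^ tameExponent F l) N) :=
    isCoefficientRing_of_algHom (E := E)
      { (IsLocalRing.residue (integers E)).comp ((t : _ →+* integers E).comp
          MvPowerSeries.constantCoeff) with
        commutes' := fun a => congrArg (IsLocalRing.residue (integers E))
          ((congrArg t ((congrArg MvPowerSeries.constantCoeff
            (MvPowerSeries.algebraMap_apply (r := a))).trans
            (MvPowerSeries.constantCoeff_C _))).trans (t.commutes a)) }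
  obtain ⟨ρ₀, hρ₀, hw₀, T, B, hρσ, hB, hT⟩ := exists_universalLift D hφ hσ hlq hlp hρbar hw hN
  refine ⟨⟨_, _, _, _, _, ρ₀, hρ₀⟩, fun R _ _ _ _ ρ hρ => ?_⟩
  obtain ⟨e, he⟩ := hρ.exists_equiv hρ₀
  refine ⟨fun P hP => ?_, ?_⟩
  · have htop : typeIdeal E σ ρ₀ P = ⊤ := by
      refine iInf_eq_top.2 fun x => iInf_eq_top.2 fun hx => absurd ?_ hP
      exact isTame_of_hasType_point hφ hσ hlq hw₀ hρσ hB hT (UnivRing.dvd_pow _ _ _ _) x hx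
    rw [TypeRing, typeIdeal_eq_comap e he, htop, Ideal.comap_top]
    exact Ideal.Quotient.subsingleton_iff.2 rfl
  have := hρ.noetherian
  have hmin := minimalPrimes_fibre e
  have hprime := isPrime_map_fibreMap e
  have : Nontrivial (SpecialFibre E R) :=
    ⟨0, 1, fun h => hprime.ne_top ((Ideal.eq_top_iff_one _).2 (h ▸ Ideal.zero_mem _))⟩
  have : IsLocalRing (SpecialFibre E R) :=
    .of_surjective' (Ideal.Quotient.mk _) Ideal.Quotient.mk_surjective
  obtain ⟨𝔭, h𝔭, huniq⟩ := existsUnique_topPoint hmin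
  refine ⟨𝔭, by rw [h𝔭]; exact hmin, fun P hP χ => ?_⟩
  obtain ⟨z, hz⟩ := exists_tameScalar hφ hσ l
  choose ζ hζ using fun i => exists_integer_of_pow_eq_one hE (hz.1 _ (χ i).2).2.2.1
  have hOK : Function.Injective (algebraMap (integers E) (PadicAlgCl l)) :=
    fun x y h => Subtype.ext (Subtype.ext h)
  have hcard := card_typePoints hOK (d := D.d) (q := residueCard F) (N := N) (ζ := ζ)
    (fun i i' h => χ.injective (Subtype.ext (hz.2 _ _ (χ i).2 (χ i').2 (by rw [← hζ, ← hζ, h]))))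
    (fun i => hOK (by rw [map_pow, hζ, (hz.1 _ (χ i).2).2.2.1, map_one]))
    (one_lt_residueCard F).le pow_padicValNat_dvd (P := P.seq χ) (fun i hi => dif_neg hi) hD hdN
  have hideal : (typeIdeal E σ ρ P).map (Ideal.Quotient.mk
      ((IsLocalRing.maximalIdeal (integers E)).map (algebraMap (integers E) R))) = _ :=
    (congrArg _ ((typeIdeal_eq_comap e he P).trans (congrArg _
      (typeIdeal_eq_map hφ hσ hlq hP χ hz hζ hρ₀ hw₀ hρσ hB hT)))).trans
        (map_fibreMap e _).symm
  have hlen := lengthAt_fibre e t (typePoints (K := PadicAlgCl l) ζ (P.seq χ)) 𝔭.1.asIdeal h𝔭.symm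
  rw [hcard, ← hideal] at hlen
  funext a
  rw [huniq a, Pi.smul_apply, pointCycle_self, nsmul_one]
  exact hlen
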